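/- **Setting.** Let $f$ be a $C^3$ flux on the ball $\mathcal B(\delta_0)\subset\mathbb R^N$ centred at $0$, strictly hyperbolic: $Df$ has real eigenvalues $\lambda_1<\dots<\lambda_N$ with $C^2$ eigenvectors $r_1,\dots,r_N$. Let $(U,F)$ be an entropy pair, $\nabla F=\nabla U\,Df$, with $U\in C^2$ and $D^2U>0$. Put $m_j=\nabla\lambda_j\cdot r_j$. Each field is genuinely nonlinear ($m_j>0$), linearly degenerate ($m_j\equiv0$), or concave-convex ($m_i(0)=0$ and $\nabla m_i\cdot r_i>0$ on $\mathcal B(\delta_0)$). For each concave-convex $i$ a $C^2$ function $\mu_i$ is given with $\nabla\mu_i\cdot r_i>0$ and $\mu_i=0\Leftrightarrow m_i=0$. **Notation.** All waves take values in a ball $\mathcal B(\rho)$. $\mathcal O_i(u)$ is the integral curve of $r_i$ through $u$, and $\mathcal H_i(u)$ the $i$-th Hugoniot curve of $u$ (the solutions $v$ of the Rankine–Hugoniot relation $f(v)-f(u)=\sigma\,(v-u)$ whose speed $\sigma=\bar\lambda_i(u,v)$ is closer to $\lambda_i(u)$ than to the other $\lambda_j(u)$, and $u$ itself). Their points with parameter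 $\mu_i=m$ are $w_i(m;u)$ and $v_i(m;u)$. A shock from $u$ to $v$ satisfies the entropy inequality if $-\sigma(U(v)-U(u))+F(v)-F(u)\le0$; it is classical if moreover $\lambda_i(u)\ge\sigma\ge\lambda_i(v)$, and nonclassical otherwise. An $i$-fan from $u$ to $v$ is a finite sequence of $i$-rarefactions and entropy-satisfying $i$-shocks with increasing speeds; $\mathcal S_i(u)$ is the set of states that can be reached from $u$ by $i$-fans. For $\mu_i(u)\ne0$, $\mu_i^\natural(u)$ and $\mu_{i0}^\flat(u)$ are the parameters of the states $v\neq u$ of $\mathcal H_i(u)$ with $\bar\lambda_i(u,v)=\lambda_i(v)$, respectively with zero entropy dissipation. A *kinetic function* is a Lipschitz function $\mu_i^\flat$ on $\mathcal B(\delta_1)$ with $\mu_{i0}^\flat<\mu_i^\flat\le\mu_i^\natural$ where $\mu_i>0$ and $\mu_i^\natural\le\mu_i^\flat<\mu_{i0}^\flat$ where $\mu_i<0$; put $u^\flat=v_i(\mu_i^\flat(u);u)$. Let $\mu_i^\sharp(u)$ be the parameter of the state $u^\sharp\in\mathcal H_i(u)$ with $\bar\lambda_i(u,u^\sharp)=\bar\lambda_i(u,u^\flat)$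 and $\mu_i^\natural\le\mu_i^\sharp<\mu_i$ at $u$ if $\mu_i(u)>0$ (reversed inequalities if $\mu_i(u)<0$). A *nucleation threshold* is a Lipschitz function $\mu_i^n$ on $\mathcal B(\delta_1)$ with $\mu_i^\natural\le\mu_i^n\le\mu_i^\sharp$ where $\mu_i>0$ and $\mu_i^\sharp\le\mu_i^n\le\mu_i^\natural$ where $\mu_i<0$. *Kinetic relation:* each nonclassical $i$-shock with left state $u$ has right state $u^\flat$. *Nucleation criterion:* (N1) if an $i$-fan from $u$ to $v$ begins with a shock and $|\mu_i(u)-\mu_i(v)|>|\mu_i(u)-\mu_i^n(u)|$, then this first shock leads from $u$ to $u^\flat$; (N2) among the solutions of a Riemann problem whose fans satisfy the entropy inequality, the kinetic relation and (N1), classical waves are preferred whenever they are available: no other such solution has a classical fan (one without nonclassical shocks) where the given one has a nonclassical fan, in the first family in which the two solutions differ in this respect. If there are several concave-convex families, the families are compared here in an arbitrary fixed order. **Theorem.** There are $0<\delta_1<\rho\le\delta_0$ and $\varepsilon,C>0$, depending only on the system with its entropy pair, eigenvectors and parameters $\mu_i$, such that for every concave-convex $i$ and $u\in\mathcal B(\delta_1)$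 we have $|\mu_i(u)|<\varepsilon$, the points $v_i(m;u)$ and $w_i(m;u)$ exist and are unique for $|m|<\varepsilon$, the parameters $\mu_i^\natural(u),\mu_{i0}^\flat(u)$ are well defined if $\mu_i(u)\ne0$, and $-\varepsilon<\mu_{i0}^\flat(u)<\mu_i^\natural(u)<0$ if $\mu_i(u)>0$, $0<\mu_i^\natural(u)<\mu_{i0}^\flat(u)<\varepsilon$ if $\mu_i(u)<0$. Moreover: 1. Let $i$ be concave-convex, with a kinetic function $\mu_i^\flat$ and a nucleation threshold $\mu_i^n$, and let $u_-\in\mathcal B(\delta_1)$. The set of states reached from $u_-$ by $i$-fans that satisfy the entropy inequality, the kinetic relation and (N1) is a subset $\mathcal W_i^{nc}(u_-)$ of $\mathcal S_i(u_-)$ which for $\mu_i(u_-)>0$ is the union of the four pieces $$\mathcal W_i^{nc}(u_-)=\begin{cases}\mathcal O_i(u_-),&\mu_i(u)\ge\mu_i(u_-),\\ \mathcal H_i(u_-),&\mu_i^n(u_-)\le\mu_i(u)\le\mu_i(u_-),\\ \mathcal H_i(u_-^\flat),&\mu_i^\flat(u_-)\le\mu_i(u)<\mu_i^\sharp(u_-),\\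 \mathcal O_i(u_-^\flat),&\mu_i(u)\le\mu_i^\flat(u_-),\end{cases}$$ (with all inequalities reversed for $\mu_i(u_-)<0$, and $\mathcal W_i^{nc}(u_-)=\mathcal O_i(u_-)$ for $\mu_i(u_-)=0$). For $\mu_i(u_-)\neq 0$ the state $u_-^\sharp$ exists and is unique, and the only such fans from $u_-$ are, respectively, a single rarefaction, a single classical shock, the shock from $u_-$ to $u_-^\flat$ followed by a classical shock, and the shock from $u_-$ to $u_-^\flat$ followed by a rarefaction (any of these waves, other than the shock to $u_-^\flat$, may be trivial); the shock to $u_-^\flat$ satisfies the entropy inequality and is nonclassical if $\mu_i^\flat(u_-)\ne\mu_i^\natural(u_-)$. For $\mu_i(u_-)=0$ the only such fans are single rarefactions (possibly trivial). The first two pieces form one branch and the last two another; within $|\mu_i|<\varepsilon$ each branch is a continuous curve parametrized by $m=\mu_i(u)$. If $\mu_i^n(u_-)=\mu_i^\sharp(u_-)$, the curve obtained by joining the branches at $m=\mu_i^\sharp(u_-)$ is, for $|m|<\varepsilon$, of class $C^2$ with second derivative bounded by $C$ at all $m\ne\mu_i^\sharp(u_-)$, and Lipschitz continuous in $m$ with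 constant $C$. For $\mu_i(u_-)=0$ the curve $m\mapsto w_i(m;u_-)$ has these properties for all $|m|<\varepsilon$. 2. For each $K\ge 0$ there is $\delta_2\in(0,\delta_1]$, depending only on $K$ and on the previous data, such that for all kinetic functions with Lipschitz constant $K$, all nucleation thresholds and all $u_l,u_r\in\mathcal B(\delta_2)$ the Riemann problem with data $u_l,u_r$ has exactly one solution made of $N+1$ constant states $u_l=u^0,u^1,\dots,u^N=u_r$ in $\mathcal B(\delta_1)$ separated by $j$-wave fans ($j=1,\dots,N$), with values in $\mathcal B(\rho)$, satisfying the entropy inequality, the kinetic relation and the nucleation criterion (N1)–(N2). States $u^0=u_l,\dots,u^N=u_r$ in $\mathcal B(\delta_1)$ are connected by fans satisfying the entropy inequality, the kinetic relation and (N1) if and only if $u^j\in\mathcal W_j(u^{j-1})$ for all $j$, where $\mathcal W_j=\mathcal W_j^{nc}$ for concave-convex fields and otherwise $\mathcal W_j(u)=\{v\in\mathcal H_j(u):\lambda_j(v)\le\lambda_j(u)\}\cup\{v\in\mathcal O_j(u):\lambda_j(v)\ge\lambda_j(u)\}$. In the solution the fan of a field that is not concave-convex is a single (possibly trivial) shock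 satisfying the Lax inequalities or a single rarefaction. The solution is a self-similar function of $x/t$, is a weak solution in the sense of distributions with initial data $u_l$ for $x<0$ and $u_r$ for $x>0$, and satisfies $\partial_tU(u)+\partial_xF(u)\le0$. -/

import Mathlib

open Set Metric MeasureTheory
open scoped ContDiff NNReal

noncomputable section

/-- States of a system of `n` conservation laws, with the Euclidean norm. -/
abbrev State (n : ℕ) : Type := EuclideanSpace ℝ (Fin n)

/-- The data of a system of conservation laws `∂ₜu + ∂ₓf(u) = 0`: the flux `f`, an entropy pair
`(U, F)`, the characteristic speeds `lam j`, the right eigenvectors `r j`, and (relevant only for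
concave-convex fields) the global parameters `mu i`. The conditions on these data are in
`ConsLaw.Hyp`. -/
structure ConsLaw (n : ℕ) where
  f : State n → State n
  U : State n → ℝ
  F : State n → ℝ
  lam : Fin n → State n → ℝ
  r : Fin n → State n → State n
  mu : Fin n → State n → ℝ

/-- An elementary wave: a shock (`isShock = true`) or a rarefaction (`isShock = false`) of the
family `fam`, connecting the state `left` to the state `right`. -/
structure Wave (n : ℕ) where
  fam : Fin n
  isShock : Bool
  left : State n
  right : State n

open Classical in
/-- The one-wave list from `u` to `v`, or no wave at all if `u = v`. -/
def Wave.seg {n : ℕ} (i : Fin n) (isShock : Bool) (u v : State n) : List (Wave n) :=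
  if u = v then [] else [⟨i, isShock, u, v⟩]

/-- The consecutive waves of the list join `u` to `v`. -/
def Wave.Connects {n : ℕ} : State n → State n → List (Wave n) → Prop
  | u, v, [] => u = v
  | u, v, a :: L => a.left = u ∧ Wave.Connects a.right v L

namespace ConsLaw

variable {n : ℕ} (S : ConsLaw n)

/-! ### The system -/

/-- `m_j = ∇λ_j · r_j`. -/
def nonlin (j : Fin n) (u : State n) : ℝ := fderiv ℝ (S.lam j) u (S.r j u)

/-- Genuinely nonlinear field (with normalized eigenvectors). -/
def IsGNL (δ : ℝ) (j : Fin n) : Prop := ∀ u ∈ ball (0 : State n) δ, 0 < S.nonlin j u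

/-- Linearly degenerate field. -/
def IsLD (δ : ℝ) (j : Fin n) : Prop := ∀ u ∈ ball (0 : State n) δ, S.nonlin j u = 0

/-- Concave-convex field: the eigenvector is transverse to the set `m_i = 0`, with
`∇m_i · r_i > 0`, and the origin belongs to that set. (That `{m_i = 0}` is a hypersurface and that
`m_i` changes sign are consequences.) -/
def IsCC (δ : ℝ) (i : Fin n) : Prop :=
  S.nonlin i 0 = 0 ∧ ∀ u ∈ ball (0 : State n) δ, 0 < fderiv ℝ (S.nonlin i) u (S.r i u)

/-- The standing assumptions, on the ball of radius `δ` about the origin. -/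
structure Hyp (δ : ℝ) : Prop where
  f_smooth : ContDiffOn ℝ 3 S.f (ball 0 δ)
  r_smooth : ∀ j, ContDiffOn ℝ 2 (S.r j) (ball 0 δ)
  r_ne_zero : ∀ j, ∀ u ∈ ball (0 : State n) δ, S.r j u ≠ 0
  eigen : ∀ j, ∀ u ∈ ball (0 : State n) δ, fderiv ℝ S.f u (S.r j u) = S.lam j u • S.r j u
  strict : ∀ u ∈ ball (0 : State n) δ, StrictMono fun j => S.lam j u
  U_smooth : ContDiffOn ℝ 2 S.U (ball 0 δ)
  U_convex : ∀ u ∈ ball (0 : State n) δ, ∀ h : State n, h ≠ 0 →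
    0 < fderiv ℝ (fderiv ℝ S.U) u h h
  entropy_pair : ∀ u ∈ ball (0 : State n) δ,
    HasFDerivAt S.F ((fderiv ℝ S.U u).comp (fderiv ℝ S.f u)) u
  fields : ∀ j, S.IsGNL δ j ∨ S.IsLD δ j ∨ S.IsCC δ j
  mu_smooth : ∀ i, S.IsCC δ i → ContDiffOn ℝ 2 (S.mu i) (ball 0 δ)
  mu_mono : ∀ i, S.IsCC δ i → ∀ u ∈ ball (0 : State n) δ, 0 < fderiv ℝ (S.mu i) u (S.r i u)
  mu_zero : ∀ i, S.IsCC δ i → ∀ u ∈ ball (0 : State n) δ, (S.mu i u = 0 ↔ S.nonlin i u = 0)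

/-! ### Shocks and rarefactions

All waves take their values in the ball of radius `ρ`. -/

/-- The speed of a jump between two distinct states satisfying the Rankine-Hugoniot relation. -/
def speed (u v : State n) : ℝ := inner ℝ (S.f v - S.f u) (v - u) / ‖v - u‖ ^ 2

/-- The `i`-th Hugoniot curve `H_i(u)`: the states `v` satisfying the Rankine-Hugoniot relation
with `u` for a speed that is closer to `λ_i(u)` than to the other characteristic speeds, together
with `u` itself. (Near the origin the Hugoniot set of `u` consists of `n` curves through `u`, and
the speed along the `i`-th one stays close to `λ_i(u)`.) -/
def hugoniot (ρ : ℝ) (i : Fin n) (u : State n) : Set (State n) :=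
  {v | v ∈ ball (0 : State n) ρ ∧
    (v = u ∨ (S.f v - S.f u = S.speed u v • (v - u) ∧
      ∀ j, j ≠ i → |S.speed u v - S.lam i u| < |S.speed u v - S.lam j u|))}

/-- `γ` runs on `[0, 1]` from `u` to `v` along an integral curve of `r_i`, in one of its two
directions. -/
def IsArc (ρ : ℝ) (i : Fin n) (u v : State n) (γ : ℝ → State n) : Prop :=
  γ 0 = u ∧ γ 1 = v ∧ ∃ s : ℝ, ∀ τ ∈ Icc (0 : ℝ) 1,
    γ τ ∈ ball (0 : State n) ρ ∧ HasDerivAt γ (s • S.r i (γ τ)) τ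

/-- The integral curve `O_i(u)` of `r_i` through `u`. -/
def integralCurve (ρ : ℝ) (i : Fin n) (u : State n) : Set (State n) :=
  {v | ∃ γ, S.IsArc ρ i u v γ}

/-- `u` and `v` are connected by an `i`-rarefaction: an arc along which the characteristic speed
increases from `u` to `v`. -/
def Rarefaction (ρ : ℝ) (i : Fin n) (u v : State n) : Prop :=
  ∃ γ, S.IsArc ρ i u v γ ∧ StrictMonoOn (fun τ => S.lam i (γ τ)) (Icc 0 1)

/-- Entropy dissipation of a shock. -/
def dissipation (u v : State n) : ℝ := -S.speed u v * (S.U v - S.U u) + (S.F v - S.F u)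

/-- Lax shock inequalities. -/
def Lax (i : Fin n) (u v : State n) : Prop :=
  S.lam i v ≤ S.speed u v ∧ S.speed u v ≤ S.lam i u

/-- `a` is a rarefaction, or a shock satisfying the entropy inequality. -/
def IsWave (ρ : ℝ) (a : Wave n) : Prop :=
  (a.isShock = true ∧ a.right ∈ S.hugoniot ρ a.fam a.left ∧ a.right ≠ a.left ∧
      S.dissipation a.left a.right ≤ 0) ∨
    (a.isShock = false ∧ S.Rarefaction ρ a.fam a.left a.right)

/-- Smallest speed in a wave. -/
def lo (a : Wave n) : ℝ := if a.isShock = true then S.speed a.left a.right else S.lam a.fam a.left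

/-- Largest speed in a wave. -/
def hi (a : Wave n) : ℝ := if a.isShock = true then S.speed a.left a.right else S.lam a.fam a.right

/-- The list `L` is an `i`-wave fan from `u` to `v`: finitely many `i`-waves, each satisfying the
entropy inequality, with increasing speeds. A shock may be attached to a rarefaction; two shocks of
equal speed (which are one shock) and two adjacent rarefactions (which are one rarefaction) are
not listed separately. -/
def IsFan (ρ : ℝ) (i : Fin n) (u v : State n) (L : List (Wave n)) : Prop :=
  Wave.Connects u v L ∧ (∀ a ∈ L, a.fam = i ∧ S.IsWave ρ a) ∧
    L.IsChain (fun a b => S.hi a < S.lo b ∨ (S.hi a = S.lo b ∧ a.isShock ≠ b.isShock))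

/-- The nonclassical `i`-wave set `S_i(u)`. -/
def waveSet (ρ : ℝ) (i : Fin n) (u : State n) : Set (State n) := {v | ∃ L, S.IsFan ρ i u v L}

/-! ### Kinetic relation and nucleation criterion -/

/-- `v_i(m; u)`: the point of `H_i(u)` with parameter `m`. -/
def hugoniotPoint (ρ : ℝ) (i : Fin n) (m : ℝ) (u : State n) : State n :=
  Classical.epsilon fun v => v ∈ S.hugoniot ρ i u ∧ S.mu i v = m

/-- `w_i(m; u)`: the point of `O_i(u)` with parameter `m`. -/
def integralPoint (ρ : ℝ) (i : Fin n) (m : ℝ) (u : State n) : State n :=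
  Classical.epsilon fun v => v ∈ S.integralCurve ρ i u ∧ S.mu i v = m

/-- `v` is the critical point of the shock speed on `H_i(u)`, where the shock is a right-contact. -/
def IsNatural (ρ : ℝ) (i : Fin n) (u v : State n) : Prop :=
  v ∈ S.hugoniot ρ i u ∧ v ≠ u ∧ S.speed u v = S.lam i v

/-- `v` is the point of `H_i(u)`, other than `u`, with zero entropy dissipation. -/
def IsZeroDiss (ρ : ℝ) (i : Fin n) (u v : State n) : Prop :=
  v ∈ S.hugoniot ρ i u ∧ v ≠ u ∧ S.dissipation u v = 0

/-- `μ_i^♮(u)`, for `μ_i(u) ≠ 0`. -/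
def muNat (ρ : ℝ) (i : Fin n) (u : State n) : ℝ :=
  S.mu i (Classical.epsilon fun v => S.IsNatural ρ i u v)

/-- `μ_{i0}^♭(u)`, for `μ_i(u) ≠ 0`. -/
def muZero (ρ : ℝ) (i : Fin n) (u : State n) : ℝ :=
  S.mu i (Classical.epsilon fun v => S.IsZeroDiss ρ i u v)

/-- The sign of `μ_i(u)`; multiplying parameters by it reduces `μ_i(u) < 0` to `μ_i(u) > 0`. -/
def sgn (i : Fin n) (u : State n) : ℝ := Real.sign (S.mu i u)

/-- Kinetic function `kin = μ_i^♭`: the inequalities required on the ball of radius `δ₁`. -/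
def IsKinetic (ρ δ₁ : ℝ) (i : Fin n) (kin : State n → ℝ) : Prop :=
  ∀ u ∈ ball (0 : State n) δ₁,
    (0 < S.mu i u → S.muZero ρ i u < kin u ∧ kin u ≤ S.muNat ρ i u) ∧
    (S.mu i u < 0 → S.muNat ρ i u ≤ kin u ∧ kin u < S.muZero ρ i u)

/-- `u^♭`, the state reached from `u` by the shock that the kinetic function prescribes. -/
def flat (ρ : ℝ) (i : Fin n) (kin : State n → ℝ) (u : State n) : State n :=
  S.hugoniotPoint ρ i (kin u) u

/-- `v = u^♯`: the shocks from `u` to `v` and from `u` to `u^♭` have the same speed, and the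
parameter of `v` lies between those of `u^♮` (included) and `u` (excluded). -/
def IsSharp (ρ : ℝ) (i : Fin n) (kin : State n → ℝ) (u v : State n) : Prop :=
  v ∈ S.hugoniot ρ i u ∧ S.speed u v = S.speed u (S.flat ρ i kin u) ∧
    S.sgn i u * S.muNat ρ i u ≤ S.sgn i u * S.mu i v ∧ S.sgn i u * S.mu i v < S.sgn i u * S.mu i u

/-- `μ_i^♯(u)`, for `μ_i(u) ≠ 0`. -/
def muSharp (ρ : ℝ) (i : Fin n) (kin : State n → ℝ) (u : State n) : ℝ :=
  S.mu i (Classical.epsilon fun v => S.IsSharp ρ i kin u v)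

/-- Nucleation threshold `nuc = μ_i^n`: the inequalities required on the ball of radius `δ₁`. -/
def IsThreshold (ρ δ₁ : ℝ) (i : Fin n) (kin nuc : State n → ℝ) : Prop :=
  ∀ u ∈ ball (0 : State n) δ₁,
    (0 < S.mu i u → S.muNat ρ i u ≤ nuc u ∧ nuc u ≤ S.muSharp ρ i kin u) ∧
    (S.mu i u < 0 → S.muSharp ρ i kin u ≤ nuc u ∧ nuc u ≤ S.muNat ρ i u)

/-- The wave is a nonclassical shock: it violates the Lax shock inequalities. -/
def IsNonclassical (a : Wave n) : Prop := a.isShock = true ∧ ¬ S.Lax a.fam a.left a.right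

/-- Kinetic relation: every nonclassical `i`-shock is the one given by the kinetic function. -/
def KineticRelation (ρ : ℝ) (i : Fin n) (kin : State n → ℝ) (L : List (Wave n)) : Prop :=
  ∀ a ∈ L, S.IsNonclassical a → a.right = S.flat ρ i kin a.left

/-- Nucleation in an `i`-fan `L` from `u` to `v` that begins with a shock: if the jump exceeds the
threshold, then the first shock is the one given by the kinetic function. -/
def Nucleation (ρ : ℝ) (i : Fin n) (kin nuc : State n → ℝ) (u v : State n)
    (L : List (Wave n)) : Prop :=
  ∀ a, L.head? = some a → a.isShock = true →
    |S.mu i u - nuc u| < |S.mu i u - S.mu i v| → a.right = S.flat ρ i kin u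

/-- Entropy-satisfying `i`-fans from `u` to `v` which obey the kinetic relation and nucleate beyond
the threshold. -/
def IsNCFan (ρ : ℝ) (i : Fin n) (kin nuc : State n → ℝ) (u v : State n)
    (L : List (Wave n)) : Prop :=
  S.IsFan ρ i u v L ∧ S.KineticRelation ρ i kin L ∧ S.Nucleation ρ i kin nuc u v L

/-! ### The nonclassical wave curve -/

/-- First piece: rarefaction. -/
def piece1 (ρ : ℝ) (i : Fin n) (u : State n) : Set (State n) :=
  {v ∈ S.integralCurve ρ i u | S.sgn i u * S.mu i u ≤ S.sgn i u * S.mu i v}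

/-- Second piece: classical shock. -/
def piece2 (ρ : ℝ) (i : Fin n) (nuc : State n → ℝ) (u : State n) : Set (State n) :=
  {v ∈ S.hugoniot ρ i u | S.sgn i u * nuc u ≤ S.sgn i u * S.mu i v ∧
    S.sgn i u * S.mu i v ≤ S.sgn i u * S.mu i u}

/-- Third piece: nonclassical shock followed by a classical shock. -/
def piece3 (ρ : ℝ) (i : Fin n) (kin : State n → ℝ) (u : State n) : Set (State n) :=
  {v ∈ S.hugoniot ρ i (S.flat ρ i kin u) | S.sgn i u * kin u ≤ S.sgn i u * S.mu i v ∧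
    S.sgn i u * S.mu i v < S.sgn i u * S.muSharp ρ i kin u}

/-- Fourth piece: nonclassical shock followed by a rarefaction. -/
def piece4 (ρ : ℝ) (i : Fin n) (kin : State n → ℝ) (u : State n) : Set (State n) :=
  {v ∈ S.integralCurve ρ i (S.flat ρ i kin u) | S.sgn i u * S.mu i v ≤ S.sgn i u * kin u}

open Classical in
/-- The nonclassical wave curve `W_i^nc(u)`. -/
def ncCurve (ρ : ℝ) (i : Fin n) (kin nuc : State n → ℝ) (u : State n) : Set (State n) :=
  if S.mu i u = 0 then S.integralCurve ρ i u
  else S.piece1 ρ i u ∪ S.piece2 ρ i nuc u ∪ S.piece3 ρ i kin u ∪ S.piece4 ρ i kin u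

/-- The first two pieces, parametrized by `m = μ_i`. -/
def classicalBranch (ρ : ℝ) (i : Fin n) (u : State n) (m : ℝ) : State n :=
  if S.sgn i u * S.mu i u ≤ S.sgn i u * m then S.integralPoint ρ i m u
  else S.hugoniotPoint ρ i m u

/-- The last two pieces, parametrized by `m = μ_i`. -/
def nonclassicalBranch (ρ : ℝ) (i : Fin n) (kin : State n → ℝ) (u : State n) (m : ℝ) : State n :=
  if S.sgn i u * kin u ≤ S.sgn i u * m then S.hugoniotPoint ρ i m (S.flat ρ i kin u)
  else S.integralPoint ρ i m (S.flat ρ i kin u)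

/-- The two branches glued at `m = μ_i^♯(u)`. -/
def gluedBranch (ρ : ℝ) (i : Fin n) (kin : State n → ℝ) (u : State n) (m : ℝ) : State n :=
  if S.sgn i u * S.muSharp ρ i kin u ≤ S.sgn i u * m then S.classicalBranch ρ i u m
  else S.nonclassicalBranch ρ i kin u m

/-- The objects attached to a concave-convex field are well defined at each state of the ball of
radius `δ₁`: the curves `H_i(u)`, `O_i(u)` are parametrized by `m = μ_i ∈ (-ε, ε)`, and the
parameters `μ_i^♮(u)`, `μ_{i0}^♭(u)` exist and are unique. -/
structure WellDefined (ρ ε : ℝ) (i : Fin n) (u : State n) : Prop where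
  mu_lt : |S.mu i u| < ε
  hugoniot_param : ∀ m, |m| < ε → ∃! v, v ∈ S.hugoniot ρ i u ∧ S.mu i v = m
  integral_param : ∀ m, |m| < ε → ∃! v, v ∈ S.integralCurve ρ i u ∧ S.mu i v = m
  natural : S.mu i u ≠ 0 → ∃! v, S.IsNatural ρ i u v
  zeroDiss : S.mu i u ≠ 0 → ∃! v, S.IsZeroDiss ρ i u v
  order_pos : 0 < S.mu i u →
    -ε < S.muZero ρ i u ∧ S.muZero ρ i u < S.muNat ρ i u ∧ S.muNat ρ i u < 0
  order_neg : S.mu i u < 0 →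
    0 < S.muNat ρ i u ∧ S.muNat ρ i u < S.muZero ρ i u ∧ S.muZero ρ i u < ε

/-- Description of the nonclassical `i`-wave curve issuing from `u` when `μ_i(u) ≠ 0`. -/
structure NCCurveAt (ρ ε : ℝ) (C : ℝ≥0) (i : Fin n) (kin nuc : State n → ℝ) (u : State n) :
    Prop where
  /-- The companion state `u^♯` exists and is unique. -/
  sharp : ∃! v, S.IsSharp ρ i kin u v
  /-- The shock from `u` to `u^♭` is entropy-satisfying, and is nonclassical unless it is the
  right-contact. -/
  flat_wave : S.IsWave ρ ⟨i, true, u, S.flat ρ i kin u⟩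
  flat_nonclassical : kin u ≠ S.muNat ρ i u → ¬ S.Lax i u (S.flat ρ i kin u)
  /-- The criteria leave exactly the following wave fans: a rarefaction, a classical shock, a
  nonclassical shock followed by a classical shock, a nonclassical shock followed by a
  rarefaction. -/
  fans : ∀ v L, S.IsNCFan ρ i kin nuc u v L ↔
    (v ∈ S.piece1 ρ i u ∧ L = Wave.seg i false u v) ∨
    (v ∈ S.piece2 ρ i nuc u ∧ L = Wave.seg i true u v) ∨
    (v ∈ S.piece3 ρ i kin u ∧
      L = ⟨i, true, u, S.flat ρ i kin u⟩ :: Wave.seg i true (S.flat ρ i kin u) v) ∨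
    (v ∈ S.piece4 ρ i kin u ∧
      L = ⟨i, true, u, S.flat ρ i kin u⟩ :: Wave.seg i false (S.flat ρ i kin u) v)
  piece2_lax : ∀ v ∈ S.piece2 ρ i nuc u, v ≠ u → S.Lax i u v
  piece3_lax : ∀ v ∈ S.piece3 ρ i kin u, v ≠ S.flat ρ i kin u → S.Lax i (S.flat ρ i kin u) v
  /-- Each of the two branches is a continuous curve along which `μ_i(u) = m`. -/
  classical_mem : ∀ m, |m| < ε → S.sgn i u * nuc u ≤ S.sgn i u * m →
    S.classicalBranch ρ i u m ∈ S.piece1 ρ i u ∪ S.piece2 ρ i nuc u ∧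
      S.mu i (S.classicalBranch ρ i u m) = m
  nonclassical_mem : ∀ m, |m| < ε → S.sgn i u * m < S.sgn i u * S.muSharp ρ i kin u →
    S.nonclassicalBranch ρ i kin u m ∈ S.piece3 ρ i kin u ∪ S.piece4 ρ i kin u ∧
      S.mu i (S.nonclassicalBranch ρ i kin u m) = m
  classical_cont : ContinuousOn (S.classicalBranch ρ i u)
    {m | |m| < ε ∧ S.sgn i u * nuc u ≤ S.sgn i u * m}
  nonclassical_cont : ContinuousOn (S.nonclassicalBranch ρ i kin u)
    {m | |m| < ε ∧ S.sgn i u * m < S.sgn i u * S.muSharp ρ i kin u}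
  /-- Conversely, the pieces consist of these branches. -/
  classical_eq : ∀ v ∈ S.piece1 ρ i u ∪ S.piece2 ρ i nuc u, |S.mu i v| < ε →
    v = S.classicalBranch ρ i u (S.mu i v)
  nonclassical_eq : ∀ v ∈ S.piece3 ρ i kin u ∪ S.piece4 ρ i kin u, |S.mu i v| < ε →
    v = S.nonclassicalBranch ρ i kin u (S.mu i v)
  /-- Regularity when the threshold is `μ_i^♯(u)`. -/
  regular : nuc u = S.muSharp ρ i kin u → ∀ m, |m| < ε → m ≠ S.muSharp ρ i kin u →
    ContDiffAt ℝ 2 (S.gluedBranch ρ i kin u) m ∧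
      ‖iteratedDeriv 2 (S.gluedBranch ρ i kin u) m‖ ≤ C
  lipschitz : nuc u = S.muSharp ρ i kin u →
    LipschitzOnWith C (S.gluedBranch ρ i kin u) (Ioo (-ε) ε)

/-- Description of the `i`-wave curve issuing from `u` when `μ_i(u) = 0`: it is the integral
curve. -/
structure NCCurveAtZero (ρ ε : ℝ) (C : ℝ≥0) (i : Fin n) (kin nuc : State n → ℝ) (u : State n) :
    Prop where
  fans : ∀ v L, S.IsNCFan ρ i kin nuc u v L ↔
    v ∈ S.integralCurve ρ i u ∧ L = Wave.seg i false u v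
  regular : ∀ m, |m| < ε → ContDiffAt ℝ 2 (fun m => S.integralPoint ρ i m u) m ∧
      ‖iteratedDeriv 2 (fun m => S.integralPoint ρ i m u) m‖ ≤ C
  lipschitz : LipschitzOnWith C (fun m => S.integralPoint ρ i m u) (Ioo (-ε) ε)

/-! ### The Riemann problem -/

/-- The classical wave curve `W_j(u)` of a genuinely nonlinear or linearly degenerate field. -/
def classicalCurve (ρ : ℝ) (j : Fin n) (u : State n) : Set (State n) :=
  {v ∈ S.hugoniot ρ j u | S.lam j v ≤ S.lam j u} ∪
    {v ∈ S.integralCurve ρ j u | S.lam j u ≤ S.lam j v}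

open Classical in
/-- The wave curve `W_j(u)` of an arbitrary field. -/
def waveCurve (ρ δ₀ : ℝ) (kin nuc : Fin n → State n → ℝ) (j : Fin n) (u : State n) :
    Set (State n) :=
  if S.IsCC δ₀ j then S.ncCurve ρ j (kin j) (nuc j) u else S.classicalCurve ρ j u

/-- `n + 1` constant states in the ball of radius `δ₁` (the domain of the kinetic functions),
starting at `ul` and ending at `ur`. -/
def IsStates (δ₁ : ℝ) (ul ur : State n) (st : Fin (n + 1) → State n) : Prop :=
  st 0 = ul ∧ st (Fin.last n) = ur ∧ ∀ k, st k ∈ ball (0 : State n) δ₁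

/-- A self-similar solution of the Riemann problem in the form of `n + 1` constant states `st`
separated by the `j`-wave fans `fan j`, all of whose waves satisfy the entropy inequality, and whose
concave-convex fans obey the kinetic relation and nucleate beyond the threshold. -/
def IsCandidate (ρ δ₀ δ₁ : ℝ) (kin nuc : Fin n → State n → ℝ) (ul ur : State n)
    (st : Fin (n + 1) → State n) (fan : Fin n → List (Wave n)) : Prop :=
  IsStates δ₁ ul ur st ∧
  (∀ j : Fin n, S.IsFan ρ j (st j.castSucc) (st j.succ) (fan j)) ∧
  (∀ j k : Fin n, j < k → ∀ a ∈ fan j, ∀ b ∈ fan k, S.hi a < S.lo b) ∧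
  ∀ i : Fin n, S.IsCC δ₀ i →
    S.IsNCFan ρ i (kin i) (nuc i) (st i.castSucc) (st i.succ) (fan i)

/-- The fan is nonclassical: it contains a nonclassical shock. -/
def HasNonclassical (L : List (Wave n)) : Prop := ∃ a ∈ L, S.IsNonclassical a

/-- The solution with fans `fan'` is preferred to the one with fans `fan`: in the first family, in
the order of priority `prio`, in which exactly one of the two solutions has a nonclassical fan, the
fan of `fan'` is classical. (If there is a single concave-convex family, this says that `fan'` is
classical and `fan` is not, and the order is irrelevant.) -/
def Preferred (prio : Equiv.Perm (Fin n)) (fan' fan : Fin n → List (Wave n)) : Prop :=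
  ∃ i, (∀ k, prio k < prio i → (S.HasNonclassical (fan' k) ↔ S.HasNonclassical (fan k))) ∧
    ¬ S.HasNonclassical (fan' i) ∧ S.HasNonclassical (fan i)

/-- The solutions selected by the entropy inequality, the kinetic relation and the nucleation
criterion, the latter including that classical waves are preferred whenever they are available. -/
def IsSolution (ρ δ₀ δ₁ : ℝ) (kin nuc : Fin n → State n → ℝ) (prio : Equiv.Perm (Fin n))
    (ul ur : State n) (st : Fin (n + 1) → State n) (fan : Fin n → List (Wave n)) : Prop :=
  S.IsCandidate ρ δ₀ δ₁ kin nuc ul ur st fan ∧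
  ∀ st' fan', S.IsCandidate ρ δ₀ δ₁ kin nuc ul ur st' fan' → ¬ S.Preferred prio fan' fan

/-- The self-similar function of `ξ = x / t` which consists of the given waves, starting at `u`.
Inside a rarefaction, the value at `ξ` is the state `z` of the arc with `λ_i(z) = ξ`. -/
def profile (ρ : ℝ) : State n → List (Wave n) → ℝ → State n
  | u, [], _ => u
  | u, a :: L, ξ =>
      if ξ ≤ S.lo a then u
      else if ξ < S.hi a then
        Classical.epsilon fun z => S.Rarefaction ρ a.fam a.left z ∧
          S.Rarefaction ρ a.fam z a.right ∧ S.lam a.fam z = ξ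
      else profile ρ a.right L ξ

/-- `w` (a function of `(t, x)`) is a weak solution in the sense of distributions, with values in
the ball of radius `ρ`, of the system for `t > 0` with the Riemann data `ul`, `ur` at `t = 0`, and it
satisfies the entropy inequality. -/
structure IsEntropySolution (ρ : ℝ) (ul ur : State n) (w : ℝ × ℝ → State n) : Prop where
  measurable : Measurable w
  mem_ball : ∀ p, w p ∈ ball (0 : State n) ρ
  weak : ∀ φ : ℝ × ℝ → ℝ, ContDiff ℝ ∞ φ → HasCompactSupport φ →
    (∫ p in {p : ℝ × ℝ | 0 < p.1},
        (fderiv ℝ φ p (1, 0) • w p + fderiv ℝ φ p (0, 1) • S.f (w p))) +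
      ∫ x : ℝ, φ (0, x) • (if x < 0 then ul else ur) = 0
  entropy : ∀ φ : ℝ × ℝ → ℝ, ContDiff ℝ ∞ φ → HasCompactSupport φ → (∀ p, 0 ≤ φ p) →
    0 ≤ (∫ p in {p : ℝ × ℝ | 0 < p.1},
        (fderiv ℝ φ p (1, 0) * S.U (w p) + fderiv ℝ φ p (0, 1) * S.F (w p))) +
      ∫ x : ℝ, φ (0, x) * S.U (if x < 0 then ul else ur)

/-- Solvability of the Riemann problem with data `ul`, `ur`. -/
structure RiemannSolved (ρ δ₀ δ₁ : ℝ) (kin nuc : Fin n → State n → ℝ)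
    (prio : Equiv.Perm (Fin n)) (ul ur : State n) : Prop where
  /-- There is exactly one solution. -/
  existsUnique : ∃! p : (Fin (n + 1) → State n) × (Fin n → List (Wave n)),
    S.IsSolution ρ δ₀ δ₁ kin nuc prio ul ur p.1 p.2
  /-- The constant states are determined by intersecting the wave curves. -/
  intersection : ∀ st, IsStates δ₁ ul ur st →
    ((∃ fan, S.IsCandidate ρ δ₀ δ₁ kin nuc ul ur st fan) ↔
      ∀ j : Fin n, st j.succ ∈ S.waveCurve ρ δ₀ kin nuc j (st j.castSucc))
  /-- In the other families the solution contains a single classical shock (or contact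
  discontinuity) or a single rarefaction. -/
  classical : ∀ st fan, S.IsSolution ρ δ₀ δ₁ kin nuc prio ul ur st fan →
    ∀ j : Fin n, ¬ S.IsCC δ₀ j →
      (fan j = Wave.seg j true (st j.castSucc) (st j.succ) ∧
        (st j.castSucc ≠ st j.succ → S.Lax j (st j.castSucc) (st j.succ))) ∨
      fan j = Wave.seg j false (st j.castSucc) (st j.succ)
  /-- The solution is a self-similar weak solution of the Riemann problem, satisfying the entropy
  inequality. -/
  weak : ∀ st fan, S.IsSolution ρ δ₀ δ₁ kin nuc prio ul ur st fan →
    S.IsEntropySolution ρ ul ur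
      fun p => S.profile ρ ul (List.ofFn fan).flatten (p.2 / p.1)

end ConsLaw

end

noncomputable section

open Filter Topology
open ContinuousLinearMap (fst snd inl inr proj smulRightL compL inverse_equiv inverse_id flip_apply comp_apply
  prod_apply id_apply toSpanSingleton toSpanSingletonCLE)

section Smooth

variable {H E : Type} [NormedAddCommGroup H] [NormedSpace ℝ H] [NormedAddCommGroup E]
  [NormedSpace ℝ E]

lemma exists_contDiff_eq_on_ball [HasContDiffBump H] {k : ℕ} {f : H → E} {δ : ℝ} (hδ : 0 < δ) (hf :
    ContDiffOn ℝ k f (ball 0 δ)) : ∃ g : H → E, ContDiff ℝ k g ∧ ∀ x ∈ ball (0 : H) (δ / 2), g x = f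
    x := by
  let χ : ContDiffBump (0 : H) := ⟨δ / 2, 3 * δ / 4, by linarith, by linarith⟩
  refine ⟨fun x => χ x • f x, ?_, fun x hx => ?_⟩
  · rw [contDiff_iff_contDiffAt]
    intro x
    by_cases hx : x ∈ ball (0 : H) δ
    · exact (χ.contDiff.contDiffAt).smul ((hf x hx).contDiffAt (isOpen_ball.mem_nhds hx))
    · have : (fun x => χ x • f x) =ᶠ[𝓝 x] fun _ => 0 := by
        have hm : (closedBall (0 : H) (3 * δ / 4))ᶜ ∈ 𝓝 x := by
          refine isClosed_closedBall.isOpen_compl.mem_nhds ?_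
          simp only [mem_compl_iff, mem_closedBall, not_le, mem_ball, not_lt] at hx ⊢
          linarith
        filter_upwards [hm] with y hy
        have : χ y = 0 := by
          apply χ.zero_of_le_dist
          simp only [mem_compl_iff, mem_closedBall, not_le] at hy
          exact hy.le
        simp [this]
      exact contDiffAt_const.congr_of_eventuallyEq this
  · have : χ x = 1 := χ.one_of_mem_closedBall (ball_subset_closedBall hx)
    simp [this]

lemma contDiff_integral_param [FiniteDimensional ℝ H] (k : ℕ) : ∀ {E : Type} [NormedAddCommGroup E]
    [NormedSpace ℝ E] [CompleteSpace E] {g : H × ℝ → E} (_ : ContDiff ℝ k g), ContDiff ℝ k fun x =>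
    ∫ t in (0 : ℝ)..1, g (x, t) := by
  induction k with
  | zero =>
    intro E _ _ _ g hg
    rw [Nat.cast_zero, contDiff_zero] at hg ⊢
    exact intervalIntegral.continuous_parametric_intervalIntegral_of_continuous'
      (f := fun x t => g (x, t)) hg 0 1
  | succ k ih =>
    intro E _ _ _ g hg
    rw [Nat.cast_add, Nat.cast_one] at hg ⊢
    obtain ⟨g', hg', hd⟩ := contDiff_succ_iff_hasFDerivAt.1 hg
    have hc : Continuous g := hg.continuous
    have hg'' : ContDiff ℝ k fun q : H × ℝ => (g' q).comp (inl ℝ H ℝ) :=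
      ((compL ℝ H (H × ℝ) E).flip
        (inl ℝ H ℝ)).contDiff.comp hg'
    refine contDiff_succ_iff_hasFDerivAt.2
      ⟨fun x => ∫ t in (0 : ℝ)..1, (g' (x, t)).comp (inl ℝ H ℝ), ih hg'', ?_⟩
    intro x
    have hK : IsCompact (closedBall x 1 ×ˢ Icc (0 : ℝ) 1) := (isCompact_closedBall x 1).prod isCompact_Icc
    obtain ⟨C, hC⟩ := hK.exists_bound_of_continuousOn hg''.continuous.continuousOn
    refine intervalIntegral.hasFDerivAt_integral_of_dominated_of_fderiv_le
      (𝕜 := ℝ) (μ := volume) (a := 0) (b := 1)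
      (F' := fun x t => (g' (x, t)).comp (inl ℝ H ℝ)) (F := fun x t => g (x, t)) (bound := fun _ => C) (ball_mem_nhds x one_pos) ?_ ?_ ?_ ?_ ?_ ?_
    · exact Eventually.of_forall fun y =>
        (hc.comp (Continuous.prodMk_right y)).aestronglyMeasurable
    · exact (hc.comp (Continuous.prodMk_right x)).intervalIntegrable _ _
    · exact (hg''.continuous.comp (Continuous.prodMk_right x)).aestronglyMeasurable
    · refine Eventually.of_forall fun t ht y hy => hC (y, t) ⟨ball_subset_closedBall hy, ?_⟩
      rw [uIoc_of_le zero_le_one] at ht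
      exact Ioc_subset_Icc_self ht
    · exact intervalIntegrable_const
    · refine Eventually.of_forall fun t _ y _ => ?_
      have h1 : HasFDerivAt (fun y : H => (y, t)) (inl ℝ H ℝ) y :=
        hasFDerivAt_prodMk_left y t
      exact (hd (y, t)).comp y h1

lemma isInvertible_of_injective [FiniteDimensional ℝ E] (T : E →L[ℝ] E) (hT : Function.Injective T)
    : T.IsInvertible :=
  ⟨(LinearEquiv.ofInjectiveEndo (T : E →ₗ[ℝ] E) hT).toContinuousLinearEquiv, by ext; rfl⟩

end Smooth

/-- The averaged derivative `∫₀¹ Df(u + t (v - u)) dt`. -/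
def meanDeriv {n : ℕ} (f : State n → State n) (q : State n × State n) :
    State n →L[ℝ] State n :=
  ∫ t in (0 : ℝ)..1, fderiv ℝ f (q.1 + t • (q.2 - q.1))

section MeanDeriv

variable {n : ℕ} {f : State n → State n}

lemma contDiff_meanDeriv (hf : ContDiff ℝ 3 f) : ContDiff ℝ 2 (meanDeriv f) := by
  have h : ContDiff ℝ 2 (fderiv ℝ f) := hf.fderiv_right (by norm_num)
  exact contDiff_integral_param 2
    (g := fun q : (State n × State n) × ℝ => fderiv ℝ f (q.1.1 + q.2 • (q.1.2 - q.1.1)))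
    (h.comp (by fun_prop))

lemma meanDeriv_self (u : State n) : meanDeriv f (u, u) = fderiv ℝ f u := by
  simp [meanDeriv]

lemma meanDeriv_swap (u v : State n) : meanDeriv f (u, v) = meanDeriv f (v, u) := by
  have := intervalIntegral.integral_comp_sub_left (a := 0) (b := 1)
    (fun t : ℝ => fderiv ℝ f (u + t • (v - u))) 1
  simp only [sub_zero, sub_self] at this
  simp only [meanDeriv]
  rw [← this]
  congr 1
  ext1 t
  congr 1
  module

lemma meanDeriv_apply (hf : ContDiff ℝ 3 f) (u v : State n) : meanDeriv f (u, v) (v - u) = f v - f u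
    := by
  have hc : Continuous (fderiv ℝ f) := hf.continuous_fderiv (by norm_num)
  have hcc : Continuous fun t : ℝ => fderiv ℝ f (u + t • (v - u)) := by fun_prop
  have h1 : ∀ t ∈ uIcc (0 : ℝ) 1, HasDerivAt (fun t : ℝ => f (u + t • (v - u)))
      (fderiv ℝ f (u + t • (v - u)) (v - u)) t := by
    intro t _
    have hd : HasFDerivAt f (fderiv ℝ f (u + t • (v - u))) (u + t • (v - u)) :=
      (hf.differentiable (by norm_num) _).hasFDerivAt
    have h2 : HasDerivAt (fun t : ℝ => u + t • (v - u)) (v - u) t := by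
      simpa using ((hasDerivAt_id t).smul_const (v - u)).const_add u
    exact hd.comp_hasDerivAt t h2
  have h3 := intervalIntegral.integral_eq_sub_of_hasDerivAt h1
    ((hcc.clm_apply continuous_const).intervalIntegrable _ _)
  simp only [meanDeriv]
  rw [ContinuousLinearMap.intervalIntegral_apply (hcc.intervalIntegrable _ _), h3]
  simp

end MeanDeriv

section Eigen

variable {n : ℕ}

lemma exists_local_eigenpair (A0 : State n →L[ℝ] State n) (l0 : ℝ) (x0 : State n) (e : State n →L[ℝ]
    ℝ) (hx : A0 x0 = l0 • x0) (he : e x0 = 1) (hinj : ∀ (y : State n) (k : ℝ), A0 y - l0 • y = k •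
    x0 → e y = 0 → y = 0) : ∃ (R : (State n →L[ℝ] State n) → State n) (l : (State n →L[ℝ] State n) →
    ℝ), ContDiffAt ℝ 2 R A0 ∧ ContDiffAt ℝ 2 l A0 ∧ R A0 = x0 ∧ l A0 = l0 ∧ ∀ᶠ A in 𝓝 A0, A (R A) =
    l A • R A ∧ e (R A) = 1 := by
  let Ψ : (State n →L[ℝ] State n) × (State n × ℝ) → State n × ℝ :=
    fun q => (q.1 q.2.1 - q.2.2 • q.2.1, e q.2.1)
  let q0 : (State n →L[ℝ] State n) × (State n × ℝ) := (A0, (x0, l0))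
  have hΨ : ContDiff ℝ 2 Ψ := by
    refine ContDiff.prodMk (ContDiff.sub ?_ ?_) ?_
    · exact contDiff_fst.clm_apply (contDiff_fst.comp contDiff_snd)
    · exact (contDiff_snd.comp contDiff_snd).smul (contDiff_fst.comp contDiff_snd)
    · exact e.contDiff.comp (contDiff_fst.comp contDiff_snd)
  have hcd : ContDiffAt ℝ 2 Ψ q0 := hΨ.contDiffAt
  have hpart : HasFDerivAt (fun z : State n × ℝ => Ψ (A0, z))
      ((fderiv ℝ Ψ q0).comp (inr ℝ _ _)) (x0, l0) :=
    ((hΨ.differentiable (by norm_num) q0).hasFDerivAt).comp (x0, l0)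
      (hasFDerivAt_prodMk_right A0 (x0, l0))
  have hval : ∀ y k, ((fderiv ℝ Ψ q0).comp (inr ℝ _ _)) (y, k) = (A0 y - (l0 • y + k • x0), e y) :=
    by
    have h1 : HasFDerivAt (fun z : State n × ℝ => Ψ (A0, z))
        (((A0.comp (fst ℝ (State n) ℝ)) -
          (l0 • (fst ℝ (State n) ℝ) +
            (snd ℝ (State n) ℝ).smulRight x0)).prod
          (e.comp (fst ℝ (State n) ℝ))) (x0, l0) := by
      refine HasFDerivAt.prodMk (HasFDerivAt.sub ?_ ?_) ?_
      · exact A0.hasFDerivAt.comp (x0, l0) hasFDerivAt_fst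
      · exact (hasFDerivAt_snd (𝕜 := ℝ) (p := (x0, l0))).smul
          (hasFDerivAt_fst (𝕜 := ℝ) (p := (x0, l0)))
      · exact e.hasFDerivAt.comp (x0, l0) hasFDerivAt_fst
    intro y k
    rw [hpart.unique h1]
    simp
  have hinv : ((fderiv ℝ Ψ q0).comp (inr ℝ _ _)).IsInvertible := by
    apply isInvertible_of_injective
    rw [injective_iff_map_eq_zero]
    rintro ⟨y, k⟩ hyk
    rw [hval, Prod.mk_eq_zero] at hyk
    have hy : y = 0 := hinj y (k) (by rw [sub_add_eq_sub_sub] at hyk; exact sub_eq_zero.1 hyk.1) hyk.2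
    subst hy
    have hx0 : x0 ≠ 0 := by rintro rfl; simp at he
    have : k = 0 := by simpa [hx0] using hyk.1
    simp [this]
  let g := hcd.implicitFunction (by norm_num) hinv
  have hg : ContDiffAt ℝ 2 g A0 := hcd.contDiffAt_implicitFunction (by norm_num) hinv
  have hg0 : g A0 = (x0, l0) := hcd.implicitFunction_apply_self (by norm_num) hinv
  have hge := hcd.eventually_apply_implicitFunction (by norm_num) hinv
  refine ⟨fun A => (g A).1, fun A => (g A).2, hg.fst, hg.snd, by simp [hg0], by simp [hg0], ?_⟩
  filter_upwards [hge] with A hA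
  have h0 : Ψ q0 = (0, 1) := by simp [Ψ, q0, hx, he]
  rw [h0] at hA
  have h1 : Ψ (A, g A) = (0, 1) := hA
  simp only [Ψ, Prod.mk.injEq] at h1
  exact ⟨sub_eq_zero.1 h1.1, h1.2⟩

/-- Smooth spectral decomposition near a matrix with real, distinct eigenvalues. -/
lemma exists_local_spectrum (A0 : State n →L[ℝ] State n) (l0 : Fin n → ℝ) (hl0 : Function.Injective
    l0) (x0 : Fin n → State n) (e : Fin n → State n →L[ℝ] ℝ) (hx : ∀ j, A0 (x0 j) = l0 j • x0 j) (he
    : ∀ j, e j (x0 j) = 1) : ∃ (R : Fin n → (State n →L[ℝ] State n) → State n) (l : Fin n → (State n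
    →L[ℝ] State n) → ℝ) (ℓ : Fin n → (State n →L[ℝ] State n) → State n →L[ℝ] ℝ), (∀ j, ContDiffAt ℝ
    2 (R j) A0 ∧ ContDiffAt ℝ 2 (l j) A0 ∧ ContDiffAt ℝ 2 (ℓ j) A0 ∧ R j A0 = x0 j ∧ l j A0 = l0 j)
    ∧ ∀ᶠ A in 𝓝 A0, (∀ j, A (R j A) = l j A • R j A ∧ e j (R j A) = 1 ∧ ℓ j A (R j A) = 1 ∧ ∀ x, ℓ j
    A (A x) = l j A * ℓ j A x) ∧ ∀ x s, x ≠ 0 → A x = s • x → ∃ j, s = l j A ∧ x = e j x • R j A :=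
    by
  have hx0 : ∀ j, x0 j ≠ 0 := fun j h => by have := he j; simp [h] at this
  have hli : LinearIndependent ℝ x0 :=
    Module.End.eigenvectors_linearIndependent' (A0 : State n →ₗ[ℝ] State n) l0 hl0 x0 fun j =>
      ⟨Module.End.mem_eigenspace_iff.2 (hx j), hx0 j⟩
  let T : (Fin n → State n) → (Fin n → ℝ) →L[ℝ] State n := fun y =>
    ∑ j, (proj (R := ℝ) (φ := fun _ : Fin n => ℝ) j).smulRight (y j)
  have hTapp : ∀ y c, T y c = ∑ j, c j • y j := fun y c => by simp [T]
  have hfr : Module.finrank ℝ (Fin n → ℝ) = Module.finrank ℝ (State n) := by simp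
  have hT0 : Function.Injective (T x0) := by
    rw [injective_iff_map_eq_zero]
    intro c hc
    rw [hTapp] at hc
    ext j
    exact Fintype.linearIndependent_iff.1 hli c hc j
  let T0 : (Fin n → ℝ) ≃L[ℝ] State n :=
    (LinearEquiv.ofInjectiveOfFinrankEq (T x0 : (Fin n → ℝ) →ₗ[ℝ] State n) hT0
      hfr).toContinuousLinearEquiv
  have hT₀ : (T0 : (Fin n → ℝ) →L[ℝ] State n) = T x0 := by ext; rfl
  have hpair : ∀ j, ∃ (R : (State n →L[ℝ] State n) → State n) (l : (State n →L[ℝ] State n) → ℝ),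
    ContDiffAt ℝ 2 R A0 ∧ ContDiffAt ℝ 2 l A0 ∧ R A0 = x0 j ∧ l A0 = l0 j ∧ ∀ᶠ A in 𝓝 A0, A (R A) =
    l A • R A ∧ e j (R A) = 1 := by
    intro j
    refine exists_local_eigenpair A0 (l0 j) (x0 j) (e j) (hx j) (he j) fun y k hy hey => ?_
    obtain ⟨c, hc⟩ := T0.surjective y
    have hc' : y = ∑ i, c i • x0 i := by rw [← hTapp, ← hT₀, ← hc]; rfl
    have h1 : ∑ i, ((l0 i - l0 j) * c i - if i = j then k else 0) • x0 i = 0 := by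
      have h2 : A0 y - l0 j • y - k • x0 j = 0 := sub_eq_zero.2 hy
      rw [hc', map_sum, Finset.smul_sum, ← Finset.sum_sub_distrib] at h2
      rw [← h2]
      simp only [sub_smul, Finset.sum_sub_distrib, map_smul, hx, ite_smul, zero_smul,
        Finset.sum_ite_eq', Finset.mem_univ, if_true, mul_smul]
      congr 2
      refine Finset.sum_congr rfl fun i _ => ?_
      rw [smul_comm]
    have h3 := Fintype.linearIndependent_iff.1 hli _ h1
    have h4 : ∀ i, i ≠ j → c i = 0 := fun i hi => by
      have := h3 i
      simp only [hi, if_false, sub_zero, mul_eq_zero, sub_eq_zero] at this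
      exact this.resolve_left fun h => hi (hl0 h)
    have h5 : y = c j • x0 j := by
      rw [hc']
      exact Finset.sum_eq_single j (fun i _ hi => by simp [h4 i hi]) (by simp)
    rw [h5, map_smul, he, smul_eq_mul, mul_one] at hey
    rw [h5, hey, zero_smul]
  choose R l hR hl hRA hlA hev using hpair
  let RR : (State n →L[ℝ] State n) → Fin n → State n := fun A j => R j A
  have hTs : ContDiffAt ℝ 2 (fun A => T (RR A)) A0 := by
    refine ContDiffAt.sum fun j _ => ?_
    have : ContDiff ℝ 2 fun y : State n =>
        (proj (R := ℝ) (φ := fun _ : Fin n => ℝ) j).smulRight y :=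
      (smulRightL ℝ (Fin n → ℝ) (State n)
        (proj (R := ℝ) (φ := fun _ : Fin n => ℝ) j)).contDiff
    exact this.contDiffAt.comp A0 (hR j)
  have hTA : T (RR A0) = T0 := by
    rw [hT₀]; congr 1; ext1 j; exact hRA j
  have hinv : ContDiffAt ℝ 2 (fun A => (T (RR A)).inverse) A0 := by
    have h1 : ContDiffAt ℝ 2 (ContinuousLinearMap.inverse : ((Fin n → ℝ) →L[ℝ] State n) → _)
        (T (RR A0)) := by rw [hTA]; exact contDiffAt_map_inverse T0
    exact h1.comp A0 hTs
  refine ⟨R, l, fun j A => (proj (R := ℝ) (φ := fun _ : Fin n => ℝ) j).comp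
    (T (RR A)).inverse, fun j => ⟨hR j, hl j, contDiffAt_const.clm_comp hinv, hRA j, hlA j⟩, ?_⟩
  have hrange : ∀ᶠ A in 𝓝 A0, T (RR A) ∈ Set.range (ContinuousLinearEquiv.toContinuousLinearMap :
    ((Fin n → ℝ) ≃L[ℝ] State n) → _) := by
    have h1 : Tendsto (fun A => T (RR A)) (𝓝 A0) (𝓝 (T (RR A0))) := hTs.continuousAt
    rw [hTA] at h1
    exact h1.eventually T0.nhds
  have hdist : ∀ᶠ A in 𝓝 A0, ∀ i j, i ≠ j → l i A ≠ l j A := by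
    rw [eventually_all]; intro i
    rw [eventually_all]; intro j
    by_cases hij : i = j
    · exact Eventually.of_forall fun A h => absurd hij h
    · have h1 : Tendsto (fun A => l i A - l j A) (𝓝 A0) (𝓝 (l0 i - l0 j)) := by
        have := ((hl i).continuousAt.tendsto.sub (hl j).continuousAt.tendsto)
        rwa [hlA, hlA] at this
      have h2 : l0 i - l0 j ≠ 0 := sub_ne_zero.2 fun h => hij (hl0 h)
      filter_upwards [h1.eventually_ne h2] with A hA _
      exact sub_ne_zero.1 hA
  filter_upwards [hrange, hdist, eventually_all.2 hev] with A hA hd hp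
  obtain ⟨TA, hTA⟩ := hA
  have hinvA : (T (RR A)).inverse = TA.symm := by
    rw [← hTA, inverse_equiv]
  have hdec : ∀ x, x = ∑ j, (TA.symm x j) • R j A := fun x => by
    have : TA (TA.symm x) = x := TA.apply_symm_apply x
    conv_lhs => rw [← this]
    have h2 : TA (TA.symm x) = T (RR A) (TA.symm x) := by rw [← hTA]; rfl
    rw [h2, hTapp]
  have hsymm : ∀ c : Fin n → ℝ, TA.symm (∑ j, c j • R j A) = c := fun c => by
    have h2 : TA c = ∑ j, c j • R j A := by
      have : TA c = T (RR A) c := by rw [← hTA]; rfl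
      rw [this, hTapp]
    rw [← h2, TA.symm_apply_apply]
  have hsR : ∀ j, TA.symm (R j A) = Pi.single j 1 := fun j => by
    rw [← hsymm (Pi.single j 1)]
    congr 1
    rw [Finset.sum_eq_single j] <;> simp +contextual
  have hAx : ∀ j x, TA.symm (A x) j = l j A * TA.symm x j := fun j x => by
    have h1 : A x = ∑ j, (l j A * TA.symm x j) • R j A := by
      conv_lhs => rw [hdec x, map_sum]
      refine Finset.sum_congr rfl fun i _ => ?_
      rw [map_smul, (hp i).1, smul_smul, mul_comm]
    rw [h1, hsymm]
  refine ⟨fun j => ⟨(hp j).1, (hp j).2, ?_, fun x => ?_⟩, fun x s hx0 hxs => ?_⟩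
  · simp [hinvA, hsR]
  · simp [hinvA, hAx]
  · have hc : TA.symm x ≠ 0 := by simpa using hx0
    obtain ⟨j, hj⟩ := Function.ne_iff.1 hc
    have hs : ∀ i, TA.symm x i ≠ 0 → s = l i A := fun i hi => by
      have h1 := hAx i x
      rw [hxs, map_smul, Pi.smul_apply, smul_eq_mul] at h1
      exact mul_right_cancel₀ hi h1
    have hoth : ∀ i, i ≠ j → TA.symm x i = 0 := fun i hi => by
      by_contra h
      exact hd i j hi ((hs i h).symm.trans (hs j hj))
    have hxj : x = TA.symm x j • R j A := by
      conv_lhs => rw [hdec x]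
      exact Finset.sum_eq_single j (fun i _ hi => by simp [hoth i hi]) (by simp)
    refine ⟨j, hs j hj, ?_⟩
    have h6 : e j x = TA.symm x j := by
      conv_lhs => rw [hxj]
      rw [map_smul, (hp j).2, smul_eq_mul, mul_one]
    rw [h6]
    exact hxj

end Eigen

section Implicit

variable {n : ℕ}

/-- The linear map `(m, u) ↦ u + (m - e u) R0`. -/
def linParam (e : State n →L[ℝ] ℝ) (R0 : State n) : ℝ × State n →L[ℝ] State n :=
  snd ℝ ℝ (State n) + (fst ℝ ℝ (State n) -
    e.comp (snd ℝ ℝ (State n))).smulRight R0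

lemma linParam_apply (e : State n →L[ℝ] ℝ) (R0 : State n) (m : ℝ) (u : State n) : linParam e R0 (m,
    u) = u + (m - e u) • R0 := by
  simp [linParam]

lemma exists_implicit_param (Rb : State n × State n → State n) (p : State n → ℝ) (hR : ContDiffAt ℝ
    2 Rb 0) (hp : ContDiffAt ℝ 2 p 0) (hp0 : p 0 = 0) (he : ∀ᶠ q in 𝓝 0, fderiv ℝ p 0 (Rb q) = 1) :
    ∃ V : ℝ × State n → State n, ContDiffAt ℝ 2 V 0 ∧ V 0 = 0 ∧ HasStrictFDerivAt V (linParam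
    (fderiv ℝ p 0) (Rb 0)) 0 ∧ ∀ᶠ z : (ℝ × State n) × State n in 𝓝 0, (z.2 - z.1.2 = fderiv ℝ p 0
    (z.2 - z.1.2) • Rb (z.1.2, z.2) ∧ p z.2 = z.1.1) ↔ V z.1 = z.2 := by
  set e := fderiv ℝ p 0 with he_def
  have he0 : e (Rb 0) = 1 := he.self_of_nhds
  let π : (ℝ × State n) × State n →L[ℝ] State n :=
    snd ℝ _ _ -
      (snd ℝ _ _).comp (fst ℝ _ _)
  let κ : (ℝ × State n) × State n →L[ℝ] State n × State n :=
    ((snd ℝ _ _).comp (fst ℝ _ _)).prod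
      (snd ℝ _ _)
  let μ : (ℝ × State n) × State n →L[ℝ] ℝ :=
    (fst ℝ _ _).comp (fst ℝ _ _)
  let G : (ℝ × State n) × State n → State n := fun z =>
    π z - (e (π z)) • Rb (κ z) + (p z.2 - μ z) • Rb 0
  have hRκ : ContDiffAt ℝ 2 (fun z => Rb (κ z)) 0 := by
    have : ContDiffAt ℝ 2 Rb (κ 0) := by simpa using hR
    exact this.comp 0 κ.contDiff.contDiffAt
  have hpz : ContDiffAt ℝ 2 (fun z : (ℝ × State n) × State n => p z.2) 0 := by
    have : ContDiffAt ℝ 2 p ((0 : (ℝ × State n) × State n).2) := hp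
    exact this.comp 0 contDiffAt_snd
  have hcd : ContDiffAt ℝ 2 G 0 :=
    (π.contDiff.contDiffAt.sub ((e.contDiff.comp π.contDiff).contDiffAt.smul hRκ)).add
      ((hpz.sub μ.contDiff.contDiffAt).smul contDiffAt_const)
  have hder : HasFDerivAt G (π - ((e.comp π).smulRight (Rb 0)) + ((e.comp (snd ℝ _ _) - μ).smulRight
    (Rb 0))) 0 := by
    refine (π.hasFDerivAt.sub ?_).add ?_
    · have h1 := (e.comp π).hasFDerivAt (x := (0 : (ℝ × State n) × State n))
      have h2 := (hRκ.differentiableAt (by norm_num)).hasFDerivAt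
      have h3 : HasFDerivAt (fun z => e (π z) • Rb (κ z)) _ 0 := h1.smul h2
      refine h3.congr_fderiv (ContinuousLinearMap.ext fun z => ?_)
      simp
    · have h1 : HasFDerivAt (fun z : (ℝ × State n) × State n => p z.2)
          (e.comp (snd ℝ _ _)) 0 := by
        have : HasFDerivAt p e ((0 : (ℝ × State n) × State n).2) :=
          (hp.differentiableAt (by norm_num)).hasFDerivAt
        exact this.comp 0 hasFDerivAt_snd
      exact (h1.sub μ.hasFDerivAt).smul_const (Rb 0)
  have hfd := hder.fderiv
  have hinr : (fderiv ℝ G 0).comp (inr ℝ (ℝ × State n) (State n)) = .id ℝ _ := by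
    rw [hfd]; ext1 v
    simp [π, μ]
  have hinv : ((fderiv ℝ G 0).comp (inr ℝ (ℝ × State n) (State n))).IsInvertible := by
    rw [hinr]; exact ⟨ContinuousLinearEquiv.refl ℝ _, rfl⟩
  have hG0 : G 0 = 0 := by simp [G, hp0]
  refine ⟨hcd.implicitFunction (by norm_num) hinv,
    hcd.contDiffAt_implicitFunction (by norm_num) hinv,
    hcd.implicitFunction_apply_self (by norm_num) hinv, ?_, ?_⟩
  · have h := hcd.hasStrictFDerivAt_implicitFunction (by norm_num) hinv
    rw [hinr, hfd, inverse_id] at h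
    refine h.congr_fderiv ?_
    refine ContinuousLinearMap.ext fun z => ?_
    obtain ⟨m, u⟩ := z
    rw [linParam_apply]
    simp [π, μ]
    module
  · have h := hcd.eventually_apply_eq_iff_implicitFunction (by norm_num) hinv
    have h2 : ∀ᶠ z in 𝓝 (0 : (ℝ × State n) × State n), e (Rb (κ z)) = 1 := by
      have : Tendsto κ (𝓝 0) (𝓝 0) := by simpa using κ.continuous.tendsto 0
      exact this.eventually he
    filter_upwards [h, h2] with z hz hz2
    rw [← hz, hG0]
    constructor
    · rintro ⟨h3, h4⟩
      simp only [G]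
      change π z - e (z.2 - z.1.2) • Rb (z.1.2, z.2) + _ = 0
      rw [← h3, h4]
      simp [π, μ]
    · intro h3
      have h4 : e (G z) = p z.2 - μ z := by
        simp only [G, map_add, map_sub, map_smul, smul_eq_mul, hz2, he0]
        ring
      rw [h3, map_zero] at h4
      have h5 : p z.2 - μ z = 0 := h4.symm
      refine ⟨?_, sub_eq_zero.1 h5⟩
      simp only [G, h5, zero_smul, add_zero] at h3
      exact sub_eq_zero.1 h3

/-- Two-jet at `u` of a curve `y` of solutions of `y - u = e (y - u) Rb (u, y)` parametrized by
`p`: it agrees with that of the integral curve of the field `x = Rb / (Dp Rb)`. -/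
lemma second_order_tangency {Rb : State n × State n → State n} {p : State n → ℝ} {e : State n →L[ℝ]
    ℝ} {x : State n → State n} {y : ℝ → State n} {u : State n} {m0 : ℝ} (hR : ContDiffAt ℝ 2 Rb (u,
    u)) (hsymm : ∀ᶠ q in 𝓝 (u, u), Rb q = Rb q.swap) (hp : ContDiffAt ℝ 2 p u) (hx :
    DifferentiableAt ℝ x u) (hxR : ∀ᶠ v in 𝓝 u, fderiv ℝ p v (x v) = 1 ∧ ∃ c : ℝ, Rb (v, v) = c • x
    v) (heR' : ∀ᶠ v in 𝓝 u, e (Rb (v, v)) = 1) (hy : ContDiffAt ℝ 2 y m0) (hyu : y m0 = u) (hyR : ∀ᶠ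
    m in 𝓝 m0, y m - u = e (y m - u) • Rb (u, y m) ∧ p (y m) = m) : deriv y m0 = x u ∧ deriv (deriv
    y) m0 = fderiv ℝ x u (x u) := by
  set ρ : ℝ → State n := fun m => Rb (u, y m) with hρ
  have hρc : ContDiffAt ℝ 2 ρ m0 := by
    have : ContDiffAt ℝ 2 Rb (u, y m0) := by rw [hyu]; exact hR
    exact ContDiffAt.comp (f := fun m => (u, y m)) m0 this (contDiffAt_const.prodMk hy)
  have one : ∀ {F : Type} [NormedAddCommGroup F] [NormedSpace ℝ F] {z : ℝ → F}, ContDiffAt ℝ 2 z m0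
    → (∀ᶠ m in 𝓝 m0, HasDerivAt z (deriv z m) m) ∧ HasDerivAt (deriv z) (deriv (deriv z) m0) m0 :=
    by
    intro F _ _ z hz
    constructor
    · filter_upwards [hz.eventually (by norm_num)] with m hm
      exact (hm.differentiableAt (by norm_num)).hasDerivAt
    · have : ContDiffAt ℝ 1 (deriv z) m0 := by
        have h1 : ContDiffAt ℝ 1 (fderiv ℝ z) m0 := hz.fderiv_right (by norm_num)
        exact h1.clm_apply contDiffAt_const
      exact (this.differentiableAt (by norm_num)).hasDerivAt
  obtain ⟨hy1, hy2⟩ := one hy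
  obtain ⟨hρ1, hρ2⟩ := one hρc
  have hyd : ∀ᶠ m in 𝓝 m0, deriv y m = e (deriv y m) • ρ m + e (y m - u) • deriv ρ m := by
    have h3 := hyR.eventually_nhds
    filter_upwards [h3, hy1, hρ1] with m h4 h5 h6
    have h7 : HasDerivAt (fun m => e (y m - u) • ρ m)
        (e (y m - u) • deriv ρ m + e (deriv y m) • ρ m) m :=
      ((e.hasFDerivAt.comp_hasDerivAt m (h5.sub_const u))).smul h6
    have h8 : HasDerivAt (fun m => y m - u) (deriv y m) m := h5.sub_const u
    have h9 : (fun m => y m - u) =ᶠ[𝓝 m] fun m => e (y m - u) • ρ m := h4.mono fun m h => h.1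
    rw [add_comm]
    exact h8.unique (h7.congr_of_eventuallyEq h9)
  have hρ0 : ρ m0 = Rb (u, u) := by simp [hρ, hyu]
  have hyd0 : deriv y m0 = e (deriv y m0) • Rb (u, u) := by
    have := hyd.self_of_nhds
    simpa [hyu, hρ0] using this
  have hydd : deriv (deriv y) m0 = e (deriv (deriv y) m0) • Rb (u, u) + (2 * e (deriv y m0)) • deriv
    ρ m0 := by
    have h1 : HasDerivAt (fun m => e (deriv y m) • ρ m + e (y m - u) • deriv ρ m)
        ((e (deriv y m0) • deriv ρ m0 + e (deriv (deriv y) m0) • ρ m0) +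
          (e (y m0 - u) • deriv (deriv ρ) m0 + e (deriv y m0) • deriv ρ m0)) m0 :=
      ((e.hasFDerivAt.comp_hasDerivAt m0 hy2).smul hρ1.self_of_nhds).add
        ((e.hasFDerivAt.comp_hasDerivAt m0 (hy1.self_of_nhds.sub_const u)).smul hρ2)
    have h2 := hy2.unique (h1.congr_of_eventuallyEq hyd)
    rw [hyu, hρ0, sub_self, map_zero, zero_smul] at h2
    conv_lhs => rw [h2]
    module
  -- the derivative of `ρ` is half of that of the diagonal
  have hRd : HasFDerivAt Rb (fderiv ℝ Rb (u, u)) (u, u) :=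
    (hR.differentiableAt (by norm_num)).hasFDerivAt
  have hsw : ∀ a b, fderiv ℝ Rb (u, u) (a, b) = fderiv ℝ Rb (u, u) (b, a) := by
    intro a b
    have h1 : HasFDerivAt (fun q => Rb (Prod.swap q))
        ((fderiv ℝ Rb (u, u)).comp (ContinuousLinearEquiv.prodComm ℝ (State n) (State n) :
          State n × State n →L[ℝ] State n × State n)) (u, u) :=
      HasFDerivAt.comp (u, u) (g := Rb) (f := Prod.swap) hRd
        (ContinuousLinearEquiv.prodComm ℝ (State n) (State n)).hasFDerivAt
    have h2 := hRd.unique (h1.congr_of_eventuallyEq hsymm)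
    conv_lhs => rw [h2]
    rfl
  have hρ' : deriv ρ m0 = fderiv ℝ Rb (u, u) (0, deriv y m0) := by
    have h1 : HasDerivAt (fun m => (u, y m)) ((0 : State n), deriv y m0) m0 :=
      (hasDerivAt_const m0 u).prodMk hy1.self_of_nhds
    have h2 : HasFDerivAt Rb (fderiv ℝ Rb (u, u)) (u, y m0) := by
      rw [hyu]; exact hRd
    exact (HasFDerivAt.comp_hasDerivAt (f := fun m => (u, y m)) m0 h2 h1).deriv
  have hdiag : HasFDerivAt (fun v => Rb (v, v))
      ((fderiv ℝ Rb (u, u)).comp ((ContinuousLinearMap.id ℝ _).prod (.id ℝ _))) u :=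
    HasFDerivAt.comp u (g := Rb) (f := fun v => (v, v)) hRd
      ((hasFDerivAt_id u).prodMk (hasFDerivAt_id u))
  have hdiag2 : ∀ h, fderiv ℝ Rb (u, u) (h, h) = (2 : ℝ) • fderiv ℝ Rb (u, u) (0, h) := by
    intro h
    have : ((h, h) : State n × State n) = (h, 0) + (0, h) := by simp
    rw [this, map_add, hsw h 0, two_smul]
  -- the field `x`
  have hpd : ∀ᶠ v in 𝓝 u, HasFDerivAt p (fderiv ℝ p v) v := by
    filter_upwards [hp.eventually (by norm_num)] with v hv
    exact (hv.differentiableAt (by norm_num)).hasFDerivAt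
  have hpdd : HasFDerivAt (fderiv ℝ p) (fderiv ℝ (fderiv ℝ p) u) u :=
    ((hp.fderiv_right (m := 1) (by norm_num)).differentiableAt (by norm_num)).hasFDerivAt
  obtain ⟨hx1, c0, hc₀⟩ := hxR.self_of_nhds
  have hxd : HasFDerivAt x (fderiv ℝ x u) u := hx.hasFDerivAt
  -- normalization along `y`
  have hpy : ∀ᶠ m in 𝓝 m0, fderiv ℝ p (y m) (deriv y m) = 1 := by
    have hyc : Tendsto y (𝓝 m0) (𝓝 u) := by
      have := hy1.self_of_nhds.continuousAt.tendsto
      rwa [hyu] at this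
    filter_upwards [hyR.eventually_nhds, hy1, hyc.eventually hpd] with m h1 h2 h3
    have h4 : HasDerivAt (fun m => p (y m)) (fderiv ℝ p (y m) (deriv y m)) m :=
      h3.comp_hasDerivAt m h2
    exact h4.unique ((hasDerivAt_id m).congr_of_eventuallyEq (h1.mono fun m h => h.2))
  have hpy2 : fderiv ℝ (fderiv ℝ p) u (deriv y m0) (deriv y m0) + fderiv ℝ p u (deriv (deriv y) m0)
    = 0 := by
    have h1 : HasDerivAt (fun m => fderiv ℝ p (y m))
        (fderiv ℝ (fderiv ℝ p) u (deriv y m0)) m0 := by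
      have : HasFDerivAt (fderiv ℝ p) (fderiv ℝ (fderiv ℝ p) u) (y m0) := by
        rw [hyu]; exact hpdd
      exact this.comp_hasDerivAt m0 hy1.self_of_nhds
    have h2 := h1.clm_apply hy2
    have h3 := h2.unique ((hasDerivAt_const m0 (1 : ℝ)).congr_of_eventuallyEq hpy)
    rw [hyu] at h3
    exact h3
  have hpx2 : ∀ h, fderiv ℝ (fderiv ℝ p) u h (x u) + fderiv ℝ p u (fderiv ℝ x u h) = 0 := by
    have h2 := hpdd.clm_apply hxd
    have h3 := h2.unique ((hasFDerivAt_const (1 : ℝ) u).congr_of_eventuallyEq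
      (hxR.mono fun v h => h.1))
    intro h
    have h4 := congrArg (fun T => T h) h3
    simp only [add_apply, comp_apply,
      flip_apply, zero_apply] at h4
    rw [add_comm]
    exact h4
  have hyx : deriv y m0 = x u := by
    rw [hyd0, hc₀, smul_smul]
    have h1 := hpy.self_of_nhds
    rw [hyu, hyd0, hc₀, smul_smul, map_smul, hx1, smul_eq_mul, mul_one] at h1
    rw [h1, one_smul]
  refine ⟨hyx, ?_⟩
  -- differentiate `x = e(x) Rb`
  have hxe : ∀ᶠ v in 𝓝 u, x v = e (x v) • Rb (v, v) := by
    filter_upwards [hxR, heR'] with v h1 h2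
    obtain ⟨-, c, hc⟩ := h1
    rw [hc, map_smul, smul_eq_mul] at h2
    rw [hc, smul_smul, mul_comm, h2, one_smul]
  have hxe' : fderiv ℝ x u (x u) = e (x u) • fderiv ℝ Rb (u, u) (x u, x u) + e (fderiv ℝ x u (x u))
    • Rb (u, u) := by
    have h1 : HasFDerivAt (fun v => e (x v) • Rb (v, v)) _ u :=
      (HasFDerivAt.comp u e.hasFDerivAt hxd).smul hdiag
    have h2 := hxd.unique (h1.congr_of_eventuallyEq hxe)
    have h3 := congrArg (fun T => T (x u)) h2
    simpa using h3
  have hdiff : deriv (deriv y) m0 - fderiv ℝ x u (x u) = (e (deriv (deriv y) m0) - e (fderiv ℝ x u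
    (x u))) • Rb (u, u) := by
    conv_lhs => rw [hydd, hxe', hρ', hyx, hdiag2]
    module
  have hzero : fderiv ℝ p u (deriv (deriv y) m0 - fderiv ℝ x u (x u)) = 0 := by
    have h1 := hpx2 (x u)
    rw [hyx] at hpy2
    rw [map_sub]
    linarith
  rw [hdiff, hc₀, smul_smul, map_smul, hx1, smul_eq_mul, mul_one] at hzero
  rw [hc₀, smul_smul, hzero, zero_smul] at hdiff
  exact sub_eq_zero.1 hdiff

end Implicit

section Flow

variable {n : ℕ}

lemma exists_local_flow {x : State n → State n} (hx : ContDiffAt ℝ 1 x 0) : ∃ φ : ℝ × State n →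
    State n, HasStrictFDerivAt φ (snd ℝ ℝ (State n) + (fst ℝ ℝ (State n)).smulRight (x 0)) 0 ∧ ∃ a >
    0, ∀ u : State n, ‖u‖ < a → φ (0, u) = u ∧ ∀ t, |t| < a → HasDerivAt (fun t => φ (t, u)) (x (φ
    (t, u))) t := by
  obtain ⟨ε, hε, a, r, L, K, hr, hpl⟩ := IsPicardLindelof.of_contDiffAt_one hx
  obtain ⟨α, hα, L', hL'⟩ :=
    (hpl 0).exists_forall_mem_closedBall_eq_hasDerivWithinAt_lipschitzOnWith
  simp only [zero_sub, zero_add] at hα hL'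
  obtain ⟨K2, N, hN, hLip⟩ := hx.exists_lipschitzOnWith
  let φ : ℝ × State n → State n := fun q => α q.2 q.1
  have hr' : (0 : ℝ) < r := hr
  have hder : ∀ u : State n, ‖u‖ < r → ∀ t, |t| < ε →
      HasDerivAt (fun t => φ (t, u)) (x (φ (t, u))) t := by
    intro u hu t ht
    rw [abs_lt] at ht
    exact ((hα u (by simpa using hu.le)).2 t ⟨ht.1.le, ht.2.le⟩).hasDerivAt
      (Icc_mem_nhds ht.1 ht.2)
  have h0 : ∀ u : State n, ‖u‖ < r → φ (0, u) = u := fun u hu => (hα u (by simpa using hu.le)).1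
  have hcont : ContinuousAt φ 0 := by
    have h1 : ContinuousOn (Function.uncurry α) (closedBall (0 : State n) r ×ˢ Icc (-ε) ε) :=
      continuousOn_prod_of_continuousOn_lipschitzOnWith _ L'
        (fun x hx => HasDerivWithinAt.continuousOn (hα x hx).2) hL'
    have h2 : ContinuousAt (Function.uncurry α) ((0 : State n), (0 : ℝ)) :=
      h1.continuousAt (prod_mem_nhds (closedBall_mem_nhds _ hr') (Icc_mem_nhds (by linarith) hε))
    have h3 : ContinuousAt (Prod.swap : ℝ × State n → State n × ℝ) 0 :=
      continuous_swap.continuousAt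
    exact ContinuousAt.comp (g := Function.uncurry α) (f := Prod.swap) h2 h3
  have hφ0 : φ 0 = 0 := h0 0 (by simpa using hr')
  have hxc : ContinuousAt (fun q => x (φ q)) 0 := by
    have : ContinuousAt x (φ 0) := by rw [hφ0]; exact hx.continuousAt
    exact this.comp hcont
  refine ⟨φ, ?_, min ε r, lt_min hε hr', fun u hu => ⟨h0 u (hu.trans_le (min_le_right _ _)),
    fun t ht => hder u (hu.trans_le (min_le_right _ _)) t (ht.trans_le (min_le_left _ _))⟩⟩
  refine .of_isLittleO (Asymptotics.isLittleO_iff.2 fun c hc => ?_)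
  have hev : ∀ᶠ q : ℝ × State n in 𝓝 0, φ q ∈ N ∧ ‖x (φ q) - x 0‖ ≤ c / 2 := by
    refine (hcont.eventually (by rw [hφ0]; exact hN)).and ?_
    have h1 : Tendsto (fun q => ‖x (φ q) - x 0‖) (𝓝 0) (𝓝 0) := by
      have := (hxc.sub (continuousAt_const (y := x 0))).norm.tendsto
      simpa [hφ0] using this
    exact (h1.eventually (gt_mem_nhds (half_pos hc))).mono fun q hq => hq.le
  obtain ⟨d, hd, hball⟩ := Metric.eventually_nhds_iff.1 hev
  set b := min (min d (min ε r)) (c / 2 / (K2 * L' + 1)) with hb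
  have hKL : (0 : ℝ) < K2 * L' + 1 := by positivity
  have hbpos : 0 < b := lt_min (lt_min hd (lt_min hε hr')) (by positivity)
  have hbd : b ≤ d := (min_le_left _ _).trans (min_le_left _ _)
  have hbε : b ≤ ε := ((min_le_left _ _).trans (min_le_right _ _)).trans (min_le_left _ _)
  have hbr : b ≤ r := ((min_le_left _ _).trans (min_le_right _ _)).trans (min_le_right _ _)
  have hbc : K2 * L' * b ≤ c / 2 := by
    have h1 : b ≤ c / 2 / (K2 * L' + 1) := min_le_right _ _
    have h2 : b * (K2 * L' + 1) ≤ c / 2 := (le_div_iff₀ hKL).1 h1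
    nlinarith
  have hnear : ∀ u : State n, ‖u‖ < b → ∀ t, |t| < b → φ (t, u) ∈ N ∧
      ‖x (φ (t, u)) - x 0‖ ≤ c / 2 := fun u hu t ht => hball (by
    rw [dist_zero_right, Prod.norm_def]
    exact max_lt (by simpa using ht.trans_le hbd) (hu.trans_le hbd))
  have hconv : Convex ℝ (Ioo (-b) b) := convex_Ioo _ _
  rw [← Prod.zero_eq_mk] at *
  have hnhds : ∀ᶠ z : (ℝ × State n) × (ℝ × State n) in 𝓝 (0, 0), dist z 0 < b :=
    Metric.ball_mem_nhds _ hbpos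
  filter_upwards [hnhds] with z hz
  obtain ⟨⟨t, u⟩, ⟨t', u'⟩⟩ := z
  rw [dist_zero_right] at hz
  simp only [Prod.norm_def, Real.norm_eq_abs, max_lt_iff] at hz
  obtain ⟨⟨ht, hu⟩, ⟨ht', hu'⟩⟩ := hz
  have hmem : t ∈ Ioo (-b) b := abs_lt.1 ht
  have hmem' : t' ∈ Ioo (-b) b := abs_lt.1 ht'
  have h0m : (0 : ℝ) ∈ Ioo (-b) b := ⟨by linarith, hbpos⟩
  -- variation in the time
  have h1 : ‖(φ (t, u) - t • x 0) - (φ (t', u) - t' • x 0)‖ ≤ c / 2 * ‖t - t'‖ := by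
    refine hconv.norm_image_sub_le_of_norm_hasDerivWithin_le
      (f := fun t => φ (t, u) - t • x 0) (f' := fun t => x (φ (t, u)) - (1 : ℝ) • x 0)
      (fun τ hτ => ?_) (fun τ hτ => ?_) hmem' hmem
    · exact ((hder u (hu.trans_le hbr) τ ((abs_lt.2 hτ).trans_le hbε)).sub
        ((hasDerivAt_id τ).smul_const (x 0))).hasDerivWithinAt
    · rw [one_smul]; exact (hnear u hu τ (abs_lt.2 hτ)).2
  -- variation in the initial state
  have h2 : ‖(φ (t', u) - φ (t', u')) - (φ (0, u) - φ (0, u'))‖ ≤ K2 * L' * ‖u - u'‖ * ‖t' - 0‖ :=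
    by
    refine hconv.norm_image_sub_le_of_norm_hasDerivWithin_le
      (f := fun t => φ (t, u) - φ (t, u')) (f' := fun t => x (φ (t, u)) - x (φ (t, u')))
      (fun τ hτ => ?_) (fun τ hτ => ?_) h0m hmem'
    · exact ((hder u (hu.trans_le hbr) τ ((abs_lt.2 hτ).trans_le hbε)).sub
        (hder u' (hu'.trans_le hbr) τ ((abs_lt.2 hτ).trans_le hbε))).hasDerivWithinAt
    · have h3 := hLip.norm_sub_le (hnear u hu τ (abs_lt.2 hτ)).1 (hnear u' hu' τ (abs_lt.2 hτ)).1
      have h4 := (hL' τ ⟨by linarith [hτ.1], by linarith [hτ.2]⟩).norm_sub_le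
        (by simpa using (hu.trans_le hbr).le : u ∈ closedBall (0 : State n) r)
        (by simpa using (hu'.trans_le hbr).le : u' ∈ closedBall (0 : State n) r)
      calc _ ≤ K2 * ‖φ (τ, u) - φ (τ, u')‖ := h3
        _ ≤ K2 * (L' * ‖u - u'‖) := by gcongr
        _ = _ := by ring
  rw [h0 u (hu.trans_le hbr), h0 u' (hu'.trans_le hbr), sub_zero] at h2
  have h5 : φ (t, u) - φ (t', u') - (snd ℝ ℝ (State n) + (fst ℝ ℝ (State n)).smulRight (x 0)) ((t,
    u) - (t', u')) = ((φ (t, u) - t • x 0) - (φ (t', u) - t' • x 0)) + ((φ (t', u) - φ (t', u')) -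
    (u - u')) := by
    simp
    module
  rw [h5]
  refine (norm_add_le _ _).trans ?_
  have h6 : K2 * L' * ‖u - u'‖ * ‖t'‖ ≤ c / 2 * ‖u - u'‖ := by
    have : ‖t'‖ ≤ b := ht'.le
    calc (K2 : ℝ) * L' * ‖u - u'‖ * ‖t'‖ ≤ K2 * L' * ‖u - u'‖ * b := by gcongr
      _ = K2 * L' * b * ‖u - u'‖ := by ring
      _ ≤ _ := by gcongr
  have h7 : ‖t - t'‖ ≤ ‖((t, u) : ℝ × State n) - (t', u')‖ :=
    norm_fst_le (((t, u) : ℝ × State n) - (t', u'))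
  have h8 : ‖u - u'‖ ≤ ‖((t, u) : ℝ × State n) - (t', u')‖ :=
    norm_snd_le (((t, u) : ℝ × State n) - (t', u'))
  have h9 : c / 2 * ‖t - t'‖ ≤ c / 2 * ‖((t, u) : ℝ × State n) - (t', u')‖ := by gcongr
  have h10 : c / 2 * ‖u - u'‖ ≤ c / 2 * ‖((t, u) : ℝ × State n) - (t', u')‖ := by gcongr
  linarith

end Flow

lemma exists_gap {n : ℕ} (l : Fin n → ℝ) (hl : Function.Injective l) : ∃ g > 0, ∀ i j, i ≠ j → 4 * g
    < |l i - l j| := by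
  have h : ∀ᶠ g in 𝓝[>] (0 : ℝ), ∀ i j, i ≠ j → 4 * g < |l i - l j| := by
    rw [eventually_all]; intro i
    rw [eventually_all]; intro j
    by_cases hij : i = j
    · exact Eventually.of_forall fun g h => absurd hij h
    · have h1 : 0 < |l i - l j| := abs_pos.2 (sub_ne_zero.2 fun h => hij (hl h))
      have h2 : Tendsto (fun g : ℝ => 4 * g) (𝓝[>] 0) (𝓝 0) := by
        have : Tendsto (fun g : ℝ => 4 * g) (𝓝 0) (𝓝 (4 * 0)) := by
          exact (continuous_const.mul continuous_id).tendsto 0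
        rw [mul_zero] at this
        exact this.mono_left nhdsWithin_le_nhds
      filter_upwards [h2.eventually (gt_mem_nhds h1)] with g hg _ using hg
  obtain ⟨g, hg, hpos⟩ := (h.and self_mem_nhdsWithin).exists
  exact ⟨g, hpos, hg⟩

namespace ConsLaw

variable {n : ℕ} (S : ConsLaw n) (δ : ℝ)

open Classical in
/-- A parameter along the `i`-th curves: `μ_i` if the field is concave-convex, otherwise the
component along `r_i(0)`. -/
def param (i : Fin n) : State n → ℝ :=
  if S.IsCC δ i then S.mu i else fun v => inner ℝ (S.r i 0) v

/-- The multiple of `r_i` along which the parameter grows at unit rate. -/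
def unitField (i : Fin n) (v : State n) : State n :=
  (fderiv ℝ (S.param δ i) v (S.r i v))⁻¹ • S.r i v

/-- The derivative of `λ_i` along `unitField`. -/
def growth (i : Fin n) (v : State n) : ℝ :=
  (fderiv ℝ (S.param δ i) v (S.r i v))⁻¹ * S.nonlin i v

variable {S δ} (hδ : 0 < δ) (hS : S.Hyp δ)
include hδ hS

omit hδ in
lemma Hyp.contDiffOn_lam (i : Fin n) : ContDiffOn ℝ 2 (S.lam i) (ball 0 δ) := by
  have h1 : ContDiffOn ℝ 2 (fderiv ℝ S.f) (ball 0 δ) :=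
    hS.f_smooth.fderiv_of_isOpen isOpen_ball (by norm_num)
  have h2 : ContDiffOn ℝ 2 (fun u => inner ℝ (S.r i u) (fderiv ℝ S.f u (S.r i u)) /
      inner ℝ (S.r i u) (S.r i u)) (ball 0 δ) := by
    refine ContDiffOn.div ?_ ?_ ?_
    · exact (hS.r_smooth i).inner ℝ (h1.clm_apply (hS.r_smooth i))
    · exact (hS.r_smooth i).inner ℝ (hS.r_smooth i)
    · exact fun u hu => inner_self_ne_zero.2 (hS.r_ne_zero i u hu)
  refine h2.congr fun u hu => ?_
  have h3 : inner ℝ (S.r i u) (S.r i u) ≠ (0 : ℝ) := inner_self_ne_zero.2 (hS.r_ne_zero i u hu)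
  rw [hS.eigen i u hu, inner_smul_right, mul_div_cancel_right₀ _ h3]

omit hδ in
lemma Hyp.contDiffOn_nonlin (i : Fin n) : ContDiffOn ℝ 1 (S.nonlin i) (ball 0 δ) :=
  (((hS.contDiffOn_lam i).fderiv_of_isOpen isOpen_ball (m := 1) (by norm_num))).clm_apply
    ((hS.r_smooth i).of_le (by norm_num))

omit hδ in
lemma Hyp.contDiffOn_param (i : Fin n) : ContDiffOn ℝ 2 (S.param δ i) (ball 0 δ) := by
  unfold param
  split_ifs with h
  · exact hS.mu_smooth i h
  · exact (contDiff_const.inner ℝ contDiff_id).contDiffOn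

lemma Hyp.param_zero (i : Fin n) : S.param δ i 0 = 0 := by
  unfold param
  split_ifs with h
  · exact (hS.mu_zero i h 0 (by simpa using hδ)).2 h.1
  · simp

lemma Hyp.param_deriv_pos (i : Fin n) : 0 < fderiv ℝ (S.param δ i) 0 (S.r i 0) := by
  have h0 : (0 : State n) ∈ ball (0 : State n) δ := by simpa using hδ
  unfold param
  split_ifs with h
  · exact hS.mu_mono i h 0 h0
  · have h1 : HasFDerivAt (fun v : State n => (inner ℝ (S.r i 0) v : ℝ))
        (innerSL ℝ (S.r i 0)) 0 := (innerSL ℝ (S.r i 0)).hasFDerivAt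
    rw [h1.fderiv]
    simpa [sq_pos_iff] using hS.r_ne_zero i 0 h0

omit hS in
lemma eventually_mem_ball : ∀ᶠ u : State n in 𝓝 0, u ∈ ball (0 : State n) δ :=
  ball_mem_nhds _ hδ

omit hδ in
lemma Hyp.contDiffOn_param_deriv (i : Fin n) : ContDiffOn ℝ 1 (fun v => fderiv ℝ (S.param δ i) v
    (S.r i v)) (ball 0 δ) :=
  ((hS.contDiffOn_param i).fderiv_of_isOpen isOpen_ball (m := 1) (by norm_num)).clm_apply
    ((hS.r_smooth i).of_le (by norm_num))

omit hS in
lemma contDiffAt_of_on {E : Type*} [NormedAddCommGroup E] [NormedSpace ℝ E] {k : WithTop ℕ∞} {g :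
    State n → E} (hg : ContDiffOn ℝ k g (ball 0 δ)) : ContDiffAt ℝ k g 0 :=
  (hg 0 (by simpa using hδ)).contDiffAt (ball_mem_nhds _ hδ)

lemma Hyp.eventually_param_deriv_pos (i : Fin n) : ∀ᶠ v in 𝓝 (0 : State n), 0 < fderiv ℝ (S.param δ
    i) v (S.r i v) :=
  (contDiffAt_of_on hδ (hS.contDiffOn_param_deriv i)).continuousAt.eventually
    (lt_mem_nhds (hS.param_deriv_pos hδ i))

lemma Hyp.contDiffAt_unitField (i : Fin n) : ContDiffAt ℝ 1 (S.unitField δ i) 0 :=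
  ((contDiffAt_of_on hδ (hS.contDiffOn_param_deriv i)).inv
    (hS.param_deriv_pos hδ i).ne').smul
    ((contDiffAt_of_on hδ (hS.r_smooth i)).of_le (by norm_num))

lemma Hyp.contDiffAt_growth (i : Fin n) : ContDiffAt ℝ 1 (S.growth δ i) 0 :=
  ((contDiffAt_of_on hδ (hS.contDiffOn_param_deriv i)).inv
    (hS.param_deriv_pos hδ i).ne').mul
    (contDiffAt_of_on hδ (hS.contDiffOn_nonlin i))

lemma Hyp.eventually_param_unitField (i : Fin n) : ∀ᶠ v in 𝓝 (0 : State n), fderiv ℝ (S.param δ i) v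
    (S.unitField δ i v) = 1 := by
  filter_upwards [hS.eventually_param_deriv_pos hδ i] with v hv
  rw [unitField, map_smul, smul_eq_mul, inv_mul_cancel₀ hv.ne']

omit hδ hS in
lemma fderiv_lam_unitField (i : Fin n) (v : State n) : fderiv ℝ (S.lam i) v (S.unitField δ i v) =
    S.growth δ i v := by
  rw [unitField, map_smul, smul_eq_mul]; rfl

/-- The averaged eigenvectors and eigenvalues near the origin, and their relation to jumps. -/
lemma Hyp.exists_averaged_spectrum : ∃ (Rb : Fin n → State n × State n → State n) (Lb : Fin n →
    State n × State n → ℝ) (ℓ : Fin n → State n → State n →L[ℝ] ℝ), (∀ j, ContDiffAt ℝ 2 (Rb j) 0 ∧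
    ContDiffAt ℝ 2 (Lb j) 0 ∧ ContDiffAt ℝ 2 (ℓ j) 0 ∧ Rb j 0 = S.unitField δ j 0 ∧ ℓ j 0
    (S.unitField δ j 0) = 1) ∧ (∀ j q, Rb j q = Rb j q.swap ∧ Lb j q = Lb j q.swap) ∧ (∀ᶠ q in 𝓝 (0
    : State n × State n), ∀ j, fderiv ℝ (S.param δ j) 0 (Rb j q) = 1 ∧ ∀ t : ℝ, q.2 - q.1 = t • Rb j
    q → S.f q.2 - S.f q.1 = Lb j q • (q.2 - q.1)) ∧ (∀ᶠ q in 𝓝 (0 : State n × State n), ∀ s : ℝ, q.2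
    ≠ q.1 → S.f q.2 - S.f q.1 = s • (q.2 - q.1) → ∃ j, s = Lb j q ∧ q.2 - q.1 = fderiv ℝ (S.param δ
    j) 0 (q.2 - q.1) • Rb j q) ∧ (∀ᶠ u in 𝓝 (0 : State n), ∀ j, Lb j (u, u) = S.lam j u ∧ (∃ c : ℝ,
    Rb j (u, u) = c • S.unitField δ j u) ∧ ∀ x, ℓ j u (fderiv ℝ S.f u x) = S.lam j u * ℓ j u x) :=
    by
  have h0 : (0 : State n) ∈ ball (0 : State n) δ := by simpa using hδ
  obtain ⟨F, hF, hFf⟩ := exists_contDiff_eq_on_ball (k := 3) hδ hS.f_smooth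
  have hF3 : ContDiff ℝ 3 F := hF
  have hFd : ∀ u ∈ ball (0 : State n) (δ / 2), fderiv ℝ F u = fderiv ℝ S.f u := by
    intro u hu
    have : F =ᶠ[𝓝 u] S.f := by
      filter_upwards [isOpen_ball.mem_nhds hu] with v hv using hFf v hv
    exact this.fderiv_eq
  have hhalf : ∀ᶠ u : State n in 𝓝 0, u ∈ ball (0 : State n) (δ / 2) :=
    ball_mem_nhds _ (half_pos hδ)
  have hA0 : meanDeriv F 0 = fderiv ℝ S.f 0 := by
    rw [← hFd 0 (by simpa using hδ)]
    exact meanDeriv_self 0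
  have hinj : Function.Injective fun j => S.lam j 0 := (hS.strict 0 h0).injective
  obtain ⟨R, l, ℓ, hsm, hev⟩ := exists_local_spectrum (meanDeriv F 0) (fun j => S.lam j 0) hinj
    (fun j => S.unitField δ j 0) (fun j => fderiv ℝ (S.param δ j) 0)
    (fun j => by
      rw [hA0, unitField, map_smul, hS.eigen j 0 h0, smul_comm])
    (fun j => (hS.eventually_param_unitField hδ j).self_of_nhds)
  have hA : ContDiff ℝ 2 (meanDeriv F) := contDiff_meanDeriv hF3
  have hAt : Tendsto (meanDeriv F) (𝓝 0) (𝓝 (meanDeriv F 0)) := hA.continuous.tendsto 0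
  have hdiag : Tendsto (fun u : State n => (u, u)) (𝓝 0) (𝓝 (0 : State n × State n)) :=
    (continuous_id.prodMk continuous_id).tendsto 0
  have hDt : Tendsto (fun u => meanDeriv F (u, u)) (𝓝 0) (𝓝 (meanDeriv F 0)) := hAt.comp hdiag
  have hDc : ContDiff ℝ 2 fun u : State n => meanDeriv F (u, u) :=
    hA.comp (contDiff_id.prodMk contDiff_id)
  have hsw : ∀ q, meanDeriv F q = meanDeriv F q.swap := fun q => meanDeriv_swap q.1 q.2
  have hmem : ∀ᶠ q : State n × State n in 𝓝 0,
      q.1 ∈ ball (0 : State n) (δ / 2) ∧ q.2 ∈ ball (0 : State n) (δ / 2) :=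
    ((continuous_fst.tendsto (0 : State n × State n)).eventually hhalf).and
      ((continuous_snd.tendsto (0 : State n × State n)).eventually hhalf)
  refine ⟨fun j q => R j (meanDeriv F q), fun j q => l j (meanDeriv F q),
    fun j u => ℓ j (meanDeriv F (u, u)), fun j => ⟨?_, ?_, ?_, ?_, ?_⟩, fun j q => ⟨?_, ?_⟩,
    ?_, ?_, ?_⟩
  · exact (hsm j).1.comp 0 hA.contDiffAt
  · exact (hsm j).2.1.comp 0 hA.contDiffAt
  · exact ContDiffAt.comp (g := ℓ j) (f := fun u => meanDeriv F (u, u)) 0 (hsm j).2.2.1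
      hDc.contDiffAt
  · exact (hsm j).2.2.2.1
  · have := (hev.self_of_nhds.1 j).2.2.1
    rw [(hsm j).2.2.2.1] at this
    exact this
  · simp only [← hsw]
  · simp only [← hsw]
  · filter_upwards [hAt.eventually hev, hmem] with q hq hm j
    refine ⟨(hq.1 j).2.1, fun t ht => ?_⟩
    rw [← hFf _ hm.1, ← hFf _ hm.2, ← meanDeriv_apply hF3, ht, map_smul, (hq.1 j).1, smul_comm]
  · filter_upwards [hAt.eventually hev, hmem] with q hq hm s hne hs
    refine hq.2 (q.2 - q.1) s (sub_ne_zero.2 hne) ?_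
    rw [← hs, ← hFf _ hm.1, ← hFf _ hm.2, ← meanDeriv_apply hF3]
  · obtain ⟨g, hg, hgap⟩ := exists_gap (fun j => S.lam j 0) hinj
    have hl : ∀ᶠ u in 𝓝 (0 : State n), ∀ j, |l j (meanDeriv F (u, u)) - S.lam j 0| < g ∧ |S.lam j u
      - S.lam j 0| < g := by
      rw [eventually_all]
      intro j
      have h1 : Tendsto (fun u => |l j (meanDeriv F (u, u)) - S.lam j 0|) (𝓝 0) (𝓝 0) := by
        have := (((hsm j).2.1.continuousAt.tendsto.comp hDt).sub_const (S.lam j 0)).abs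
        rw [(hsm j).2.2.2.2] at this
        simpa using this
      have h2 : Tendsto (fun u => |S.lam j u - S.lam j 0|) (𝓝 0) (𝓝 0) := by
        have := (((contDiffAt_of_on hδ (hS.contDiffOn_lam j)).continuousAt.tendsto).sub_const
          (S.lam j 0)).abs
        simpa using this
      exact (h1.eventually (gt_mem_nhds hg)).and (h2.eventually (gt_mem_nhds hg))
    filter_upwards [hDt.eventually hev, hhalf, hl, eventually_mem_ball hδ,
      eventually_all.2 (hS.eventually_param_deriv_pos hδ)] with u hu hu2 hlu hub hpos j
    have hAu : meanDeriv F (u, u) = fderiv ℝ S.f u := by rw [meanDeriv_self, hFd u hu2]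
    have hone : fderiv ℝ (S.param δ j) u (S.r j u) ≠ 0 := (hpos j).ne'
    obtain ⟨k, hk1, hk2⟩ := hu.2 (S.r j u) (S.lam j u) (hS.r_ne_zero j u hub)
      (by rw [hAu]; exact hS.eigen j u hub)
    have hkj : k = j := by
      by_contra hne
      have h1 := hgap k j hne
      have h2 := (hlu k).1
      have h3 := (hlu j).2
      rw [hk1] at h3
      rw [abs_lt] at h2 h3
      rcases lt_abs.1 h1 with h | h <;> linarith
    subst hkj
    refine ⟨hk1.symm, ?_, fun x => ?_⟩
    · set c := fderiv ℝ (S.param δ k) 0 (S.r k u)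
      have hc : c ≠ 0 := fun h => hS.r_ne_zero k u hub (by rw [hk2, h, zero_smul])
      refine ⟨c⁻¹ * fderiv ℝ (S.param δ k) u (S.r k u), ?_⟩
      rw [unitField, smul_smul, mul_assoc, mul_inv_cancel₀ hone, mul_one]
      conv_rhs => rw [hk2]
      rw [smul_smul, inv_mul_cancel₀ hc, one_smul]
    · rw [hk1, ← hAu]
      exact (hu.1 k).2.2.2 x

end ConsLaw

namespace ConsLaw

variable {n : ℕ}

/-- Germs at the origin of the averaged spectral data of a family, of the parametrization `V` of its
Hugoniot curves and of the parametrization `W` of its integral curves. -/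
structure Germ (S : ConsLaw n) (δ g : ℝ) (i : Fin n) where
  Rb : State n × State n → State n
  Lb : State n × State n → ℝ
  ℓ : State n → State n →L[ℝ] ℝ
  V : ℝ × State n → State n
  W : ℝ × State n → State n
  Rb_smooth : ContDiffAt ℝ 2 Rb 0
  Lb_smooth : ContDiffAt ℝ 2 Lb 0
  ℓ_smooth : ContDiffAt ℝ 2 ℓ 0
  ℓ_zero : ℓ 0 (S.unitField δ i 0) = 1
  Rb_symm : ∀ q, Rb q = Rb q.swap
  Lb_symm : ∀ q, Lb q = Lb q.swap
  e_Rb : ∀ᶠ q in 𝓝 0, fderiv ℝ (S.param δ i) 0 (Rb q) = 1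
  jump : ∀ᶠ q in 𝓝 (0 : State n × State n), ∀ t : ℝ, q.2 - q.1 = t • Rb q →
    S.f q.2 - S.f q.1 = Lb q • (q.2 - q.1)
  diag : ∀ᶠ u in 𝓝 (0 : State n), Lb (u, u) = S.lam i u ∧
      (∃ c : ℝ, Rb (u, u) = c • S.unitField δ i u) ∧
      ∀ x, ℓ u (fderiv ℝ S.f u x) = S.lam i u * ℓ u x
  hug : ∀ᶠ q in 𝓝 (0 : State n × State n), ∀ ρ, q.2 ∈ ball (0 : State n) ρ →
    (q.2 ∈ S.hugoniot ρ i q.1 ↔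
      q.2 - q.1 = fderiv ℝ (S.param δ i) 0 (q.2 - q.1) • Rb q)
  near : ∀ᶠ q in 𝓝 (0 : State n × State n), |Lb q - S.lam i 0| < g
  V_smooth : ContDiffAt ℝ 2 V 0
  V_zero : V 0 = 0
  V_strict : HasStrictFDerivAt V (linParam (fderiv ℝ (S.param δ i) 0) (S.unitField δ i 0)) 0
  V_iff : ∀ᶠ z : (ℝ × State n) × State n in 𝓝 0,
        (z.2 - z.1.2 = fderiv ℝ (S.param δ i) 0 (z.2 - z.1.2) • Rb (z.1.2, z.2) ∧
          S.param δ i z.2 = z.1.1) ↔ V z.1 = z.2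
  W_zero : W 0 = 0
  W_strict : HasStrictFDerivAt W (linParam (fderiv ℝ (S.param δ i) 0) (S.unitField δ i 0)) 0
  W_flow : ∀ᶠ z : ℝ × State n in 𝓝 0,
    HasDerivAt (fun m => W (m, z.2)) (S.unitField δ i (W z)) z.1
  W_self : ∀ᶠ u in 𝓝 (0 : State n), W (S.param δ i u, u) = u

variable {S : ConsLaw n} {δ : ℝ}

lemma speed_eq {u v : State n} {s : ℝ} (hne : v ≠ u) (h : S.f v - S.f u = s • (v - u)) : S.speed u v
    = s := by
  have h1 : ‖v - u‖ ^ 2 ≠ 0 := pow_ne_zero _ (norm_ne_zero_iff.2 (sub_ne_zero.2 hne))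
  rw [speed, h, real_inner_smul_left, real_inner_self_eq_norm_sq, mul_div_cancel_right₀ _ h1]

lemma Hyp.exists_germ (hδ : 0 < δ) (hS : S.Hyp δ) {g : ℝ} (hg : 0 < g) (hgap : ∀ i j, i ≠ j → 4 * g
    < |S.lam i 0 - S.lam j 0|) (i : Fin n) : Nonempty (Germ S δ g i) := by
  obtain ⟨Rb, Lb, ℓ, hsm, hsymm, hjump, hclass, hdiag⟩ := hS.exists_averaged_spectrum hδ
  have hp2 : ContDiffAt ℝ 2 (S.param δ i) 0 := contDiffAt_of_on hδ (hS.contDiffOn_param i)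
  have hp0 := hS.param_zero hδ i
  obtain ⟨V, hV, hV0, hVs, hViff⟩ := exists_implicit_param (Rb i) (S.param δ i) (hsm i).1 hp2 hp0
    (hjump.mono fun q h => (h i).1)
  obtain ⟨φ, hφs, a, ha, hφ⟩ := exists_local_flow (hS.contDiffAt_unitField hδ i)
  have hLb0 : ∀ j, Lb j 0 = S.lam j 0 := fun j => (hdiag.self_of_nhds j).1
  have hnear : ∀ j, ∀ᶠ q in 𝓝 (0 : State n × State n), |Lb j q - S.lam j 0| < g := by
    intro j
    have h1 : Tendsto (fun q => |Lb j q - S.lam j 0|) (𝓝 0) (𝓝 0) := by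
      have := ((hsm j).2.1.continuousAt.tendsto.sub_const (S.lam j 0)).abs
      simpa [hLb0] using this
    exact h1.eventually (gt_mem_nhds hg)
  have hnear2 : ∀ j, ∀ᶠ q in 𝓝 (0 : State n × State n), |S.lam j q.1 - S.lam j 0| < g := by
    intro j
    have h1 : Tendsto (fun u => |S.lam j u - S.lam j 0|) (𝓝 0) (𝓝 0) := by
      have := ((contDiffAt_of_on hδ (hS.contDiffOn_lam j)).continuousAt.tendsto.sub_const
        (S.lam j 0)).abs
      simpa using this
    exact (continuous_fst.tendsto (0 : State n × State n)).eventually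
      (h1.eventually (gt_mem_nhds hg))
  have hpc : ContinuousAt (S.param δ i) 0 := hp2.continuousAt
  have hpt : Tendsto (S.param δ i) (𝓝 0) (𝓝 0) := by simpa [hp0] using hpc.tendsto
  refine ⟨⟨Rb i, Lb i, ℓ i, V, fun z => φ (z.1 - S.param δ i z.2, z.2), (hsm i).1, (hsm i).2.1,
    (hsm i).2.2.1, (hsm i).2.2.2.2, fun q => (hsymm i q).1, fun q => (hsymm i q).2,
    hjump.mono fun q h => (h i).1, hjump.mono fun q h => (h i).2, hdiag.mono fun u h => h i, ?_,
    hnear i, hV, hV0, ?_, hViff, ?_, ?_, ?_, ?_⟩⟩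
  · filter_upwards [hjump, hclass, eventually_all.2 hnear, eventually_all.2 hnear2]
      with q hj hc hn hn2 ρ hρ
    constructor
    · rintro ⟨-, h | ⟨hRH, hclose⟩⟩
      · simp [h]
      · by_cases hne : q.2 = q.1
        · simp [hne]
        · obtain ⟨k, hk1, hk2⟩ := hc _ hne hRH
          have hki : k = i := by
            by_contra hki
            have h1 := hclose k hki
            rw [hk1] at h1
            have h2 := hgap i k (Ne.symm hki)
            have h3 := abs_lt.1 (hn k)
            have h4 := abs_lt.1 (hn2 k)
            have h5 := abs_lt.1 (hn2 i)
            have h6 : |Lb k q - S.lam k q.1| < 2 * g := by rw [abs_lt]; constructor <;> linarith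
            have h7 := abs_lt.1 (h1.trans h6)
            rcases lt_abs.1 h2 with h | h <;> linarith
          rw [hki] at hk2
          exact hk2
    · intro h
      refine ⟨hρ, ?_⟩
      by_cases hne : q.2 = q.1
      · exact Or.inl hne
      · have hRH := (hj i).2 _ h
        have hs := speed_eq hne hRH
        refine Or.inr ⟨by rw [hs]; exact hRH, fun j hji => ?_⟩
        rw [hs]
        have h2 := hgap i j (Ne.symm hji)
        have h3 := abs_lt.1 (hn i)
        have h4 := abs_lt.1 (hn2 i)
        have h5 := abs_lt.1 (hn2 j)
        have h6 : |Lb i q - S.lam i q.1| < 2 * g := by rw [abs_lt]; constructor <;> linarith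
        refine h6.trans ?_
        rw [lt_abs]
        rcases lt_abs.1 h2 with h | h
        · left; linarith
        · right; linarith
  · rw [(hsm i).2.2.2.1] at hVs
    exact hVs
  · simp only [Prod.fst_zero, Prod.snd_zero, hp0, sub_zero]
    exact (hφ 0 (by simpa using ha)).1
  · have hps : HasStrictFDerivAt (S.param δ i) (fderiv ℝ (S.param δ i) 0) 0 :=
      hp2.hasStrictFDerivAt (by norm_num)
    have h1 : HasStrictFDerivAt (fun z : ℝ × State n => (z.1 - S.param δ i z.2, z.2))
        ((fst ℝ ℝ (State n) - (fderiv ℝ (S.param δ i) 0).comp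
          (snd ℝ ℝ (State n))).prod (snd ℝ ℝ (State n))) 0 := by
      refine (hasStrictFDerivAt_fst.sub ?_).prodMk hasStrictFDerivAt_snd
      have : HasStrictFDerivAt (S.param δ i) (fderiv ℝ (S.param δ i) 0)
        ((0 : ℝ × State n).2) := hps
      exact this.comp (0 : ℝ × State n) hasStrictFDerivAt_snd
    have h2 : HasStrictFDerivAt φ (snd ℝ ℝ (State n) +
        (fst ℝ ℝ (State n)).smulRight (S.unitField δ i 0))
        ((fun z : ℝ × State n => (z.1 - S.param δ i z.2, z.2)) 0) := by
      have h0 : ((0 : ℝ × State n).1 - S.param δ i (0 : ℝ × State n).2, (0 : ℝ × State n).2) =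
          (0 : ℝ × State n) := by simp [hp0]
      simp only [h0]
      exact hφs
    refine (h2.comp (0 : ℝ × State n) h1).congr_fderiv (ContinuousLinearMap.ext fun z => ?_)
    obtain ⟨m, u⟩ := z
    rw [linParam_apply]
    simp
  · have h1 : ∀ᶠ z : ℝ × State n in 𝓝 0, ‖z.2‖ < a := by
      have := (continuous_snd.norm.tendsto (0 : ℝ × State n))
      simp only [Prod.snd_zero, norm_zero] at this
      exact this.eventually (gt_mem_nhds ha)
    have h2 : ∀ᶠ z : ℝ × State n in 𝓝 0, |z.1 - S.param δ i z.2| < a := by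
      have h3 : Tendsto (fun z : ℝ × State n => S.param δ i z.2) (𝓝 0) (𝓝 0) :=
        hpt.comp (continuous_snd.tendsto (0 : ℝ × State n))
      have := ((continuous_fst.tendsto (0 : ℝ × State n)).sub h3).abs
      simp only [Prod.fst_zero, sub_zero, abs_zero] at this
      exact this.eventually (gt_mem_nhds ha)
    filter_upwards [h1, h2] with z hz1 hz2
    have h4 := (hφ z.2 hz1).2 _ hz2
    exact h4.comp_sub_const z.1 (S.param δ i z.2)
  · have h1 : ∀ᶠ u : State n in 𝓝 0, ‖u‖ < a := by
      have := (continuous_norm.tendsto (0 : State n))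
      rw [norm_zero] at this
      exact this.eventually (gt_mem_nhds ha)
    filter_upwards [h1] with u hu
    simp only [sub_self]
    exact (hφ u hu).1

end ConsLaw

namespace ConsLaw

variable {n : ℕ} {S : ConsLaw n} {g ρ ε δ δ' δ1 m x y K : ℝ} {i j : Fin n} {u v u' z : State n}
  {γ : ℝ → State n} {L : List (Wave n)} {a : Wave n} {kin nuc : State n → ℝ}

lemma tendsto_clm_apply {α E F : Type*} [NormedAddCommGroup E] [NormedSpace ℝ E] [NormedAddCommGroup
    F] [NormedSpace ℝ F] {l : Filter α} {T : α → E →L[ℝ] F} {x : α → E} {T0 : E →L[ℝ] F} {x0 : E}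
    (hT : Tendsto T l (𝓝 T0)) (hx : Tendsto x l (𝓝 x0)) : Tendsto (fun a => T a (x a)) l (𝓝 (T0 x0))
    :=
  (isBoundedBilinearMap_apply.continuous.tendsto (T0, x0)).comp (hT.prodMk_nhds hx)

section Partial

variable {E : Type} [NormedAddCommGroup E] [NormedSpace ℝ E]

/-- Partial derivative in the first variable. -/
def pd (g : ℝ × State n → E) (z : ℝ × State n) : E := fderiv ℝ g z (1, 0)

lemma contDiffAt_pd {g : ℝ × State n → E} {z : ℝ × State n} {k l : WithTop ℕ∞} (hg : ContDiffAt ℝ k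
    g z) (hkl : l + 1 ≤ k) : ContDiffAt ℝ l (pd g) z :=
  (hg.fderiv_right hkl).clm_apply contDiffAt_const

lemma hasDerivAt_pd {g : ℝ × State n → E} {z : ℝ × State n} (hg : DifferentiableAt ℝ g z) :
    HasDerivAt (fun m => g (m, z.2)) (pd g z) z.1 := by
  have h1 : HasDerivAt (fun m : ℝ => (m, z.2)) ((1 : ℝ), (0 : State n)) z.1 :=
    (hasDerivAt_id z.1).prodMk (hasDerivAt_const z.1 z.2)
  exact HasFDerivAt.comp_hasDerivAt (f := fun m : ℝ => (m, z.2)) z.1 hg.hasFDerivAt h1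

lemma contDiffAt_slice {g : ℝ × State n → E} {z : ℝ × State n} {k : WithTop ℕ∞} (hg : ContDiffAt ℝ k
    g z) : ContDiffAt ℝ k (fun m => g (m, z.2)) z.1 :=
  ContDiffAt.comp (f := fun m : ℝ => (m, z.2)) z.1 hg (contDiffAt_id.prodMk contDiffAt_const)

lemma eventually_pd {g : ℝ × State n → E} (hg : ContDiffAt ℝ 2 g 0) : ∀ᶠ z in 𝓝 (0 : ℝ × State n),
    HasDerivAt (fun m => g (m, z.2)) (pd g z) z.1 ∧ HasDerivAt (fun m => pd g (m, z.2)) (pd (pd g)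
    z) z.1 ∧ ContDiffAt ℝ 2 (fun m => g (m, z.2)) z.1 := by
  filter_upwards [hg.eventually (by norm_num)] with z hz
  exact ⟨hasDerivAt_pd (hz.differentiableAt (by norm_num)),
    hasDerivAt_pd ((contDiffAt_pd (l := 1) hz (by norm_num)).differentiableAt (by norm_num)),
    contDiffAt_slice hz⟩

lemma continuousAt_pd_pd {g : ℝ × State n → E} (hg : ContDiffAt ℝ 2 g 0) : ContinuousAt (pd (pd g))
    0 :=
  (contDiffAt_pd (l := 0) (contDiffAt_pd (l := 1) hg (by norm_num)) (by norm_num)).continuousAt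

lemma continuousAt_pd {g : ℝ × State n → E} (hg : ContDiffAt ℝ 2 g 0) :
    ContinuousAt (pd g) 0 := (contDiffAt_pd (l := 1) hg (by norm_num)).continuousAt

end Partial

namespace Germ

variable (G : Germ S δ g i)

lemma tendsto_V : Tendsto G.V (𝓝 0) (𝓝 0) := by
  have := G.V_smooth.continuousAt.tendsto
  rwa [G.V_zero] at this

lemma tendsto_W : Tendsto G.W (𝓝 0) (𝓝 0) := by
  have := G.W_strict.continuousAt.tendsto
  rwa [G.W_zero] at this

lemma eventually_V : ∀ᶠ z in 𝓝 (0 : ℝ × State n), (G.V z - z.2 = fderiv ℝ (S.param δ i) 0 (G.V z -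
    z.2) • G.Rb (z.2, G.V z) ∧ S.param δ i (G.V z) = z.1) := by
  have h : Tendsto (fun z => (z, G.V z)) (𝓝 0) (𝓝 ((0 : ℝ × State n), (0 : State n))) :=
    tendsto_id.prodMk_nhds G.tendsto_V
  filter_upwards [h.eventually G.V_iff] with z hz using hz.2 rfl

lemma tendsto_param (hδ : 0 < δ) (hS : S.Hyp δ) : Tendsto (S.param δ i) (𝓝 0) (𝓝 0) := by
  have := (contDiffAt_of_on hδ (hS.contDiffOn_param i)).continuousAt.tendsto
  rwa [hS.param_zero hδ i] at this

lemma eventually_hug_iff (hδ : 0 < δ) (hS : S.Hyp δ) : ∀ᶠ q in 𝓝 (0 : State n × State n), (q.2 - q.1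
    = fderiv ℝ (S.param δ i) 0 (q.2 - q.1) • G.Rb q) ↔ G.V (S.param δ i q.2, q.1) = q.2 := by
  have h : Tendsto (fun q : State n × State n => ((S.param δ i q.2, q.1), q.2)) (𝓝 0)
      (𝓝 (((0 : ℝ), (0 : State n)), (0 : State n))) :=
    (((tendsto_param hδ hS).comp (continuous_snd.tendsto (0 : State n × State n))).prodMk_nhds
      (continuous_fst.tendsto (0 : State n × State n))).prodMk_nhds
      (continuous_snd.tendsto (0 : State n × State n))
  filter_upwards [h.eventually G.V_iff] with q hq
  rw [← hq]
  simp

lemma eventually_V_self (hδ : 0 < δ) (hS : S.Hyp δ) : ∀ᶠ u in 𝓝 (0 : State n), G.V (S.param δ i u,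
    u) = u := by
  have h : Tendsto (fun u : State n => (u, u)) (𝓝 0) (𝓝 (0 : State n × State n)) :=
    (continuous_id.prodMk continuous_id).tendsto 0
  filter_upwards [h.eventually (G.eventually_hug_iff hδ hS)] with u hu
  exact hu.1 (by simp)

/-- The shock speed along the Hugoniot curve. -/
def s (z : ℝ × State n) : ℝ := G.Lb (z.2, G.V z)

lemma tendsto_pair : Tendsto (fun z : ℝ × State n => (z.2, G.V z)) (𝓝 0) (𝓝 (0 : State n × State n))
    :=
  (continuous_snd.tendsto (0 : ℝ × State n)).prodMk_nhds G.tendsto_V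

lemma s_smooth : ContDiffAt ℝ 2 G.s 0 := by
  have h : ContDiffAt ℝ 2 G.Lb ((0 : ℝ × State n).2, G.V 0) := by
    rw [G.V_zero]; exact G.Lb_smooth
  exact ContDiffAt.comp (f := fun z : ℝ × State n => (z.2, G.V z)) 0 h
    (contDiffAt_snd.prodMk G.V_smooth)

lemma eventually_jump : ∀ᶠ z in 𝓝 (0 : ℝ × State n), S.f (G.V z) - S.f z.2 = G.s z • (G.V z - z.2)
    := by
  filter_upwards [G.tendsto_pair.eventually G.jump, G.eventually_V] with z hz hV
  exact hz _ hV.1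

lemma eventually_s_near : ∀ᶠ z in 𝓝 (0 : ℝ × State n), |G.s z - S.lam i 0| < g := by
  filter_upwards [G.tendsto_pair.eventually G.near] with z hz using hz

lemma pd_V_zero : pd G.V 0 = S.unitField δ i 0 := by
  rw [pd, G.V_strict.hasFDerivAt.fderiv, linParam_apply]
  simp

variable (hδ : 0 < δ) (hS : S.Hyp δ)
include hδ hS

/-- The two-jets of the Hugoniot curve and of the integral curve agree at the base point. -/
lemma eventually_two_jet : ∀ᶠ u in 𝓝 (0 : State n), pd G.V (S.param δ i u, u) = S.unitField δ i u ∧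
    pd (pd G.V) (S.param δ i u, u) = fderiv ℝ (S.unitField δ i) u (S.unitField δ i u) := by
  have hpu : Tendsto (fun u : State n => (S.param δ i u, u)) (𝓝 0) (𝓝 (0 : ℝ × State n)) :=
    (tendsto_param hδ hS).prodMk_nhds tendsto_id
  have hdg : Tendsto (fun u : State n => (u, u)) (𝓝 0) (𝓝 (0 : State n × State n)) :=
    (continuous_id.prodMk continuous_id).tendsto 0
  have hp2 : ContDiffAt ℝ 2 (S.param δ i) 0 := contDiffAt_of_on hδ (hS.contDiffOn_param i)
  filter_upwards [hdg.eventually (G.Rb_smooth.eventually (by norm_num)),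
    hp2.eventually (by norm_num), (hS.contDiffAt_unitField hδ i).eventually (by norm_num),
    (hS.eventually_param_unitField hδ i).eventually_nhds, G.diag.eventually_nhds,
    (hdg.eventually G.e_Rb).eventually_nhds, hpu.eventually (eventually_pd G.V_smooth).eventually_nhds,
    hpu.eventually G.eventually_V.eventually_nhds, G.eventually_V_self hδ hS]
    with u h1 h2 h3 h4 h5 h6 h7 h8 h9
  have hline : Tendsto (fun m : ℝ => (m, u)) (𝓝 (S.param δ i u)) (𝓝 (S.param δ i u, u)) :=
    (continuous_id.prodMk continuous_const).tendsto _
  have h10 := second_order_tangency (y := fun m => G.V (m, u)) (m0 := S.param δ i u) h1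
    (Eventually.of_forall G.Rb_symm) h2 (h3.differentiableAt (by norm_num))
    (h4.and (h5.mono fun v hv => hv.2.1)) h6 h7.self_of_nhds.2.2 h9
    ((hline.eventually h8).mono fun m hm => hm)
  have h11 : deriv (fun m => G.V (m, u)) =ᶠ[𝓝 (S.param δ i u)] fun m => pd G.V (m, u) :=
    (hline.eventually h7).mono fun m hm => hm.1.deriv
  have h12 : deriv (deriv fun m => G.V (m, u)) (S.param δ i u) =
      pd (pd G.V) (S.param δ i u, u) := by
    rw [h11.deriv_eq]; exact h7.self_of_nhds.2.1.deriv
  rw [h11.self_of_nhds, h12] at h10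
  exact h10

lemma eventually_s_self : ∀ᶠ u in 𝓝 (0 : State n), G.s (S.param δ i u, u) = S.lam i u ∧ pd G.s
    (S.param δ i u, u) = S.growth δ i u / 2 := by
  have hpu : Tendsto (fun u : State n => (S.param δ i u, u)) (𝓝 0) (𝓝 (0 : ℝ × State n)) :=
    (tendsto_param hδ hS).prodMk_nhds tendsto_id
  have hdg : Tendsto (fun u : State n => (u, u)) (𝓝 0) (𝓝 (0 : State n × State n)) :=
    (continuous_id.prodMk continuous_id).tendsto 0
  filter_upwards [hdg.eventually (G.Lb_smooth.eventually (by norm_num)), G.diag.eventually_nhds,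
    G.eventually_V_self hδ hS, G.eventually_two_jet hδ hS,
    hpu.eventually (eventually_pd G.V_smooth), hpu.eventually (eventually_pd G.s_smooth)]
    with u h1 h2 h3 h4 h5 h6
  refine ⟨by rw [s]; simp only [h3]; exact h2.self_of_nhds.1, ?_⟩
  have hL : HasFDerivAt G.Lb (fderiv ℝ G.Lb (u, u)) (u, u) :=
    (h1.differentiableAt (by norm_num)).hasFDerivAt
  have hsw : ∀ a b, fderiv ℝ G.Lb (u, u) (a, b) = fderiv ℝ G.Lb (u, u) (b, a) := by
    intro a b
    have h7 : HasFDerivAt (fun q => G.Lb (Prod.swap q))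
        ((fderiv ℝ G.Lb (u, u)).comp (ContinuousLinearEquiv.prodComm ℝ (State n) (State n) :
          State n × State n →L[ℝ] State n × State n)) (u, u) :=
      HasFDerivAt.comp (u, u) (g := G.Lb) (f := Prod.swap) hL
        (ContinuousLinearEquiv.prodComm ℝ (State n) (State n)).hasFDerivAt
    have h8 := hL.unique (h7.congr_of_eventuallyEq (Eventually.of_forall G.Lb_symm))
    conv_lhs => rw [h8]
    rfl
  have hdiag : HasFDerivAt (fun v => G.Lb (v, v))
      ((fderiv ℝ G.Lb (u, u)).comp ((ContinuousLinearMap.id ℝ _).prod (.id ℝ _))) u :=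
    HasFDerivAt.comp u (g := G.Lb) (f := fun v => (v, v)) hL
      ((hasFDerivAt_id u).prodMk (hasFDerivAt_id u))
  have hlam : HasFDerivAt (S.lam i) ((fderiv ℝ G.Lb (u, u)).comp
      ((ContinuousLinearMap.id ℝ _).prod (.id ℝ _))) u :=
    hdiag.congr_of_eventuallyEq (h2.mono fun v hv => hv.1.symm)
  have h9 : S.growth δ i u = 2 * fderiv ℝ G.Lb (u, u) (0, S.unitField δ i u) := by
    rw [← fderiv_lam_unitField, hlam.fderiv]
    have : ((S.unitField δ i u, S.unitField δ i u) : State n × State n) =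
      (S.unitField δ i u, 0) + (0, S.unitField δ i u) := by simp
    simp only [comp_apply, prod_apply,
      id_apply]
    rw [this, map_add, hsw _ 0]
    ring
  have h10 : HasDerivAt (fun m => G.s (m, u)) (fderiv ℝ G.Lb (u, u) (0, S.unitField δ i u))
      (S.param δ i u) := by
    have h11 : HasDerivAt (fun m => (u, G.V (m, u))) ((0 : State n), S.unitField δ i u)
        (S.param δ i u) := by
      rw [← h4.1]; exact (hasDerivAt_const _ u).prodMk h5.1
    have h12 : HasFDerivAt G.Lb (fderiv ℝ G.Lb (u, u)) (u, G.V (S.param δ i u, u)) := by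
      rw [h3]; exact hL
    exact HasFDerivAt.comp_hasDerivAt (f := fun m => (u, G.V (m, u))) (S.param δ i u) h12 h11
  rw [h9, h6.1.unique h10]
  ring

/-- The differentiated Rankine-Hugoniot relation. -/
lemma eventually_jump_deriv : ∀ᶠ z in 𝓝 (0 : ℝ × State n), fderiv ℝ S.f (G.V z) (pd G.V z) = G.s z •
    pd G.V z + pd G.s z • (G.V z - z.2) := by
  have hf : ∀ᶠ u in 𝓝 (0 : State n), DifferentiableAt ℝ S.f u := by
    filter_upwards [eventually_mem_ball hδ] with u hu
    exact ((hS.f_smooth u hu).contDiffAt (isOpen_ball.mem_nhds hu)).differentiableAt (by norm_num)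
  filter_upwards [G.eventually_jump.eventually_nhds, eventually_pd G.V_smooth,
    eventually_pd G.s_smooth, G.tendsto_V.eventually hf] with z h1 h2 h3 h4
  have hline : Tendsto (fun m : ℝ => (m, z.2)) (𝓝 z.1) (𝓝 z) :=
    (continuous_id.prodMk continuous_const).tendsto _
  have h5 : HasDerivAt (fun m => S.f (G.V (m, z.2)) - S.f z.2)
      (fderiv ℝ S.f (G.V z) (pd G.V z)) z.1 := by
    have : HasFDerivAt S.f (fderiv ℝ S.f (G.V z)) (G.V (z.1, z.2)) := h4.hasFDerivAt
    exact (HasFDerivAt.comp_hasDerivAt (f := fun m => G.V (m, z.2)) z.1 this h2.1).sub_const _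
  have h6 : HasDerivAt (fun m => G.s (m, z.2) • (G.V (m, z.2) - z.2))
      (G.s z • pd G.V z + pd G.s z • (G.V z - z.2)) z.1 := h3.1.smul (h2.1.sub_const _)
  exact h5.unique (h6.congr_of_eventuallyEq ((hline.eventually h1).mono fun m hm => hm))

lemma eventually_left_relation : ∀ᶠ z in 𝓝 (0 : ℝ × State n), (S.lam i (G.V z) - G.s z) * G.ℓ (G.V
    z) (pd G.V z) = pd G.s z * G.ℓ (G.V z) (G.V z - z.2) := by
  filter_upwards [G.eventually_jump_deriv hδ hS, G.tendsto_V.eventually G.diag] with z h1 h2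
  have h3 := h2.2.2 (pd G.V z)
  rw [h1, map_add, map_smul, map_smul, smul_eq_mul, smul_eq_mul] at h3
  linear_combination -h3

omit hδ hS in
/-- The left eigenvector at `V z` is almost dual to the tangent vectors of the Hugoniot curves. -/
lemma eventually_left_tangent : ∀ᶠ q in 𝓝 (0 : (ℝ × State n) × (ℝ × State n)), 1 / 2 < G.ℓ (G.V q.1)
    (pd G.V q.2) := by
  have h1 : Tendsto (fun q : (ℝ × State n) × (ℝ × State n) => G.ℓ (G.V q.1) (pd G.V q.2)) (𝓝 0)
      (𝓝 (G.ℓ 0 (S.unitField δ i 0))) := by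
    have h2 : Tendsto (fun q : (ℝ × State n) × (ℝ × State n) => G.ℓ (G.V q.1)) (𝓝 0) (𝓝 (G.ℓ 0)) :=
      (G.ℓ_smooth.continuousAt.tendsto.comp G.tendsto_V).comp
        (continuous_fst.tendsto (0 : (ℝ × State n) × (ℝ × State n)))
    have h3 : Tendsto (fun q : (ℝ × State n) × (ℝ × State n) => pd G.V q.2) (𝓝 0)
        (𝓝 (S.unitField δ i 0)) := by
      have h4 := (continuousAt_pd G.V_smooth).tendsto
      rw [G.pd_V_zero] at h4
      exact h4.comp (continuous_snd.tendsto (0 : (ℝ × State n) × (ℝ × State n)))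
    exact tendsto_clm_apply h2 h3
  rw [G.ℓ_zero] at h1
  exact h1.eventually (lt_mem_nhds (by norm_num))

/-- The Hessian of the entropy on pairs of tangent vectors. -/
lemma eventually_hessian : ∃ q0 > 0, ∀ᶠ q in 𝓝 (0 : (ℝ × State n) × (ℝ × State n)), q0 < fderiv ℝ
    (fderiv ℝ S.U) (G.V q.1) (pd G.V q.1) (pd G.V q.2) ∧ fderiv ℝ (fderiv ℝ S.U) (G.V q.1) (pd G.V
    q.1) (pd G.V q.2) < 3 * q0 := by
  have hX : S.unitField δ i 0 ≠ 0 := fun h => by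
    have := (hS.eventually_param_unitField hδ i).self_of_nhds
    rw [h, map_zero] at this
    exact zero_ne_one this
  have h0 := hS.U_convex 0 (by simpa using hδ) _ hX
  set b := fderiv ℝ (fderiv ℝ S.U) 0 (S.unitField δ i 0) (S.unitField δ i 0)
  have hc : ContinuousAt (fderiv ℝ (fderiv ℝ S.U)) 0 := by
    have h1 : ContDiffOn ℝ 1 (fderiv ℝ S.U) (ball 0 δ) :=
      hS.U_smooth.fderiv_of_isOpen isOpen_ball (by norm_num)
    have h2 : ContDiffOn ℝ 0 (fderiv ℝ (fderiv ℝ S.U)) (ball 0 δ) :=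
      h1.fderiv_of_isOpen isOpen_ball (by norm_num)
    exact (contDiffAt_of_on hδ h2).continuousAt
  have h4 := (continuousAt_pd G.V_smooth).tendsto
  rw [G.pd_V_zero] at h4
  have h1 : Tendsto (fun q : (ℝ × State n) × (ℝ × State n) =>
      fderiv ℝ (fderiv ℝ S.U) (G.V q.1) (pd G.V q.1) (pd G.V q.2)) (𝓝 0) (𝓝 b) :=
    tendsto_clm_apply (tendsto_clm_apply ((hc.tendsto.comp G.tendsto_V).comp
      (continuous_fst.tendsto (0 : (ℝ × State n) × (ℝ × State n))))
      (h4.comp (continuous_fst.tendsto (0 : (ℝ × State n) × (ℝ × State n)))))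
      (h4.comp (continuous_snd.tendsto (0 : (ℝ × State n) × (ℝ × State n))))
  refine ⟨b / 2, half_pos h0, ?_⟩
  exact (h1.eventually (lt_mem_nhds (half_lt_self h0))).and
    (h1.eventually (gt_mem_nhds (by linarith)))

omit hδ hS in
/-- The convexity gap of the entropy. -/
def Q (z : ℝ × State n) : ℝ :=
  S.U z.2 - S.U (G.V z) - fderiv ℝ S.U (G.V z) (z.2 - G.V z)

lemma eventually_Q_deriv : ∀ᶠ z in 𝓝 (0 : ℝ × State n), HasDerivAt (fun m => G.Q (m, z.2)) (fderiv ℝ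
    (fderiv ℝ S.U) (G.V z) (pd G.V z) (G.V z - z.2)) z.1 := by
  have hU : ∀ᶠ u in 𝓝 (0 : State n), ContDiffAt ℝ 2 S.U u := by
    filter_upwards [eventually_mem_ball hδ] with u hu
    exact (hS.U_smooth u hu).contDiffAt (isOpen_ball.mem_nhds hu)
  filter_upwards [eventually_pd G.V_smooth, G.tendsto_V.eventually hU] with z h1 h2
  have h3 : HasFDerivAt S.U (fderiv ℝ S.U (G.V z)) (G.V (z.1, z.2)) :=
    (h2.differentiableAt (by norm_num)).hasFDerivAt
  have h4 : HasFDerivAt (fderiv ℝ S.U) (fderiv ℝ (fderiv ℝ S.U) (G.V z)) (G.V (z.1, z.2)) :=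
    ((h2.fderiv_right (m := 1) (by norm_num)).differentiableAt (by norm_num)).hasFDerivAt
  have h5 := HasFDerivAt.comp_hasDerivAt (f := fun m => G.V (m, z.2)) z.1 h3 h1.1
  have h6 := HasFDerivAt.comp_hasDerivAt (f := fun m => G.V (m, z.2)) z.1 h4 h1.1
  have h7 := (h5.const_sub (S.U z.2)).sub (h6.clm_apply (h1.1.const_sub z.2))
  refine h7.congr_deriv ?_
  simp only [map_neg, map_sub, Function.comp_apply]
  ring

lemma eventually_dissipation_deriv : ∀ᶠ z in 𝓝 (0 : ℝ × State n), HasDerivAt (fun m => -G.s (m, z.2)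
    * (S.U (G.V (m, z.2)) - S.U z.2) + (S.F (G.V (m, z.2)) - S.F z.2)) (pd G.s z * G.Q z) z.1 := by
  filter_upwards [eventually_pd G.V_smooth, eventually_pd G.s_smooth,
    G.tendsto_V.eventually (eventually_mem_ball hδ), G.eventually_jump_deriv hδ hS]
    with z h1 h2 h3 h4
  have hU : HasFDerivAt S.U (fderiv ℝ S.U (G.V z)) (G.V (z.1, z.2)) :=
    (((hS.U_smooth _ h3).contDiffAt (isOpen_ball.mem_nhds h3)).differentiableAt
      (by norm_num)).hasFDerivAt
  have hF := hS.entropy_pair _ h3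
  have h5 := HasFDerivAt.comp_hasDerivAt (f := fun m => G.V (m, z.2)) z.1 hU h1.1
  have h6 := HasFDerivAt.comp_hasDerivAt (f := fun m => G.V (m, z.2)) z.1 hF h1.1
  have h7 := (h2.1.neg.mul (h5.sub_const (S.U z.2))).add (h6.sub_const (S.F z.2))
  refine h7.congr_deriv ?_
  simp only [comp_apply, h4, map_add, map_smul, smul_eq_mul, Q, map_sub,
    Function.comp_apply, Pi.neg_apply]
  ring

end Germ

lemma exists_slope_eq {f f' : ℝ → ℝ} {a b : ℝ} (h : ∀ x ∈ uIcc a b, HasDerivAt f (f' x) x) : ∃ ξ ∈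
    uIcc a b, f b - f a = f' ξ * (b - a) := by
  rcases lt_trichotomy a b with hab | hab | hab
  · rw [uIcc_of_le hab.le] at h ⊢
    obtain ⟨ξ, hξ, he⟩ := exists_hasDerivAt_eq_slope f f' hab
      (fun x hx => (h x hx).continuousAt.continuousWithinAt)
      (fun x hx => h x (Ioo_subset_Icc_self hx))
    refine ⟨ξ, Ioo_subset_Icc_self hξ, ?_⟩
    rw [he, div_mul_cancel₀ _ (sub_ne_zero.2 hab.ne')]
  · subst hab
    exact ⟨a, left_mem_uIcc, by simp⟩
  · rw [uIcc_of_ge hab.le] at h ⊢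
    obtain ⟨ξ, hξ, he⟩ := exists_hasDerivAt_eq_slope f f' hab
      (fun x hx => (h x hx).continuousAt.continuousWithinAt)
      (fun x hx => h x (Ioo_subset_Icc_self hx))
    refine ⟨ξ, Ioo_subset_Icc_self hξ, ?_⟩
    rw [he, ← neg_sub a b, mul_neg, div_mul_cancel₀ _ (sub_ne_zero.2 hab.ne'), neg_sub]

lemma abs_lt_of_mem_uIcc {a b c : ℝ} (ha : |a| < c) (hb : |b| < c) (hx : x ∈ uIcc a b) : |x| < c :=
    by
  rw [abs_lt] at *
  rw [mem_uIcc] at hx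
  rcases hx with h | h <;> constructor <;> linarith [h.1, h.2]

lemma contDiffAt_two_of_ode {x : State n → State n} {w : ℝ → State n} (hx : ContDiffAt ℝ 1 x (w m))
    (h : ∀ᶠ t in 𝓝 m, HasDerivAt w (x (w t)) t) : ContDiffAt ℝ 2 w m ∧ HasDerivAt (deriv w) (fderiv
    ℝ x (w m) (x (w m))) m := by
  have hw := h.self_of_nhds
  have key : ∀ k : ℕ, ContDiffAt ℝ k (fun t => x (w t)) m → ContDiffAt ℝ (k + 1) w m := by
    intro k hk
    refine contDiffAt_succ_iff_hasFDerivAt.2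
      ⟨fun t => toSpanSingleton ℝ (x (w t)), ?_, ?_⟩
    · obtain ⟨u, hu, hmem⟩ := Filter.eventually_iff_exists_mem.1 h
      exact ⟨u, hu, fun t ht => (hmem t ht).hasFDerivAt⟩
    · exact (toSpanSingletonCLE (𝕜 := ℝ) (E := State n)).contDiff.contDiffAt.comp m hk
  have h0 : ContDiffAt ℝ 0 (fun t => x (w t)) m := by
    have h1 : ∀ᶠ t in 𝓝 m, ContinuousAt (fun t => x (w t)) t := by
      filter_upwards [h, hw.continuousAt.eventually (hx.eventually (by norm_num))] with t ht hxt
      exact ContinuousAt.comp (f := w) hxt.continuousAt ht.continuousAt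
    rw [contDiffAt_zero]
    obtain ⟨u, hu, hmem⟩ := Filter.eventually_iff_exists_mem.1 h1
    exact ⟨u, hu, fun t ht => (hmem t ht).continuousWithinAt⟩
  have h1 : ContDiffAt ℝ 1 w m := by simpa using key 0 (by simpa using h0)
  have h2 : ContDiffAt ℝ 1 (fun t => x (w t)) m := hx.comp m h1
  refine ⟨by simpa [one_add_one_eq_two] using key 1 (by simpa using h2), ?_⟩
  have h3 : deriv w =ᶠ[𝓝 m] fun t => x (w t) := h.mono fun t ht => ht.deriv
  exact (HasFDerivAt.comp_hasDerivAt (f := w) m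
    (hx.differentiableAt (by norm_num)).hasFDerivAt hw).congr_of_eventuallyEq h3

section Box

lemma exists_box {P : ℝ × State n → Prop} (h : ∀ᶠ z in 𝓝 0, P z) : ∃ b > 0, ∀ m u, |m| < b → ‖u‖ < b
    → P (m, u) := by
  obtain ⟨b, hb, hP⟩ := Metric.eventually_nhds_iff.1 h
  refine ⟨b, hb, fun m u hm hu => hP ?_⟩
  rw [dist_zero_right, Prod.norm_def]
  exact max_lt (by simpa using hm) hu

lemma exists_box2 {P : (ℝ × State n) × (ℝ × State n) → Prop} (h : ∀ᶠ z in 𝓝 0, P z) : ∃ b > 0, ∀ m u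
    m' u', |m| < b → ‖u‖ < b → |m'| < b → ‖u'‖ < b → P ((m, u), (m', u')) := by
  obtain ⟨b, hb, hP⟩ := Metric.eventually_nhds_iff.1 h
  refine ⟨b, hb, fun m u m' u' hm hu hm' hu' => hP ?_⟩
  rw [dist_zero_right]
  simp only [Prod.norm_def, max_lt_iff, Real.norm_eq_abs]
  exact ⟨⟨hm, hu⟩, hm', hu'⟩

lemma exists_pair {P : State n × State n → Prop} (h : ∀ᶠ z in 𝓝 0, P z) : ∃ b > 0, ∀ u v, ‖u‖ < b →
    ‖v‖ < b → P (u, v) := by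
  obtain ⟨b, hb, hP⟩ := Metric.eventually_nhds_iff.1 h
  refine ⟨b, hb, fun m u hm hu => hP ?_⟩
  rw [dist_zero_right, Prod.norm_def]
  exact max_lt hm hu

lemma exists_radius {P : State n → Prop} (h : ∀ᶠ z in 𝓝 0, P z) : ∃ b > 0, ∀ u, ‖u‖ < b → P u := by
  obtain ⟨b, hb, hP⟩ := Metric.eventually_nhds_iff.1 h
  exact ⟨b, hb, fun u hu => hP (by simpa using hu)⟩

lemma eventually_norm_lt {E F : Type*} [TopologicalSpace E] [Zero E] [NormedAddCommGroup F] {g : E →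
    F} (hg : ContinuousAt g 0) : ∃ B > 0, ∀ᶠ z in 𝓝 0, ‖g z‖ < B :=
  ⟨‖g 0‖ + 1, by positivity, hg.norm.eventually (gt_mem_nhds (lt_add_one _))⟩

end Box

lemma IsArc.mono {ρ' : ℝ} (h : ρ ≤ ρ') (hγ : S.IsArc ρ i u v γ) : S.IsArc ρ' i u v γ :=
  ⟨hγ.1, hγ.2.1, hγ.2.2.imp fun _ hs τ hτ => ⟨ball_subset_ball h (hs τ hτ).1, (hs τ hτ).2⟩⟩

lemma IsArc.continuousOn (hγ : S.IsArc ρ i u v γ) : ContinuousOn γ (Icc 0 1) := by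
  obtain ⟨-, -, s, hs⟩ := hγ
  exact fun τ hτ => (hs τ hτ).2.continuousAt.continuousWithinAt

namespace Germ

variable (G : Germ S δ g i) (hδ : 0 < δ) (hS : S.Hyp δ)
include hδ hS

omit G in
lemma exists_param_lt {b : ℝ} (hb : 0 < b) : ∃ c > 0, c ≤ b ∧ ∀ u, ‖u‖ < c → |S.param δ i u| < b :=
    by
  have h := (tendsto_param (i := i) hδ hS).abs
  rw [abs_zero] at h
  obtain ⟨c, hc, h2⟩ := exists_radius (h.eventually (gt_mem_nhds hb))
  exact ⟨min c b, lt_min hc hb, min_le_right _ _, fun u hu => h2 u (hu.trans_le (min_le_left _ _))⟩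

lemma eventually_param_diff : ∀ᶠ u in 𝓝 (0 : State n), HasFDerivAt (S.param δ i) (fderiv ℝ (S.param
    δ i) u) u := by
  filter_upwards [eventually_mem_ball hδ] with u hu
  exact (((hS.contDiffOn_param i u hu).contDiffAt (isOpen_ball.mem_nhds hu)).differentiableAt
    (by norm_num)).hasFDerivAt

lemma exists_W_param : ∃ b > 0, ∀ m u, |m| < b → |S.param δ i u| < b → ‖u‖ < b → S.param δ i (G.W
    (m, u)) = m := by
  obtain ⟨b, hb, h⟩ := exists_box (G.W_flow.and ((G.tendsto_W.eventually
    (eventually_param_diff hδ hS)).and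
    (G.tendsto_W.eventually (hS.eventually_param_unitField hδ i))))
  obtain ⟨b2, hb2, h₂⟩ := exists_radius G.W_self
  refine ⟨min b b2, lt_min hb hb2, fun m u hm hpu hu => ?_⟩
  have hu' := hu.trans_le (min_le_left _ _)
  obtain ⟨ξ, -, hξ⟩ := exists_slope_eq (f := fun m => S.param δ i (G.W (m, u)))
    (f' := fun _ => 1) (a := S.param δ i u) (b := m) (fun x hx => by
      have hx' := abs_lt_of_mem_uIcc (hpu.trans_le (min_le_left _ _))
        (hm.trans_le (min_le_left _ _)) hx
      obtain ⟨h3, h4, h5⟩ := h x u hx' hu'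
      exact (HasFDerivAt.comp_hasDerivAt (f := fun m => G.W (m, u)) x h4 h3).congr_deriv h5)
  simp only [h₂ u (hu.trans_le (min_le_right _ _))] at hξ
  linarith

lemma eventually_W_smooth : ∀ᶠ z in 𝓝 (0 : ℝ × State n), ContDiffAt ℝ 2 (fun m => G.W (m, z.2)) z.1
    ∧ deriv (fun m => G.W (m, z.2)) z.1 = S.unitField δ i (G.W z) ∧ deriv (deriv fun m => G.W (m,
    z.2)) z.1 = fderiv ℝ (S.unitField δ i) (G.W z) (S.unitField δ i (G.W z)) := by
  filter_upwards [G.W_flow.eventually_nhds, G.tendsto_W.eventually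
    ((hS.contDiffAt_unitField hδ i).eventually (by norm_num))] with z h1 h2
  have hline : Tendsto (fun m : ℝ => (m, z.2)) (𝓝 z.1) (𝓝 z) :=
    (continuous_id.prodMk continuous_const).tendsto _
  have h3 := contDiffAt_two_of_ode (x := S.unitField δ i) (w := fun m => G.W (m, z.2)) (m := z.1)
    h2 (hline.eventually h1)
  exact ⟨h3.1, h1.self_of_nhds.deriv, h3.2.deriv⟩

lemma eventually_lam_W : ∀ᶠ z in 𝓝 (0 : ℝ × State n), HasDerivAt (fun m => S.lam i (G.W (m, z.2)))
    (S.growth δ i (G.W z)) z.1 := by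
  filter_upwards [G.W_flow, G.tendsto_W.eventually (eventually_mem_ball hδ)] with z h1 h2
  have h3 : HasFDerivAt (S.lam i) (fderiv ℝ (S.lam i) (G.W z)) (G.W (z.1, z.2)) :=
    (((hS.contDiffOn_lam i _ h2).contDiffAt (isOpen_ball.mem_nhds h2)).differentiableAt
      (by norm_num)).hasFDerivAt
  exact (HasFDerivAt.comp_hasDerivAt (f := fun m => G.W (m, z.2)) z.1 h3 h1).congr_deriv
    (fderiv_lam_unitField i _)

/-- Arcs are pieces of the curves `W(·, u)`, along which the parameter is monotone. -/
lemma exists_arc_eq : ∃ b > 0, ∀ u v γ, S.IsArc b i u v γ → (∀ τ ∈ Icc (0 : ℝ) 1, γ τ = G.W (S.param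
    δ i (γ τ), u)) ∧ (StrictMonoOn (fun τ => S.param δ i (γ τ)) (Icc 0 1) ∨ StrictAntiOn (fun τ =>
    S.param δ i (γ τ)) (Icc 0 1) ∨ ∀ τ ∈ Icc (0 : ℝ) 1, γ τ = u) := by
  obtain ⟨K, N, hN, hK⟩ := (hS.contDiffAt_unitField hδ i).exists_lipschitzOnWith
  obtain ⟨B, hB, hBev⟩ := eventually_norm_lt
    (contDiffAt_of_on hδ (hS.contDiffOn_param_deriv i)).continuousAt
  obtain ⟨b, hb, h⟩ := exists_box (G.W_flow.and (G.tendsto_W.eventually hN))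
  obtain ⟨b2, hb2, h₂⟩ := exists_radius (G.W_self.and ((eventually_param_diff (i := i) hδ hS).and
    ((hS.eventually_param_deriv_pos hδ i).and (hBev.and hN))))
  obtain ⟨c, hc, hcb, hp⟩ := exists_param_lt (i := i) hδ hS (lt_min hb hb2)
  refine ⟨c, hc, fun u v γ hγ => ?_⟩
  obtain ⟨hγ0, hγ1, s, hs⟩ := id hγ
  have hmem : ∀ τ ∈ Icc (0 : ℝ) 1, ‖γ τ‖ < c := fun τ hτ => by simpa using (hs τ hτ).1
  have hmem2 : ∀ τ ∈ Icc (0 : ℝ) 1, ‖γ τ‖ < b2 := fun τ hτ =>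
    (hmem τ hτ).trans_le (hcb.trans (min_le_right _ _))
  have h01 : (0 : ℝ) ∈ Icc (0 : ℝ) 1 := ⟨le_rfl, zero_le_one⟩
  have hu : ‖u‖ < b := by
    rw [← hγ0]; exact (hmem 0 h01).trans_le (hcb.trans (min_le_left _ _))
  have hdp : ∀ τ ∈ Icc (0 : ℝ) 1, HasDerivAt (fun τ => S.param δ i (γ τ))
      (s * fderiv ℝ (S.param δ i) (γ τ) (S.r i (γ τ))) τ := fun τ hτ =>
    (HasFDerivAt.comp_hasDerivAt (f := γ) τ (h₂ _ (hmem2 τ hτ)).2.1 (hs τ hτ).2).congr_deriv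
      (by rw [map_smul, smul_eq_mul])
  have hpos : ∀ τ ∈ Icc (0 : ℝ) 1, 0 < fderiv ℝ (S.param δ i) (γ τ) (S.r i (γ τ)) :=
    fun τ hτ => (h₂ _ (hmem2 τ hτ)).2.2.1
  have hpb : ∀ τ ∈ Icc (0 : ℝ) 1, |S.param δ i (γ τ)| < b := fun τ hτ =>
    (hp _ (hmem τ hτ)).trans_le (min_le_left _ _)
  have hcont : ContinuousOn (fun τ => S.param δ i (γ τ)) (Icc 0 1) := fun τ hτ =>
    (hdp τ hτ).continuousAt.continuousWithinAt
  refine ⟨?_, ?_⟩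
  · set wc : ℝ → State n := fun τ => G.W (S.param δ i (γ τ), u)
    have hwc : ∀ τ ∈ Icc (0 : ℝ) 1, HasDerivAt wc
        ((s * fderiv ℝ (S.param δ i) (γ τ) (S.r i (γ τ))) • S.unitField δ i (wc τ)) τ :=
      fun τ hτ => HasDerivAt.scomp (g₁ := fun m => G.W (m, u))
        (h := fun τ => S.param δ i (γ τ)) τ (h _ u (hpb τ hτ) hu).1 (hdp τ hτ)
    have hγd : ∀ τ ∈ Icc (0 : ℝ) 1, HasDerivAt γ
        ((s * fderiv ℝ (S.param δ i) (γ τ) (S.r i (γ τ))) • S.unitField δ i (γ τ)) τ :=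
      fun τ hτ => (hs τ hτ).2.congr_deriv (by
        rw [unitField, smul_smul, mul_assoc, mul_inv_cancel₀ (hpos τ hτ).ne', mul_one])
    have hI : ∀ τ ∈ Ico (0 : ℝ) 1, τ ∈ Icc (0 : ℝ) 1 := fun τ hτ => Ico_subset_Icc_self hτ
    exact ODE_solution_unique_of_mem_Icc_right (K := Real.toNNReal (|s| * B) * K)
      (v := fun τ y => (s * fderiv ℝ (S.param δ i) (γ τ) (S.r i (γ τ))) • S.unitField δ i y)
      (s := fun _ => N) (fun τ hτ => by
        refine LipschitzOnWith.of_dist_le_mul fun y hy y' hy' => ?_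
        rw [dist_smul₀, NNReal.coe_mul, mul_assoc]
        refine mul_le_mul ?_ (hK.dist_le_mul y hy y' hy') dist_nonneg (NNReal.coe_nonneg _)
        rw [Real.coe_toNNReal _ (by positivity), norm_mul, Real.norm_eq_abs]
        exact mul_le_mul_of_nonneg_left (h₂ _ (hmem2 τ (hI τ hτ))).2.2.2.1.le (abs_nonneg _))
      (fun τ hτ => (hγd τ hτ).continuousAt.continuousWithinAt)
      (fun τ hτ => (hγd τ (hI τ hτ)).hasDerivWithinAt)
      (fun τ hτ => (h₂ _ (hmem2 τ (hI τ hτ))).2.2.2.2)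
      (fun τ hτ => (hwc τ hτ).continuousAt.continuousWithinAt)
      (fun τ hτ => (hwc τ (hI τ hτ)).hasDerivWithinAt)
      (fun τ hτ => (h _ u (hpb τ (hI τ hτ)) hu).2)
      (by
        rw [hγ0]
        refine ((h₂ u ?_).1).symm
        rw [← hγ0]; exact hmem2 0 h01)
  · rcases lt_trichotomy s 0 with hs0 | hs0 | hs0
    · refine Or.inr (Or.inl (strictAntiOn_of_deriv_neg (convex_Icc 0 1) hcont fun τ hτ => ?_))
      have hτ' := interior_subset hτ
      rw [(hdp τ hτ').deriv]
      exact mul_neg_of_neg_of_pos hs0 (hpos τ hτ')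
    · refine Or.inr (Or.inr fun τ hτ => ?_)
      have h5 := (convex_Icc (0 : ℝ) 1).norm_image_sub_le_of_norm_hasDerivWithin_le (C := 0)
        (f := γ) (f' := fun τ => s • S.r i (γ τ))
        (fun τ hτ => (hs τ hτ).2.hasDerivWithinAt) (fun τ _ => by simp [hs0]) h01 hτ
      rw [zero_mul, norm_le_zero_iff, sub_eq_zero, hγ0] at h5
      exact h5
    · refine Or.inl (strictMonoOn_of_deriv_pos (convex_Icc 0 1) hcont fun τ hτ => ?_)
      have hτ' := interior_subset hτ
      rw [(hdp τ hτ').deriv]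
      exact mul_pos hs0 (hpos τ hτ')

omit G hδ hS in
lemma param_mem_uIcc_of_arc {p : State n → ℝ} (h0 : γ 0 = u) (h : StrictMonoOn (fun τ => p (γ τ))
    (Icc 0 1) ∨ StrictAntiOn (fun τ => p (γ τ)) (Icc 0 1) ∨ ∀ τ ∈ Icc (0 : ℝ) 1, γ τ = u) {τ : ℝ}
    (hτ : τ ∈ Icc (0 : ℝ) 1) : p (γ τ) ∈ uIcc (p u) (p (γ 1)) := by
  have h01 : (0 : ℝ) ∈ Icc (0 : ℝ) 1 := ⟨le_rfl, zero_le_one⟩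
  have h11 : (1 : ℝ) ∈ Icc (0 : ℝ) 1 := ⟨zero_le_one, le_rfl⟩
  rw [mem_uIcc, ← h0]
  rcases h with h | h | h
  · exact Or.inl ⟨h.monotoneOn h01 hτ hτ.1, h.monotoneOn hτ h11 hτ.2⟩
  · exact Or.inr ⟨h.antitoneOn hτ h11 hτ.2, h.antitoneOn h01 hτ hτ.1⟩
  · rw [h τ hτ, h 1 h11, h 0 h01]; exact Or.inl ⟨le_rfl, le_rfl⟩

lemma exists_arc : ∃ b > 0, ∀ u m ρ, ‖u‖ < b → |m| < b → (∀ m' ∈ uIcc (S.param δ i u) m, ‖G.W (m',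
    u)‖ < ρ) → ∃ γ, S.IsArc ρ i u (G.W (m, u)) γ := by
  obtain ⟨R, hR, harc⟩ := G.exists_arc_eq hδ hS
  have hr : ContDiffAt ℝ 1 (S.r i) 0 := (contDiffAt_of_on hδ (hS.r_smooth i)).of_le (by norm_num)
  obtain ⟨ψ, hψs, a, ha, hψ⟩ := exists_local_flow hr
  have hψ0 : ψ 0 = 0 := (hψ 0 (by simpa using ha)).1
  have hψt : Tendsto ψ (𝓝 0) (𝓝 0) := by
    have := hψs.continuousAt.tendsto
    rwa [hψ0] at this
  set D := fderiv ℝ (S.param δ i) 0 (S.r i 0)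
  have hD : 0 < D := hS.param_deriv_pos hδ i
  obtain ⟨d0, hd0, hbox⟩ := exists_box ((hψt.eventually (ball_mem_nhds _ hR)).and
    ((hψt.eventually (eventually_param_diff (i := i) hδ hS)).and
      (hψt.eventually ((contDiffAt_of_on hδ (hS.contDiffOn_param_deriv i)).continuousAt.eventually
        (lt_mem_nhds (half_lt_self hD))))))
  set d := min d0 a with hd
  have hdpos : 0 < d := lt_min hd0 ha
  obtain ⟨c, hc, hcb, hp⟩ := exists_param_lt (i := i) hδ hS (b := D * d / 8) (by positivity)
  refine ⟨min c (min d (D * d / 8)), lt_min hc (lt_min hdpos (by positivity)),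
    fun u m ρ hu hm hρ => ?_⟩
  have hud : ‖u‖ < d := hu.trans_le ((min_le_right _ _).trans (min_le_left _ _))
  have hm8 : |m| < D * d / 8 := hm.trans_le ((min_le_right _ _).trans (min_le_right _ _))
  have hp8 : |S.param δ i u| < D * d / 8 := hp u (hu.trans_le (min_le_left _ _))
  have hfl : ∀ t, |t| < d → HasDerivAt (fun t => ψ (t, u)) (S.r i (ψ (t, u))) t := fun t ht =>
    (hψ u (hud.trans_le (min_le_right _ _))).2 t (ht.trans_le (min_le_right _ _))
  have hpd : ∀ t, |t| < d → HasDerivAt (fun t => S.param δ i (ψ (t, u)))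
      (fderiv ℝ (S.param δ i) (ψ (t, u)) (S.r i (ψ (t, u)))) t := fun t ht =>
    HasFDerivAt.comp_hasDerivAt (f := fun t => ψ (t, u)) t
      (hbox t u (ht.trans_le (min_le_left _ _)) (hud.trans_le (min_le_left _ _))).2.1 (hfl t ht)
  have hlow : ∀ t, |t| < d → D / 2 < fderiv ℝ (S.param δ i) (ψ (t, u)) (S.r i (ψ (t, u))) :=
    fun t ht =>
    (hbox t u (ht.trans_le (min_le_left _ _)) (hud.trans_le (min_le_left _ _))).2.2
  have hψu : ψ (0, u) = u := (hψ u (hud.trans_le (min_le_right _ _))).1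
  have hab : ∀ t, |t| ≤ d / 2 → |t| < d := fun t ht => by linarith
  have hup : m < S.param δ i (ψ (d / 2, u)) := by
    obtain ⟨ξ, hξ, he⟩ := exists_slope_eq (f := fun t => S.param δ i (ψ (t, u))) (a := 0)
      (b := d / 2) (fun x hx => hpd x (by
        rw [uIcc_of_le (by linarith)] at hx
        rw [abs_of_nonneg hx.1]; linarith [hx.2]))
    rw [uIcc_of_le (by linarith)] at hξ
    have h6 := hlow ξ (by rw [abs_of_nonneg hξ.1]; linarith [hξ.2])
    simp only [hψu, sub_zero] at he
    have h7 := abs_lt.1 hm8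
    have h8 := abs_lt.1 hp8
    nlinarith
  have hdn : S.param δ i (ψ (-(d / 2), u)) < m := by
    obtain ⟨ξ, hξ, he⟩ := exists_slope_eq (f := fun t => S.param δ i (ψ (t, u))) (a := 0)
      (b := -(d / 2)) (fun x hx => hpd x (by
        rw [uIcc_of_ge (by linarith)] at hx
        rw [abs_of_nonpos hx.2]; linarith [hx.1]))
    rw [uIcc_of_ge (by linarith)] at hξ
    have h6 := hlow ξ (by rw [abs_of_nonpos hξ.2]; linarith [hξ.1])
    simp only [hψu, sub_zero] at he
    have h7 := abs_lt.1 hm8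
    have h8 := abs_lt.1 hp8
    nlinarith
  obtain ⟨t, ht, htm⟩ := intermediate_value_Icc (a := -(d / 2)) (b := d / 2) (by linarith)
    (f := fun t => S.param δ i (ψ (t, u))) (fun t ht =>
      (hpd t (hab t (abs_le.2 ht))).continuousAt.continuousWithinAt) ⟨hdn.le, hup.le⟩
  have htd : ∀ τ ∈ Icc (0 : ℝ) 1, |τ * t| < d := fun τ hτ => by
    rw [abs_mul, abs_of_nonneg hτ.1]
    have h5 := abs_le.2 ht
    have h6 := mul_le_mul hτ.2 h5 (abs_nonneg _) zero_le_one
    linarith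
  have hder : ∀ τ ∈ Icc (0 : ℝ) 1, HasDerivAt (fun τ => ψ (τ * t, u)) (t • S.r i (ψ (τ * t, u))) τ :=
    fun τ hτ => by
      have h5 : HasDerivAt (fun τ : ℝ => τ * t) t τ := by
        simpa using (hasDerivAt_id τ).mul_const t
      exact HasDerivAt.scomp τ (hfl _ (htd τ hτ)) h5
  have hγ : S.IsArc R i u (ψ (t, u)) fun τ => ψ (τ * t, u) :=
    ⟨by simp [hψu], by simp, t, fun τ hτ =>
      ⟨(hbox _ u ((htd τ hτ).trans_le (min_le_left _ _)) (hud.trans_le (min_le_left _ _))).1,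
        hder τ hτ⟩⟩
  obtain ⟨h1, h2⟩ := harc u _ _ hγ
  have h11 : (1 : ℝ) ∈ Icc (0 : ℝ) 1 := ⟨zero_le_one, le_rfl⟩
  have hend : ψ (t, u) = G.W (m, u) := by
    have := h1 1 h11
    simp only [one_mul] at this htm
    rw [htm] at this
    exact this
  refine ⟨fun τ => ψ (τ * t, u), ⟨by simp [hψu], by simp [hend], t, fun τ hτ => ⟨?_, hder τ hτ⟩⟩⟩
  have h3 := param_mem_uIcc_of_arc (p := S.param δ i) (γ := fun τ => ψ (τ * t, u)) (u := u)
    (by simp [hψu]) h2 hτ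
  simp only [one_mul] at h3 htm
  rw [htm] at h3
  have h4 := hρ _ h3
  rw [mem_ball_zero_iff]
  have h5 : ψ (τ * t, u) = _ := h1 τ hτ
  rwa [← h5] at h4

end Germ

section

variable (hδ : 0 < δ) (hS : S.Hyp δ)
include hδ hS

omit hδ hS in
lemma growth_zero (hi : S.IsCC δ i) : S.growth δ i 0 = 0 := by
  rw [growth, hi.1, mul_zero]

lemma Hyp.growth_deriv_pos (hi : S.IsCC δ i) : 0 < fderiv ℝ (S.growth δ i) 0 (S.unitField δ i 0) :=
    by
  have hD := hS.param_deriv_pos hδ i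
  have h1 : HasFDerivAt (fun v => (fderiv ℝ (S.param δ i) v (S.r i v))⁻¹)
      (fderiv ℝ (fun v => (fderiv ℝ (S.param δ i) v (S.r i v))⁻¹) 0) 0 :=
    (((contDiffAt_of_on hδ (hS.contDiffOn_param_deriv i)).inv hD.ne').differentiableAt
      (by norm_num)).hasFDerivAt
  have h2 : HasFDerivAt (S.nonlin i) (fderiv ℝ (S.nonlin i) 0) 0 :=
    ((contDiffAt_of_on hδ (hS.contDiffOn_nonlin i)).differentiableAt (by norm_num)).hasFDerivAt
  have h3 : HasFDerivAt (S.growth δ i) _ 0 := h1.mul h2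
  rw [h3.fderiv]
  simp only [hi.1, zero_smul, add_zero, smul_apply, smul_eq_mul, unitField,
    map_smul]
  have := hi.2 0 (mem_ball_self hδ)
  positivity

lemma fderiv_growth (hX : ContDiffAt ℝ 1 (S.unitField δ i) 0) : fderiv ℝ (S.growth δ i) 0
    (S.unitField δ i 0) = fderiv ℝ (fderiv ℝ (S.lam i)) 0 (S.unitField δ i 0) (S.unitField δ i 0) +
    fderiv ℝ (S.lam i) 0 (fderiv ℝ (S.unitField δ i) 0 (S.unitField δ i 0)) := by
  have h1 : S.growth δ i = fun v => fderiv ℝ (S.lam i) v (S.unitField δ i v) := by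
    ext v; exact (fderiv_lam_unitField i v).symm
  have h2 : HasFDerivAt (fderiv ℝ (S.lam i)) (fderiv ℝ (fderiv ℝ (S.lam i)) 0) 0 :=
    (((contDiffAt_of_on hδ (hS.contDiffOn_lam i)).fderiv_right (m := 1)
      (by norm_num)).differentiableAt (by norm_num)).hasFDerivAt
  have h3 := (hX.differentiableAt (by norm_num)).hasFDerivAt
  rw [h1, (h2.clm_apply h3).fderiv]
  simp [add_comm]

namespace Germ

variable (G : Germ S δ g i)

lemma pd_pd_s_zero (hi : S.IsCC δ i) : pd (pd G.s) 0 = fderiv ℝ (S.growth δ i) 0 (S.unitField δ i 0)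
    / 3 := by
  set a := fderiv ℝ (S.growth δ i) 0 (S.unitField δ i 0) with ha
  set c := pd (pd G.s) 0 with hc
  have hp0 := hS.param_zero hδ i
  have hline : Tendsto (fun m : ℝ => (m, (0 : State n))) (𝓝 0) (𝓝 0) :=
    (continuous_id.prodMk continuous_const).tendsto _
  have hg0 := growth_zero hi
  have hVd := eventually_pd G.V_smooth
  have hsd := eventually_pd G.s_smooth
  have hs0 := (G.eventually_s_self hδ hS).self_of_nhds
  have hj0 := (G.eventually_two_jet hδ hS).self_of_nhds
  rw [hp0] at hs0 hj0
  change G.s 0 = _ ∧ pd G.s 0 = _ at hs0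
  change pd G.V 0 = _ ∧ pd (pd G.V) 0 = _ at hj0
  rw [hg0, zero_div] at hs0
  have hlamC := contDiffAt_of_on hδ (hS.contDiffOn_lam i)
  -- the function `lam (V m) - s m` and its derivative
  have hG1 : ∀ᶠ m in 𝓝 (0 : ℝ), HasDerivAt (fun m => S.lam i (G.V (m, 0)) - G.s (m, 0))
      (fderiv ℝ (S.lam i) (G.V (m, 0)) (pd G.V (m, 0)) - pd G.s (m, 0)) m := by
    filter_upwards [hline.eventually hVd, hline.eventually hsd, hline.eventually
      (G.tendsto_V.eventually (hlamC.eventually (by norm_num)))] with m h1 h2 h3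
    have h4 : HasFDerivAt (S.lam i) (fderiv ℝ (S.lam i) (G.V (m, 0))) (G.V (m, 0)) :=
      (h3.differentiableAt (by norm_num)).hasFDerivAt
    exact (HasFDerivAt.comp_hasDerivAt (f := fun m => G.V (m, 0)) m h4 h1.1).sub h2.1
  have hG2 : HasDerivAt (fun m : ℝ => fderiv ℝ (S.lam i) (G.V (m, 0)) (pd G.V (m, 0)) -
      pd G.s (m, 0)) (a - c) 0 := by
    have h1 := hVd.self_of_nhds
    have h2 := hsd.self_of_nhds
    have h3 : HasFDerivAt (fderiv ℝ (S.lam i)) (fderiv ℝ (fderiv ℝ (S.lam i)) 0) (G.V (0, 0)) := by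
      have : G.V (0, 0) = 0 := G.V_zero
      rw [this]
      exact ((hlamC.fderiv_right (m := 1) (by norm_num)).differentiableAt (by norm_num)).hasFDerivAt
    have h4 := (HasFDerivAt.comp_hasDerivAt (f := fun m : ℝ => G.V (m, 0)) 0 h3 h1.1).clm_apply h1.2.1
    refine (h4.sub h2.2.1).congr_deriv ?_
    rw [ha, fderiv_growth hδ hS (hS.contDiffAt_unitField hδ i)]
    have e1 : G.V (0, 0) = 0 := G.V_zero
    have e2 : pd G.V (0, (0 : ℝ × State n).2) = S.unitField δ i 0 := hj0.1
    have e3 : pd (pd G.V) 0 = _ := hj0.2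
    simp only [Function.comp_apply, Prod.snd_zero, e1, hj0.1, e3, hc] at e2 ⊢
    rw [e2]
  have hG0 : fderiv ℝ (S.lam i) (G.V (0, 0)) (pd G.V (0, 0)) - pd G.s (0, 0) = 0 := by
    have e1 : G.V (0, 0) = 0 := G.V_zero
    have e2 : pd G.V (0, 0) = S.unitField δ i 0 := hj0.1
    have e3 : pd G.s (0, 0) = 0 := hs0.2
    rw [e1, e2, e3, fderiv_lam_unitField, hg0, sub_zero]
  have hlim1 : Tendsto (fun m : ℝ => (S.lam i (G.V (m, 0)) - G.s (m, 0)) / m ^ 2) (𝓝[≠] 0)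
      (𝓝 ((a - c) / 2)) := by
    have hev : ∀ᶠ m : ℝ in 𝓝[≠] 0, m ≠ 0 := self_mem_nhdsWithin
    refine HasDerivAt.lhopital_zero_nhdsNE (g' := fun m => 2 * m) (hG1.filter_mono nhdsWithin_le_nhds)
      (Eventually.of_forall fun m => by simpa using hasDerivAt_pow 2 m)
      (hev.mono fun m hm => mul_ne_zero two_ne_zero hm) ?_ ?_ ?_
    · have := hG1.self_of_nhds.continuousAt.tendsto
      have e1 : G.V (0, 0) = 0 := G.V_zero
      have e2 : G.s (0, 0) = S.lam i 0 := hs0.1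
      simp only [e1, e2, sub_self] at this
      exact this.mono_left nhdsWithin_le_nhds
    · have : Tendsto (fun m : ℝ => m ^ 2) (𝓝 0) (𝓝 (0 ^ 2)) := (continuous_pow 2).tendsto 0
      rw [zero_pow two_ne_zero] at this
      exact this.mono_left nhdsWithin_le_nhds
    · have h5 := hG2.tendsto_slope
      have h6 := h5.div_const 2
      refine h6.congr' (hev.mono fun m hm => ?_)
      rw [slope_def_field, hG0]
      field_simp
      simp
  have hlim2 : Tendsto (fun m : ℝ => pd G.s (m, 0) / m) (𝓝[≠] 0) (𝓝 c) := by
    refine (hsd.self_of_nhds.2.1).tendsto_slope.congr fun m => ?_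
    have e3 : pd G.s (0, 0) = 0 := hs0.2
    rw [slope_def_field]
    simp [e3]
  have hVlim : Tendsto (fun m : ℝ => m⁻¹ • G.V (m, 0)) (𝓝[≠] 0) (𝓝 (S.unitField δ i 0)) := by
    have h5 := (hVd.self_of_nhds.1).tendsto_slope
    rw [hj0.1] at h5
    refine h5.congr fun m => ?_
    have e1 : G.V (0, 0) = 0 := G.V_zero
    rw [slope_def_module]
    simp [e1]
  have hℓlim : Tendsto (fun m : ℝ => G.ℓ (G.V (m, 0))) (𝓝 0) (𝓝 (G.ℓ 0)) :=
    G.ℓ_smooth.continuousAt.tendsto.comp (G.tendsto_V.comp hline)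
  have hlim3 : Tendsto (fun m : ℝ => G.ℓ (G.V (m, 0)) (pd G.V (m, 0))) (𝓝[≠] 0) (𝓝 1) := by
    have h5 : Tendsto (fun m : ℝ => pd G.V (m, 0)) (𝓝 0) (𝓝 (S.unitField δ i 0)) := by
      rw [← hj0.1]
      exact (continuousAt_pd G.V_smooth).tendsto.comp hline
    have h6 := tendsto_clm_apply hℓlim h5
    rw [G.ℓ_zero] at h6
    exact h6.mono_left nhdsWithin_le_nhds
  have hlim4 : Tendsto (fun m : ℝ => G.ℓ (G.V (m, 0)) (m⁻¹ • G.V (m, 0))) (𝓝[≠] 0) (𝓝 1) := by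
    have h6 := tendsto_clm_apply (hℓlim.mono_left nhdsWithin_le_nhds) hVlim
    rwa [G.ℓ_zero] at h6
  have hrel : ∀ᶠ m : ℝ in 𝓝[≠] 0, (S.lam i (G.V (m, 0)) - G.s (m, 0)) / m ^ 2 * G.ℓ (G.V (m, 0)) (pd
    G.V (m, 0)) = pd G.s (m, 0) / m * G.ℓ (G.V (m, 0)) (m⁻¹ • G.V (m, 0)) := by
    have hev : ∀ᶠ m : ℝ in 𝓝[≠] 0, m ≠ 0 := self_mem_nhdsWithin
    filter_upwards [hev, (hline.eventually (G.eventually_left_relation hδ hS)).filter_mono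
      nhdsWithin_le_nhds] with m hm h
    simp only [sub_zero] at h
    rw [map_smul, smul_eq_mul, div_mul_eq_mul_div, h]
    field_simp
  have := tendsto_nhds_unique (hlim1.mul hlim3) ((hlim2.mul hlim4).congr' (hrel.mono fun _ h => h.symm))
  linarith

include G in
lemma eventually_growth (hi : S.IsCC δ i) : ∃ a > 0, ∀ᶠ u in 𝓝 (0 : State n), ∃ k ∈ Icc a (4 * a),
    S.growth δ i u = k * S.param δ i u := by
  set a := fderiv ℝ (S.growth δ i) 0 (S.unitField δ i 0) with ha
  have hapos : 0 < a := hS.growth_deriv_pos hδ hi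
  have hgC := hS.contDiffAt_growth hδ i
  have h1 : Tendsto (fun v => fderiv ℝ (S.growth δ i) v (S.unitField δ i v)) (𝓝 0) (𝓝 a) :=
    tendsto_clm_apply (hgC.fderiv_right (m := 0) (by norm_num)).continuousAt.tendsto
      (hS.contDiffAt_unitField hδ i).continuousAt.tendsto
  have h2 : ∀ᶠ v in 𝓝 (0 : State n), HasFDerivAt (S.growth δ i) (fderiv ℝ (S.growth δ i) v) v ∧
    fderiv ℝ (S.growth δ i) v (S.unitField δ i v) ∈ Icc (a / 2) (4 * (a / 2)) ∧ v ∈ ball (0 : State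
    n) δ := by
    filter_upwards [hgC.eventually (by norm_num), h1.eventually (Icc_mem_nhds (half_lt_self hapos)
      (show a < 4 * (a / 2) by linarith)), eventually_mem_ball hδ] with v h3 h4 h5
    exact ⟨(h3.differentiableAt (by norm_num)).hasFDerivAt, h4, h5⟩
  obtain ⟨b, hb, h⟩ := exists_box (G.W_flow.and (G.tendsto_W.eventually h2))
  obtain ⟨b2, hb2, hWp⟩ := G.exists_W_param hδ hS
  have hpt := (tendsto_param (i := i) hδ hS).abs
  rw [abs_zero] at hpt
  refine ⟨a / 2, half_pos hapos, ?_⟩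
  filter_upwards [G.W_self, hpt.eventually (gt_mem_nhds (lt_min hb hb2)),
    ball_mem_nhds (0 : State n) (lt_min hb hb2)] with u hu hpu hnu
  rw [mem_ball_zero_iff] at hnu
  have h0b : |(0 : ℝ)| < b := by simpa
  have hnub := hnu.trans_le (min_le_left _ _)
  obtain ⟨ξ, hξ, he⟩ := exists_slope_eq (f := fun m => S.growth δ i (G.W (m, u)))
    (f' := fun m => fderiv ℝ (S.growth δ i) (G.W (m, u)) (S.unitField δ i (G.W (m, u))))
    (a := 0) (b := S.param δ i u) (fun x hx => by
      obtain ⟨h4, h5, -⟩ := h x u (abs_lt_of_mem_uIcc h0b (hpu.trans_le (min_le_left _ _)) hx) hnub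
      exact HasFDerivAt.comp_hasDerivAt (f := fun m => G.W (m, u)) x h5 h4)
  have hz : S.growth δ i (G.W (0, u)) = 0 := by
    have h6 := hWp 0 u (by simpa) (hpu.trans_le (min_le_right _ _)) (hnu.trans_le (min_le_right _ _))
    rw [param, if_pos hi, hS.mu_zero i hi _ (h 0 u h0b hnub).2.2.2] at h6
    rw [growth, h6, mul_zero]
  simp only [hu, hz, sub_zero] at he
  exact ⟨_, (h ξ u (abs_lt_of_mem_uIcc h0b (hpu.trans_le (min_le_left _ _)) hξ) hnub).2.2.1, he⟩

end Germ

end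

/-- A description, for base points `u` with `‖u‖ < R` and parameters `|m| < M`, of the Hugoniot
curves `V m u` and the integral curves `W m u` of a family, parametrized by `p`. -/
structure Chart (S : ConsLaw n) (i : Fin n) (g : ℝ) where
  (R M B q : ℝ)
  R_pos : 0 < R
  M_pos : 0 < M
  B_pos : 0 < B
  q_pos : 0 < q
  p : State n → ℝ
  (V W : ℝ → State n → State n)
  (s s1 s2 Q : ℝ → State n → ℝ)
  h : State n → ℝ
  e : State n →L[ℝ] ℝ
  X : State n
  e_X : e X = 1
  p_zero : p 0 = 0
  p_strict : HasStrictFDerivAt p e 0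
  p_lt : ∀ {u}, ‖u‖ < R → |p u| < M
  p_lip : ∀ {u v}, ‖u‖ < R → ‖v‖ < R → |p u - p v| ≤ B * ‖u - v‖
  V_strict : HasStrictFDerivAt (fun z : ℝ × State n => V z.1 z.2) (linParam e X) 0
  W_strict : HasStrictFDerivAt (fun z : ℝ × State n => W z.1 z.2) (linParam e X) 0
  p_V : ∀ {m u}, |m| < M → ‖u‖ < R → p (V m u) = m
  p_W : ∀ {m u}, |m| < M → ‖u‖ < R → p (W m u) = m
  V_p : ∀ {u}, ‖u‖ < R → V (p u) u = u
  W_p : ∀ {u}, ‖u‖ < R → W (p u) u = u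
  hug : ∀ {ρ u v}, ‖u‖ < R → ‖v‖ < R → v ∈ ball (0 : State n) ρ →
    (v ∈ S.hugoniot ρ i u ↔ V (p v) u = v)
  symm : ∀ {u v}, ‖u‖ < R → ‖v‖ < R → V (p v) u = v → V (p u) v = u ∧ s (p u) v = s (p v) u
  hug_of_jump : ∀ {u v t}, ‖u‖ < R → ‖v‖ < R → S.f v - S.f u = t • (v - u) →
    |t - S.lam i 0| < g → V (p v) u = v
  jump : ∀ {m u}, |m| < M → ‖u‖ < R → S.f (V m u) - S.f u = s m u • (V m u - u)
  s_self : ∀ {u}, ‖u‖ < R → s (p u) u = S.lam i u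
  s_near : ∀ {m u}, |m| < M → ‖u‖ < R → |s m u - S.lam i 0| < g
  lam_near : ∀ {u}, ‖u‖ < R → |S.lam i u - S.lam i 0| < g
  s_deriv : ∀ {m u}, |m| < M → ‖u‖ < R → HasDerivAt (fun m => s m u) (s1 m u) m
  s1_deriv : ∀ {m u}, |m| < M → ‖u‖ < R → HasDerivAt (fun m => s1 m u) (s2 m u) m
  s1_self : ∀ {u}, ‖u‖ < R → s1 (p u) u = h u / 2
  s1_lip : ∀ {m u m' u'}, |m| < M → ‖u‖ < R → |m'| < M → ‖u'‖ < R →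
    |s1 m u - s1 m' u'| ≤ B * (|m - m'| + ‖u - u'‖)
  lax : ∀ {m u}, |m| < M → ‖u‖ < R →
    ∃ κ > 0, S.lam i (V m u) - s m u = κ * ((m - p u) * s1 m u)
  E_deriv : ∀ {m u}, |m| < M → ‖u‖ < R →
    HasDerivAt (fun m => S.dissipation u (V m u)) (s1 m u * Q m u) m
  Q_self : ∀ {u}, ‖u‖ < R → Q (p u) u = 0
  Q_deriv : ∀ {m u}, |m| < M → ‖u‖ < R →
    ∃ k, q ≤ k ∧ k ≤ 3 * q ∧ HasDerivAt (fun m => Q m u) ((m - p u) * k) m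
  arc_eq : ∀ {ρ u v γ}, ρ ≤ R → S.IsArc ρ i u v γ →
    (∀ τ ∈ Icc (0 : ℝ) 1, γ τ = W (p (γ τ)) u) ∧
    (StrictMonoOn (fun τ => p (γ τ)) (Icc 0 1) ∨
      StrictAntiOn (fun τ => p (γ τ)) (Icc 0 1) ∨ ∀ τ ∈ Icc (0 : ℝ) 1, γ τ = u)
  arc_exists : ∀ {ρ m u}, |m| < M → ‖u‖ < R → (∀ m' ∈ uIcc (p u) m, ‖W m' u‖ < ρ) →
    ∃ γ, S.IsArc ρ i u (W m u) γ
  lam_W : ∀ {m u}, |m| < M → ‖u‖ < R → HasDerivAt (fun m => S.lam i (W m u)) (h (W m u)) m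
  V_smooth : ∀ {m u}, |m| < M → ‖u‖ < R → ContDiffAt ℝ 2 (fun m => V m u) m ∧
    ‖deriv (fun m => V m u) m‖ ≤ B ∧ ‖deriv (deriv fun m => V m u) m‖ ≤ B
  W_smooth : ∀ {m u}, |m| < M → ‖u‖ < R → ContDiffAt ℝ 2 (fun m => W m u) m ∧
    ‖deriv (fun m => W m u) m‖ ≤ B ∧ ‖deriv (deriv fun m => W m u) m‖ ≤ B
  jet : ∀ {u}, ‖u‖ < R → deriv (fun m => V m u) (p u) = deriv (fun m => W m u) (p u) ∧
    deriv (deriv fun m => V m u) (p u) = deriv (deriv fun m => W m u) (p u)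

namespace Chart

/-- The shock speed is uniformly convex along the Hugoniot curves, and the characteristic speed has
a nondegenerate minimum along the integral curves at `p = 0`. -/
structure Convex (Γ : Chart S i g) (c C : ℝ) : Prop where
  c_pos : 0 < c
  C_pos : 0 < C
  s2_ge : ∀ {m u}, |m| < Γ.M → ‖u‖ < Γ.R → c ≤ Γ.s2 m u
  growth : ∀ {u}, ‖u‖ < Γ.R → ∃ k, 0 < k ∧ k ≤ C ∧ Γ.h u = k * Γ.p u

structure Nonlinear (Γ : Chart S i g) : Prop where
  s1_pos : ∀ {m u}, |m| < Γ.M → ‖u‖ < Γ.R → 0 < Γ.s1 m u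
  h_pos : ∀ {u}, ‖u‖ < Γ.R → 0 < Γ.h u

structure Degenerate (Γ : Chart S i g) : Prop where
  V_eq : ∀ {m u}, |m| < Γ.M → ‖u‖ < Γ.R → Γ.V m u = Γ.W m u
  s_eq : ∀ {m u}, |m| < Γ.M → ‖u‖ < Γ.R → Γ.s m u = S.lam i u
  lam_V : ∀ {m u}, |m| < Γ.M → ‖u‖ < Γ.R → S.lam i (Γ.V m u) = S.lam i u
  diss : ∀ {m u}, |m| < Γ.M → ‖u‖ < Γ.R → S.dissipation u (Γ.V m u) = 0

lemma speed_V (Γ : Chart S i g) (hm : |m| < Γ.M) (hu : ‖u‖ < Γ.R) (hne : m ≠ Γ.p u) : S.speed u (Γ.V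
    m u) = Γ.s m u :=
  speed_eq (fun h => hne (by rw [← Γ.p_V hm hu, h])) (Γ.jump hm hu)

end Chart

namespace Germ

variable (G : Germ S δ g i) (hδ : 0 < δ) (hS : S.Hyp δ)

lemma eventually_dissipation : ∀ᶠ z in 𝓝 (0 : ℝ × State n), S.dissipation z.2 (G.V z) = -G.s z *
    (S.U (G.V z) - S.U z.2) + (S.F (G.V z) - S.F z.2) := by
  filter_upwards [G.eventually_jump] with z h
  by_cases hne : G.V z = z.2
  · simp [dissipation, hne]
  · rw [dissipation, speed_eq hne h]

lemma eventually_slice {E : Type} [NormedAddCommGroup E] [NormedSpace ℝ E] {w : ℝ × State n → E} (hw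
    : ContDiffAt ℝ 2 w 0) : ∃ B > 0, ∀ᶠ z in 𝓝 (0 : ℝ × State n), ContDiffAt ℝ 2 (fun m => w (m,
    z.2)) z.1 ∧ deriv (fun m => w (m, z.2)) z.1 = pd w z ∧ deriv (deriv fun m => w (m, z.2)) z.1 =
    pd (pd w) z ∧ ‖pd w z‖ < B ∧ ‖pd (pd w) z‖ < B := by
  obtain ⟨B, hB, h1⟩ := eventually_norm_lt (continuousAt_pd hw)
  obtain ⟨B2, hB2, h2⟩ := eventually_norm_lt (continuousAt_pd_pd hw)
  refine ⟨max B B2, lt_max_of_lt_left hB, ?_⟩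
  filter_upwards [(eventually_pd hw).eventually_nhds, h1, h2] with z h3 h4 h5
  have hline : Tendsto (fun m : ℝ => (m, z.2)) (𝓝 z.1) (𝓝 z) :=
    (continuous_id.prodMk continuous_const).tendsto _
  have h6 := h3.self_of_nhds
  have h7 : deriv (fun m => w (m, z.2)) =ᶠ[𝓝 z.1] fun m => pd w (m, z.2) :=
    (hline.eventually h3).mono fun m hm => hm.1.deriv
  exact ⟨h6.2.2, h6.1.deriv, by rw [h7.deriv_eq]; exact h6.2.1.deriv,
    h4.trans_le (le_max_left _ _), h5.trans_le (le_max_right _ _)⟩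

include hδ hS

lemma eventually_W_slice : ∃ B > 0, ∀ᶠ z in 𝓝 (0 : ℝ × State n), ContDiffAt ℝ 2 (fun m => G.W (m,
    z.2)) z.1 ∧ deriv (fun m => G.W (m, z.2)) z.1 = S.unitField δ i (G.W z) ∧ deriv (deriv fun m =>
    G.W (m, z.2)) z.1 = fderiv ℝ (S.unitField δ i) (G.W z) (S.unitField δ i (G.W z)) ∧ ‖deriv (fun m
    => G.W (m, z.2)) z.1‖ < B ∧ ‖deriv (deriv fun m => G.W (m, z.2)) z.1‖ < B := by
  have hX := hS.contDiffAt_unitField hδ i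
  obtain ⟨B, hB, h1⟩ := eventually_norm_lt hX.continuousAt
  obtain ⟨B2, hB2, h2⟩ := eventually_norm_lt (g := fun v => fderiv ℝ (S.unitField δ i) v
    (S.unitField δ i v)) (tendsto_clm_apply
      (hX.fderiv_right (m := 0) (by norm_num)).continuousAt.tendsto hX.continuousAt.tendsto)
  refine ⟨max B B2, lt_max_of_lt_left hB, ?_⟩
  filter_upwards [G.eventually_W_smooth hδ hS, G.tendsto_W.eventually h1,
    G.tendsto_W.eventually h2] with z h3 h4 h5
  refine ⟨h3.1, h3.2.1, h3.2.2, ?_, ?_⟩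
  · rw [h3.2.1]; exact h4.trans_le (le_max_left _ _)
  · rw [h3.2.2]; exact h5.trans_le (le_max_right _ _)

lemma eventually_lam_near (hg : 0 < g) : ∀ᶠ u in 𝓝 (0 : State n), ∀ j, |S.lam j u - S.lam j 0| < g
    := by
  refine eventually_all.2 fun j => ?_
  have h1 : Tendsto (fun u => |S.lam j u - S.lam j 0|) (𝓝 0) (𝓝 0) := by
    simpa using ((contDiffAt_of_on hδ (hS.contDiffOn_lam j)).continuousAt.tendsto.sub_const
      (S.lam j 0)).abs
  exact h1.eventually (gt_mem_nhds hg)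

omit hδ hS in
lemma mem_hugoniot_of_jump (hgap : ∀ i j, i ≠ j → 4 * g < |S.lam i 0 - S.lam j 0|) {t : ℝ} (hu : ∀
    j, |S.lam j u - S.lam j 0| < g) (h : S.f v - S.f u = t • (v - u)) (ht : |t - S.lam i 0| < g) (hv
    : v ∈ ball (0 : State n) ρ) : v ∈ S.hugoniot ρ i u := by
  refine ⟨hv, or_iff_not_imp_left.2 fun hne => ?_⟩
  have hs := speed_eq hne h
  refine ⟨by rw [hs]; exact h, fun j hji => ?_⟩
  rw [hs]
  have h2 := hgap i j (Ne.symm hji)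
  have h3 := abs_lt.1 ht
  have h4 := abs_lt.1 (hu i)
  have h5 := abs_lt.1 (hu j)
  have h6 : |t - S.lam i u| < 2 * g := by rw [abs_lt]; constructor <;> linarith
  refine h6.trans ?_
  rw [lt_abs]
  rcases lt_abs.1 h2 with h | h
  · left; linarith
  · right; linarith

lemma exists_chart (hg : 0 < g) (hgap : ∀ i j, i ≠ j → 4 * g < |S.lam i 0 - S.lam j 0|) {P : ℝ ×
    State n → Prop} (hP : ∀ᶠ z in 𝓝 0, P z) : ∃ Γ : Chart S i g, Γ.p = S.param δ i ∧ Γ.X =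
    S.unitField δ i 0 ∧ Γ.e = fderiv ℝ (S.param δ i) 0 ∧ Γ.h = S.growth δ i ∧ (∀ m u, Γ.V m u = G.V
    (m, u) ∧ Γ.W m u = G.W (m, u) ∧ Γ.s m u = G.s (m, u) ∧ Γ.s1 m u = pd G.s (m, u) ∧ Γ.s2 m u = pd
    (pd G.s) (m, u)) ∧ ∀ m u, |m| < Γ.M → ‖u‖ < Γ.R → P (m, u) := by
  have hp2 : ContDiffAt ℝ 2 (S.param δ i) 0 := contDiffAt_of_on hδ (hS.contDiffOn_param i)
  have hp0 := hS.param_zero hδ i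
  obtain ⟨q0, hq0, hhess⟩ := G.eventually_hessian hδ hS
  obtain ⟨B1, hB1, hV⟩ := eventually_slice G.V_smooth
  obtain ⟨B2, hB2, hW⟩ := G.eventually_W_slice hδ hS
  obtain ⟨K1, N1, hN₁, hK1⟩ := (hp2.of_le (m := 1) (by norm_num)).exists_lipschitzOnWith
  obtain ⟨K2, N2, hN2, hK2⟩ :=
    (contDiffAt_pd (l := 1) G.s_smooth (by norm_num)).exists_lipschitzOnWith
  obtain ⟨b1, hb1, H1⟩ := exists_box (G.eventually_V.and (G.eventually_jump.and
    (G.eventually_s_near.and ((eventually_pd G.s_smooth).and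
    ((G.eventually_left_relation hδ hS).and ((G.eventually_dissipation_deriv hδ hS).and
    ((G.eventually_dissipation).and ((G.eventually_Q_deriv hδ hS).and
    ((eventually_pd G.V_smooth).and ((G.eventually_lam_W hδ hS).and (hV.and (hW.and
    (hP.and hN2)))))))))))))
  obtain ⟨b2, hb2, H2⟩ := exists_box2 (G.eventually_left_tangent.and hhess)
  obtain ⟨b3, hb3, H3⟩ := exists_pair (G.hug.and (G.eventually_hug_iff hδ hS))
  obtain ⟨b4, hb4, H4⟩ := exists_radius ((G.eventually_V_self hδ hS).and (G.W_self.and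
    ((G.eventually_s_self hδ hS).and ((eventually_lam_near hδ hS hg).and
    ((G.eventually_two_jet hδ hS).and hN₁)))))
  obtain ⟨b5, hb5, H5⟩ := G.exists_W_param hδ hS
  obtain ⟨b6, hb6, H6⟩ := G.exists_arc_eq hδ hS
  obtain ⟨b7, hb7, H7⟩ := G.exists_arc hδ hS
  obtain ⟨M, hM, hM1, hM2, hM3, hM4, hM5, hM6, hM7⟩ : ∃ M > 0, M ≤ b1 ∧ M ≤ b2 ∧ M ≤ b3 ∧ M ≤ b4 ∧
      M ≤ b5 ∧ M ≤ b6 ∧ M ≤ b7 :=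
    ⟨min b1 (min b2 (min b3 (min b4 (min b5 (min b6 b7))))), by positivity, by simp, by simp,
      by simp, by simp, by simp, by simp, by simp⟩
  obtain ⟨R, hR, hRM, hp⟩ := exists_param_lt (i := i) hδ hS hM
  have box : ∀ {m u}, |m| < M → ‖u‖ < R → _ := fun {m u} hm hu =>
    H1 m u (lt_of_lt_of_le hm hM1) (lt_of_lt_of_le hu (hRM.trans hM1))
  have box2 : ∀ {m u m' u'}, |m| < M → ‖u‖ < R → |m'| < M → ‖u'‖ < R → _ :=
    fun {m u m' u'} hm hu hm' hu' => H2 m u m' u' (lt_of_lt_of_le hm hM2)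
      (lt_of_lt_of_le hu (hRM.trans hM2)) (lt_of_lt_of_le hm' hM2)
      (lt_of_lt_of_le hu' (hRM.trans hM2))
  have pair : ∀ {u v}, ‖u‖ < R → ‖v‖ < R → _ := fun {u v} hu hv =>
    H3 u v (lt_of_lt_of_le hu (hRM.trans hM3)) (lt_of_lt_of_le hv (hRM.trans hM3))
  have rad : ∀ {u}, ‖u‖ < R → _ := fun {u} hu => H4 u (lt_of_lt_of_le hu (hRM.trans hM4))
  have hugV : ∀ {ρ : ℝ} {u v : State n}, ‖u‖ < R → ‖v‖ < R → v ∈ ball (0 : State n) ρ →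
      (v ∈ S.hugoniot ρ i u ↔ G.V (S.param δ i v, u) = v) := fun hu hv hρ =>
    ((pair hu hv).1 _ hρ).trans (pair hu hv).2
  have nbhd : ∀ {m : ℝ}, |m| < M → ∀ᶠ x in 𝓝 m, |x| < M := fun hm =>
    (continuous_abs.tendsto _).eventually (gt_mem_nhds hm)
  have scal : ∀ (T : State n →L[ℝ] ℝ) {m : ℝ} {u : State n}, |m| < M → ‖u‖ < R → ∃ ξ, |ξ| < M ∧ T
    (G.V (m, u) - u) = (m - S.param δ i u) * T (pd G.V (ξ, u)) := by
    intro T m u hm hu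
    obtain ⟨ξ, hξ, he⟩ := exists_slope_eq (f := fun x => T (G.V (x, u)))
      (f' := fun x => T (pd G.V (x, u))) (a := S.param δ i u) (b := m) (fun x hx =>
        T.hasFDerivAt.comp_hasDerivAt x
          (box (abs_lt_of_mem_uIcc (hp u hu) hm hx) hu).2.2.2.2.2.2.2.2.1.1)
    refine ⟨ξ, abs_lt_of_mem_uIcc (hp u hu) hm hξ, ?_⟩
    simp only [(rad hu).1] at he
    rw [map_sub, he, mul_comm]
  refine ⟨{
    R := R
    M := M
    B := B1 + B2 + K1 + K2
    q := q0
    R_pos := hR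
    M_pos := hM
    B_pos := by positivity
    q_pos := hq0
    p := S.param δ i
    V := fun m u => G.V (m, u)
    W := fun m u => G.W (m, u)
    s := fun m u => G.s (m, u)
    s1 := fun m u => pd G.s (m, u)
    s2 := fun m u => pd (pd G.s) (m, u)
    Q := fun m u => G.Q (m, u)
    h := S.growth δ i
    e := fderiv ℝ (S.param δ i) 0
    X := S.unitField δ i 0
    e_X := (hS.eventually_param_unitField hδ i).self_of_nhds
    p_zero := hp0
    p_strict := hp2.hasStrictFDerivAt (by norm_num)
    p_lt := fun hu => hp _ hu
    p_lip := fun {u v} hu hv => ?_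
    V_strict := G.V_strict
    W_strict := G.W_strict
    p_V := fun hm hu => (box hm hu).1.2
    p_W := fun hm hu => H5 _ _ (lt_of_lt_of_le hm hM5) (lt_of_lt_of_le (hp _ hu) hM5)
      (lt_of_lt_of_le hu (hRM.trans hM5))
    V_p := fun hu => (rad hu).1
    W_p := fun hu => (rad hu).2.1
    hug := hugV
    symm := fun {u v} hu hv h => ?_
    hug_of_jump := fun {u v t} hu hv h ht => ?_
    jump := fun hm hu => (box hm hu).2.1
    s_self := fun hu => (rad hu).2.2.1.1
    s_near := fun hm hu => (box hm hu).2.2.1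
    lam_near := fun hu => (rad hu).2.2.2.1 i
    s_deriv := fun hm hu => (box hm hu).2.2.2.1.1
    s1_deriv := fun hm hu => (box hm hu).2.2.2.1.2.1
    s1_self := fun hu => (rad hu).2.2.1.2
    s1_lip := fun {m u m' u'} hm hu hm' hu' => ?_
    lax := fun {m u} hm hu => ?_
    E_deriv := fun {m u} hm hu => ?_
    Q_self := fun {u} hu => ?_
    Q_deriv := fun {m u} hm hu => ?_
    arc_eq := fun {ρ u v γ} hρ hγ => H6 u v γ (hγ.mono (hρ.trans (hRM.trans hM6)))
    arc_exists := fun {ρ m u} hm hu h => H7 u m ρ (lt_of_lt_of_le hu (hRM.trans hM7))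
      (lt_of_lt_of_le hm hM7) h
    lam_W := fun hm hu => (box hm hu).2.2.2.2.2.2.2.2.2.1
    V_smooth := fun {m u} hm hu => ?_
    W_smooth := fun {m u} hm hu => ?_
    jet := fun {u} hu => ?_ }, rfl, rfl, rfl, rfl, fun m u => ⟨rfl, rfl, rfl, rfl, rfl⟩,
    fun m u hm hu => (box hm hu).2.2.2.2.2.2.2.2.2.2.2.2.1⟩
  · have h := hK1.dist_le_mul u (rad hu).2.2.2.2.2 v (rad hv).2.2.2.2.2
    rw [Real.dist_eq, dist_eq_norm] at h
    refine h.trans (mul_le_mul_of_nonneg_right ?_ (norm_nonneg _))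
    have := K2.coe_nonneg
    linarith
  · have h1 := (pair hu hv).2.2 h
    have h2 : u - v = fderiv ℝ (S.param δ i) 0 (u - v) • G.Rb (v, u) := by
      rw [G.Rb_symm (v, u), ← neg_sub v u, map_neg, neg_smul]
      exact congrArg Neg.neg h1
    have h3 := (pair hv hu).2.1 h2
    refine ⟨h3, ?_⟩
    change G.Lb (v, G.V (S.param δ i u, v)) = G.Lb (u, G.V (S.param δ i v, u))
    rw [h, h3, G.Lb_symm]
    rfl
  · have hv' : v ∈ ball (0 : State n) R := by simpa using hv
    exact (hugV hu hv hv').1 (mem_hugoniot_of_jump hgap (rad hu).2.2.2.1 h ht hv')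
  · have h := hK2.dist_le_mul _ (box hm hu).2.2.2.2.2.2.2.2.2.2.2.2.2 _
      (box hm' hu').2.2.2.2.2.2.2.2.2.2.2.2.2
    rw [Real.dist_eq] at h
    have h2 : dist (m, u) (m', u') ≤ |m - m'| + ‖u - u'‖ := by
      rw [Prod.dist_eq, Real.dist_eq, dist_eq_norm]
      exact max_le (by linarith [norm_nonneg (u - u')]) (by linarith [abs_nonneg (m - m')])
    have h3 := mul_le_mul_of_nonneg_left h2 K2.coe_nonneg
    refine (h.trans h3).trans (mul_le_mul_of_nonneg_right ?_ (by positivity))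
    have := K1.coe_nonneg
    linarith
  · obtain ⟨ξ, hξ, he⟩ := scal (G.ℓ (G.V (m, u))) hm hu
    have h1 := (box hm hu).2.2.2.2.1
    have h2 := (box2 hm hu hm hu).1
    have h3 := (box2 hm hu hξ hu).1
    simp only at h1 h2 h3
    rw [he] at h1
    refine ⟨G.ℓ (G.V (m, u)) (pd G.V (ξ, u)) / G.ℓ (G.V (m, u)) (pd G.V (m, u)),
      div_pos (by linarith) (by linarith), ?_⟩
    have h4 : G.ℓ (G.V (m, u)) (pd G.V (m, u)) ≠ 0 := by linarith
    field_simp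
    linarith
  · refine (box hm hu).2.2.2.2.2.1.congr_of_eventuallyEq ?_
    filter_upwards [nbhd hm] with x hx
    exact (box hx hu).2.2.2.2.2.2.1
  · change S.U u - S.U (G.V (S.param δ i u, u)) -
      fderiv ℝ S.U (G.V (S.param δ i u, u)) (u - G.V (S.param δ i u, u)) = 0
    rw [(rad hu).1]
    simp
  · obtain ⟨ξ, hξ, he⟩ := scal (fderiv ℝ (fderiv ℝ S.U) (G.V (m, u)) (pd G.V (m, u))) hm hu
    have h2 := (box2 hm hu hξ hu).2
    refine ⟨_, h2.1.le, h2.2.le, ?_⟩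
    rw [← he]
    exact (box hm hu).2.2.2.2.2.2.2.1
  · have h := (box hm hu).2.2.2.2.2.2.2.2.2.2.1
    simp only at h
    have := K1.coe_nonneg
    have := K2.coe_nonneg
    refine ⟨h.1, ?_, ?_⟩
    · rw [h.2.1]; linarith [h.2.2.2.1]
    · rw [h.2.2.1]; linarith [h.2.2.2.2]
  · have h := (box hm hu).2.2.2.2.2.2.2.2.2.2.2.1
    simp only at h
    have := K1.coe_nonneg
    have := K2.coe_nonneg
    exact ⟨h.1, by linarith [h.2.2.2.1], by linarith [h.2.2.2.2]⟩
  · have h := (box (hp u hu) hu).2.2.2.2.2.2.2.2.2.2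
    have h1 := h.1
    have h2 := h.2.1
    have h3 := (rad hu).2.2.2.2.1
    simp only at h1 h2
    rw [(rad hu).2.1] at h2
    rw [h1.2.1, h2.2.1, h3.1, h1.2.2.1, h2.2.2.1, h3.2]
    exact ⟨rfl, rfl⟩

end Germ

namespace Chart

variable (Γ : Chart S i g)

lemma V_zero : Γ.V 0 0 = 0 := by
  have := Γ.V_p (u := 0) (by simpa using Γ.R_pos)
  rwa [Γ.p_zero] at this

lemma W_zero : Γ.W 0 0 = 0 := by
  have := Γ.W_p (u := 0) (by simpa using Γ.R_pos)
  rwa [Γ.p_zero] at this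

lemma eventually_lt : ∀ᶠ z in 𝓝 (0 : ℝ × State n), |z.1| < Γ.M ∧ ‖z.2‖ < Γ.R := by
  have h1 : Tendsto (fun z : ℝ × State n => |z.1|) (𝓝 0) (𝓝 0) := by
    simpa using (continuous_fst.abs.tendsto (0 : ℝ × State n))
  have h2 : Tendsto (fun z : ℝ × State n => ‖z.2‖) (𝓝 0) (𝓝 0) := by
    simpa using (continuous_snd.norm.tendsto (0 : ℝ × State n))
  exact (h1.eventually (gt_mem_nhds Γ.M_pos)).and (h2.eventually (gt_mem_nhds Γ.R_pos))

lemma tendsto_W : Tendsto (fun z : ℝ × State n => Γ.W z.1 z.2) (𝓝 0) (𝓝 0) := by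
  have := Γ.W_strict.continuousAt.tendsto
  simpa [W_zero] using this

lemma diss_self (u : State n) : S.dissipation u u = 0 := by simp [dissipation]

lemma eq_of_deriv_zero {f : ℝ → ℝ} {a b : ℝ} (h : ∀ x ∈ uIcc a b, HasDerivAt f 0 x) : f b = f a :=
    by
  obtain ⟨ξ, -, he⟩ := exists_slope_eq (f' := fun _ => 0) h
  linarith

end Chart

lemma IsArc.jump {c : ℝ} (hS : S.Hyp δ) (hρ : ρ ≤ δ) (hγ : S.IsArc ρ i u v γ) (hlam : ∀ τ ∈ Icc (0 :
    ℝ) 1, S.lam i (γ τ) = c) : S.f v - S.f u = c • (v - u) := by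
  obtain ⟨h0, h1, s, hs⟩ := hγ
  have hder : ∀ τ ∈ Icc (0 : ℝ) 1, HasDerivWithinAt (fun τ => S.f (γ τ) - c • γ τ) 0 (Icc 0 1) τ := by
    intro τ hτ
    obtain ⟨hb, hd⟩ := hs τ hτ
    have hb' := ball_subset_ball hρ hb
    have hf : HasFDerivAt S.f (fderiv ℝ S.f (γ τ)) (γ τ) :=
      ((hS.f_smooth.contDiffAt (isOpen_ball.mem_nhds hb')).differentiableAt
        (by norm_num)).hasFDerivAt
    refine ((hf.comp_hasDerivAt τ hd).sub (hd.const_smul c)).hasDerivWithinAt.congr_deriv ?_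
    rw [map_smul, hS.eigen i _ hb', hlam τ hτ, smul_comm, sub_self]
  have := (convex_Icc (0 : ℝ) 1).norm_image_sub_le_of_norm_hasDerivWithin_le (C := 0) hder
    (fun τ _ => by simp) (left_mem_Icc.2 zero_le_one) (right_mem_Icc.2 zero_le_one)
  rw [zero_mul, norm_le_zero_iff, h0, h1] at this
  rw [smul_sub, sub_eq_sub_iff_sub_eq_sub]
  exact (sub_eq_zero.1 this)

lemma Chart.eventually_degenerate (Γ : Chart S i g) (hS : S.Hyp δ) (hδ : 0 < δ) (hh : ∀ u, ‖u‖ < δ →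
    Γ.h u = 0) : ∀ᶠ z in 𝓝 (0 : ℝ × State n), Γ.V z.1 z.2 = Γ.W z.1 z.2 ∧ Γ.s z.1 z.2 = S.lam i z.2
    ∧ S.lam i (Γ.W z.1 z.2) = S.lam i z.2 := by
  have hWn : Tendsto (fun z : ℝ × State n => ‖Γ.W z.1 z.2‖) (𝓝 0) (𝓝 0) := by
    simpa using Γ.tendsto_W.norm
  obtain ⟨b, hb, h⟩ := exists_box ((hWn.eventually (gt_mem_nhds hδ)).and
    ((hWn.eventually (gt_mem_nhds Γ.R_pos)).and Γ.eventually_lt))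
  have hp : Tendsto Γ.p (𝓝 0) (𝓝 0) := by
    simpa [Γ.p_zero] using Γ.p_strict.continuousAt.tendsto
  have hp' : Tendsto (fun z : ℝ × State n => |Γ.p z.2|) (𝓝 0) (𝓝 0) := by
    simpa using (hp.comp (continuous_snd.tendsto (0 : ℝ × State n))).abs
  obtain ⟨b', hb', h'⟩ := exists_box (hp'.eventually (gt_mem_nhds hb))
  have hm : ∀ᶠ z in 𝓝 (0 : ℝ × State n), dist z 0 < min b b' :=
    ball_mem_nhds _ (lt_min hb hb')
  filter_upwards [hm] with z hz
  rw [dist_zero_right, Prod.norm_def, max_lt_iff] at hz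
  obtain ⟨m, u⟩ := z
  simp only at hz ⊢
  have hmb : |m| < b := hz.1.trans_le (min_le_left _ _)
  have hub : ‖u‖ < b := hz.2.trans_le (min_le_left _ _)
  have hpb : |Γ.p u| < b := h' m u (hz.1.trans_le (min_le_right _ _)) (hz.2.trans_le (min_le_right _ _))
  have hM : |m| < Γ.M := (h m u hmb hub).2.2.1
  have hR : ‖u‖ < Γ.R := (h m u hmb hub).2.2.2
  have hW : ∀ x ∈ uIcc (Γ.p u) m, ‖Γ.W x u‖ < δ ∧ ‖Γ.W x u‖ < Γ.R ∧ |x| < Γ.M := fun x hx =>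
    have h1 := h x u (abs_lt_of_mem_uIcc hpb hmb hx) hub
    ⟨h1.1, h1.2.1, h1.2.2.1⟩
  have hlam : ∀ x ∈ uIcc (Γ.p u) m, S.lam i (Γ.W x u) = S.lam i u := by
    intro x hx
    have := Chart.eq_of_deriv_zero (f := fun x => S.lam i (Γ.W x u)) (a := Γ.p u) (b := x)
      (fun y hy => by
        have hy' := uIcc_subset_uIcc_left hx hy
        have h3 := Γ.lam_W (hW y hy').2.2 hR
        rwa [hh _ (hW y hy').1] at h3)
    simpa only [Γ.W_p hR] using this
  obtain ⟨γ, hγ⟩ := Γ.arc_exists (ρ := min δ Γ.R) hM hR fun x hx => lt_min (hW x hx).1 (hW x hx).2.1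
  obtain ⟨h1, h2⟩ := Γ.arc_eq (min_le_right _ _) hγ
  have hj := hγ.jump hS (min_le_left _ _) (c := S.lam i u) fun τ hτ => by
    rw [h1 τ hτ]
    refine hlam _ ?_
    have := Germ.param_mem_uIcc_of_arc hγ.1 h2 hτ
    rwa [hγ.2.1, Γ.p_W hM hR] at this
  have hV := Γ.hug_of_jump hR (hW m right_mem_uIcc).2.1 hj (Γ.lam_near hR)
  rw [Γ.p_W hM hR] at hV
  refine ⟨hV, ?_, hlam m right_mem_uIcc⟩
  by_cases hne : m = Γ.p u
  · rw [hne, Γ.s_self hR]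
  · have h3 := Γ.speed_V hM hR hne
    have h4 : S.speed u (Γ.W m u) = S.lam i u :=
      speed_eq (fun h => hne (by rw [← Γ.p_W hM hR, h])) hj
    rw [← h3, hV, h4]

lemma Chart.degenerate_of (Γ : Chart S i g) (h : ∀ {m u}, |m| < Γ.M → ‖u‖ < Γ.R → Γ.V m u = Γ.W m u
    ∧ Γ.s m u = S.lam i u ∧ S.lam i (Γ.W m u) = S.lam i u) : Γ.Degenerate := by
  refine ⟨fun hm hu => (h hm hu).1, fun hm hu => (h hm hu).2.1, fun hm hu => ?_, fun {m u} hm hu => ?_⟩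
  · rw [(h hm hu).1, (h hm hu).2.2]
  · have h0 : ∀ {x}, |x| < Γ.M → Γ.s1 x u = 0 := fun {x} hx => by
      refine (Γ.s_deriv hx hu).unique ((hasDerivAt_const x (S.lam i u)).congr_of_eventuallyEq ?_)
      filter_upwards [(continuous_abs.tendsto x).eventually (gt_mem_nhds hx)] with y hy
      exact (h hy hu).2.1
    have := Chart.eq_of_deriv_zero (f := fun x => S.dissipation u (Γ.V x u)) (a := Γ.p u) (b := m)
      (fun y hy => by
        have hy' := abs_lt_of_mem_uIcc (Γ.p_lt hu) hm hy
        have h3 := Γ.E_deriv hy' hu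
        rwa [h0 hy', zero_mul] at h3)
    simpa only [Γ.V_p hu, Chart.diss_self] using this

lemma Hyp.exists_chart (hδ : 0 < δ) (hS : S.Hyp δ) (hg : 0 < g) (hgap : ∀ i j, i ≠ j → 4 * g <
    |S.lam i 0 - S.lam j 0|) (i : Fin n) : ∃ Γ : Chart S i g, Γ.p = S.param δ i ∧ Γ.X = S.unitField
    δ i 0 ∧ (S.IsCC δ i → ∃ c C, Γ.Convex c C) ∧ (S.IsGNL δ i → Γ.Nonlinear) ∧ (S.IsLD δ i →
    Γ.Degenerate) := by
  obtain ⟨G⟩ := hS.exists_germ hδ hg hgap i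
  have hsnd : Tendsto (fun z : ℝ × State n => z.2) (𝓝 0) (𝓝 0) :=
    continuous_snd.tendsto (0 : ℝ × State n)
  by_cases hi : S.IsCC δ i
  · obtain ⟨a, ha, h1⟩ := G.eventually_growth hδ hS hi
    have hpos := hS.growth_deriv_pos hδ hi
    have h2 : ∀ᶠ z in 𝓝 (0 : ℝ × State n), pd (pd G.s) 0 / 2 < pd (pd G.s) z := by
      refine (continuousAt_pd_pd G.s_smooth).eventually (lt_mem_nhds (half_lt_self ?_))
      rw [G.pd_pd_s_zero hδ hS hi]; positivity
    have h3 : 0 < pd (pd G.s) 0 := by rw [G.pd_pd_s_zero hδ hS hi]; positivity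
    obtain ⟨Γ, e1, e2, e3, e4, e5, e6⟩ := G.exists_chart hδ hS hg hgap (h2.and (hsnd.eventually h1))
    refine ⟨Γ, e1, e2, fun _ => ⟨pd (pd G.s) 0 / 2, 4 * a, ⟨half_pos h3, by positivity,
      fun {m u} hm hu => ?_, fun {u} hu => ?_⟩⟩, fun h => ?_, fun h => ?_⟩
    · rw [(e5 m u).2.2.2.2]; exact (e6 m u hm hu).1.le
    · obtain ⟨k, hk, he⟩ := (e6 0 u (by simpa using Γ.M_pos) hu).2
      exact ⟨k, ha.trans_le hk.1, hk.2, by rw [e4, e1]; exact he⟩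
    · exact absurd hi.1 (h 0 (mem_ball_self hδ)).ne'
    · have h5 := hi.2 0 (mem_ball_self hδ)
      have h6 : S.nonlin i =ᶠ[𝓝 0] fun _ => 0 := by
        filter_upwards [eventually_mem_ball hδ] with u hu using h u hu
      rw [h6.fderiv_eq] at h5
      simp at h5
  · rcases hS.fields i with h | h | h
    · have h0 : 0 < S.growth δ i 0 :=
        mul_pos (inv_pos.2 (hS.param_deriv_pos hδ i)) (h 0 (mem_ball_self hδ))
      have hp0 := hS.param_zero hδ i
      have hs0 := (G.eventually_s_self hδ hS).self_of_nhds.2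
      rw [hp0] at hs0
      have h1 : ∀ᶠ z in 𝓝 (0 : ℝ × State n), 0 < pd G.s z := by
        refine (continuousAt_pd G.s_smooth).eventually (lt_mem_nhds ?_)
        change 0 < pd G.s (0, 0)
        rw [hs0]; positivity
      have h2 : ∀ᶠ u in 𝓝 (0 : State n), 0 < S.growth δ i u :=
        (hS.contDiffAt_growth hδ i).continuousAt.eventually (lt_mem_nhds h0)
      obtain ⟨Γ, e1, e2, e3, e4, e5, e6⟩ := G.exists_chart hδ hS hg hgap (h1.and (hsnd.eventually h2))
      refine ⟨Γ, e1, e2, fun h' => absurd h' hi, fun _ => ⟨fun {m u} hm hu => ?_, fun {u} hu => ?_⟩,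
        fun h' => ?_⟩
      · rw [(e5 m u).2.2.2.1]; exact (e6 m u hm hu).1
      · rw [e4]; exact (e6 0 u (by simpa using Γ.M_pos) hu).2
      · exact absurd (h' 0 (mem_ball_self hδ)) (h 0 (mem_ball_self hδ)).ne'
    · have hgr : ∀ u : State n, ‖u‖ < δ → S.growth δ i u = 0 := fun u hu => by
        rw [growth, h u (by simpa using hu), mul_zero]
      obtain ⟨Γ0, e1, e2, e3, e4, e5, e6⟩ := G.exists_chart hδ hS hg hgap (P := fun _ => True)
        (Eventually.of_forall fun _ => trivial)
      have h1 := Γ0.eventually_degenerate hS hδ (by rw [e4]; exact hgr)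
      obtain ⟨Γ, d1, d2, d3, d4, d5, d6⟩ := G.exists_chart hδ hS hg hgap
        h1
      refine ⟨Γ, d1, d2, fun h' => absurd h' hi, fun h' => ?_, fun _ => ?_⟩
      · exact absurd (h 0 (mem_ball_self hδ)) (h' 0 (mem_ball_self hδ)).ne'
      · refine Γ.degenerate_of fun {m u} hm hu => ?_
        have h2 := d6 m u hm hu
        simp only at h2
        rw [(e5 m u).1, (e5 m u).2.1, (e5 m u).2.2.1] at h2
        rw [(d5 m u).1, (d5 m u).2.1, (d5 m u).2.2.1]
        exact h2
    · exact absurd h hi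

variable {Γ : Chart S i g} {c C σ η r : ℝ}

lemma lt_of_deriv_pos {f f' : ℝ → ℝ} {a b : ℝ} (hab : a < b) (h : ∀ x ∈ Icc a b, HasDerivAt f (f' x)
    x) (hpos : ∀ x ∈ Ioo a b, 0 < f' x) : f a < f b := by
  refine strictMonoOn_of_deriv_pos (convex_Icc a b)
    (fun x hx => (h x hx).continuousAt.continuousWithinAt) (fun x hx => ?_)
    (left_mem_Icc.2 hab.le) (right_mem_Icc.2 hab.le) hab
  rw [interior_Icc] at hx
  rw [(h x (Ioo_subset_Icc_self hx)).deriv]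
  exact hpos x hx

lemma lt_of_deriv_neg {f f' : ℝ → ℝ} {a b : ℝ} (hab : a < b) (h : ∀ x ∈ Icc a b, HasDerivAt f (f' x)
    x) (hneg : ∀ x ∈ Ioo a b, f' x < 0) : f b < f a := by
  have := lt_of_deriv_pos (f := fun x => -f x) (f' := fun x => -f' x) hab
    (fun x hx => (h x hx).neg) (fun x hx => neg_pos.2 (hneg x hx))
  simpa using this

lemma abs_lt_of_mem_Icc {a b : ℝ} (ha : |a| < c) (hb : |b| < c) (hx : x ∈ Icc a b) :
    |x| < c := abs_lt_of_mem_uIcc ha hb (Icc_subset_uIcc hx)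

lemma linParam_neg (e : State n →L[ℝ] ℝ) (X : State n) : (linParam e X).comp ((-fst ℝ ℝ (State
    n)).prod (snd ℝ ℝ (State n))) = linParam (-e) (-X) := by
  ext z <;> simp [linParam]

namespace Chart

lemma hasStrictFDerivAt_neg {V : ℝ → State n → State n} {e : State n →L[ℝ] ℝ} {X : State n} (h :
    HasStrictFDerivAt (fun z : ℝ × State n => V z.1 z.2) (linParam e X) 0) : HasStrictFDerivAt (fun
    z : ℝ × State n => V (-z.1) z.2) (linParam (-e) (-X)) 0 := by
  have h1 : HasStrictFDerivAt (fun z : ℝ × State n => (-z.1, z.2))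
      ((-fst ℝ ℝ (State n)).prod (snd ℝ ℝ (State n))) 0 :=
    hasStrictFDerivAt_fst.neg.prodMk hasStrictFDerivAt_snd
  have h2 : HasStrictFDerivAt (fun z : ℝ × State n => V z.1 z.2) (linParam e X)
      ((fun z : ℝ × State n => (-z.1, z.2)) 0) := by
    have h0 : (-(0 : ℝ × State n).1, (0 : ℝ × State n).2) = 0 := by simp
    change HasStrictFDerivAt _ _ (-(0 : ℝ × State n).1, (0 : ℝ × State n).2)
    rw [h0]; exact h
  have h3 := h2.comp (0 : ℝ × State n) h1
  rwa [linParam_neg] at h3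

lemma hasDerivAt_neg_arg {E : Type*} [NormedAddCommGroup E] [NormedSpace ℝ E] {f : ℝ → E} {f' : E}
 (h : HasDerivAt f f' (-x)) : HasDerivAt (fun y => f (-y)) (-f') x := by
  exact (HasDerivAt.scomp x h (hasDerivAt_neg x)).congr_deriv (by simp)

lemma two_jet_neg_arg {f : ℝ → State n} (x : ℝ) : deriv (fun y => f (-y)) x = -deriv f (-x) ∧ deriv
    (deriv fun y => f (-y)) x = deriv (deriv f) (-x) := by
  have h : (deriv fun y => f (-y)) = fun y => -deriv f (-y) := funext fun y => deriv_comp_neg f y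
  refine ⟨deriv_comp_neg f x, ?_⟩
  rw [h, deriv.fun_neg, deriv_comp_neg (deriv f), neg_neg]

lemma smooth_neg_arg {f : ℝ → State n} {B : ℝ} (h : ContDiffAt ℝ 2 f (-x) ∧ ‖deriv f (-x)‖ ≤ B ∧
    ‖deriv (deriv f) (-x)‖ ≤ B) : ContDiffAt ℝ 2 (fun y => f (-y)) x ∧ ‖deriv (fun y => f (-y)) x‖ ≤
    B ∧ ‖deriv (deriv fun y => f (-y)) x‖ ≤ B := by
  obtain ⟨h1, h2⟩ := two_jet_neg_arg (f := f) x
  rw [h1, h2, norm_neg]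
  exact ⟨h.1.comp x contDiff_neg.contDiffAt, h.2⟩

lemma neg_mem_uIcc {a b : ℝ} (h : x ∈ uIcc a b) : -x ∈ uIcc (-a) (-b) := by
  rw [mem_uIcc] at *
  rcases h with h | h
  · grind
  · grind

/-- The chart with reversed parameter. -/
def reflect (Γ : Chart S i g) : Chart S i g where
  R := Γ.R
  M := Γ.M
  B := Γ.B
  q := Γ.q
  R_pos := Γ.R_pos
  M_pos := Γ.M_pos
  B_pos := Γ.B_pos
  q_pos := Γ.q_pos
  p := fun u => -Γ.p u
  V := fun m u => Γ.V (-m) u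
  W := fun m u => Γ.W (-m) u
  s := fun m u => Γ.s (-m) u
  s1 := fun m u => -Γ.s1 (-m) u
  s2 := fun m u => Γ.s2 (-m) u
  Q := fun m u => Γ.Q (-m) u
  h := fun u => -Γ.h u
  e := -Γ.e
  X := -Γ.X
  e_X := by simpa using Γ.e_X
  p_zero := by simpa using Γ.p_zero
  p_strict := Γ.p_strict.neg
  p_lt := fun hu => by simpa using Γ.p_lt hu
  p_lip := fun {u v} hu hv => by
    rw [neg_sub_neg, abs_sub_comm]; exact Γ.p_lip hu hv
  V_strict := hasStrictFDerivAt_neg Γ.V_strict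
  W_strict := hasStrictFDerivAt_neg Γ.W_strict
  p_V := fun hm hu => by rw [Γ.p_V (by simpa using hm) hu, neg_neg]
  p_W := fun hm hu => by rw [Γ.p_W (by simpa using hm) hu, neg_neg]
  V_p := fun hu => by rw [neg_neg, Γ.V_p hu]
  W_p := fun hu => by rw [neg_neg, Γ.W_p hu]
  hug := fun hu hv hρ => by simpa using Γ.hug hu hv hρ
  symm := fun hu hv h => by simpa using Γ.symm hu hv (by simpa using h)
  hug_of_jump := fun hu hv h ht => by simpa using Γ.hug_of_jump hu hv h ht
  jump := fun hm hu => Γ.jump (by simpa using hm) hu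
  s_self := fun hu => by simpa using Γ.s_self hu
  s_near := fun hm hu => Γ.s_near (by simpa using hm) hu
  lam_near := Γ.lam_near
  s_deriv := fun {m u} hm hu => hasDerivAt_neg_arg (Γ.s_deriv (by simpa using hm) hu)
  s1_deriv := fun {m u} hm hu => by
    exact (hasDerivAt_neg_arg (Γ.s1_deriv (m := -m) (by simpa using hm) hu)).neg.congr_deriv
      (neg_neg _)
  s1_self := fun {u} hu => by rw [neg_neg, Γ.s1_self hu]; ring
  s1_lip := fun {m u m' u'} hm hu hm' hu' => by
    have := Γ.s1_lip (m := -m) (m' := -m') (by simpa using hm) hu (by simpa using hm') hu'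
    rw [neg_sub_neg] at this ⊢
    rwa [abs_sub_comm, abs_sub_comm m m']
  lax := fun {m u} hm hu => by
    obtain ⟨κ, hκ, h⟩ := Γ.lax (m := -m) (by simpa using hm) hu
    exact ⟨κ, hκ, by rw [h]; ring⟩
  E_deriv := fun {m u} hm hu => by
    have := hasDerivAt_neg_arg (Γ.E_deriv (m := -m) (by simpa using hm) hu)
    rwa [← neg_mul] at this
  Q_self := fun hu => by simpa using Γ.Q_self hu
  Q_deriv := fun {m u} hm hu => by
    obtain ⟨k, h1, h2, h3⟩ := Γ.Q_deriv (m := -m) (by simpa using hm) hu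
    exact ⟨k, h1, h2, (hasDerivAt_neg_arg h3).congr_deriv (by ring)⟩
  arc_eq := fun {ρ u v γ} hρ hγ => by
    obtain ⟨h1, h2⟩ := Γ.arc_eq hρ hγ
    refine ⟨fun τ hτ => by simpa using h1 τ hτ, ?_⟩
    rcases h2 with h | h | h
    · exact Or.inr (Or.inl fun x hx y hy hxy => neg_lt_neg (h hx hy hxy))
    · exact Or.inl fun x hx y hy hxy => neg_lt_neg (h hx hy hxy)
    · exact Or.inr (Or.inr h)
  arc_exists := fun {ρ m u} hm hu h => Γ.arc_exists (by simpa using hm) hu fun m' hm' => by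
    have := h (-m') (by simpa using neg_mem_uIcc hm')
    simpa using this
  lam_W := fun {m u} hm hu =>
    hasDerivAt_neg_arg (f := fun m => S.lam i (Γ.W m u)) (Γ.lam_W (by simpa using hm) hu)
  V_smooth := fun {m u} hm hu => smooth_neg_arg (Γ.V_smooth (by simpa using hm) hu)
  W_smooth := fun {m u} hm hu => smooth_neg_arg (Γ.W_smooth (by simpa using hm) hu)
  jet := fun {u} hu => by
    obtain ⟨h1, h2⟩ := two_jet_neg_arg (f := fun m => Γ.V m u) (-Γ.p u)
    obtain ⟨h3, h4⟩ := two_jet_neg_arg (f := fun m => Γ.W m u) (-Γ.p u)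
    obtain ⟨h5, h6⟩ := Γ.jet hu
    rw [h1, h2, h3, h4, neg_neg, h5, h6]
    exact ⟨rfl, rfl⟩

lemma Convex.reflect (hc : Γ.Convex c C) : Γ.reflect.Convex c C where
  c_pos := hc.c_pos
  C_pos := hc.C_pos
  s2_ge := fun {m u} hm hu => hc.s2_ge (m := -m) (by simpa [Chart.reflect] using hm) hu
  growth := fun {u} hu => by
    obtain ⟨k, h1, h2, h3⟩ := hc.growth hu
    exact ⟨k, h1, h2, by simp [Chart.reflect, h3]⟩

/-- The shocks issuing from a state `u` with `p u > 0`: `N` is the parameter of the right-contact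
and `Z` the parameter of the shock with vanishing entropy dissipation. -/
structure ShockData (Γ : Chart S i g) (u : State n) (N Z : ℝ) : Prop where
  Z_lt : Z < N
  N_neg : N < 0
  s1_N : Γ.s1 N u = 0
  diss_iff : ∀ {x}, |x| < Γ.M → x ≠ Γ.p u →
    (S.dissipation u (Γ.V x u) ≤ 0 ↔ Z ≤ x ∧ x < Γ.p u)
  diss_zero_iff : ∀ {x}, |x| < Γ.M → x ≠ Γ.p u → (S.dissipation u (Γ.V x u) = 0 ↔ x = Z)
  s1_pos : ∀ {x}, |x| < Γ.M → N < x → 0 < Γ.s1 x u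
  s1_neg : ∀ {x}, |x| < Γ.M → x < N → Γ.s1 x u < 0
  s_lt : ∀ {x}, |x| < Γ.M → Z ≤ x → x < Γ.p u → Γ.s x u < S.lam i u

variable (hc : Γ.Convex c C)
include hc

lemma Convex.s1_mono (hu : ‖u‖ < Γ.R) (hx : |x| < Γ.M) (hy : |y| < Γ.M) (hxy : x ≤ y) : Γ.s1 x u + c
    * (y - x) ≤ Γ.s1 y u := by
  obtain ⟨ξ, hξ, he⟩ := exists_slope_eq (f := fun x => Γ.s1 x u) (f' := fun x => Γ.s2 x u)
    (a := x) (b := y) (fun z hz => Γ.s1_deriv (abs_lt_of_mem_uIcc hx hy hz) hu)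
  have := hc.s2_ge (abs_lt_of_mem_uIcc hx hy hξ) hu
  nlinarith

lemma Convex.s_ge (hu : ‖u‖ < Γ.R) (hx : |x| < Γ.M) (hy : |y| < Γ.M) : Γ.s x u + Γ.s1 x u * (y - x)
    + c / 2 * (y - x) ^ 2 ≤ Γ.s y u := by
  obtain ⟨ξ, hξ, he⟩ := exists_slope_eq (a := x) (b := y)
    (f := fun z => Γ.s z u - Γ.s1 x u * (z - x) - c / 2 * (z - x) ^ 2)
    (f' := fun z => Γ.s1 z u - Γ.s1 x u - c * (z - x)) (fun z hz => by
      have h1 := Γ.s_deriv (abs_lt_of_mem_uIcc hx hy hz) hu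
      have h2 : HasDerivAt (fun z : ℝ => z - x) 1 z := (hasDerivAt_id z).sub_const x
      refine ((h1.sub (h2.const_mul (Γ.s1 x u))).sub ((h2.pow 2).const_mul (c / 2))).congr_deriv ?_
      simp; ring)
  have hξM := abs_lt_of_mem_uIcc hx hy hξ
  rw [mem_uIcc] at hξ
  have : 0 ≤ (Γ.s1 ξ u - Γ.s1 x u - c * (ξ - x)) * (y - x) := by
    rcases hξ with h | h
    · have := hc.s1_mono hu hx hξM h.1
      exact mul_nonneg (by linarith) (by linarith)
    · have := hc.s1_mono hu hξM hx h.2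
      exact mul_nonneg_of_nonpos_of_nonpos (by linarith) (by linarith)
  simp only [sub_self] at he
  nlinarith

omit hc in
lemma Q_lt (hu : ‖u‖ < Γ.R) (hx : |x| < Γ.M) (hxy : x < y) (hy : y ≤ Γ.p u) : Γ.Q y u < Γ.Q x u :=
    by
  choose! k hk using fun z (hz : |z| < Γ.M) => Γ.Q_deriv hz hu
  have hm : ∀ z ∈ Icc x y, |z| < Γ.M := fun z hz =>
    abs_lt_of_mem_Icc hx (Γ.p_lt hu) ⟨hz.1, hz.2.trans hy⟩
  refine lt_of_deriv_neg hxy (fun z hz => (hk z (hm z hz)).2.2) fun z hz => ?_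
  have := (hk z (hm z (Ioo_subset_Icc_self hz))).1
  exact mul_neg_of_neg_of_pos (by linarith [hz.2]) (Γ.q_pos.trans_le this)

omit hc in
lemma Q_lt_right (hu : ‖u‖ < Γ.R) (hy : |y| < Γ.M) (hxy : x < y) (hx : Γ.p u ≤ x) : Γ.Q x u < Γ.Q y
    u := by
  have h := Q_lt (Γ := Γ.reflect) (u := u) (x := -y) (y := -x) hu (by simpa [reflect] using hy)
    (neg_lt_neg hxy) (neg_le_neg hx)
  simpa [reflect] using h

lemma Convex.diss_pos (hu : ‖u‖ < Γ.R) (hx : |x| < Γ.M) (hp : 0 ≤ Γ.p u) (hlt : Γ.p u < x) : 0 <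
    S.dissipation u (Γ.V x u) := by
  have hm : ∀ z ∈ Icc (Γ.p u) x, |z| < Γ.M := fun z hz => abs_lt_of_mem_Icc (Γ.p_lt hu) hx hz
  have := lt_of_deriv_pos hlt (fun z hz => Γ.E_deriv (hm z hz) hu) fun z hz => by
    have h1 := hc.s1_mono hu (Γ.p_lt hu) (hm z (Ioo_subset_Icc_self hz)) hz.1.le
    rw [Γ.s1_self hu] at h1
    obtain ⟨k, hk, -, he⟩ := hc.growth hu
    have h2 := Q_lt_right hu (hm z (Ioo_subset_Icc_self hz)) hz.1 le_rfl
    rw [Γ.Q_self hu] at h2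
    have h3 : 0 < c * (z - Γ.p u) := mul_pos hc.c_pos (by linarith [hz.1])
    have h4 : 0 ≤ k * Γ.p u := mul_nonneg hk.le hp
    exact mul_pos (by rw [he] at h1; linarith) h2
  simpa only [Γ.V_p hu, diss_self] using this

lemma Convex.diss_pos_of_zero (hu : ‖u‖ < Γ.R) (hx : |x| < Γ.M) (hp : Γ.p u = 0) (hne : x ≠ 0) : 0 <
    S.dissipation u (Γ.V x u) := by
  rcases lt_or_gt_of_ne hne with h | h
  · have := hc.reflect.diss_pos (x := -x) (u := u) hu (by simpa [Chart.reflect] using hx)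
      (by simp [Chart.reflect, hp]) (by simpa [Chart.reflect, hp] using h)
    simpa [Chart.reflect] using this
  · exact hc.diss_pos hu hx hp.ge (by rwa [hp])

lemma Convex.exists_shockData (hu : ‖u‖ < Γ.R) (hp : 0 < Γ.p u) (hK : (C / c + 1) * Γ.p u < Γ.M) (hV
    : ‖Γ.V 0 u‖ < Γ.R) : ∃ N Z, -(C / c) * Γ.p u < Z ∧ Γ.ShockData u N Z := by
  have hcp := hc.c_pos
  have hCc : 0 < C / c := div_pos hc.C_pos hcp
  set a := Γ.p u with ha
  have haM : |a| < Γ.M := Γ.p_lt hu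
  obtain ⟨k, hk, hkC, hka⟩ := hc.growth hu
  have hs1a : Γ.s1 a u = k * a / 2 := by rw [Γ.s1_self hu, hka]
  have hs1a0 : 0 < Γ.s1 a u := by rw [hs1a]; positivity
  set b := -(C / c) * a with hb
  have hbneg : b < 0 := by rw [hb]; nlinarith
  have hbM : |b| < Γ.M := by grind
  have hcb : c * (a - b) = C * a + c * a := by rw [hb]; field_simp; ring
  have hca : 0 < c * a := mul_pos hcp hp
  have hkaC : k * a ≤ C * a := by nlinarith
  have h0M : |(0 : ℝ)| < Γ.M := by simpa using Γ.M_pos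
  -- the right-contact
  have hs1b : Γ.s1 b u < 0 := by
    have := hc.s1_mono hu hbM haM (by linarith)
    nlinarith
  have hmab : ∀ z ∈ Icc b a, |z| < Γ.M := fun z hz => abs_lt_of_mem_Icc hbM haM hz
  obtain ⟨N, hN, hN0⟩ := intermediate_value_Icc (by linarith : b ≤ a)
    (f := fun x => Γ.s1 x u) (fun z hz => (Γ.s1_deriv (hmab z hz) hu).continuousAt.continuousWithinAt)
    ⟨hs1b.le, hs1a0.le⟩
  simp only at hN0
  have hNM := hmab N hN
  have hpos : ∀ {x}, |x| < Γ.M → N < x → 0 < Γ.s1 x u := fun {x} hx h => by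
    have := hc.s1_mono hu hNM hx h.le
    have h3 : 0 < c * (x - N) := mul_pos hcp (by linarith)
    linarith
  have hneg : ∀ {x}, |x| < Γ.M → x < N → Γ.s1 x u < 0 := fun {x} hx h => by
    have := hc.s1_mono hu hx hNM h.le
    have h3 : 0 < c * (N - x) := mul_pos hcp (by linarith)
    linarith
  have hbN : b < N := lt_of_le_of_ne hN.1 fun h => by rw [h] at hs1b; linarith
  have hNa : N < a := lt_of_le_of_ne hN.2 fun h => by rw [← h] at hs1a0; linarith
  -- the sign of `N`
  have hN0' : N < 0 := by
    by_contra hcon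
    push Not at hcon
    have h1 : Γ.s1 0 u ≤ 0 := by grind
    have hpv := Γ.p_V h0M hu
    obtain ⟨h2, h3⟩ := Γ.symm hu hV (by rw [hpv])
    rw [hpv] at h3
    obtain ⟨k', -, -, hk'⟩ := hc.growth hV
    have h4 := hc.s_ge hV h0M haM
    have h5 := Γ.s1_self hV
    have h6 := Γ.s_self hV
    rw [hpv] at h5 h6 hk'
    rw [h5, hk', h6, h3] at h4
    obtain ⟨κ, hκ, h7⟩ := Γ.lax h0M hu
    have h8 : 0 ≤ κ * ((0 - Γ.p u) * Γ.s1 0 u) :=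
      mul_nonneg hκ.le (mul_nonneg_of_nonpos_of_nonpos (by linarith) h1)
    have h9 : 0 < c / 2 * (a - 0) ^ 2 := by positivity
    linarith
  -- the comparison function
  have hQN : 0 < Γ.Q N u := by
    have := Q_lt hu hNM hNa le_rfl
    rwa [Γ.Q_self hu] at this
  have hcmp : ∀ x, |x| < Γ.M → x < a → Γ.Q N u * (Γ.s x u - S.lam i u) < S.dissipation u (Γ.V x u)
    := by
    intro x hx hxa
    have hder : ∀ z, |z| < Γ.M → HasDerivAt
        (fun z => S.dissipation u (Γ.V z u) - Γ.Q N u * (Γ.s z u - S.lam i u))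
        (Γ.s1 z u * Γ.Q z u - Γ.Q N u * Γ.s1 z u) z := fun z hz =>
      (Γ.E_deriv hz hu).sub (((Γ.s_deriv hz hu).sub_const _).const_mul _)
    have hval : S.dissipation u (Γ.V a u) - Γ.Q N u * (Γ.s a u - S.lam i u) = 0 := by
      rw [Γ.V_p hu, diss_self, Γ.s_self hu]; ring
    have hmon : ∀ y z, |y| < Γ.M → y < z → z ≤ a → (z ≤ N ∨ N ≤ y) → S.dissipation u (Γ.V z u) - Γ.Q
      N u * (Γ.s z u - S.lam i u) < S.dissipation u (Γ.V y u) - Γ.Q N u * (Γ.s y u - S.lam i u) :=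
      by
      intro y z hy hyz hza hor
      have hm : ∀ t ∈ Icc y z, |t| < Γ.M := fun t ht =>
        abs_lt_of_mem_Icc hy haM ⟨ht.1, ht.2.trans hza⟩
      refine lt_of_deriv_neg hyz (fun t ht => hder t (hm t ht)) fun t ht => ?_
      have htM := hm t (Ioo_subset_Icc_self ht)
      rw [mul_comm (Γ.Q N u), ← mul_sub]
      rcases hor with h | h
      · have htN : t < N := ht.2.trans_le h
        exact mul_neg_of_neg_of_pos (hneg htM htN)
          (sub_pos.2 (Q_lt hu htM htN hNa.le))
      · have htN : N < t := h.trans_lt ht.1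
        exact mul_neg_of_pos_of_neg (hpos htM htN)
          (sub_neg.2 (Q_lt hu hNM htN (ht.2.le.trans hza)))
    rw [← sub_pos, ← hval]
    rcases le_or_gt N x with h | h
    · grind
    · grind
  have hEneg : ∀ x, N ≤ x → x < a → S.dissipation u (Γ.V x u) < 0 := by
    intro x hx hxa
    have hm : ∀ t ∈ Icc x a, |t| < Γ.M := fun t ht => hmab t ⟨hN.1.trans (hx.trans ht.1), ht.2⟩
    have := lt_of_deriv_pos hxa (fun t ht => Γ.E_deriv (hm t ht) hu) fun t ht => by
      refine mul_pos (hpos (hm t (Ioo_subset_Icc_self ht)) (hx.trans_lt ht.1)) ?_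
      have := Q_lt hu (hm t (Ioo_subset_Icc_self ht)) ht.2 le_rfl
      rwa [Γ.Q_self hu] at this
    rwa [ha, Γ.V_p hu, diss_self] at this
  have hEanti : ∀ x y, |x| < Γ.M → x < y → y ≤ N → S.dissipation u (Γ.V y u) < S.dissipation u (Γ.V
    x u) := by
    intro x y hx hxy hy
    have hm : ∀ t ∈ Icc x y, |t| < Γ.M := fun t ht => abs_lt_of_mem_Icc hx hNM ⟨ht.1, ht.2.trans hy⟩
    refine lt_of_deriv_neg hxy (fun t ht => Γ.E_deriv (hm t ht) hu) fun t ht => ?_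
    have htM := hm t (Ioo_subset_Icc_self ht)
    have htN := ht.2.trans_le hy
    have := Q_lt hu htM htN hNa.le
    exact mul_neg_of_neg_of_pos (hneg htM htN) (hQN.trans this)
  -- the shock without dissipation
  have hsb : S.lam i u < Γ.s b u := by
    have h1 := hc.s_ge hu haM hbM
    rw [Γ.s_self hu, hs1a] at h1
    have h2 : c / 2 * (b - a) ^ 2 = (C * a + c * a) * (a - b) / 2 := by rw [← hcb]; ring
    have h3 : 0 < (C * a + c * a - k * a) * (a - b) / 2 := by
      have : 0 < a - b := by linarith
      have : 0 < C * a + c * a - k * a := by linarith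
      positivity
    nlinarith
  have hEb : 0 < S.dissipation u (Γ.V b u) := by
    have := hcmp b hbM (by linarith)
    have h2 : 0 < Γ.Q N u * (Γ.s b u - S.lam i u) := mul_pos hQN (by linarith)
    linarith
  obtain ⟨Z, hZ, hZ0⟩ := intermediate_value_Icc' hbN.le
    (f := fun x => S.dissipation u (Γ.V x u))
    (fun z hz => (Γ.E_deriv (hmab z ⟨hz.1, hz.2.trans hN.2⟩) hu).continuousAt.continuousWithinAt)
    ⟨(hEneg N le_rfl hNa).le, hEb.le⟩
  simp only at hZ0
  have hbZ : b < Z := lt_of_le_of_ne hZ.1 fun h => by rw [h] at hEb; linarith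
  have hZN : Z < N := lt_of_le_of_ne hZ.2 fun h => by grind
  have hZM := hmab Z ⟨hZ.1, hZ.2.trans hN.2⟩
  have hEpos : ∀ x, |x| < Γ.M → x < Z → 0 < S.dissipation u (Γ.V x u) := fun x hx h => by grind
  have hEneg' : ∀ x, |x| < Γ.M → Z < x → x < a → S.dissipation u (Γ.V x u) < 0 := by grind
  refine ⟨N, Z, hbZ, hZN, hN0', hN0, fun {x} hx hne => ⟨fun h => ⟨?_, ?_⟩, fun h => ?_⟩,
    fun {x} hx hne => ⟨fun h => ?_, fun h => by rw [h, hZ0]⟩, hpos, hneg, fun {x} hx hZx hxa => ?_⟩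
  · grind
  · exact lt_of_le_of_ne (not_lt.1 fun h' => absurd (hc.diss_pos hu hx hp.le h') (not_lt.2 h)) hne
  · grind
  · rcases lt_trichotomy x Z with h' | h' | h'
    · grind
    · exact h'
    · rcases lt_or_gt_of_ne hne with h2 | h2
      · grind
      · exact absurd h (hc.diss_pos hu hx hp.le h2).ne'
  · have h1 := hcmp x hx hxa
    have h2 : S.dissipation u (Γ.V x u) ≤ 0 := by grind
    by_contra h3
    push Not at h3
    have : 0 ≤ Γ.Q N u * (Γ.s x u - S.lam i u) := mul_nonneg hQN.le (by linarith)
    linarith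

end Chart

lemma speed_comm (u v : State n) : S.speed u v = S.speed v u := by
  rw [speed, speed, ← neg_sub (S.f v), ← neg_sub v u, inner_neg_neg, norm_neg]

lemma dissipation_comm (u v : State n) : S.dissipation v u = -S.dissipation u v := by
  rw [dissipation, dissipation, speed_comm v u]; ring

lemma IsArc.left_mem (h : S.IsArc ρ i u v γ) : ‖u‖ < ρ := by
  obtain ⟨h0, -, s, hs⟩ := h
  have := (hs 0 (left_mem_Icc.2 zero_le_one)).1
  rwa [h0, mem_ball_zero_iff] at this

lemma IsArc.right_mem (h : S.IsArc ρ i u v γ) : ‖v‖ < ρ := by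
  obtain ⟨-, h1, s, hs⟩ := h
  have := (hs 1 (right_mem_Icc.2 zero_le_one)).1
  rwa [h1, mem_ball_zero_iff] at this

lemma self_mem_integralCurve (hu : ‖u‖ < ρ) : u ∈ S.integralCurve ρ i u :=
  ⟨fun _ => u, rfl, rfl, 0, fun τ _ => ⟨by simpa using hu, by simpa using hasDerivAt_const τ u⟩⟩

lemma self_mem_hugoniot (hu : ‖u‖ < ρ) : u ∈ S.hugoniot ρ i u :=
  ⟨by simpa using hu, Or.inl rfl⟩

lemma IsWave.right_mem (h : S.IsWave ρ a) : ‖a.right‖ < ρ := by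
  rcases h with ⟨-, h, -⟩ | ⟨-, γ, h, -⟩
  · simpa using h.1
  · exact h.right_mem

lemma isFan_nil : S.IsFan ρ i u v [] ↔ u = v := by
  simp [IsFan, Wave.Connects]

lemma isFan_single : S.IsFan ρ i u v [a] ↔ (a.left = u ∧ a.right = v) ∧ a.fam = i ∧ S.IsWave ρ a :=
    by
  simp [IsFan, Wave.Connects]

lemma isFan_cons_cons {b : Wave n} : S.IsFan ρ i u v (a :: b :: L) ↔ (a.left = u ∧ a.fam = i ∧
    S.IsWave ρ a ∧ (S.hi a < S.lo b ∨ (S.hi a = S.lo b ∧ a.isShock ≠ b.isShock))) ∧ S.IsFan ρ i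
    a.right v (b :: L) := by
  simp only [IsFan, Wave.Connects, List.forall_mem_cons, List.isChain_cons_cons]
  tauto

lemma IsFan.head (h : S.IsFan ρ i u v (a :: L)) : a.left = u ∧ a.fam = i ∧ S.IsWave ρ a :=
  ⟨h.1.1, h.2.1 a List.mem_cons_self⟩

/-- Entropy-satisfying shocks are slower than the characteristic speed on their left. -/
def ShocksSlow (S : ConsLaw n) (ρ : ℝ) (i : Fin n) : Prop :=
  ∀ u v, ‖u‖ < ρ → v ∈ S.hugoniot ρ i u → v ≠ u → S.dissipation u v ≤ 0 →
    S.speed u v < S.lam i u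

lemma IsFan.next (hT : ShocksSlow S ρ i) {b : Wave n} (h : S.IsFan ρ i u v (a :: b :: L)) :
    a.isShock = true ∧ S.speed u a.right ≤ S.lam i a.right ∧ S.IsFan ρ i a.right v (b :: L) ∧
    (b.isShock = true → S.speed u a.right < S.speed a.right b.right ∧ S.speed u a.right < S.lam i
    a.right) := by
  obtain ⟨⟨h1, h2, h3, h4⟩, h5⟩ := isFan_cons_cons.1 h
  obtain ⟨h6, h7, h8⟩ := h5.head
  have hz := h3.right_mem
  have hlo : b.isShock = true → S.lo b = S.speed a.right b.right ∧ S.lo b < S.lam i a.right := by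
    intro hb
    have : S.lo b = S.speed a.right b.right := by rw [lo, if_pos hb, h6]
    refine ⟨this, ?_⟩
    rw [this]
    rcases h8 with ⟨-, h8, h9, h10⟩ | ⟨h8, -⟩
    · rw [h6, h7] at h8
      rw [h6] at h9 h10
      exact hT _ _ hz h8 h9 h10
    · grind
  have hlo' : b.isShock = false → S.lo b = S.lam i a.right := fun hb => by
    rw [lo, hb, h6, h7]; simp
  have ha : a.isShock = true := by
    by_contra ha
    rw [Bool.not_eq_true] at ha
    have hhi : S.hi a = S.lam i a.right := by rw [hi, ha, h2]; simp
    rw [hhi] at h4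
    cases hb : b.isShock
    · grind
    · grind
  have hhi : S.hi a = S.speed u a.right := by rw [hi, if_pos ha, h1]
  refine ⟨ha, ?_, h5, fun hb => ?_⟩
  · grind
  · grind

namespace Chart

/-- Radii of balls of states to which the analysis of shocks applies. -/
structure Good (Γ : Chart S i g) (c C ρ : ℝ) : Prop where
  le : ρ ≤ Γ.R
  small : ∀ z, ‖z‖ < ρ → (C / c + 1) * |Γ.p z| < Γ.M
  zero : ∀ z, ‖z‖ < ρ → ‖Γ.V 0 z‖ < Γ.R

lemma Good.reflect (hg : Γ.Good c C ρ) : Γ.reflect.Good c C ρ :=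
  ⟨hg.le, fun z hz => by simpa [Chart.reflect] using hg.small z hz,
    fun z hz => by simpa [Chart.reflect] using hg.zero z hz⟩

lemma mem_hugoniot (hρ : ρ ≤ Γ.R) (hu : ‖u‖ < ρ) : v ∈ S.hugoniot ρ i u ↔ ‖v‖ < ρ ∧ Γ.V (Γ.p v) u =
    v := by
  constructor
  · intro h
    have hv : ‖v‖ < ρ := by simpa using h.1
    exact ⟨hv, (Γ.hug (hu.trans_le hρ) (hv.trans_le hρ) h.1).1 h⟩
  · rintro ⟨hv, h⟩
    exact (Γ.hug (hu.trans_le hρ) (hv.trans_le hρ) (by simpa using hv)).2 h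

lemma speed_of_mem (hρ : ρ ≤ Γ.R) (hu : ‖u‖ < ρ) (hv : v ∈ S.hugoniot ρ i u) (hne : v ≠ u) : Γ.p v ≠
    Γ.p u ∧ S.speed u v = Γ.s (Γ.p v) u := by
  obtain ⟨h1, h2⟩ := (mem_hugoniot hρ hu).1 hv
  have h3 : Γ.p v ≠ Γ.p u := fun h => hne (by rw [← h2, h, Γ.V_p (hu.trans_le hρ)])
  refine ⟨h3, ?_⟩
  conv_lhs => rw [← h2]
  exact Γ.speed_V (Γ.p_lt (h1.trans_le hρ)) (hu.trans_le hρ) h3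

lemma arc_right (hρ : ρ ≤ Γ.R) (h : v ∈ S.integralCurve ρ i u) : v = Γ.W (Γ.p v) u := by
  obtain ⟨γ, hγ⟩ := h
  have := (Γ.arc_eq hρ hγ).1 1 (right_mem_Icc.2 zero_le_one)
  rwa [hγ.2.1] at this

lemma continuousOn_p_arc (hρ : ρ ≤ Γ.R) (hγ : S.IsArc ρ i u v γ) : ContinuousOn (fun τ => Γ.p (γ τ))
    (Icc 0 1) := by
  have h1 : ContinuousOn Γ.p (ball 0 Γ.R) := by
    refine (LipschitzOnWith.of_dist_le_mul (K := Γ.B.toNNReal) fun x hx y hy => ?_).continuousOn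
    rw [Real.coe_toNNReal _ Γ.B_pos.le, Real.dist_eq, dist_eq_norm]
    exact Γ.p_lip (by simpa using hx) (by simpa using hy)
  refine h1.comp hγ.continuousOn fun τ hτ => ?_
  obtain ⟨-, -, s, hs⟩ := hγ
  exact ball_subset_ball hρ (hs τ hτ).1

lemma exists_arc_param (hρ : ρ ≤ Γ.R) (hγ : S.IsArc ρ i u v γ) {τ τ' : ℝ} (hτ : τ ∈ Icc (0 : ℝ) 1)
    (hτ' : τ' ∈ Icc (0 : ℝ) 1) (hx : x ∈ uIcc (Γ.p (γ τ)) (Γ.p (γ τ'))) : ∃ t ∈ Icc (0 : ℝ) 1, Γ.p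
    (γ t) = x ∧ γ t = Γ.W x u ∧ ‖Γ.W x u‖ < ρ := by
  have hsub : uIcc τ τ' ⊆ Icc 0 1 := by
    rw [← uIcc_of_le (zero_le_one' ℝ)] at hτ hτ' ⊢
    exact uIcc_subset_uIcc hτ hτ'
  obtain ⟨t, ht, he⟩ := intermediate_value_uIcc ((continuousOn_p_arc hρ hγ).mono hsub) hx
  have h1 := (Γ.arc_eq hρ hγ).1 t (hsub ht)
  simp only at he
  rw [he] at h1
  obtain ⟨-, -, s, hs⟩ := hγ
  refine ⟨t, hsub ht, he, h1, ?_⟩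
  rw [← h1]
  simpa using (hs t (hsub ht)).1

lemma Convex.lam_lt_of_arc (hc : Γ.Convex c C) (hρ : ρ ≤ Γ.R) (hγ : S.IsArc ρ i u v γ) {τ τ' : ℝ}
    (hτ : τ ∈ Icc (0 : ℝ) 1) (hτ' : τ' ∈ Icc (0 : ℝ) 1) (h0 : 0 ≤ Γ.p (γ τ)) (hlt : Γ.p (γ τ) < Γ.p
    (γ τ')) : S.lam i (γ τ) < S.lam i (γ τ') := by
  have hu := hγ.left_mem.trans_le hρ
  have hm : ∀ x ∈ Icc (Γ.p (γ τ)) (Γ.p (γ τ')), ‖Γ.W x u‖ < Γ.R ∧ |x| < Γ.M := fun x hx => by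
    obtain ⟨t, ht, h1, h2, h3⟩ := exists_arc_param hρ hγ hτ hτ' (Icc_subset_uIcc hx)
    have h4 := h3.trans_le hρ
    refine ⟨h4, ?_⟩
    rw [← h1, h2]; exact Γ.p_lt h4
  have := lt_of_deriv_pos hlt (f := fun x => S.lam i (Γ.W x u))
    (fun x hx => Γ.lam_W (hm x hx).2 hu) fun x hx => by
      have hx' := hm x (Ioo_subset_Icc_self hx)
      obtain ⟨k, hk, -, he⟩ := hc.growth hx'.1
      rw [he, Γ.p_W hx'.2 hu]
      exact mul_pos hk (h0.trans_lt hx.1)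
  simpa only [← (Γ.arc_eq hρ hγ).1 τ hτ, ← (Γ.arc_eq hρ hγ).1 τ' hτ'] using this

lemma Convex.rarefaction_of_lt (hc : Γ.Convex c C) (hρ : ρ ≤ Γ.R) (h : v ∈ S.integralCurve ρ i u)
    (hp : 0 ≤ Γ.p u) (hlt : Γ.p u < Γ.p v) : S.Rarefaction ρ i u v := by
  obtain ⟨γ, hγ⟩ := h
  have h01 : (0 : ℝ) ∈ Icc (0 : ℝ) 1 := left_mem_Icc.2 zero_le_one
  have h11 : (1 : ℝ) ∈ Icc (0 : ℝ) 1 := right_mem_Icc.2 zero_le_one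
  refine ⟨γ, hγ, ?_⟩
  rcases (Γ.arc_eq hρ hγ).2 with h | h | h
  · intro τ hτ τ' hτ' hlt'
    refine hc.lam_lt_of_arc hρ hγ hτ hτ' ?_ (h hτ hτ' hlt')
    have := h.monotoneOn h01 hτ hτ.1
    simp only [hγ.1] at this
    linarith
  · have := h.antitoneOn h01 h11 zero_le_one
    simp only [hγ.1, hγ.2.1] at this
    linarith
  · have := h 1 h11
    rw [hγ.2.1] at this
    rw [this] at hlt
    exact absurd hlt (lt_irrefl _)

lemma Rarefaction.ne (h : S.Rarefaction ρ i u v) : v ≠ u := by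
  rintro rfl
  obtain ⟨γ, hγ, hm⟩ := h
  have := hm (left_mem_Icc.2 zero_le_one) (right_mem_Icc.2 zero_le_one) zero_lt_one
  simp only [hγ.1, hγ.2.1] at this
  exact lt_irrefl _ this

lemma Rarefaction.mem (h : S.Rarefaction ρ i u v) : v ∈ S.integralCurve ρ i u :=
  let ⟨γ, hγ, _⟩ := h
  ⟨γ, hγ⟩

lemma Convex.rarefaction_iff (hc : Γ.Convex c C) (hρ : ρ ≤ Γ.R) (hp : 0 < Γ.p u) : S.Rarefaction ρ i
    u v ↔ v ∈ S.integralCurve ρ i u ∧ Γ.p u < Γ.p v := by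
  refine ⟨fun hr => ⟨Rarefaction.mem hr, ?_⟩, fun h => hc.rarefaction_of_lt hρ h.1 hp.le h.2⟩
  have hne := Rarefaction.ne hr
  obtain ⟨γ, hγ, hm⟩ := hr
  have h01 : (0 : ℝ) ∈ Icc (0 : ℝ) 1 := left_mem_Icc.2 zero_le_one
  have h11 : (1 : ℝ) ∈ Icc (0 : ℝ) 1 := right_mem_Icc.2 zero_le_one
  rcases (Γ.arc_eq hρ hγ).2 with h | h | h
  · have := h h01 h11 zero_lt_one
    simpa only [hγ.1, hγ.2.1] using this
  · have h1 := h h01 h11 zero_lt_one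
    simp only [hγ.1, hγ.2.1] at h1
    obtain ⟨t, ht, h2, -⟩ := exists_arc_param hρ hγ h01 h11 (x := max (Γ.p v) (Γ.p u / 2)) (by
      rw [hγ.1, hγ.2.1, uIcc_of_ge h1.le]
      exact ⟨le_max_left _ _, max_le h1.le (by linarith)⟩)
    have h3 : Γ.p (γ t) < Γ.p (γ 0) := by
      rw [h2, hγ.1]; exact max_lt h1 (by linarith)
    have h4 : 0 < t := lt_of_le_of_ne ht.1 fun h => by rw [← h] at h3; exact lt_irrefl _ h3
    have h5 := hc.lam_lt_of_arc hρ hγ ht h01 (by rw [h2]; exact le_max_of_le_right (by linarith)) h3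
    have h6 := hm h01 ht h4
    simp only at h6
    linarith
  · exact absurd (by rw [← hγ.2.1, h 1 h11]) hne

lemma Convex.rarefaction_iff_of_zero (hc : Γ.Convex c C) (hρ : ρ ≤ Γ.R) (hp : Γ.p u = 0) :
    S.Rarefaction ρ i u v ↔ v ∈ S.integralCurve ρ i u ∧ v ≠ u := by
  refine ⟨fun hr => ⟨Rarefaction.mem hr, Rarefaction.ne hr⟩, fun ⟨h, hne⟩ => ?_⟩
  have hu : ‖u‖ < Γ.R := by
    obtain ⟨γ, hγ⟩ := h
    exact hγ.left_mem.trans_le hρ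
  rcases lt_trichotomy (Γ.p u) (Γ.p v) with h1 | h1 | h1
  · exact hc.rarefaction_of_lt hρ h hp.ge h1
  · refine absurd ?_ hne
    rw [arc_right hρ h, ← h1, Γ.W_p hu]
  · exact hc.reflect.rarefaction_of_lt hρ h (by simp [Chart.reflect, hp]) (neg_lt_neg h1)

variable (hc : Γ.Convex c C) (hg : Γ.Good c C ρ)
include hc hg

lemma Good.exists_shockData (hu : ‖u‖ < ρ) (hp : 0 < Γ.p u) : ∃ N Z, -(C / c) * Γ.p u < Z ∧
    Γ.ShockData u N Z :=
  hc.exists_shockData (hu.trans_le hg.le) hp (by simpa [abs_of_pos hp] using hg.small u hu)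
    (hg.zero u hu)

lemma Good.shock_lt (hu : ‖u‖ < ρ) (hv : v ∈ S.hugoniot ρ i u) (hne : v ≠ u) (hd : S.dissipation u v
    ≤ 0) (hp : 0 ≤ Γ.p u) : S.speed u v < S.lam i u := by
  obtain ⟨h1, h2⟩ := speed_of_mem hg.le hu hv hne
  obtain ⟨h3, h4⟩ := (mem_hugoniot hg.le hu).1 hv
  have hM := Γ.p_lt (h3.trans_le hg.le)
  rw [← h4] at hd
  rcases hp.eq_or_lt with hp | hp
  · exact absurd (hc.diss_pos_of_zero (hu.trans_le hg.le) hM hp.symm (by rwa [← hp] at h1))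
      (not_lt.2 hd)
  · obtain ⟨N, Z, -, D⟩ := hg.exists_shockData hc hu hp
    obtain ⟨h5, h6⟩ := (D.diss_iff hM h1).1 hd
    rw [h2]
    exact D.s_lt hM h5 h6

lemma Good.shocksSlow : ShocksSlow S ρ i := fun u v hu hv hne hd => by
  rcases le_total 0 (Γ.p u) with hp | hp
  · exact hg.shock_lt hc hu hv hne hd hp
  · exact hg.reflect.shock_lt hc.reflect hu hv hne hd (by simpa [Chart.reflect] using hp)

/-- No entropy-satisfying shock issues from a state with `p u = 0`. -/
lemma Good.isFan_iff_of_zero (hu : ‖u‖ < ρ) (hp : Γ.p u = 0) : S.IsFan ρ i u v L ↔ v ∈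
    S.integralCurve ρ i u ∧ L = Wave.seg i false u v := by
  constructor
  · intro h
    match L, h with
    | [], h =>
      rw [isFan_nil] at h
      subst h
      exact ⟨self_mem_integralCurve hu, by simp [Wave.seg]⟩
    | a :: L, h =>
      obtain ⟨h1, h2, h3⟩ := h.head
      have ha : a.isShock = false := by
        rcases h3 with ⟨-, h4, h5, h6⟩ | ⟨h4, -⟩
        · rw [h1, h2] at h4
          rw [h1] at h5 h6
          obtain ⟨h7, h8⟩ := (mem_hugoniot hg.le hu).1 h4
          have h9 := (speed_of_mem hg.le hu h4 h5).1
          rw [hp] at h9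
          rw [← h8] at h6
          exact absurd (hc.diss_pos_of_zero (hu.trans_le hg.le) (Γ.p_lt (h7.trans_le hg.le)) hp h9)
            (not_lt.2 h6)
        · exact h4
      match L, h with
      | [], h =>
        obtain ⟨⟨-, h4⟩, -⟩ := isFan_single.1 h
        rcases h3 with ⟨h5, -⟩ | ⟨-, h5⟩
        · grind
        · rw [h1, h2, h4] at h5
          refine ⟨Rarefaction.mem h5, ?_⟩
          rw [Wave.seg, if_neg (Rarefaction.ne h5).symm, ← h1, ← h2, ← h4, ← ha]
      | b :: L, h =>
        have := (h.next (hg.shocksSlow hc)).1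
        rw [ha] at this
        exact absurd this (by simp)
  · rintro ⟨h, rfl⟩
    by_cases hne : u = v
    · rw [Wave.seg, if_pos hne, isFan_nil]
      exact hne
    · rw [Wave.seg, if_neg hne, isFan_single]
      exact ⟨⟨rfl, rfl⟩, rfl, Or.inr ⟨rfl, (hc.rarefaction_iff_of_zero hg.le hp).2 ⟨h, Ne.symm hne⟩⟩⟩

end Chart

namespace Chart

lemma ShockData.s_strictMono {N Z : ℝ} (D : Γ.ShockData u N Z) (hu : ‖u‖ < Γ.R) (hx : |x| < Γ.M) (hy
    : |y| < Γ.M) (hN : N ≤ x) (hxy : x < y) : Γ.s x u < Γ.s y u := by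
  have hm : ∀ t ∈ Icc x y, |t| < Γ.M := fun t ht => abs_lt_of_mem_Icc hx hy ht
  exact lt_of_deriv_pos hxy (fun t ht => Γ.s_deriv (hm t ht) hu)
    fun t ht => D.s1_pos (hm t (Ioo_subset_Icc_self ht)) (hN.trans_lt ht.1)

lemma ShockData.s_strictAnti {N Z : ℝ} (D : Γ.ShockData u N Z) (hu : ‖u‖ < Γ.R) (hx : |x| < Γ.M) (hy
    : |y| < Γ.M) (hN : y ≤ N) (hxy : x < y) : Γ.s y u < Γ.s x u := by
  have hm : ∀ t ∈ Icc x y, |t| < Γ.M := fun t ht => abs_lt_of_mem_Icc hx hy ht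
  exact lt_of_deriv_neg hxy (fun t ht => Γ.s_deriv (hm t ht) hu)
    fun t ht => D.s1_neg (hm t (Ioo_subset_Icc_self ht)) (ht.2.trans_le hN)

lemma ShockData.N_lt {N Z : ℝ} (D : Γ.ShockData u N Z) (hp : 0 < Γ.p u) :
    N < Γ.p u := D.N_neg.trans hp

/-- Along the shocks from `u`, a Lax shock is one that does not go beyond the right-contact. -/
lemma ShockData.lam_V_le_iff {N Z : ℝ} (D : Γ.ShockData u N Z) (hu : ‖u‖ < Γ.R)
 (hx : |x| < Γ.M) (hlt : x < Γ.p u) :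
    (S.lam i (Γ.V x u) ≤ Γ.s x u ↔ N ≤ x) ∧ (S.lam i (Γ.V x u) < Γ.s x u ↔ N < x) := by
  obtain ⟨κ, hκ, he⟩ := Γ.lax hx hu
  have hneg : x - Γ.p u < 0 := by linarith
  rcases lt_trichotomy x N with h | h | h
  · have h1 : 0 < κ * ((x - Γ.p u) * Γ.s1 x u) :=
      mul_pos hκ (mul_pos_of_neg_of_neg hneg (D.s1_neg hx h))
    constructor <;> constructor <;> intro h' <;> linarith
  · have h1 : κ * ((x - Γ.p u) * Γ.s1 x u) = 0 := by rw [h, D.s1_N]; simp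
    constructor <;> constructor <;> intro h' <;> linarith
  · have h1 : κ * ((x - Γ.p u) * Γ.s1 x u) < 0 :=
      mul_neg_of_pos_of_neg hκ (mul_neg_of_neg_of_pos hneg (D.s1_pos hx h))
    constructor <;> constructor <;> intro h' <;> linarith

/-- A state `u` with `p u > 0`, the shock from `u` to `z` prescribed by the kinetic function, and
the classical shock of the same speed, with parameter `T`. -/
structure FanData (Γ : Chart S i g) (ρ : ℝ) (u z : State n) (N Z k T : ℝ) : Prop where
  u_lt : ‖u‖ < ρ
  p_pos : 0 < Γ.p u
  data : Γ.ShockData u N Z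
  Z_lt : Z < k
  k_le : k ≤ N
  k_lt : |k| < Γ.M
  z_eq : Γ.V k u = z
  z_lt : ‖z‖ < ρ
  N_le : N ≤ T
  T_lt : T < Γ.p u
  s_T : Γ.s T u = Γ.s k u
  sharp_lt : ‖Γ.V T u‖ < ρ

lemma ShockData.exists_sharp {N Z k : ℝ} (D : Γ.ShockData u N Z) (hu : ‖u‖ < Γ.R) (hp : 0 < Γ.p u)
    (hZ : Z < k) (hkN : k ≤ N) (hk : |k| < Γ.M) : ∃ T, N ≤ T ∧ T < Γ.p u ∧ Γ.s T u = Γ.s k u ∧ ∀ T',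
    N ≤ T' → T' < Γ.p u → Γ.s T' u = Γ.s k u → T' = T := by
  have hpM := Γ.p_lt hu
  have hkp : k < Γ.p u := hkN.trans_lt (D.N_lt hp)
  have hNM : |N| < Γ.M := abs_lt_of_mem_Icc hk hpM ⟨hkN, (D.N_lt hp).le⟩
  have hm : ∀ t ∈ Icc N (Γ.p u), |t| < Γ.M := fun t ht => abs_lt_of_mem_Icc hNM hpM ht
  have h1 : Γ.s N u ≤ Γ.s k u := by
    rcases hkN.eq_or_lt with h | h
    · rw [h]
    · exact (D.s_strictAnti hu hk hNM le_rfl h).le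
  have h2 : Γ.s k u < S.lam i u := D.s_lt hk hZ.le hkp
  obtain ⟨T, hT, he⟩ := intermediate_value_Icc (D.N_lt hp).le (f := fun x => Γ.s x u)
    (fun t ht => (Γ.s_deriv (hm t ht) hu).continuousAt.continuousWithinAt)
    ⟨h1, by simp only [Γ.s_self hu]; exact h2.le⟩
  simp only at he
  refine ⟨T, hT.1, lt_of_le_of_ne hT.2 fun h => ?_, he, fun T' h3 h4 h5 => ?_⟩
  · rw [h, Γ.s_self hu] at he; linarith
  · have hT' := hm T' ⟨h3, h4.le⟩
    rcases lt_trichotomy T' T with h | h | h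
    · have := D.s_strictMono hu hT' (hm T hT) h3 h
      linarith
    · exact h
    · have := D.s_strictMono hu (hm T hT) hT' hT.1 h
      linarith

namespace FanData

variable {N Z k T : ℝ} (F : Γ.FanData ρ u z N Z k T)
include F

lemma k_lt_p : k < Γ.p u := F.k_le.trans_lt (F.data.N_lt F.p_pos)

lemma k_neg : k < 0 := F.k_le.trans_lt F.data.N_neg

lemma k_le_T : k ≤ T := F.k_le.trans F.N_le

variable (hg : Γ.Good c C ρ)
include hg

lemma u_R : ‖u‖ < Γ.R := F.u_lt.trans_le hg.le

lemma z_R : ‖z‖ < Γ.R := F.z_lt.trans_le hg.le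

lemma T_M : |T| < Γ.M := abs_lt_of_mem_Icc F.k_lt (Γ.p_lt (F.u_R hg)) ⟨F.k_le_T, F.T_lt.le⟩

lemma p_z : Γ.p z = k := by rw [← F.z_eq, Γ.p_V F.k_lt (F.u_R hg)]

lemma z_ne : z ≠ u := fun h => by
  have := F.p_z hg
  rw [h] at this
  have := F.k_lt_p
  linarith

lemma z_mem : z ∈ S.hugoniot ρ i u :=
  (mem_hugoniot hg.le F.u_lt).2 ⟨F.z_lt, by rw [F.p_z hg, F.z_eq]⟩

lemma speed_z : S.speed u z = Γ.s k u := by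
  rw [(speed_of_mem hg.le F.u_lt (F.z_mem hg) (F.z_ne hg)).2, F.p_z hg]

omit hg in
lemma diss_z : S.dissipation u z ≤ 0 := by
  rw [← F.z_eq]
  exact (F.data.diss_iff F.k_lt F.k_lt_p.ne).2 ⟨F.Z_lt.le, F.k_lt_p⟩

lemma isWave_z : S.IsWave ρ ⟨i, true, u, z⟩ :=
  Or.inl ⟨rfl, F.z_mem hg, F.z_ne hg, F.diss_z⟩

lemma lax_z_iff : S.lam i z ≤ S.speed u z ↔ N ≤ k := by
  rw [F.speed_z hg, ← F.z_eq]
  exact (F.data.lam_V_le_iff (F.u_R hg) F.k_lt F.k_lt_p).1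

lemma speed_le_lam : S.speed u z ≤ S.lam i z := by
  rcases F.k_le.eq_or_lt with h | h
  · have h1 := (F.data.lam_V_le_iff (F.u_R hg) F.k_lt F.k_lt_p).2
    rw [F.speed_z hg, ← F.z_eq]
    by_contra h2
    push Not at h2
    exact absurd (h1.1 h2) (by rw [h]; exact lt_irrefl _)
  · have := (F.lax_z_iff hg).not.2 (not_le.2 h)
    linarith

lemma sharp_flat : Γ.V T z = Γ.V T u ∧ Γ.V (Γ.p u) z = u ∧ Γ.s (Γ.p u) z = Γ.s k u ∧ (k < N → Γ.s T
    z = Γ.s k u ∧ k < T ∧ N < T) := by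
  have hu := F.u_R hg
  have hz := F.z_R hg
  have hpz := F.p_z hg
  have hj1 := Γ.jump F.k_lt hu
  have hj2 := Γ.jump (F.T_M hg) hu
  rw [F.s_T] at hj2
  rw [F.z_eq] at hj1
  have hj : S.f (Γ.V T u) - S.f z = Γ.s k u • (Γ.V T u - z) := by
    have : S.f (Γ.V T u) - S.f z = (S.f (Γ.V T u) - S.f u) - (S.f z - S.f u) := by abel
    rw [this, hj1, hj2, ← smul_sub]
    congr 1
    abel
  have h1 := Γ.hug_of_jump hz (F.sharp_lt.trans_le hg.le) hj (Γ.s_near F.k_lt hu)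
  rw [Γ.p_V (F.T_M hg) hu] at h1
  obtain ⟨h2, h3⟩ := Γ.symm hu hz (by rw [hpz, F.z_eq])
  rw [hpz] at h3
  refine ⟨h1, h2, h3, fun hkN => ?_⟩
  have hNM : |N| < Γ.M := abs_lt_of_mem_Icc F.k_lt (F.T_M hg) ⟨F.k_le, F.N_le⟩
  have hNT : N < T := lt_of_le_of_ne F.N_le fun h => by
    have h4 := F.data.s_strictAnti hu F.k_lt hNM le_rfl hkN
    have h5 := F.s_T
    rw [← h] at h5
    linarith
  have hkT : k < T := hkN.trans hNT
  refine ⟨?_, hkT, hNT⟩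
  rw [← Γ.speed_V (F.T_M hg) hz (by rw [hpz]; exact hkT.ne'), h1]
  refine speed_eq (fun h => ?_) hj
  have := Γ.p_V (F.T_M hg) hu
  rw [h, hpz] at this
  exact hkT.ne this

/-- The shocks that can follow the shock from `u` to `z`. -/
lemma second_shock (hc : Γ.Convex c C) (hy : |y| < Γ.M) (hne : y ≠ k) : ((S.dissipation z (Γ.V y z)
    ≤ 0 ∧ Γ.s k u < Γ.s y z) ↔ k < y ∧ y < T) ∧ (k < y → y < T → S.lam i (Γ.V y z) < Γ.s y z ∧ Γ.s y
    z < S.lam i z) := by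
  have hu := F.u_R hg
  have hz := F.z_R hg
  have hpz := F.p_z hg
  obtain ⟨h1, h2, h3, h4⟩ := F.sharp_flat hg
  obtain ⟨N', Z', -, D⟩ := hg.reflect.exists_shockData hc.reflect F.z_lt
    (by simpa [Chart.reflect, hpz] using F.k_neg)
  have hrp : Γ.reflect.p z = -k := by simp [Chart.reflect, hpz]
  have hrV : ∀ x, Γ.reflect.V x z = Γ.V (-x) z := fun _ => rfl
  have hrs : ∀ x, Γ.reflect.s x z = Γ.s (-x) z := fun _ => rfl
  have habs : ∀ {x}, |x| < Γ.M → |-x| < Γ.reflect.M := fun h => by simpa [Chart.reflect] using h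
  have hdiss : ∀ {x}, |x| < Γ.M → x ≠ k →
      (S.dissipation z (Γ.V x z) ≤ 0 ↔ Z' ≤ -x ∧ k < x) := fun {x} hx hxk => by
    have := D.diss_iff (habs hx) (by rw [hrp]; simpa using hxk)
    rw [hrV, neg_neg, hrp, neg_lt_neg_iff] at this
    exact this
  have hslt : ∀ {x}, |x| < Γ.M → Z' ≤ -x → k < x → Γ.s x z < S.lam i z := fun {x} hx h5 h6 => by
    have := D.s_lt (habs hx) h5 (by rw [hrp]; linarith)
    rwa [hrs, neg_neg] at this
  rcases F.k_le.eq_or_lt with hkN | hkN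
  · have hTk : T = k := by
      have hNM : |N| < Γ.M := by rw [← hkN]; exact F.k_lt
      by_contra hTk
      have h5 := F.data.s_strictMono hu F.k_lt (F.T_M hg) hkN.ge (lt_of_le_of_ne F.k_le_T (Ne.symm hTk))
      rw [F.s_T] at h5
      exact lt_irrefl _ h5
    refine ⟨⟨fun ⟨h5, h6⟩ => ?_, fun ⟨h5, h6⟩ => absurd h6 (by rw [hTk]; exact not_lt.2 h5.le)⟩,
      fun h5 h6 => absurd h6 (by rw [hTk]; exact not_lt.2 h5.le)⟩
    obtain ⟨h7, h8⟩ := (hdiss hy hne).1 h5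
    have h9 := hslt hy h7 h8
    have h10 := (F.lax_z_iff hg).2 hkN.ge
    rw [F.speed_z hg] at h10
    linarith
  · obtain ⟨hsT, hkT, hNT⟩ := h4 hkN
    have hpM := Γ.p_lt hu
    have hTM := F.T_M hg
    have hmono : ∀ {x x'}, |x| < Γ.M → |x'| < Γ.M → x < x' → x' ≤ -N' → Γ.s x' z < Γ.s x z :=
      fun {x x'} hx hx' hlt hN => by
        have := D.s_strictMono hz (habs hx') (habs hx) (by linarith) (by linarith)
        simpa only [hrs, neg_neg] using this
    have hanti : ∀ {x x'}, |x| < Γ.M → |x'| < Γ.M → x < x' → -N' ≤ x → Γ.s x z < Γ.s x' z :=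
      fun {x x'} hx hx' hlt hN => by
        have := D.s_strictAnti hz (habs hx') (habs hx) (by linarith) (by linarith)
        simpa only [hrs, neg_neg] using this
    have hTN : T < -N' := by
      by_contra h
      have := hanti hTM hpM F.T_lt (not_lt.1 h)
      linarith
    have hNp : -N' < Γ.p u := by
      by_contra h
      have := hmono hTM hpM F.T_lt (not_lt.1 h)
      linarith
    have hZN := D.Z_lt
    refine ⟨⟨fun ⟨h5, h6⟩ => ?_, fun ⟨h5, h6⟩ => ?_⟩, fun h5 h6 => ⟨?_, ?_⟩⟩
    · obtain ⟨h7, h8⟩ := (hdiss hy hne).1 h5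
      refine ⟨h8, ?_⟩
      by_contra h9
      push Not at h9
      rcases le_or_gt y (Γ.p u) with h10 | h10
      · grind
      · have h11 : S.dissipation z u = 0 := by
          refine le_antisymm ?_ ?_
          · grind
          · rw [dissipation_comm u z]
            have := F.diss_z
            linarith
        have h12 := (D.diss_zero_iff (habs hpM) (by rw [hrp]; simpa using F.k_lt_p.ne')).1
          (by rw [hrV, neg_neg, h2, h11])
        linarith
    · grind
    · have := (D.lam_V_le_iff hz (habs hy) (by rw [hrp]; linarith)).2.2 (by linarith)
      simpa only [hrs, hrV, neg_neg] using this
    · grind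

end FanData

end Chart

lemma Wave.seg_self (b : Bool) (u : State n) : Wave.seg i b u u = [] := by simp [Wave.seg]

lemma Wave.seg_of_ne {b : Bool} (h : u ≠ v) :
    Wave.seg i b u v = [⟨i, b, u, v⟩] := by simp [Wave.seg, h]

lemma Wave.mem_seg {b : Bool} : a ∈ Wave.seg i b u v ↔ u ≠ v ∧ a = ⟨i, b, u, v⟩ := by
  rw [Wave.seg]; split_ifs with h <;> simp [h]

lemma isFan_seg {b : Bool} (h : u ≠ v → S.IsWave ρ ⟨i, b, u, v⟩) : S.IsFan ρ i u v (Wave.seg i b u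
    v) := by
  by_cases hne : u = v
  · subst hne; rw [Wave.seg_self, isFan_nil]
  · rw [Wave.seg_of_ne hne, isFan_single]
    exact ⟨⟨rfl, rfl⟩, rfl, h hne⟩

lemma isFan_cons_seg {b : Bool} (ha : S.IsWave ρ ⟨i, true, u, z⟩) (h : z ≠ v → S.IsWave ρ ⟨i, b, z,
    v⟩ ∧ (S.speed u z < S.lo ⟨i, b, z, v⟩ ∨ (S.speed u z = S.lo ⟨i, b, z, v⟩ ∧ b = false))) :
    S.IsFan ρ i u v (⟨i, true, u, z⟩ :: Wave.seg i b z v) := by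
  by_cases hne : z = v
  · subst hne; rw [Wave.seg_self, isFan_single]
    exact ⟨⟨rfl, rfl⟩, rfl, ha⟩
  · have := isFan_seg (i := i) fun h' => (h h').1
    rw [Wave.seg_of_ne hne] at this ⊢
    rw [isFan_cons_cons]
    refine ⟨⟨rfl, rfl, ha, ?_⟩, this⟩
    rcases (h hne).2 with h' | h'
    · exact Or.inl (by simpa [hi] using h')
    · exact Or.inr ⟨by simpa [hi] using h'.1, by simp [h'.2]⟩

lemma nucleation_cons (h : a.isShock = true → |S.mu i u - nuc u| < |S.mu i u - S.mu i v| → a.right =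
    S.flat ρ i kin u) : S.Nucleation ρ i kin nuc u v (a :: L) := by
  intro b hb
  rw [List.head?_cons, Option.some.injEq] at hb
  subst hb
  exact h

namespace Chart.FanData

variable {N Z k T : ℝ} (F : Γ.FanData ρ u z N Z k T)
  (hg : Γ.Good c C ρ) (hc : Γ.Convex c C)
include F hg hc

omit hc in
lemma first_shock (hx : |x| < Γ.M) (hne : x ≠ Γ.p u) : (S.dissipation u (Γ.V x u) ≤ 0 ↔ Z ≤ x ∧ x <
    Γ.p u) ∧ (Z ≤ x → x < Γ.p u → (S.Lax i u (Γ.V x u) ↔ N ≤ x) ∧ (S.speed u (Γ.V x u) ≤ S.lam i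
    (Γ.V x u) → x ≤ N) ∧ (S.speed u (Γ.V x u) < S.lam i (Γ.V x u) → x < N)) := by
  have hu := F.u_R hg
  refine ⟨F.data.diss_iff hx hne, fun h1 h2 => ?_⟩
  obtain ⟨h3, h4⟩ := F.data.lam_V_le_iff hu hx h2
  rw [Lax, Γ.speed_V hx hu hne, h3]
  have h5 := F.data.s_lt hx h1 h2
  refine ⟨⟨fun h => h.1, fun h => ⟨h, h5.le⟩⟩, fun h => ?_, fun h => ?_⟩
  · grind
  · grind

lemma isNCFan_iff {ν : ℝ} (hνN : N ≤ ν) (hflat : S.flat ρ i kin u = z) (habs : ∀ v, |S.mu i u - S.mu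
    i v| = |Γ.p u - Γ.p v|) (hnuc : |S.mu i u - nuc u| = Γ.p u - ν) : S.IsNCFan ρ i kin nuc u v L ↔
    ((v ∈ S.integralCurve ρ i u ∧ Γ.p u ≤ Γ.p v) ∧ L = Wave.seg i false u v) ∨ ((v ∈ S.hugoniot ρ i
    u ∧ ν ≤ Γ.p v ∧ Γ.p v ≤ Γ.p u) ∧ L = Wave.seg i true u v) ∨ ((v ∈ S.hugoniot ρ i z ∧ k ≤ Γ.p v ∧
    Γ.p v < T) ∧ L = ⟨i, true, u, z⟩ :: Wave.seg i true z v) ∨ ((v ∈ S.integralCurve ρ i z ∧ Γ.p v ≤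
    k) ∧ L = ⟨i, true, u, z⟩ :: Wave.seg i false z v) := by
  have hu := F.u_R hg
  have hz := F.z_R hg
  have hpz := F.p_z hg
  have hslow := hg.shocksSlow hc
  constructor
  · rintro ⟨hfan, hkin, hN1⟩
    match L, hfan with
    | [], hfan =>
      rw [isFan_nil] at hfan
      subst hfan
      exact Or.inl ⟨⟨self_mem_integralCurve F.u_lt, le_rfl⟩, (Wave.seg_self _ _).symm⟩
    | ⟨j, b, u', w⟩ :: L, hfan =>
      obtain ⟨h1, h2, h3⟩ := hfan.head
      simp only at h1 h2
      subst h1 h2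
      cases b
      · match L, hfan with
        | [], hfan =>
          obtain ⟨⟨-, h4⟩, -⟩ := isFan_single.1 hfan
          simp only at h4
          subst h4
          rcases h3 with ⟨h5, -⟩ | ⟨-, h5⟩
          · simp at h5
          · obtain ⟨h6, h7⟩ := (hc.rarefaction_iff hg.le F.p_pos).1 h5
            exact Or.inl ⟨⟨h6, h7.le⟩, (Wave.seg_of_ne (Rarefaction.ne h5).symm).symm⟩
        | b :: L, hfan => exact absurd (hfan.next hslow).1 (by simp)
      · have hw : w ∈ S.hugoniot ρ j u' ∧ w ≠ u' ∧ S.dissipation u' w ≤ 0 := by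
          rcases h3 with ⟨-, h4⟩ | ⟨h4, -⟩
          · exact h4
          · simp at h4
        obtain ⟨hw1, hw2, hw3⟩ := hw
        obtain ⟨hwρ, hwV⟩ := (mem_hugoniot hg.le F.u_lt).1 hw1
        have hwM := Γ.p_lt (hwρ.trans_le hg.le)
        have hne := (speed_of_mem hg.le F.u_lt hw1 hw2).1
        obtain ⟨h4, h5⟩ := F.first_shock hg hwM hne
        rw [hwV] at h4 h5
        obtain ⟨hZx, hxp⟩ := h4.1 hw3
        obtain ⟨hlax, hcontact, hfast⟩ := h5 hZx hxp
        have hnon : Γ.p w < N → w = z := fun h => by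
          have := hkin ⟨j, true, u', w⟩ List.mem_cons_self
            ⟨rfl, hlax.not.2 (not_le.2 h)⟩
          rwa [hflat] at this
        have hN1' : Γ.p v < ν → w = z := fun h => by
          have := hN1 ⟨j, true, u', w⟩ rfl rfl (by
            rw [hnuc, habs]
            exact lt_of_lt_of_le (by linarith) (le_abs_self _))
          rwa [hflat] at this
        match L, hfan with
        | [], hfan =>
          obtain ⟨⟨-, h6⟩, -⟩ := isFan_single.1 hfan
          simp only at h6
          subst h6
          rcases le_or_gt ν (Γ.p w) with h7 | h7
          · exact Or.inr (Or.inl ⟨⟨hw1, h7, hxp.le⟩, (Wave.seg_of_ne hw2.symm).symm⟩)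
          · have h8 := hN1' h7
            subst h8
            exact Or.inr (Or.inr (Or.inr ⟨⟨self_mem_integralCurve F.z_lt, hpz.le⟩, by
              rw [Wave.seg_self]⟩))
        | ⟨j', b', w'', w'⟩ :: L, hfan =>
          obtain ⟨-, h6, h7, h8⟩ := hfan.next hslow
          simp only at h6 h7 h8
          have hxN := hcontact h6
          obtain ⟨h9, h10, h11⟩ := h7.head
          simp only at h9 h10
          subst h9 h10
          cases b'
          · match L, h7 with
            | [], h7 =>
              obtain ⟨⟨-, h12⟩, -⟩ := isFan_single.1 h7
              simp only at h12
              subst h12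
              rcases h11 with ⟨h12, -⟩ | ⟨-, h12⟩
              · simp at h12
              simp only at h12
              have hpw : Γ.p w'' < 0 := hxN.trans_lt F.data.N_neg
              obtain ⟨h13, h14⟩ := (hc.reflect.rarefaction_iff (Γ := Γ.reflect) hg.le
                (by simpa [Chart.reflect] using hpw)).1 h12
              have h15 : Γ.p w' < Γ.p w'' := by simpa [Chart.reflect] using h14
              have h16 : w'' = z := hN1' (by linarith)
              subst h16
              rw [hpz] at h15
              exact Or.inr (Or.inr (Or.inr ⟨⟨h13, h15.le⟩, by
                rw [Wave.seg_of_ne (Rarefaction.ne h12).symm]⟩))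
            | b :: L, h7 => exact absurd (h7.next hslow).1 (by simp)
          · obtain ⟨h12, h13⟩ := h8 rfl
            have h14 := hnon (hfast h13)
            subst h14
            have hw' : w' ∈ S.hugoniot ρ j' w'' ∧ w' ≠ w'' ∧ S.dissipation w'' w' ≤ 0 := by
              rcases h11 with ⟨-, h4⟩ | ⟨h4, -⟩
              · exact h4
              · simp at h4
            obtain ⟨hw1', hw2', hw3'⟩ := hw'
            obtain ⟨hwρ', hwV'⟩ := (mem_hugoniot hg.le F.z_lt).1 hw1'
            have hwM' := Γ.p_lt (hwρ'.trans_le hg.le)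
            obtain ⟨hne', hsp⟩ := speed_of_mem hg.le F.z_lt hw1' hw2'
            rw [hpz] at hne'
            obtain ⟨h15, h16⟩ := F.second_shock hg hc hwM' hne'
            rw [hsp, F.speed_z hg] at h12
            obtain ⟨h17, h18⟩ := h15.1 ⟨by rwa [hwV'], h12⟩
            match L, h7 with
            | [], h7 =>
              obtain ⟨⟨-, h19⟩, -⟩ := isFan_single.1 h7
              simp only at h19
              subst h19
              exact Or.inr (Or.inr (Or.inl ⟨⟨hw1', h17.le, h18⟩, by
                rw [Wave.seg_of_ne hw2'.symm]⟩))
            | b :: L, h7 =>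
              have h19 := (h7.next hslow).2.1
              simp only at h19
              have h20 := (h16 h17 h18).1
              rw [hsp] at h19
              rw [hwV'] at h20
              linarith
  · rintro (⟨⟨h1, h2⟩, rfl⟩ | ⟨⟨h1, h2, h3⟩, rfl⟩ | ⟨⟨h1, h2, h3⟩, rfl⟩ | ⟨⟨h1, h2⟩, rfl⟩)
    · have hr : u ≠ v → S.Rarefaction ρ i u v := fun hne => by
        refine hc.rarefaction_of_lt hg.le h1 F.p_pos.le (lt_of_le_of_ne h2 fun h => hne ?_)
        rw [arc_right hg.le h1, ← h, Γ.W_p hu]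
      refine ⟨isFan_seg fun hne => Or.inr ⟨rfl, hr hne⟩, fun a ha hna => ?_, fun a ha hsh => ?_⟩
      · obtain ⟨hne, rfl⟩ := Wave.mem_seg.1 ha
        exact absurd hna.1 (by simp)
      · obtain ⟨hne, rfl⟩ := Wave.mem_seg.1 (List.mem_of_mem_head? ha)
        simp at hsh
    · obtain ⟨hvρ, hvV⟩ := (mem_hugoniot hg.le F.u_lt).1 h1
      have hvM := Γ.p_lt (hvρ.trans_le hg.le)
      have hNv : N ≤ Γ.p v := hνN.trans h2
      have hZv : Z ≤ Γ.p v := F.data.Z_lt.le.trans hNv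
      have hlt : u ≠ v → Γ.p v < Γ.p u := fun hne => lt_of_le_of_ne h3
        (speed_of_mem hg.le F.u_lt h1 (Ne.symm hne)).1
      have hfs : u ≠ v → _ := fun hne => F.first_shock hg hvM (hlt hne).ne
      rw [hvV] at hfs
      refine ⟨isFan_seg fun hne => Or.inl ⟨rfl, h1, Ne.symm hne, (hfs hne).1.2 ⟨hZv, hlt hne⟩⟩,
        fun a ha hna => ?_, fun a ha hsh hbig => ?_⟩
      · obtain ⟨hne, rfl⟩ := Wave.mem_seg.1 ha
        exact absurd (((hfs hne).2 hZv (hlt hne)).1.2 hNv) hna.2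
      · grind
    · obtain ⟨hvρ, hvV⟩ := (mem_hugoniot hg.le F.z_lt).1 h1
      have hvM := Γ.p_lt (hvρ.trans_le hg.le)
      have hss : z ≠ v → (k < Γ.p v) ∧ S.speed z v = Γ.s (Γ.p v) z ∧ _ := fun hne => by
        obtain ⟨hne', hsp⟩ := speed_of_mem hg.le F.z_lt h1 (Ne.symm hne)
        rw [hpz] at hne'
        exact ⟨lt_of_le_of_ne h2 (Ne.symm hne'), hsp, F.second_shock hg hc hvM hne'⟩
      rw [hvV] at hss
      refine ⟨isFan_cons_seg (F.isWave_z hg) fun hne => ?_, fun a ha hna => ?_, ?_⟩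
      · obtain ⟨h4, h5, h6, h7⟩ := hss hne
        obtain ⟨h8, h9⟩ := h6.2 ⟨h4, h3⟩
        refine ⟨Or.inl ⟨rfl, h1, Ne.symm hne, h8⟩, Or.inl ?_⟩
        simp only [lo, if_true]
        rwa [h5, F.speed_z hg]
      · rcases List.mem_cons.1 ha with rfl | ha
        · exact hflat.symm
        · obtain ⟨hne, rfl⟩ := Wave.mem_seg.1 ha
          obtain ⟨h4, h5, h6, h7⟩ := hss hne
          obtain ⟨h8, h9⟩ := h7 h4 h3
          exact absurd ⟨by simp only; rw [h5]; exact h8.le, by simp only; rw [h5]; exact h9.le⟩ hna.2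
      · exact nucleation_cons fun _ _ => hflat.symm
    · have hr : z ≠ v → S.Rarefaction ρ i z v := fun hne => by
        have := F.k_neg
        refine hc.reflect.rarefaction_of_lt (Γ := Γ.reflect) hg.le h1
          (by simp [Chart.reflect, hpz, this.le]) ?_
        simp only [Chart.reflect, hpz, neg_lt_neg_iff]
        refine lt_of_le_of_ne h2 fun h => hne ?_
        rw [arc_right hg.le h1, h, ← hpz, Γ.W_p hz]
      refine ⟨isFan_cons_seg (F.isWave_z hg) fun hne => ⟨Or.inr ⟨rfl, hr hne⟩, ?_⟩, fun a ha hna => ?_,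
        ?_⟩
      · simp only [lo, Bool.false_eq_true, if_false, and_true]
        exact (F.speed_le_lam hg).lt_or_eq
      · rcases List.mem_cons.1 ha with rfl | ha
        · exact hflat.symm
        · obtain ⟨hne, rfl⟩ := Wave.mem_seg.1 ha
          exact absurd hna.1 (by simp)
      · exact nucleation_cons fun _ _ => hflat.symm

end Chart.FanData

lemma epsilon_eq {α : Type*} [Nonempty α] {P : α → Prop} {a : α} (h : ∀ v, P v ↔ v = a) :
    Classical.epsilon P = a :=
  (h _).1 (Classical.epsilon_spec ⟨a, (h a).2 rfl⟩)

section Glue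

variable {E : Type*} [NormedAddCommGroup E] [NormedSpace ℝ E] {g h : ℝ → E} {a : ℝ}

lemma contDiffAt_succ_of_hasDerivAt {f f' : ℝ → E} {k : ℕ} (h : ∀ᶠ t in 𝓝 m, HasDerivAt f (f' t) t)
    (hk : ContDiffAt ℝ k f' m) : ContDiffAt ℝ (k + 1) f m := by
  refine contDiffAt_succ_iff_hasFDerivAt.2
    ⟨fun t => toSpanSingleton ℝ (f' t), ?_, ?_⟩
  · obtain ⟨u, hu, hmem⟩ := Filter.eventually_iff_exists_mem.1 h
    exact ⟨u, hu, fun t ht => (hmem t ht).hasFDerivAt⟩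
  · exact (toSpanSingletonCLE (𝕜 := ℝ) (E := E)).contDiff.contDiffAt.comp m hk

lemma contDiffAt_deriv {f : ℝ → E} {k l : WithTop ℕ∞} (hf : ContDiffAt ℝ k f x) (hkl : l + 1 ≤ k) :
    ContDiffAt ℝ l (deriv f) x := by
  have h := (hf.fderiv_right hkl).clm_apply (contDiffAt_const (c := (1 : ℝ)))
  exact h

omit [NormedAddCommGroup E] [NormedSpace ℝ E] in
lemma ite_eventuallyEq_of_lt (hx : a < x) : (fun x => if a ≤ x then g x else h x) =ᶠ[𝓝 x] g := by
  filter_upwards [lt_mem_nhds hx] with y hy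
  rw [if_pos (le_of_lt hy)]

omit [NormedAddCommGroup E] [NormedSpace ℝ E] in
lemma ite_eventuallyEq_of_gt (hx : x < a) : (fun x => if a ≤ x then g x else h x) =ᶠ[𝓝 x] h := by
  filter_upwards [gt_mem_nhds hx] with y hy
  rw [if_neg (not_le.2 hy)]

omit [NormedAddCommGroup E] [NormedSpace ℝ E] in
lemma ite_eqOn_Iic (h0 : g a = h a) (hx : x ≤ a) : (if a ≤ x then g x else h x) = h x := by
  rcases hx.eq_or_lt with rfl | hx
  · simp [h0]
  · rw [if_neg (not_le.2 hx)]

omit [NormedSpace ℝ E] in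
lemma continuousAt_ite (hg : ContinuousAt g a) (hh : ContinuousAt h a) (h0 : g a = h a) :
    ContinuousAt (fun x => if a ≤ x then g x else h x) a := by
  rw [← continuousWithinAt_univ, ← Iic_union_Ici (a := a)]
  refine ContinuousWithinAt.union ?_ ?_
  · exact hh.continuousWithinAt.congr (fun x hx => ite_eqOn_Iic h0 hx) (ite_eqOn_Iic h0 le_rfl)
  · exact hg.continuousWithinAt.congr (fun x hx => if_pos hx) (if_pos le_rfl)

lemma hasDerivAt_ite {d : E} (hg : HasDerivAt g d a) (hh : HasDerivAt h d a) (h0 : g a = h a) :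
    HasDerivAt (fun x => if a ≤ x then g x else h x) d a := by
  rw [← hasDerivWithinAt_univ, ← Iic_union_Ici (a := a)]
  refine HasDerivWithinAt.union ?_ ?_
  · exact hh.hasDerivWithinAt.congr (fun x hx => ite_eqOn_Iic h0 hx) (ite_eqOn_Iic h0 le_rfl)
  · exact hg.hasDerivWithinAt.congr (fun x hx => if_pos hx) (if_pos le_rfl)

lemma contDiffAt_two_ite (hg : ContDiffAt ℝ 2 g a) (hh : ContDiffAt ℝ 2 h a) (h0 : g a = h a) (h1 :
    deriv g a = deriv h a) (h2 : deriv (deriv g) a = deriv (deriv h) a) : ContDiffAt ℝ 2 (fun x =>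
    if a ≤ x then g x else h x) a ∧ deriv (deriv fun x => if a ≤ x then g x else h x) a = deriv
    (deriv g) a := by
  have aux : ∀ {w : ℝ → E}, ContDiffAt ℝ 2 w a → ∀ᶠ x in 𝓝 a, HasDerivAt w (deriv w x) x ∧
    HasDerivAt (deriv w) (deriv (deriv w) x) x ∧ ContinuousAt (deriv (deriv w)) x := by
    intro w hw
    filter_upwards [hw.eventually (by norm_num)] with x hx
    have e1 : ContDiffAt ℝ 1 (deriv w) x := contDiffAt_deriv hx (by norm_num)
    have e2 : ContDiffAt ℝ 0 (deriv (deriv w)) x := contDiffAt_deriv e1 (by norm_num)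
    exact ⟨(hx.differentiableAt (by norm_num)).hasDerivAt,
      (e1.differentiableAt (by norm_num)).hasDerivAt, e2.continuousAt⟩
  have hga := aux hg
  have hha := aux hh
  have hd1 : ∀ᶠ x in 𝓝 a, HasDerivAt (fun x => if a ≤ x then g x else h x)
      (if a ≤ x then deriv g x else deriv h x) x := by
    filter_upwards [hga, hha] with x hgx hhx
    rcases lt_trichotomy a x with hx | rfl | hx
    · rw [if_pos hx.le]
      exact hgx.1.congr_of_eventuallyEq (ite_eventuallyEq_of_lt hx)
    · rw [if_pos le_rfl]
      exact hasDerivAt_ite hgx.1 (h1 ▸ hhx.1) h0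
    · rw [if_neg (not_le.2 hx)]
      exact hhx.1.congr_of_eventuallyEq (ite_eventuallyEq_of_gt hx)
  have hd2 : ∀ᶠ x in 𝓝 a, HasDerivAt (fun x => if a ≤ x then deriv g x else deriv h x)
      (if a ≤ x then deriv (deriv g) x else deriv (deriv h) x) x := by
    filter_upwards [hga, hha] with x hgx hhx
    rcases lt_trichotomy a x with hx | rfl | hx
    · rw [if_pos hx.le]
      exact hgx.2.1.congr_of_eventuallyEq (ite_eventuallyEq_of_lt hx)
    · rw [if_pos le_rfl]
      exact hasDerivAt_ite hgx.2.1 (h2 ▸ hhx.2.1) h1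
    · rw [if_neg (not_le.2 hx)]
      exact hhx.2.1.congr_of_eventuallyEq (ite_eventuallyEq_of_gt hx)
  have hc : ∀ᶠ x in 𝓝 a, ContinuousAt
      (fun x => if a ≤ x then deriv (deriv g) x else deriv (deriv h) x) x := by
    filter_upwards [hga, hha] with x hgx hhx
    rcases lt_trichotomy a x with hx | rfl | hx
    · exact hgx.2.2.congr (ite_eventuallyEq_of_lt hx).symm
    · exact continuousAt_ite hgx.2.2 hhx.2.2 h2
    · exact hhx.2.2.congr (ite_eventuallyEq_of_gt hx).symm
  have hc0 : ContDiffAt ℝ 0 (fun x => if a ≤ x then deriv (deriv g) x else deriv (deriv h) x) a := by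
    rw [contDiffAt_zero]
    obtain ⟨u, hu, hmem⟩ := Filter.eventually_iff_exists_mem.1 hc
    exact ⟨u, hu, fun t ht => (hmem t ht).continuousWithinAt⟩
  have hc1 := contDiffAt_succ_of_hasDerivAt (k := 0) hd2 (by simpa using hc0)
  have hc2 := contDiffAt_succ_of_hasDerivAt (k := 1) hd1 (by simpa using hc1)
  refine ⟨by simpa [one_add_one_eq_two] using hc2, ?_⟩
  have he : (deriv fun x => if a ≤ x then g x else h x) =ᶠ[𝓝 a]
      fun x => if a ≤ x then deriv g x else deriv h x := hd1.mono fun x hx => hx.deriv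
  rw [he.deriv_eq, hd2.self_of_nhds.deriv, if_pos le_rfl]

/-- Twice continuously differentiable at `x`, with second derivative bounded by `B`. -/
def SmoothAt (f : ℝ → E) (B x : ℝ) : Prop :=
  ContDiffAt ℝ 2 f x ∧ ‖deriv (deriv f) x‖ ≤ B

lemma SmoothAt.congr {f f' : ℝ → E} {B : ℝ} (hf : SmoothAt f B x) (he : f' =ᶠ[𝓝 x] f) : SmoothAt f'
    B x :=
  ⟨hf.1.congr_of_eventuallyEq he, by rw [he.deriv.deriv_eq]; exact hf.2⟩

lemma smoothAt_ite {B : ℝ} (hg : a ≤ x → SmoothAt g B x) (hh : x ≤ a → SmoothAt h B x) (h0 : x = a →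
    g a = h a ∧ deriv g a = deriv h a ∧ deriv (deriv g) a = deriv (deriv h) a) : SmoothAt (fun x =>
    if a ≤ x then g x else h x) B x := by
  rcases lt_trichotomy a x with hx | rfl | hx
  · exact (hg hx.le).congr (ite_eventuallyEq_of_lt hx)
  · obtain ⟨e0, e1, e2⟩ := h0 rfl
    obtain ⟨h3, h4⟩ := contDiffAt_two_ite (hg le_rfl).1 (hh le_rfl).1 e0 e1 e2
    exact ⟨h3, by rw [h4]; exact (hg le_rfl).2⟩
  · exact (hh hx.le).congr (ite_eventuallyEq_of_gt hx)

omit [NormedSpace ℝ E] in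
lemma lipschitzOnWith_ite {s : Set ℝ} [hs : s.OrdConnected] {K : ℝ≥0} (hg : LipschitzOnWith K g (s ∩
    Ici a)) (hh : LipschitzOnWith K h (s ∩ Iic a)) (h0 : g a = h a) : LipschitzOnWith K (fun x => if
    a ≤ x then g x else h x) s := by
  have key : ∀ x ∈ s, ∀ y ∈ s, x ≤ y → dist (if a ≤ x then g x else h x) (if a ≤ y then g y else h
    y) ≤ K * dist x y := by
    intro x hx y hy hxy
    rcases le_or_gt a x with h1 | h1
    · rw [if_pos h1, if_pos (h1.trans hxy)]
      exact hg.dist_le_mul x ⟨hx, h1⟩ y ⟨hy, h1.trans hxy⟩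
    · rcases le_or_gt a y with h2 | h2
      · rw [if_neg (not_le.2 h1), if_pos h2]
        have ha : a ∈ s := hs.out hx hy ⟨h1.le, h2⟩
        calc dist (h x) (g y) ≤ dist (h x) (h a) + dist (g a) (g y) := by
              rw [h0]; exact dist_triangle _ _ _
          _ ≤ K * dist x a + K * dist a y :=
              add_le_add (hh.dist_le_mul x ⟨hx, h1.le⟩ a ⟨ha, self_mem_Iic⟩)
                (hg.dist_le_mul a ⟨ha, self_mem_Ici⟩ y ⟨hy, h2⟩)
          _ = K * dist x y := by
              rw [← mul_add, Real.dist_eq, Real.dist_eq, Real.dist_eq, abs_of_nonpos (by linarith),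
                abs_of_nonpos (by linarith), abs_of_nonpos (by linarith)]
              ring
      · rw [if_neg (not_le.2 h1), if_neg (not_le.2 h2)]
        exact hh.dist_le_mul x ⟨hx, h1.le⟩ y ⟨hy, h2.le⟩
  refine LipschitzOnWith.of_dist_le_mul fun x hx y hy => ?_
  rcases le_total x y with h1 | h1
  · exact key x hx y hy h1
  · rw [dist_comm, dist_comm x]
    exact key y hy x hx h1

lemma smoothAt_comp_sign (hσ : σ = 1 ∨ σ = -1) {f : ℝ → State n} {B : ℝ} (h : SmoothAt f B (σ * m))
    : SmoothAt (fun m => f (σ * m)) B m := by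
  rcases hσ with rfl | rfl
  · simpa using h
  · have e : (fun m => f (-1 * m)) = fun m => f (-m) := by simp
    rw [neg_one_mul] at h
    rw [e]
    exact ⟨h.1.comp m contDiff_neg.contDiffAt, by
      rw [(ConsLaw.Chart.two_jet_neg_arg (f := f) m).2]; exact h.2⟩

end Glue

namespace Chart

lemma smoothAt_V (hm : |m| < Γ.M) (hu : ‖u‖ < Γ.R) :
    SmoothAt (fun m => Γ.V m u) Γ.B m := ⟨(Γ.V_smooth hm hu).1, (Γ.V_smooth hm hu).2.2⟩

lemma smoothAt_W (hm : |m| < Γ.M) (hu : ‖u‖ < Γ.R) :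
    SmoothAt (fun m => Γ.W m u) Γ.B m := ⟨(Γ.W_smooth hm hu).1, (Γ.W_smooth hm hu).2.2⟩

lemma lipschitz_of_deriv {f : ℝ → State n} {B : ℝ} {s : Set ℝ} (hB : 0 ≤ B) (hs : _root_.Convex ℝ s)
    (h : ∀ m ∈ s, ContDiffAt ℝ 2 f m ∧ ‖deriv f m‖ ≤ B) : LipschitzOnWith B.toNNReal f s := by
  refine hs.lipschitzOnWith_of_nnnorm_deriv_le
    (fun m hm => (h m hm).1.differentiableAt (by norm_num)) fun m hm => ?_
  rw [← NNReal.coe_le_coe, coe_nnnorm, Real.coe_toNNReal _ hB]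
  exact (h m hm).2

lemma lipschitz_V (hu : ‖u‖ < Γ.R) : LipschitzOnWith Γ.B.toNNReal (fun m => Γ.V m u) (Ioo (-Γ.M)
    Γ.M) :=
  lipschitz_of_deriv Γ.B_pos.le (convex_Ioo _ _) fun _ hm =>
    ⟨(Γ.V_smooth (abs_lt.2 hm) hu).1, (Γ.V_smooth (abs_lt.2 hm) hu).2.1⟩

lemma lipschitz_W (hu : ‖u‖ < Γ.R) : LipschitzOnWith Γ.B.toNNReal (fun m => Γ.W m u) (Ioo (-Γ.M)
    Γ.M) :=
  lipschitz_of_deriv Γ.B_pos.le (convex_Ioo _ _) fun _ hm =>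
    ⟨(Γ.W_smooth (abs_lt.2 hm) hu).1, (Γ.W_smooth (abs_lt.2 hm) hu).2.1⟩

/-- The rarefaction and classical shock branch. -/
def cb (Γ : Chart S i g) (u : State n) (x : ℝ) : State n :=
  if Γ.p u ≤ x then Γ.W x u else Γ.V x u

/-- The branch behind the shock to `z`. -/
def nb (Γ : Chart S i g) (z : State n) (k x : ℝ) : State n :=
  if k ≤ x then Γ.V x z else Γ.W x z

def gl (Γ : Chart S i g) (u z : State n) (k T x : ℝ) : State n :=
  if T ≤ x then Γ.cb u x else Γ.nb z k x

lemma smoothAt_cb (hx : |x| < Γ.M) (hu : ‖u‖ < Γ.R) : SmoothAt (Γ.cb u) Γ.B x :=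
  smoothAt_ite (fun _ => smoothAt_W hx hu) (fun _ => smoothAt_V hx hu) fun _ =>
    ⟨by rw [Γ.W_p hu, Γ.V_p hu], (Γ.jet hu).1.symm, (Γ.jet hu).2.symm⟩

lemma smoothAt_nb (hx : |x| < Γ.M) (hz : ‖z‖ < Γ.R) : SmoothAt (Γ.nb z (Γ.p z)) Γ.B x :=
  smoothAt_ite (fun _ => smoothAt_V hx hz) (fun _ => smoothAt_W hx hz) fun _ =>
    ⟨by rw [Γ.W_p hz, Γ.V_p hz], (Γ.jet hz).1, (Γ.jet hz).2⟩

lemma lipschitz_cb (hu : ‖u‖ < Γ.R) : LipschitzOnWith Γ.B.toNNReal (Γ.cb u) (Ioo (-Γ.M) Γ.M) :=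
  lipschitzOnWith_ite ((lipschitz_W hu).mono inter_subset_left)
    ((lipschitz_V hu).mono inter_subset_left) (by rw [Γ.W_p hu, Γ.V_p hu])

lemma lipschitz_nb (hz : ‖z‖ < Γ.R) : LipschitzOnWith Γ.B.toNNReal (Γ.nb z (Γ.p z)) (Ioo (-Γ.M) Γ.M)
    :=
  lipschitzOnWith_ite ((lipschitz_V hz).mono inter_subset_left)
    ((lipschitz_W hz).mono inter_subset_left) (by rw [Γ.W_p hz, Γ.V_p hz])

lemma FanData.smoothAt_gl {N Z k T : ℝ} (F : Γ.FanData ρ u z N Z k T) (hg : Γ.Good c C ρ) (hx : |x|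
    < Γ.M) (hne : x ≠ T) : SmoothAt (Γ.gl u z k T) Γ.B x :=
  smoothAt_ite (fun _ => smoothAt_cb hx (F.u_R hg))
    (fun _ => by rw [← F.p_z hg]; exact smoothAt_nb hx (F.z_R hg)) fun h => absurd h hne

lemma FanData.lipschitz_gl {N Z k T : ℝ} (F : Γ.FanData ρ u z N Z k T) (hg : Γ.Good c C ρ) :
    LipschitzOnWith Γ.B.toNNReal (Γ.gl u z k T) (Ioo (-Γ.M) Γ.M) :=
  lipschitzOnWith_ite ((lipschitz_cb (F.u_R hg)).mono inter_subset_left)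
    (by rw [← F.p_z hg]; exact (lipschitz_nb (F.z_R hg)).mono inter_subset_left) (by
      rw [cb, nb, if_neg (not_le.2 F.T_lt), if_pos F.k_le_T, (F.sharp_flat hg).1])

/-- Admissible choices of the radii and of the range of the parameter. -/
structure Scale (Γ : Chart S i g) (c C ρ ε δ' δ1 : ℝ) : Prop where
  good : Γ.Good c C ρ
  ε_pos : 0 < ε
  ε_le : ε ≤ Γ.M
  δ'_le : δ' ≤ ρ
  curve_mem : ∀ z m, ‖z‖ < δ' → |m| < ε → ‖Γ.V m z‖ < ρ ∧ ‖Γ.W m z‖ < ρ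
  p_lt : ∀ z, ‖z‖ < δ' → |Γ.p z| < ε
  δ1_le : δ1 ≤ δ'
  p_small : ∀ u, ‖u‖ < δ1 → (C / c + 1) * |Γ.p u| < ε
  shock_mem : ∀ u m, ‖u‖ < δ1 → |m| ≤ (C / c + 1) * |Γ.p u| → ‖Γ.V m u‖ < δ'

lemma Scale.reflect (h : Γ.Scale c C ρ ε δ' δ1) :
    Γ.reflect.Scale c C ρ ε δ' δ1 where
  good := h.good.reflect
  ε_pos := h.ε_pos
  ε_le := h.ε_le
  δ'_le := h.δ'_le
  curve_mem := fun z m hz hm => h.curve_mem z (-m) hz (by simpa using hm)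
  p_lt := fun z hz => by simpa [Chart.reflect] using h.p_lt z hz
  δ1_le := h.δ1_le
  p_small := fun u hu => by simpa [Chart.reflect] using h.p_small u hu
  shock_mem := fun u m hu hm => h.shock_mem u (-m) hu (by simpa [Chart.reflect] using hm)

/-- The chart is parametrized by `σ μ_i`, with `σ` a sign. -/
structure Oriented (Γ : Chart S i g) (σ : ℝ) : Prop where
  sign : σ = 1 ∨ σ = -1
  p_eq : ∀ u, Γ.p u = σ * S.mu i u

namespace Oriented

variable (O : Γ.Oriented σ)
include O

lemma sq : σ * σ = 1 := by rcases O.sign with h | h <;> rw [h] <;> norm_num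

lemma abs_mul (x : ℝ) : |σ * x| = |x| := by rcases O.sign with h | h <;> simp [h]

lemma mul_eq_iff : σ * x = y ↔ x = σ * y := by
  constructor <;> rintro h
  · rw [← h, ← mul_assoc, O.sq, one_mul]
  · rw [h, ← mul_assoc, O.sq, one_mul]

lemma mu_eq (u : State n) : S.mu i u = σ * Γ.p u := O.mul_eq_iff.1 (O.p_eq u).symm

lemma mu_eq_iff : S.mu i u = m ↔ Γ.p u = σ * m := by
  rw [O.p_eq, O.mul_eq_iff, ← mul_assoc, O.sq, one_mul]

lemma abs_mu (u : State n) : |S.mu i u| = |Γ.p u| := by rw [O.p_eq, O.abs_mul]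

lemma abs_mu_sub (u v : State n) : |S.mu i u - S.mu i v| = |Γ.p u - Γ.p v| := by
  rw [O.p_eq, O.p_eq, ← mul_sub, O.abs_mul]

lemma sgn_eq (hp : 0 < Γ.p u) : S.sgn i u = σ := by
  rw [O.p_eq] at hp
  rcases O.sign with h | h
  · rw [h, one_mul] at hp; rw [sgn, Real.sign_of_pos hp, h]
  · rw [h] at hp; rw [sgn, Real.sign_of_neg (by linarith), h]

lemma reflect : Γ.reflect.Oriented (-σ) where
  sign := by rcases O.sign with h | h <;> simp [h]
  p_eq := fun u => by simp [Chart.reflect, O.p_eq]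

end Oriented

namespace Scale

variable (Sc : Γ.Scale c C ρ ε δ' δ1)
include Sc

lemma V_mem (hz : ‖z‖ < δ') (hm : |m| < ε) : Γ.V m z ∈ S.hugoniot ρ i z ∧ Γ.p (Γ.V m z) = m := by
  have hzρ := hz.trans_le Sc.δ'_le
  have hp := Γ.p_V (hm.trans_le Sc.ε_le) (hzρ.trans_le Sc.good.le)
  exact ⟨(mem_hugoniot Sc.good.le hzρ).2 ⟨(Sc.curve_mem z m hz hm).1, by rw [hp]⟩, hp⟩

lemma W_mem (hz : ‖z‖ < δ') (hm : |m| < ε) : Γ.W m z ∈ S.integralCurve ρ i z ∧ Γ.p (Γ.W m z) = m :=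
    by
  have hzR := (hz.trans_le Sc.δ'_le).trans_le Sc.good.le
  exact ⟨Γ.arc_exists (hm.trans_le Sc.ε_le) hzR fun m' hm' =>
    (Sc.curve_mem z m' hz (abs_lt_of_mem_uIcc (Sc.p_lt z hz) hm hm')).2,
    Γ.p_W (hm.trans_le Sc.ε_le) hzR⟩

lemma hugoniot_iff (hz : ‖z‖ < δ') (hm : |m| < ε) : (v ∈ S.hugoniot ρ i z ∧ Γ.p v = m) ↔ v = Γ.V m z
    := by
  constructor
  · rintro ⟨h1, h2⟩
    rw [← h2, ((mem_hugoniot Sc.good.le (hz.trans_le Sc.δ'_le)).1 h1).2]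
  · rintro rfl
    exact Sc.V_mem hz hm

lemma integral_iff (hz : ‖z‖ < δ') (hm : |m| < ε) : (v ∈ S.integralCurve ρ i z ∧ Γ.p v = m) ↔ v =
    Γ.W m z := by
  constructor
  · rintro ⟨h1, h2⟩
    rw [← h2, ← arc_right Sc.good.le h1]
  · rintro rfl
    exact Sc.W_mem hz hm

variable (O : Γ.Oriented σ)
include O

lemma hugoniotPoint_eq (hz : ‖z‖ < δ') (hm : |m| < ε) : S.hugoniotPoint ρ i m z = Γ.V (σ * m) z :=
    by
  refine epsilon_eq fun v => ?_
  rw [← Sc.hugoniot_iff hz (by rwa [O.abs_mul]), O.mu_eq_iff]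

lemma integralPoint_eq (hz : ‖z‖ < δ') (hm : |m| < ε) : S.integralPoint ρ i m z = Γ.W (σ * m) z :=
    by
  refine epsilon_eq fun v => ?_
  rw [← Sc.integral_iff hz (by rwa [O.abs_mul]), O.mu_eq_iff]

variable (hc : Γ.Convex c C)
include hc

lemma shockData (hu : ‖u‖ < δ1) (hp : 0 < Γ.p u) : ∃ N Z, Γ.ShockData u N Z ∧ -ε < Z ∧ (∀ v,
    S.IsNatural ρ i u v ↔ v = Γ.V N u) ∧ S.muNat ρ i u = σ * N ∧ (∀ v, S.IsZeroDiss ρ i u v ↔ v =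
    Γ.V Z u) ∧ S.muZero ρ i u = σ * Z ∧ ∀ x, Z ≤ x → x ≤ Γ.p u → |x| < ε ∧ |x| < Γ.M ∧ ‖Γ.V x u‖ <
    δ' := by
  have huδ := hu.trans_le Sc.δ1_le
  have huρ := huδ.trans_le Sc.δ'_le
  have huR := huρ.trans_le Sc.good.le
  obtain ⟨N, Z, hZ, D⟩ := Sc.good.exists_shockData hc huρ hp
  have hK := Sc.p_small u hu
  rw [abs_of_pos hp] at hK
  have hCc : 0 < C / c := div_pos hc.C_pos hc.c_pos
  have hrange : ∀ x, Z ≤ x → x ≤ Γ.p u → |x| < ε ∧ |x| < Γ.M ∧ ‖Γ.V x u‖ < δ' := fun x h1 h2 => by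
    have h3 : |x| ≤ (C / c + 1) * |Γ.p u| := by
      rw [abs_of_pos hp, abs_le]
      constructor <;> nlinarith
    have h4 := h3.trans_lt (Sc.p_small u hu)
    exact ⟨h4, h4.trans_le Sc.ε_le, Sc.shock_mem u x hu h3⟩
  have hNp := D.N_lt hp
  have hnat : ∀ v, S.IsNatural ρ i u v ↔ v = Γ.V N u := by
    intro v
    obtain ⟨h1, h2, h3⟩ := hrange N D.Z_lt.le hNp.le
    rw [← Sc.hugoniot_iff huδ h1, IsNatural]
    refine and_congr_right fun hv => ?_
    obtain ⟨h4, h5⟩ := (mem_hugoniot Sc.good.le huρ).1 hv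
    have hvM := Γ.p_lt (h4.trans_le Sc.good.le)
    obtain ⟨κ, hκ, hl⟩ := Γ.lax hvM huR
    rw [h5] at hl
    constructor
    · rintro ⟨hne, hs⟩
      obtain ⟨h6, h7⟩ := speed_of_mem Sc.good.le huρ hv hne
      rw [← hs, h7, sub_self] at hl
      have h8 : Γ.s1 (Γ.p v) u = 0 := by grind
      rcases lt_trichotomy (Γ.p v) N with h | h | h
      · exact absurd h8 (D.s1_neg hvM h).ne
      · exact h
      · exact absurd h8 (D.s1_pos hvM h).ne'
    · intro h
      have hne : v ≠ u := fun h' => by rw [h'] at h; linarith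
      refine ⟨hne, ?_⟩
      rw [(speed_of_mem Sc.good.le huρ hv hne).2]
      rw [h, D.s1_N, mul_zero, mul_zero] at hl
      rw [h]; linarith
  have hzero : ∀ v, S.IsZeroDiss ρ i u v ↔ v = Γ.V Z u := by
    intro v
    obtain ⟨h1, h2, h3⟩ := hrange Z le_rfl (D.Z_lt.le.trans hNp.le)
    rw [← Sc.hugoniot_iff huδ h1, IsZeroDiss]
    refine and_congr_right fun hv => ?_
    obtain ⟨h4, h5⟩ := (mem_hugoniot Sc.good.le huρ).1 hv
    have hvM := Γ.p_lt (h4.trans_le Sc.good.le)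
    constructor
    · rintro ⟨hne, hs⟩
      refine (D.diss_zero_iff hvM (speed_of_mem Sc.good.le huρ hv hne).1).1 (by rwa [h5])
    · intro h
      have hlt : Γ.p v < Γ.p u := by rw [h]; exact D.Z_lt.trans hNp
      have hne : v ≠ u := fun h' => by rw [h'] at hlt; exact lt_irrefl _ hlt
      refine ⟨hne, ?_⟩
      have := (D.diss_zero_iff hvM hlt.ne).2 h
      rwa [h5] at this
  refine ⟨N, Z, D, by nlinarith, hnat, ?_, hzero, ?_, hrange⟩
  · rw [muNat, epsilon_eq hnat, O.mu_eq, Γ.p_V (hrange N D.Z_lt.le hNp.le).2.1 huR]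
  · rw [muZero, epsilon_eq hzero, O.mu_eq, Γ.p_V (hrange Z le_rfl (D.Z_lt.trans hNp).le).2.1 huR]

lemma wellDefined_of_nonneg (hu : ‖u‖ < δ1) (hp : 0 ≤ Γ.p u) : S.WellDefined ρ ε i u := by
  have huδ := hu.trans_le Sc.δ1_le
  have hh : ∀ m, |m| < ε → ∃! v, v ∈ S.hugoniot ρ i u ∧ S.mu i v = m := fun m hm => by
    refine ⟨Γ.V (σ * m) u, ?_, fun v hv => ?_⟩
    · simp only [O.mu_eq_iff]
      exact Sc.V_mem huδ (by rwa [O.abs_mul])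
    · exact (Sc.hugoniot_iff huδ (by rwa [O.abs_mul])).1 (by rwa [← O.mu_eq_iff])
  have hi : ∀ m, |m| < ε → ∃! v, v ∈ S.integralCurve ρ i u ∧ S.mu i v = m := fun m hm => by
    refine ⟨Γ.W (σ * m) u, ?_, fun v hv => ?_⟩
    · simp only [O.mu_eq_iff]
      exact Sc.W_mem huδ (by rwa [O.abs_mul])
    · exact (Sc.integral_iff huδ (by rwa [O.abs_mul])).1 (by rwa [← O.mu_eq_iff])
  have hmu := O.p_eq u
  rcases hp.eq_or_lt with hp | hp
  · have h0 : S.mu i u = 0 := by rw [O.mu_eq, ← hp, mul_zero]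
    exact ⟨by rw [h0, abs_zero]; exact Sc.ε_pos, hh, hi, fun h => absurd h0 h, fun h => absurd h0 h,
      fun h => absurd h0 h.ne', fun h => absurd h0 h.ne⟩
  · obtain ⟨N, Z, D, hZ, hnat, hN', hzero, hZ', hr⟩ := Sc.shockData O hc hu hp
    refine ⟨by rw [O.abs_mu]; exact Sc.p_lt u huδ, hh, hi, fun _ => ?_, fun _ => ?_, fun h => ?_,
      fun h => ?_⟩
    · exact ⟨_, (hnat _).2 rfl, fun v hv => (hnat v).1 hv⟩
    · exact ⟨_, (hzero _).2 rfl, fun v hv => (hzero v).1 hv⟩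
    · have hσ : σ = 1 := by
        rcases O.sign with h' | h'
        · exact h'
        · rw [h'] at hmu; linarith
      rw [hN', hZ', hσ, one_mul, one_mul]
      exact ⟨hZ, D.Z_lt, D.N_neg⟩
    · have hσ : σ = -1 := by
        rcases O.sign with h' | h'
        · rw [h'] at hmu; linarith
        · exact h'
      rw [hN', hZ', hσ]
      have := D.Z_lt
      have := D.N_neg
      refine ⟨by linarith, by linarith, by linarith⟩

lemma wellDefined (hu : ‖u‖ < δ1) : S.WellDefined ρ ε i u := by
  rcases le_total 0 (Γ.p u) with hp | hp
  · exact Sc.wellDefined_of_nonneg O hc hu hp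
  · exact Sc.reflect.wellDefined_of_nonneg O.reflect hc.reflect hu (by simpa [Chart.reflect] using hp)

/-- The data of the wave curve issuing from `u`, given a kinetic function. -/
lemma exists_fanData (hkin : S.IsKinetic ρ δ1 i kin) (hu : ‖u‖ < δ1) (hp : 0 < Γ.p u) : ∃ N Z T,
    Γ.FanData ρ u (S.flat ρ i kin u) N Z (σ * kin u) T ∧ ‖S.flat ρ i kin u‖ < δ' ∧ S.muNat ρ i u = σ
    * N ∧ (∀ v, S.IsSharp ρ i kin u v ↔ v = Γ.V T u) ∧ S.muSharp ρ i kin u = σ * T := by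
  have huδ := hu.trans_le Sc.δ1_le
  have huρ := huδ.trans_le Sc.δ'_le
  have huR := huρ.trans_le Sc.good.le
  obtain ⟨N, Z, D, hZ, hnat, hN', hzero, hZ', hr⟩ := Sc.shockData O hc hu hp
  have hNp := D.N_lt hp
  have hsg := O.sgn_eq hp
  have hk : Z < σ * kin u ∧ σ * kin u ≤ N := by
    obtain ⟨h1, h2⟩ := hkin u (by simpa using hu)
    have hmu := O.p_eq u
    rw [hN', hZ'] at h1 h2
    rcases O.sign with h | h
    · rw [h, one_mul] at hmu
      rw [h, one_mul, one_mul] at h1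
      rw [h, one_mul]
      exact h1 (by linarith)
    · rw [h] at hmu h2 ⊢
      obtain ⟨h3, h4⟩ := h2 (by linarith)
      constructor <;> linarith
  obtain ⟨hkε, hkM, hkδ⟩ := hr _ hk.1.le (hk.2.trans hNp.le)
  have hflat : S.flat ρ i kin u = Γ.V (σ * kin u) u :=
    Sc.hugoniotPoint_eq O huδ (by rwa [O.abs_mul] at hkε)
  obtain ⟨T, hNT, hTp, hsT, huniq⟩ := D.exists_sharp huR hp hk.1 hk.2 hkM
  obtain ⟨hTε, hTM, hTδ⟩ := hr T (D.Z_lt.le.trans hNT) hTp.le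
  have F : Γ.FanData ρ u (S.flat ρ i kin u) N Z (σ * kin u) T :=
    ⟨huρ, hp, D, hk.1, hk.2, hkM, hflat.symm, by rw [hflat]; exact hkδ.trans_le Sc.δ'_le, hNT, hTp,
      hsT, hTδ.trans_le Sc.δ'_le⟩
  have hsharp : ∀ v, S.IsSharp ρ i kin u v ↔ v = Γ.V T u := by
    intro v
    rw [← Sc.hugoniot_iff huδ hTε, IsSharp, hsg, hN', ← mul_assoc, O.sq, one_mul, ← O.p_eq, ← O.p_eq,
      F.speed_z Sc.good]
    refine and_congr_right fun hv => ?_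
    constructor
    · rintro ⟨h1, h2, h3⟩
      have hne : v ≠ u := fun h => by rw [h] at h3; exact lt_irrefl _ h3
      rw [(speed_of_mem Sc.good.le huρ hv hne).2] at h1
      exact huniq _ h2 h3 h1
    · intro h
      have hne : v ≠ u := fun h' => by rw [h'] at h; linarith
      rw [(speed_of_mem Sc.good.le huρ hv hne).2, h]
      exact ⟨hsT, hNT, hTp⟩
  refine ⟨N, Z, T, F, by rw [hflat]; exact hkδ, hN', hsharp, ?_⟩
  rw [muSharp, epsilon_eq hsharp, O.mu_eq, Γ.p_V hTM huR]

end Scale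

end Chart

lemma iteratedDeriv_two_eq {E : Type*} [NormedAddCommGroup E] [NormedSpace ℝ E] (f : ℝ → E) :
    iteratedDeriv 2 f = deriv (deriv f) := by
  rw [iteratedDeriv_succ, iteratedDeriv_one]

lemma setOf_isNCFan_eq {P₁ P₂ P₃ P₄ : State n → Prop} {L1 L2 L3 L4 : State n → List (Wave n)} (h : ∀
    v L, S.IsNCFan ρ i kin nuc u v L ↔ (P₁ v ∧ L = L1 v) ∨ (P₂ v ∧ L = L2 v) ∨ (P₃ v ∧ L = L3 v) ∨
    (P₄ v ∧ L = L4 v)) : {v | ∃ L, S.IsNCFan ρ i kin nuc u v L} = {v | P₁ v} ∪ {v | P₂ v} ∪ {v | P₃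
    v} ∪ {v | P₄ v} := by
  ext v
  simp only [mem_ofPred_eq, h, mem_union]
  constructor
  · grind
  · grind

namespace Chart.Scale

variable (Sc : Γ.Scale c C ρ ε δ' δ1) (O : Γ.Oriented σ)
  (hc : Γ.Convex c C)
include Sc O hc

omit Sc hc in
/-- The pieces of the wave curve, in terms of the parameter of the chart. -/
lemma pieces (hp : 0 < Γ.p u) {T : ℝ} (hT : S.muSharp ρ i kin u = σ * T) (v : State n) : (v ∈
    S.piece1 ρ i u ↔ v ∈ S.integralCurve ρ i u ∧ Γ.p u ≤ Γ.p v) ∧ (v ∈ S.piece2 ρ i nuc u ↔ v ∈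
    S.hugoniot ρ i u ∧ σ * nuc u ≤ Γ.p v ∧ Γ.p v ≤ Γ.p u) ∧ (v ∈ S.piece3 ρ i kin u ↔ v ∈ S.hugoniot
    ρ i (S.flat ρ i kin u) ∧ σ * kin u ≤ Γ.p v ∧ Γ.p v < T) ∧ (v ∈ S.piece4 ρ i kin u ↔ v ∈
    S.integralCurve ρ i (S.flat ρ i kin u) ∧ Γ.p v ≤ σ * kin u) := by
  have hsg := O.sgn_eq hp
  simp only [piece1, piece2, piece3, piece4, mem_ofPred_eq, hsg, hT, ← mul_assoc, O.sq, one_mul,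
    ← O.p_eq, and_self, iff_self]

omit Sc hc in
lemma threshold (hnuc : S.IsThreshold ρ δ1 i kin nuc) (hu : ‖u‖ < δ1) (hp : 0 < Γ.p u) {N T : ℝ} (hN
    : S.muNat ρ i u = σ * N) (hT : S.muSharp ρ i kin u = σ * T) : N ≤ σ * nuc u ∧ σ * nuc u ≤ T :=
    by
  obtain ⟨h1, h2⟩ := hnuc u (by simpa using hu)
  have hmu := O.p_eq u
  rw [hN, hT] at h1 h2
  rcases O.sign with h | h
  · rw [h, one_mul] at hmu
    rw [h, one_mul, one_mul] at h1
    rw [h, one_mul]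
    exact h1 (by linarith)
  · rw [h] at hmu h2 ⊢
    obtain ⟨h3, h4⟩ := h2 (by linarith)
    constructor <;> linarith

lemma fans (hkin : S.IsKinetic ρ δ1 i kin) (hnuc : S.IsThreshold ρ δ1 i kin nuc) (hu : ‖u‖ < δ1) (hp
    : 0 < Γ.p u) (v : State n) (L : List (Wave n)) : S.IsNCFan ρ i kin nuc u v L ↔ (v ∈ S.piece1 ρ i
    u ∧ L = Wave.seg i false u v) ∨ (v ∈ S.piece2 ρ i nuc u ∧ L = Wave.seg i true u v) ∨ (v ∈
    S.piece3 ρ i kin u ∧ L = ⟨i, true, u, S.flat ρ i kin u⟩ :: Wave.seg i true (S.flat ρ i kin u) v)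
    ∨ (v ∈ S.piece4 ρ i kin u ∧ L = ⟨i, true, u, S.flat ρ i kin u⟩ :: Wave.seg i false (S.flat ρ i
    kin u) v) := by
  obtain ⟨N, Z, T, F, hz, hN, hsharp, hT⟩ := Sc.exists_fanData O hc hkin hu hp
  obtain ⟨hν1, hν2⟩ := threshold O hnuc hu hp hN hT
  obtain ⟨h1, h2, h3, h4⟩ := pieces O hp hT (nuc := nuc) v
  rw [F.isNCFan_iff Sc.good hc hν1 rfl (O.abs_mu_sub u) ?_, h1, h2, h3, h4]
  have : S.mu i u - nuc u = σ * (Γ.p u - σ * nuc u) := by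
    rw [mul_sub, ← O.mu_eq, ← mul_assoc, O.sq, one_mul]
  rw [this, O.abs_mul, abs_of_nonneg]
  linarith [F.T_lt]

omit hc in
lemma classicalBranch_eq (hu : ‖u‖ < δ1) (hp : 0 < Γ.p u) (hm : |m| < ε) : S.classicalBranch ρ i u m
    = Γ.cb u (σ * m) := by
  rw [classicalBranch, cb, O.sgn_eq hp, ← O.p_eq, Sc.integralPoint_eq O (hu.trans_le Sc.δ1_le) hm,
    Sc.hugoniotPoint_eq O (hu.trans_le Sc.δ1_le) hm]

omit hc in
lemma nonclassicalBranch_eq (hp : 0 < Γ.p u) (hz : ‖S.flat ρ i kin u‖ < δ') (hm : |m| < ε) :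
    S.nonclassicalBranch ρ i kin u m = Γ.nb (S.flat ρ i kin u) (σ * kin u) (σ * m) := by
  rw [nonclassicalBranch, nb, O.sgn_eq hp, Sc.integralPoint_eq O hz hm,
    Sc.hugoniotPoint_eq O hz hm]

lemma ncCurveAt (hkin : S.IsKinetic ρ δ1 i kin) (hnuc : S.IsThreshold ρ δ1 i kin nuc) (hu : ‖u‖ <
    δ1) (hp : 0 < Γ.p u) {B : ℝ≥0} (hB : Γ.B ≤ B) : S.NCCurveAt ρ ε B i kin nuc u := by
  obtain ⟨N, Z, T, F, hz, hN, hsharp, hT⟩ := Sc.exists_fanData O hc hkin hu hp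
  obtain ⟨hν1, hν2⟩ := threshold O hnuc hu hp hN hT
  have hpc := pieces O hp hT (nuc := nuc)
  have hsg := O.sgn_eq hp
  have huδ := hu.trans_le Sc.δ1_le
  have hu' := F.u_R Sc.good
  have hz' := F.z_R Sc.good
  have hpz := F.p_z Sc.good
  have hcb : ∀ m, |m| < ε → S.classicalBranch ρ i u m = Γ.cb u (σ * m) :=
    fun m hm => Sc.classicalBranch_eq O hu hp hm
  have hnb : ∀ m, |m| < ε → S.nonclassicalBranch ρ i kin u m =
      Γ.nb (S.flat ρ i kin u) (σ * kin u) (σ * m) :=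
    fun m hm => Sc.nonclassicalBranch_eq O hp hz hm
  have hgl : ∀ m, |m| < ε → S.gluedBranch ρ i kin u m =
      Γ.gl u (S.flat ρ i kin u) (σ * kin u) T (σ * m) := fun m hm => by
    rw [gluedBranch, gl, hsg, hT, ← mul_assoc, O.sq, one_mul, hcb m hm, hnb m hm]
  have habs : ∀ {m}, |m| < ε → |σ * m| < ε := fun hm => by rwa [O.abs_mul]
  have hM : ∀ {m}, |m| < ε → |σ * m| < Γ.M := fun hm => (habs hm).trans_le Sc.ε_le
  have hmaps : MapsTo (fun m => σ * m) (Ioo (-ε) ε) (Ioo (-Γ.M) Γ.M) := fun m hm =>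
    abs_lt.1 (hM (abs_lt.2 hm))
  have hmulLip : LipschitzWith 1 (fun m : ℝ => σ * m) :=
    LipschitzWith.of_dist_le_mul fun x y => by
      rw [Real.dist_eq, Real.dist_eq, ← mul_sub, O.abs_mul, NNReal.coe_one, one_mul]
  have hnear : ∀ {m}, |m| < ε → ∀ᶠ x in 𝓝 m, |x| < ε := fun hm =>
    (continuous_abs.tendsto _).eventually (gt_mem_nhds hm)
  have hBB : Γ.B.toNNReal ≤ B := Real.toNNReal_le_iff_le_coe.2 hB
  refine ⟨⟨_, (hsharp _).2 rfl, fun v hv => (hsharp v).1 hv⟩, F.isWave_z Sc.good, fun hne hlax => ?_,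
    Sc.fans O hc hkin hnuc hu hp, fun v hv hne => ?_, fun v hv hne => ?_, fun m hm hmν => ?_,
    fun m hm hmT => ?_, ?_, ?_, fun v hv hvε => ?_, fun v hv hvε => ?_, fun _ m hm hmT => ?_,
    fun _ => ?_⟩
  · refine hne ?_
    have h1 := (F.lax_z_iff Sc.good).1 hlax.1
    have h2 : σ * kin u = N := le_antisymm F.k_le h1
    rw [hN, ← h2, ← mul_assoc, O.sq, one_mul]
  · obtain ⟨h1, h2, h3⟩ := (hpc v).2.1.1 hv
    obtain ⟨h4, h5⟩ := (mem_hugoniot Sc.good.le F.u_lt).1 h1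
    have h6 := (speed_of_mem Sc.good.le F.u_lt h1 hne).1
    have h7 := F.first_shock Sc.good (Γ.p_lt (h4.trans_le Sc.good.le)) h6
    rw [h5] at h7
    have := F.data.Z_lt
    exact (h7.2 (by linarith) (lt_of_le_of_ne h3 h6)).1.2 (by linarith)
  · obtain ⟨h1, h2, h3⟩ := (hpc v).2.2.1.1 hv
    obtain ⟨h4, h5⟩ := (mem_hugoniot Sc.good.le F.z_lt).1 h1
    obtain ⟨h6, h8⟩ := speed_of_mem Sc.good.le F.z_lt h1 hne
    rw [hpz] at h6
    have h7 := (F.second_shock Sc.good hc (Γ.p_lt (h4.trans_le Sc.good.le)) h6).2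
      (lt_of_le_of_ne h2 (Ne.symm h6)) h3
    rw [h5, ← h8] at h7
    exact ⟨h7.1.le, h7.2.le⟩
  · rw [hsg] at hmν
    rw [hcb m hm, mem_union, (hpc _).1, (hpc _).2.1, O.mu_eq_iff, cb]
    split_ifs with h
    · obtain ⟨h1, h2⟩ := Sc.W_mem huδ (habs hm)
      rw [h2]
      exact ⟨Or.inl ⟨h1, h⟩, rfl⟩
    · obtain ⟨h1, h2⟩ := Sc.V_mem huδ (habs hm)
      rw [h2]
      exact ⟨Or.inr ⟨h1, hmν, (not_le.1 h).le⟩, rfl⟩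
  · rw [hsg, hT, ← mul_assoc, O.sq, one_mul] at hmT
    rw [hnb m hm, mem_union, (hpc _).2.2.1, (hpc _).2.2.2, O.mu_eq_iff, nb]
    split_ifs with h
    · obtain ⟨h1, h2⟩ := Sc.V_mem hz (habs hm)
      rw [h2]
      exact ⟨Or.inl ⟨h1, h, hmT⟩, rfl⟩
    · obtain ⟨h1, h2⟩ := Sc.W_mem hz (habs hm)
      rw [h2]
      exact ⟨Or.inr ⟨h1, (not_le.1 h).le⟩, rfl⟩
  · refine ContinuousOn.congr (f := fun m => Γ.cb u (σ * m)) (fun m hm => ?_) fun m hm => hcb m hm.1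
    exact (smoothAt_comp_sign O.sign (smoothAt_cb (hM hm.1) hu')).1.continuousAt.continuousWithinAt
  · refine ContinuousOn.congr (f := fun m => Γ.nb (S.flat ρ i kin u) (σ * kin u) (σ * m))
      (fun m hm => ?_) fun m hm => hnb m hm.1
    rw [← hpz]
    exact (smoothAt_comp_sign O.sign (smoothAt_nb (hM hm.1) hz')).1.continuousAt.continuousWithinAt
  · rw [hcb _ hvε, ← O.p_eq, cb]
    rcases hv with hv | hv
    · obtain ⟨h1, h2⟩ := (hpc v).1.1 hv
      rw [if_pos h2]
      exact arc_right Sc.good.le h1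
    · obtain ⟨h1, h2, h3⟩ := (hpc v).2.1.1 hv
      have h5 := ((mem_hugoniot Sc.good.le F.u_lt).1 h1).2
      rcases h3.eq_or_lt with h3 | h3
      · rw [if_pos h3.ge, h3, Γ.W_p hu', ← h5, h3, Γ.V_p hu']
      · rw [if_neg (not_le.2 h3), h5]
  · rw [hnb _ hvε, ← O.p_eq, nb]
    rcases hv with hv | hv
    · obtain ⟨h1, h2, -⟩ := (hpc v).2.2.1.1 hv
      rw [if_pos h2]
      exact ((mem_hugoniot Sc.good.le F.z_lt).1 h1).2.symm
    · obtain ⟨h1, h2⟩ := (hpc v).2.2.2.1 hv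
      have h5 := arc_right Sc.good.le h1
      rcases h2.eq_or_lt with h3 | h3
      · rw [if_pos h3.ge, h3, ← hpz, Γ.V_p hz']
        rw [h5, h3, ← hpz, Γ.W_p hz']
      · grind
  · have h1 : SmoothAt (S.gluedBranch ρ i kin u) Γ.B m := by
      refine (smoothAt_comp_sign O.sign (F.smoothAt_gl Sc.good (hM hm) fun h => hmT ?_)).congr ?_
      · rw [hT, ← h, ← mul_assoc, O.sq, one_mul]
      · filter_upwards [hnear hm] with x hx using hgl x hx
    rw [iteratedDeriv_two_eq]
    exact ⟨h1.1, h1.2.trans hB⟩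
  · have h1 := ((F.lipschitz_gl Sc.good).comp (hmulLip.lipschitzOnWith (s := Ioo (-ε) ε)) hmaps).weaken
      (K' := B) (by rw [mul_one]; exact hBB)
    intro x hx y hy
    rw [hgl x (abs_lt.2 hx), hgl y (abs_lt.2 hy)]
    exact h1 hx hy

lemma ncCurve_eq (hkin : S.IsKinetic ρ δ1 i kin) (hnuc : S.IsThreshold ρ δ1 i kin nuc) (hu : ‖u‖ <
    δ1) (hp : 0 < Γ.p u) : {v | ∃ L, S.IsNCFan ρ i kin nuc u v L} = S.ncCurve ρ i kin nuc u := by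
  rw [setOf_isNCFan_eq (Sc.fans O hc hkin hnuc hu hp), ncCurve, if_neg]
  · rfl
  · intro h
    rw [O.mu_eq_iff, mul_zero] at h
    linarith

omit O in
lemma fans_of_zero (hu : ‖u‖ < δ1) (hp : Γ.p u = 0) (v : State n) (L : List (Wave n)) : S.IsNCFan ρ
    i kin nuc u v L ↔ v ∈ S.integralCurve ρ i u ∧ L = Wave.seg i false u v := by
  rw [IsNCFan, Sc.good.isFan_iff_of_zero hc ((hu.trans_le Sc.δ1_le).trans_le Sc.δ'_le) hp]
  refine ⟨fun h => h.1, ?_⟩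
  rintro ⟨h, rfl⟩
  refine ⟨⟨h, rfl⟩, fun a ha hna => ?_, fun a ha hsh => ?_⟩
  · obtain ⟨hne, rfl⟩ := Wave.mem_seg.1 ha
    exact absurd hna.1 (by simp)
  · obtain ⟨hne, rfl⟩ := Wave.mem_seg.1 (List.mem_of_mem_head? ha)
    simp at hsh

lemma ncCurveAtZero (hu : ‖u‖ < δ1) (hp : Γ.p u = 0) {B : ℝ≥0} (hB : Γ.B ≤ B) : S.NCCurveAtZero ρ ε
    B i kin nuc u := by
  have huδ := hu.trans_le Sc.δ1_le
  have huR := (huδ.trans_le Sc.δ'_le).trans_le Sc.good.le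
  have hM : ∀ {m}, |m| < ε → |σ * m| < Γ.M := fun hm => by
    rw [O.abs_mul]; exact hm.trans_le Sc.ε_le
  refine ⟨Sc.fans_of_zero hc hu hp, fun m hm => ?_, ?_⟩
  · have h1 : SmoothAt (fun m => S.integralPoint ρ i m u) Γ.B m := by
      refine (smoothAt_comp_sign O.sign (smoothAt_W (hM hm) huR)).congr ?_
      filter_upwards [(continuous_abs.tendsto _).eventually (gt_mem_nhds hm)] with x hx
        using Sc.integralPoint_eq O huδ hx
    rw [iteratedDeriv_two_eq]
    exact ⟨h1.1, h1.2.trans hB⟩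
  · have hmulLip : LipschitzWith 1 (fun m : ℝ => σ * m) :=
      LipschitzWith.of_dist_le_mul fun x y => by
        rw [Real.dist_eq, Real.dist_eq, ← mul_sub, O.abs_mul, NNReal.coe_one, one_mul]
    have h1 := ((lipschitz_W huR).comp (hmulLip.lipschitzOnWith (s := Ioo (-ε) ε))
      fun m hm => abs_lt.1 (hM (abs_lt.2 hm))).weaken (K' := B)
      (by rw [mul_one]; exact Real.toNNReal_le_iff_le_coe.2 hB)
    intro x hx y hy
    simp only [Sc.integralPoint_eq O huδ (abs_lt.2 hx), Sc.integralPoint_eq O huδ (abs_lt.2 hy)]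
    exact h1 hx hy

/-- The first part of the theorem. -/
lemma waveCurve_spec (hkin : S.IsKinetic ρ δ1 i kin) (hnuc : S.IsThreshold ρ δ1 i kin nuc) (hu : ‖u‖
    < δ1) {B : ℝ≥0} (hB : Γ.B ≤ B) : {v | ∃ L, S.IsNCFan ρ i kin nuc u v L} = S.ncCurve ρ i kin nuc
    u ∧ S.ncCurve ρ i kin nuc u ⊆ S.waveSet ρ i u ∧ (S.mu i u ≠ 0 → S.NCCurveAt ρ ε B i kin nuc u) ∧
    (S.mu i u = 0 → S.NCCurveAtZero ρ ε B i kin nuc u) := by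
  have h1 : {v | ∃ L, S.IsNCFan ρ i kin nuc u v L} = S.ncCurve ρ i kin nuc u := by
    rcases lt_trichotomy 0 (Γ.p u) with hp | hp | hp
    · exact Sc.ncCurve_eq O hc hkin hnuc hu hp
    · ext v
      rw [ncCurve, if_pos (O.mu_eq_iff.2 (by rw [mul_zero, hp]))]
      simp [Sc.fans_of_zero hc hu hp.symm]
    · exact Sc.reflect.ncCurve_eq O.reflect hc.reflect hkin hnuc hu
        (by simpa [Chart.reflect] using hp)
  refine ⟨h1, ?_, fun h => ?_, fun h => ?_⟩
  · rw [← h1]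
    rintro v ⟨L, hL⟩
    exact ⟨L, hL.1⟩
  · rcases lt_trichotomy 0 (Γ.p u) with hp | hp | hp
    · exact Sc.ncCurveAt O hc hkin hnuc hu hp hB
    · exact absurd (by rw [O.mu_eq, ← hp, mul_zero]) h
    · exact Sc.reflect.ncCurveAt O.reflect hc.reflect hkin hnuc hu
        (by simpa [Chart.reflect] using hp) hB
  · rw [O.mu_eq_iff, mul_zero] at h
    exact Sc.ncCurveAtZero O hc hu h hB

end Chart.Scale

namespace Chart

lemma Q_bounds (hu : ‖u‖ < Γ.R) (hx : |x| < Γ.M) (hle : x ≤ Γ.p u) : Γ.q / 2 * (Γ.p u - x) ^ 2 ≤ Γ.Q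
    x u ∧ Γ.Q x u ≤ 3 * Γ.q / 2 * (Γ.p u - x) ^ 2 := by
  choose! k hk using fun z (hz : |z| < Γ.M) => Γ.Q_deriv hz hu
  have hm : ∀ z ∈ uIcc x (Γ.p u), |z| < Γ.M := fun z hz => abs_lt_of_mem_uIcc hx (Γ.p_lt hu) hz
  have key : ∀ r : ℝ, ∃ ξ ∈ uIcc x (Γ.p u), -(Γ.Q x u - r / 2 * (Γ.p u - x) ^ 2) = (ξ - Γ.p u) * (k
    ξ - r) * (Γ.p u - x) := by
    intro r
    obtain ⟨ξ, hξ, he⟩ := exists_slope_eq (a := x) (b := Γ.p u)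
      (f := fun z => Γ.Q z u - r / 2 * (Γ.p u - z) ^ 2)
      (f' := fun z => (z - Γ.p u) * (k z - r)) (fun z hz => by
        have h2 : HasDerivAt (fun z : ℝ => Γ.p u - z) (-1) z := (hasDerivAt_id z).const_sub _
        refine ((hk z (hm z hz)).2.2.sub ((h2.pow 2).const_mul (r / 2))).congr_deriv ?_
        simp; ring)
    refine ⟨ξ, hξ, ?_⟩
    simp only [Γ.Q_self hu, sub_self] at he
    linarith
  constructor
  · obtain ⟨ξ, hξ, he⟩ := key Γ.q
    have h1 := (hk ξ (hm ξ hξ)).1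
    rw [uIcc_of_le hle] at hξ
    have : (ξ - Γ.p u) * (k ξ - Γ.q) * (Γ.p u - x) ≤ 0 :=
      mul_nonpos_of_nonpos_of_nonneg (mul_nonpos_of_nonpos_of_nonneg (by linarith [hξ.2])
        (by linarith)) (by linarith)
    linarith
  · obtain ⟨ξ, hξ, he⟩ := key (3 * Γ.q)
    have h1 := (hk ξ (hm ξ hξ)).2.1
    rw [uIcc_of_le hle] at hξ
    have : 0 ≤ (ξ - Γ.p u) * (k ξ - 3 * Γ.q) * (Γ.p u - x) :=
      mul_nonneg (mul_nonneg_of_nonpos_of_nonpos (by linarith [hξ.2])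
        (by linarith)) (by linarith)
    linarith

lemma Convex.strength (hc : Γ.Convex c C) {N Z k : ℝ} (D : Γ.ShockData u N Z) (hu : ‖u‖ < Γ.R) (hp :
    0 < Γ.p u) (hk : |k| < Γ.M) (hZ : Z ≤ k) (hkN : k ≤ N) : 3 * c / 32 * Γ.p u ^ 2 ≤ S.lam i u -
    Γ.s k u := by
  have hcp := hc.c_pos
  set a := Γ.p u with ha
  have haM : |a| < Γ.M := Γ.p_lt hu
  have hNa : N < a := D.N_lt hp
  have hNM : |N| < Γ.M := abs_lt_of_mem_Icc hk haM ⟨hkN, hNa.le⟩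
  have hm : ∀ z ∈ Icc k a, |z| < Γ.M := fun z hz => abs_lt_of_mem_Icc hk haM hz
  obtain ⟨hQ1, hQ2⟩ := Q_bounds hu hNM hNa.le
  rw [← ha] at hQ1 hQ2
  have hq := Γ.q_pos
  have hQN : 0 < Γ.Q N u := by
    have : 0 < a - N := by linarith
    have : 0 < Γ.q / 2 * (a - N) ^ 2 := by positivity
    linarith
  have hder : ∀ z ∈ Icc k a, HasDerivAt
      (fun z => S.dissipation u (Γ.V z u) - Γ.Q N u * (Γ.s z u - S.lam i u))
      (Γ.s1 z u * (Γ.Q z u - Γ.Q N u)) z := fun z hz =>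
    ((Γ.E_deriv (hm z hz) hu).sub (((Γ.s_deriv (hm z hz) hu).sub_const _).const_mul _)).congr_deriv
      (by ring)
  have hmono : ∀ y z, k ≤ y → y ≤ z → z ≤ a → (z ≤ N ∨ N ≤ y) → S.dissipation u (Γ.V z u) - Γ.Q N u
    * (Γ.s z u - S.lam i u) ≤ S.dissipation u (Γ.V y u) - Γ.Q N u * (Γ.s y u - S.lam i u) := by
    intro y z hy hyz hza hor
    rcases hyz.eq_or_lt with rfl | hyz
    · exact le_rfl
    refine (lt_of_deriv_neg hyz (fun t ht => hder t ⟨hy.trans ht.1, ht.2.trans hza⟩) fun t ht => ?_).le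
    have htM := hm t ⟨hy.trans ht.1.le, ht.2.le.trans hza⟩
    rcases hor with h | h
    · have htN : t < N := ht.2.trans_le h
      exact mul_neg_of_neg_of_pos (D.s1_neg htM htN) (sub_pos.2 (Q_lt hu htM htN hNa.le))
    · have htN : N < t := h.trans_lt ht.1
      exact mul_neg_of_pos_of_neg (D.s1_pos htM htN)
        (sub_neg.2 (Q_lt hu hNM htN (ht.2.le.trans hza)))
  set x := a - (a - N) / 4 with hx
  have h1 := hmono k N le_rfl hkN hNa.le (Or.inl le_rfl)
  have h2 := hmono N x hkN (by rw [hx]; linarith) (by rw [hx]; linarith) (Or.inr le_rfl)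
  obtain ⟨ξ, hξ, he⟩ := exists_slope_eq (a := x) (b := a) (fun z hz => by
    rw [uIcc_of_le (by rw [hx]; linarith)] at hz
    exact hder z ⟨by linarith [hz.1], hz.2⟩)
  rw [uIcc_of_le (by rw [hx]; linarith)] at hξ
  simp only [ha, Γ.V_p hu, Γ.s_self hu, diss_self, sub_self, mul_zero] at he
  rw [← ha] at he
  have hξM := hm ξ ⟨by linarith [hξ.1], hξ.2⟩
  have h3 := (Q_bounds hu hξM hξ.2).2
  have h4 : c * (3 / 4 * (a - N)) ≤ Γ.s1 ξ u := by
    have := hc.s1_mono hu hNM hξM (by linarith [hξ.1])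
    rw [D.s1_N] at this
    have h5 : 3 / 4 * (a - N) ≤ ξ - N := by linarith [hξ.1]
    nlinarith
  have h5 : Γ.Q ξ u ≤ Γ.Q N u / 2 := by
    have h6 : (a - ξ) ^ 2 ≤ ((a - N) / 4) ^ 2 :=
      pow_le_pow_left₀ (by linarith [hξ.2]) (by linarith [hξ.1]) 2
    have h7 : 3 * Γ.q / 2 * (a - ξ) ^ 2 ≤ 3 * Γ.q / 2 * ((a - N) / 4) ^ 2 :=
      by gcongr
    have h8 : 3 * Γ.q / 2 * ((a - N) / 4) ^ 2 = 3 / 16 * (Γ.q / 2 * (a - N) ^ 2) := by ring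
    rw [← ha] at h3
    linarith
  have hE : S.dissipation u (Γ.V k u) ≤ 0 :=
    (D.diss_iff hk (by rw [← ha]; linarith)).2 ⟨hZ, by rw [← ha]; linarith⟩
  have h6 : c * (3 / 4 * (a - N)) * (Γ.Q N u / 2) ≤ Γ.s1 ξ u * (Γ.Q N u - Γ.Q ξ u) := by
    refine mul_le_mul h4 (by linarith) (by positivity) ?_
    refine le_trans ?_ h4
    have : 0 < a - N := by linarith
    positivity
  have h7 : Γ.s1 ξ u * (Γ.Q ξ u - Γ.Q N u) * (a - x) =
      -(Γ.s1 ξ u * (Γ.Q N u - Γ.Q ξ u) * ((a - N) / 4)) := by rw [hx]; ring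
  have h8 : c * (3 / 4 * (a - N)) * (Γ.Q N u / 2) * ((a - N) / 4) ≤
      Γ.s1 ξ u * (Γ.Q N u - Γ.Q ξ u) * ((a - N) / 4) :=
    by gcongr
  have h9 : Γ.Q N u * (3 * c / 32 * (a - N) ^ 2) ≤ Γ.Q N u * (S.lam i u - Γ.s k u) := by
    have : c * (3 / 4 * (a - N)) * (Γ.Q N u / 2) * ((a - N) / 4) =
      Γ.Q N u * (3 * c / 32 * (a - N) ^ 2) := by ring
    linarith
  have h10 := le_of_mul_le_mul_left h9 hQN
  have h11 : a ^ 2 ≤ (a - N) ^ 2 := pow_le_pow_left₀ hp.le (by linarith [D.N_neg]) 2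
  have h12 : 3 * c / 32 * a ^ 2 ≤ 3 * c / 32 * (a - N) ^ 2 :=
    by gcongr
  linarith

namespace FanData

variable {N Z k T : ℝ} (F : Γ.FanData ρ u z N Z k T) (hg : Γ.Good c C ρ)
  (hc : Γ.Convex c C)
include F hg hc

lemma k_gt : -(C / c) * Γ.p u < k := by
  obtain ⟨N', Z', h1, D⟩ := hg.exists_shockData hc F.u_lt F.p_pos
  have hu := F.u_R hg
  have hM : |Z'| < Γ.M := by
    have h2 := hg.small u F.u_lt
    have hCc := div_pos hc.C_pos hc.c_pos
    have hp := F.p_pos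
    rw [abs_of_pos hp] at h2
    have h3 := D.Z_lt.trans D.N_neg
    rw [abs_of_neg h3]
    nlinarith
  have hne : Z' ≠ Γ.p u := ((D.Z_lt.trans D.N_neg).trans F.p_pos).ne
  have h4 := (F.data.diss_zero_iff hM hne).1 ((D.diss_zero_iff hM hne).2 rfl)
  rw [h4] at h1
  exact h1.trans F.Z_lt

lemma gap_le : 3 * c / (16 * C) * Γ.p u ≤ Γ.p u - T := by
  have hu := F.u_R hg
  have h1 := hc.strength F.data hu F.p_pos F.k_lt F.Z_lt.le F.k_le
  rw [← F.s_T] at h1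
  have hpM := Γ.p_lt hu
  obtain ⟨ξ, hξ, he⟩ := exists_slope_eq (a := T) (b := Γ.p u) (f := fun x => Γ.s x u)
    (f' := fun x => Γ.s1 x u) (fun z hz =>
      Γ.s_deriv (abs_lt_of_mem_uIcc (F.T_M hg) hpM hz) hu)
  have hξM := abs_lt_of_mem_uIcc (F.T_M hg) hpM hξ
  rw [uIcc_of_le F.T_lt.le] at hξ
  simp only [Γ.s_self hu] at he
  have h2 := hc.s1_mono hu hξM hpM hξ.2
  obtain ⟨κ, hκ, hκC, hh⟩ := hc.growth hu
  rw [Γ.s1_self hu, hh] at h2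
  have hp := F.p_pos
  have h3 : Γ.s1 ξ u ≤ C * Γ.p u / 2 := by
    have h4 : 0 ≤ c * (Γ.p u - ξ) := mul_nonneg hc.c_pos.le (by linarith [hξ.2])
    have h5 : κ * Γ.p u ≤ C * Γ.p u := by gcongr
    linarith
  have h4 : Γ.s1 ξ u * (Γ.p u - T) ≤ C * Γ.p u / 2 * (Γ.p u - T) :=
    mul_le_mul_of_nonneg_right h3 (by linarith [F.T_lt])
  have hC := hc.C_pos
  have h5 : Γ.p u * (3 * c / 32 * Γ.p u) ≤ Γ.p u * (C / 2 * (Γ.p u - T)) := by nlinarith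
  have h6 := le_of_mul_le_mul_left h5 hp
  rw [div_mul_eq_mul_div, div_le_iff₀ (by positivity)]
  linarith

end FanData

/-- The divided differences of the shock speed. -/
def slope (Γ : Chart S i g) (u : State n) (k x : ℝ) : ℝ :=
  ∫ t in (0 : ℝ)..1, Γ.s1 (k + t * (x - k)) u

lemma abs_segment_lt {k M t : ℝ} (hk : |k| < M) (hx : |x| < M) (ht : t ∈ Icc (0 : ℝ) 1) : |k + t *
    (x - k)| < M := by
  refine abs_lt_of_mem_uIcc hk hx ?_
  have h := (convex_uIcc k x).add_smul_sub_mem left_mem_uIcc right_mem_uIcc ht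
  simpa using h

lemma continuousOn_s1_segment (hu : ‖u‖ < Γ.R) {k : ℝ} (hk : |k| < Γ.M) (hx : |x| < Γ.M) :
    ContinuousOn (fun t => Γ.s1 (k + t * (x - k)) u) (uIcc 0 1) := by
  rw [uIcc_of_le zero_le_one]
  intro t ht
  have h1 := (Γ.s1_deriv (abs_segment_lt hk hx ht) hu).continuousAt
  exact (ContinuousAt.comp (f := fun t => k + t * (x - k)) (g := fun m => Γ.s1 m u) h1
    (by fun_prop)).continuousWithinAt

lemma slope_spec (hu : ‖u‖ < Γ.R) {k : ℝ} (hk : |k| < Γ.M) (hx : |x| < Γ.M) : Γ.slope u k x * (x -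
    k) = Γ.s x u - Γ.s k u := by
  have h := intervalIntegral.integral_eq_sub_of_hasDerivAt (a := (0 : ℝ)) (b := 1)
    (f := fun t => Γ.s (k + t * (x - k)) u) (f' := fun t => Γ.s1 (k + t * (x - k)) u * (x - k))
    (fun t ht => by
      rw [uIcc_of_le zero_le_one] at ht
      have h2 : HasDerivAt (fun t : ℝ => k + t * (x - k)) (x - k) t := by
        simpa using ((hasDerivAt_id t).mul_const (x - k)).const_add k
      exact HasDerivAt.comp (h₂ := fun m => Γ.s m u) (h := fun t => k + t * (x - k)) t
        (Γ.s_deriv (abs_segment_lt hk hx ht) hu) h2)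
    (((continuousOn_s1_segment hu hk hx).mul continuousOn_const).intervalIntegrable)
  rw [intervalIntegral.integral_mul_const] at h
  rw [slope, h]
  simp

lemma Convex.slope_mono (hc : Γ.Convex c C) (hu : ‖u‖ < Γ.R) {k : ℝ} (hk : |k| < Γ.M) (hx : |x| <
    Γ.M) (hy : |y| < Γ.M) (hxy : x ≤ y) : Γ.slope u k x + c / 2 * (y - x) ≤ Γ.slope u k y := by
  have h1 := (continuousOn_s1_segment hu hk hx).intervalIntegrable (μ := volume)
  have h2 := (continuousOn_s1_segment hu hk hy).intervalIntegrable (μ := volume)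
  have h3 : IntervalIntegrable (fun t : ℝ => t * (c * (y - x))) volume 0 1 :=
    (Continuous.intervalIntegrable (by fun_prop) _ _)
  have h4 : ∫ t in (0 : ℝ)..1, (Γ.s1 (k + t * (x - k)) u + t * (c * (y - x))) ≤ ∫ t in (0 : ℝ)..1,
    Γ.s1 (k + t * (y - k)) u := by
    refine intervalIntegral.integral_mono_on zero_le_one (h1.add h3) h2 fun t ht => ?_
    have h5 := hc.s1_mono hu (abs_segment_lt hk hx ht) (abs_segment_lt hk hy ht)
      (by nlinarith [ht.1])
    have h6 : c * (k + t * (y - k) - (k + t * (x - k))) = t * (c * (y - x)) := by ring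
    linarith
  rw [intervalIntegral.integral_add h1 h3, intervalIntegral.integral_mul_const, integral_id] at h4
  rw [slope, slope]
  linarith

lemma slope_sub_le (hu : ‖u‖ < Γ.R) (hu' : ‖u'‖ < Γ.R) {k k' : ℝ} (hk : |k| < Γ.M) (hk' : |k'| <
    Γ.M) (hx : |x| < Γ.M) : |Γ.slope u k x - Γ.slope u' k' x| ≤ Γ.B * (|k - k'| + ‖u - u'‖) := by
  have h1 := (continuousOn_s1_segment hu hk hx).intervalIntegrable (μ := volume)
  have h2 := (continuousOn_s1_segment hu' hk' hx).intervalIntegrable (μ := volume)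
  rw [slope, slope, ← intervalIntegral.integral_sub h1 h2]
  have := intervalIntegral.norm_integral_le_of_norm_le_const (a := (0 : ℝ)) (b := 1)
    (f := fun t => Γ.s1 (k + t * (x - k)) u - Γ.s1 (k' + t * (x - k')) u')
    (C := Γ.B * (|k - k'| + ‖u - u'‖)) (fun t ht => by
      rw [uIoc_of_le zero_le_one] at ht
      have ht' := Ioc_subset_Icc_self ht
      have h3 := Γ.s1_lip (abs_segment_lt hk hx ht') hu (abs_segment_lt hk' hx ht') hu'
      rw [Real.norm_eq_abs]
      refine h3.trans (mul_le_mul_of_nonneg_left ?_ Γ.B_pos.le)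
      have h4 : k + t * (x - k) - (k' + t * (x - k')) = (1 - t) * (k - k') := by ring
      rw [h4, abs_mul, abs_of_nonneg (by linarith [ht'.2])]
      have : (1 - t) * |k - k'| ≤ 1 * |k - k'| :=
        mul_le_mul_of_nonneg_right (by linarith [ht'.1]) (abs_nonneg _)
      linarith)
  simpa using this

namespace FanData

lemma slope_eq_zero {N Z k T : ℝ} (F : Γ.FanData ρ u z N Z k T) (hg : Γ.Good c C ρ) : Γ.slope u k T
    = 0 := by
  have hu := F.u_R hg
  rcases F.k_le_T.eq_or_lt with h | h
  · have hN : k = N := le_antisymm F.k_le (by rw [h]; exact F.N_le)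
    rw [← h, slope]
    simp [hN, F.data.s1_N]
  · have h1 := slope_spec hu F.k_lt (F.T_M hg)
    rw [F.s_T, sub_self] at h1
    exact (mul_eq_zero.1 h1).resolve_right (sub_ne_zero.2 h.ne')

lemma sharp_sub_le {z' : State n} {N Z k T N' Z' k' T' : ℝ} (F : Γ.FanData ρ u z N Z k T) (F' :
    Γ.FanData ρ u' z' N' Z' k' T') (hg : Γ.Good c C ρ) (hc : Γ.Convex c C) : |T - T'| ≤ 2 / c * Γ.B
    * (|k - k'| + ‖u - u'‖) := by
  have key : ∀ {u z u' z' : State n} {N Z k T N' Z' k' T' : ℝ} (F : Γ.FanData ρ u z N Z k T) (F' :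
    Γ.FanData ρ u' z' N' Z' k' T'), T ≤ T' → T' - T ≤ 2 / c * Γ.B * (|k - k'| + ‖u - u'‖) := by
    intro u z u' z' N Z k T N' Z' k' T' F F' hle
    have h1 := hc.slope_mono (F.u_R hg) F.k_lt (F.T_M hg) (F'.T_M hg) hle
    have h2 := slope_sub_le (F.u_R hg) (F'.u_R hg) F.k_lt F'.k_lt (F'.T_M hg)
    rw [F'.slope_eq_zero hg, sub_zero] at h2
    rw [F.slope_eq_zero hg] at h1
    have h3 := (le_abs_self _).trans h2
    have hcp := hc.c_pos
    have h4 : c / 2 * (T' - T) ≤ Γ.B * (|k - k'| + ‖u - u'‖) := by linarith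
    have h5 : T' - T = 2 / c * (c / 2 * (T' - T)) := by field_simp
    rw [h5, mul_assoc (2 / c)]
    gcongr
  rcases le_total T T' with h | h
  · rw [abs_sub_comm, abs_of_nonneg (by linarith)]
    exact key F F' h
  · rw [abs_of_nonneg (by linarith), abs_sub_comm k, norm_sub_rev u]
    exact key F' F h

end FanData

end Chart

/-- Two families of curves with a joint Lipschitz bound, glued at Lipschitz parameters where they
agree. -/
lemma norm_ite_sub_ite_le {ι E F : Type*} [SeminormedAddCommGroup E] [SeminormedAddCommGroup F] {P :
    ι → Prop} {s : Set ℝ} {b : ι → F} {α β : ι → ℝ → E} {t : ι → ℝ} {L : ℝ} (hL : 0 ≤ L) (hK : 0 ≤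
    K) (hα : ∀ i j x y, P i → P j → x ∈ s → y ∈ s → ‖α i x - α j y‖ ≤ L * (|x - y| + ‖b i - b j‖))
    (hβ : ∀ i j x y, P i → P j → x ∈ s → y ∈ s → ‖β i x - β j y‖ ≤ L * (|x - y| + ‖b i - b j‖)) (hs
    : ∀ i, P i → t i ∈ s) (ht : ∀ i j, P i → P j → |t i - t j| ≤ K * ‖b i - b j‖) (h0 : ∀ i, P i → α
    i (t i) = β i (t i)) {i j : ι} (hi : P i) (hj : P j) (hx : x ∈ s) (hy : y ∈ s) : ‖(if t i ≤ x
    then α i x else β i x) - (if t j ≤ y then α j y else β j y)‖ ≤ L * (2 * K + 1) * (|x - y| + ‖b i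
    - b j‖) := by
  have hmix : ∀ {i j x y}, P i → P j → x ∈ s → y ∈ s → t i ≤ x → y < t j → ‖α i x - β j y‖ ≤ L * (2
    * K + 1) * (|x - y| + ‖b i - b j‖) := by
    intro i j x y hi hj hx hy h1 h2
    have h3 := hα i i x (t i) hi hi hx (hs i hi)
    have h4 := hβ i j (t i) y hi hj (hs i hi) hy
    rw [h0 i hi] at h3
    rw [sub_self, norm_zero, add_zero, abs_of_nonneg (by linarith)] at h3
    have h5 := norm_sub_le_norm_sub_add_norm_sub (α i x) (β i (t i)) (β j y)
    have h6 := (abs_le.1 (ht i j hi hj)).1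
    have h0 := norm_nonneg (b i - b j)
    have hKd : 0 ≤ K * ‖b i - b j‖ := by positivity
    have hKx : 0 ≤ K * |x - y| := by positivity
    have h7 : x - t i + (|t i - y| + ‖b i - b j‖) ≤ (2 * K + 1) * (|x - y| + ‖b i - b j‖) := by
      have := le_abs_self (x - y)
      rcases abs_cases (t i - y) with h | h <;> linarith
    have := mul_le_mul_of_nonneg_left h7 hL
    linarith
  have hsame : ∀ {a d : ℝ}, 0 ≤ d → a ≤ L * d → a ≤ L * (2 * K + 1) * d := fun {a d} hd h => by
    have : 0 ≤ L * K * d := by positivity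
    linarith
  split_ifs with h1 h2 h2
  · exact hsame (by positivity) (hα i j x y hi hj hx hy)
  · grind
  · rw [norm_sub_rev, abs_sub_comm, norm_sub_rev (b i)]
    exact hmix hj hi hy hx h2 (not_le.1 h1)
  · exact hsame (by positivity) (hβ i j x y hi hj hx hy)

namespace Chart

/-- The deviation of a wave from the linearized wave. -/
def dev (Γ : Chart S i g) (u v : State n) : State n := v - u - (Γ.p v - Γ.e u) • Γ.X

lemma dev_comp (u z v : State n) : Γ.dev u v = Γ.dev z v + (Γ.dev u z - Γ.e (Γ.dev u z) • Γ.X) := by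
  simp only [dev, map_sub, map_smul, Γ.e_X, smul_eq_mul, mul_one]
  module

lemma dev_sub_self (u v : State n) : Γ.dev u v - Γ.dev u u = v - u - (Γ.p v - Γ.p u) • Γ.X := by
  simp only [dev]; module

lemma norm_sub_proj_le (w : State n) : ‖w - Γ.e w • Γ.X‖ ≤ (1 + ‖Γ.e‖ * ‖Γ.X‖) * ‖w‖ := by
  refine (norm_sub_le _ _).trans ?_
  rw [norm_smul]
  have := mul_le_mul_of_nonneg_right (Γ.e.le_opNorm w) (norm_nonneg Γ.X)
  linarith

/-- For small states and parameters, the curves of the chart are close to straight lines. -/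
structure Near (Γ : Chart S i g) (η r : ℝ) : Prop where
  η_nonneg : 0 ≤ η
  r_R : r ≤ Γ.R
  r_M : r ≤ Γ.M
  V : ∀ {m u m' u'}, |m| < r → ‖u‖ < r → |m'| < r → ‖u'‖ < r →
    ‖Γ.dev u (Γ.V m u) - Γ.dev u' (Γ.V m' u')‖ ≤ η * (|m - m'| + ‖u - u'‖)
  W : ∀ {m u m' u'}, |m| < r → ‖u‖ < r → |m'| < r → ‖u'‖ < r →
    ‖Γ.dev u (Γ.W m u) - Γ.dev u' (Γ.W m' u')‖ ≤ η * (|m - m'| + ‖u - u'‖)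

lemma Near.reflect (h : Γ.Near η r) : Γ.reflect.Near η r where
  η_nonneg := h.η_nonneg
  r_R := h.r_R
  r_M := h.r_M
  V := fun {m u m' u'} h1 h2 h3 h4 => by
    have := h.V (m := -m) (m' := -m') (by simpa) h2 (by simpa) h4
    rw [← abs_sub_comm, show -m' - -m = m - m' by ring] at this
    convert this using 3 <;> simp only [dev, Chart.reflect, neg_apply] <;> module
  W := fun {m u m' u'} h1 h2 h3 h4 => by
    have := h.W (m := -m) (m' := -m') (by simpa) h2 (by simpa) h4
    rw [← abs_sub_comm, show -m' - -m = m - m' by ring] at this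
    convert this using 3 <;> simp only [dev, Chart.reflect, neg_apply] <;> module

lemma exists_near (Γ : Chart S i g) (hη : 0 < η) : ∃ r > 0, Γ.Near η r := by
  have key : ∀ Y : ℝ → State n → State n,
      HasStrictFDerivAt (fun z : ℝ × State n => Y z.1 z.2) (linParam Γ.e Γ.X) 0 →
      (∀ {m u}, |m| < Γ.M → ‖u‖ < Γ.R → Γ.p (Y m u) = m) → ∀ᶠ r in 𝓝[>] (0 : ℝ),
      r ≤ Γ.R → r ≤ Γ.M → ∀ {m u m' u'}, |m| < r → ‖u‖ < r → |m'| < r → ‖u'‖ < r →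
      ‖Γ.dev u (Y m u) - Γ.dev u' (Y m' u')‖ ≤ η * (|m - m'| + ‖u - u'‖) := by
    intro Y hY hp
    obtain ⟨s, hs, h⟩ := hY.approximates_deriv_on_nhds (c := η.toNNReal) (Or.inr (by simpa))
    obtain ⟨a, ha, has⟩ := Metric.mem_nhds_iff.1 hs
    filter_upwards [Ioo_mem_nhdsGT ha] with r hr hR hM m u m' u' h1 h2 h3 h4
    have hmem : ∀ {m : ℝ} {u : State n}, |m| < r → ‖u‖ < r → (m, u) ∈ s := fun h1 h2 =>
      has (by
        rw [mem_ball_zero_iff, Prod.norm_def]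
        exact max_lt (h1.trans hr.2) (h2.trans hr.2))
    have h5 := h (m, u) (hmem h1 h2) (m', u') (hmem h3 h4)
    rw [Prod.mk_sub_mk, linParam_apply, Real.coe_toNNReal _ hη.le] at h5
    have h6 : ‖((m - m', u - u') : ℝ × State n)‖ ≤ |m - m'| + ‖u - u'‖ := by
      rw [Prod.norm_def]
      exact max_le (le_add_of_nonneg_right (norm_nonneg _)) (le_add_of_nonneg_left (abs_nonneg _))
    refine le_trans (le_of_eq ?_) (h5.trans (mul_le_mul_of_nonneg_left h6 hη.le))
    rw [dev, dev, hp (h1.trans_le hM) (h2.trans_le hR), hp (h3.trans_le hM) (h4.trans_le hR), map_sub]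
    congr 1
    module
  obtain ⟨r, ⟨⟨⟨h1, h2⟩, h3⟩, h4⟩, h5⟩ := ((((key _ Γ.V_strict Γ.p_V).and (key _ Γ.W_strict Γ.p_W)).and
    (Ioc_mem_nhdsGT Γ.R_pos)).and (Ioc_mem_nhdsGT Γ.M_pos)).and self_mem_nhdsWithin |>.exists
  exact ⟨r, h5, hη.le, h3.2, h4.2, h1 h3.2 h4.2, h2 h3.2 h4.2⟩

namespace Near

variable (hN : Γ.Near η r)
include hN

lemma V_sub_le (hm : |m| < r) (hu : ‖u‖ < r) (hp : |Γ.p u| < r) : ‖Γ.V m u - u - (m - Γ.p u) • Γ.X‖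
    ≤ η * |m - Γ.p u| := by
  have h := hN.V hm hu hp hu
  have hR := hu.trans_le hN.r_R
  rwa [Γ.V_p hR, dev_sub_self, Γ.p_V (hm.trans_le hN.r_M) hR, sub_self, norm_zero, add_zero] at h

lemma W_sub_le (hm : |m| < r) (hu : ‖u‖ < r) (hp : |Γ.p u| < r) : ‖Γ.W m u - u - (m - Γ.p u) • Γ.X‖
    ≤ η * |m - Γ.p u| := by
  have h := hN.W hm hu hp hu
  have hR := hu.trans_le hN.r_R
  rwa [Γ.W_p hR, dev_sub_self, Γ.p_W (hm.trans_le hN.r_M) hR, sub_self, norm_zero, add_zero] at h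

lemma cb_sub_le (hm : |m| < r) (hu : ‖u‖ < r) (hp : |Γ.p u| < r) : ‖Γ.cb u m - u - (m - Γ.p u) •
    Γ.X‖ ≤ η * |m - Γ.p u| := by
  rw [cb]; split_ifs
  · exact hN.W_sub_le hm hu hp
  · exact hN.V_sub_le hm hu hp

lemma dev_cb_sub_le {m' : ℝ} (hm : |m| < r) (hu : ‖u‖ < r) (hp : |Γ.p u| < r) (hm' : |m'| < r) (hu'
    : ‖u'‖ < r) (hp' : |Γ.p u'| < r) : ‖Γ.dev u (Γ.cb u m) - Γ.dev u' (Γ.cb u' m')‖ ≤ η * (2 * Γ.B +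
    1) * (|m - m'| + ‖u - u'‖) := by
  have := norm_ite_sub_ite_le (P := fun u => ‖u‖ < r ∧ |Γ.p u| < r) (s := {m | |m| < r}) (b := id)
    (α := fun u m => Γ.dev u (Γ.W m u)) (β := fun u m => Γ.dev u (Γ.V m u)) (t := Γ.p)
    hN.η_nonneg Γ.B_pos.le (fun u u' m m' h h' h1 h2 => hN.W h1 h.1 h2 h'.1)
    (fun u u' m m' h h' h1 h2 => hN.V h1 h.1 h2 h'.1) (fun u h => h.2)
    (fun u u' h h' => Γ.p_lip (h.1.trans_le hN.r_R) (h'.1.trans_le hN.r_R))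
    (fun u h => by rw [Γ.W_p (h.1.trans_le hN.r_R), Γ.V_p (h.1.trans_le hN.r_R)])
    (i := u) (j := u') ⟨hu, hp⟩ ⟨hu', hp'⟩ hm hm'
  simpa only [cb, apply_ite (Γ.dev u), apply_ite (Γ.dev u'), id] using this

end Near

variable (Sc : Γ.Scale c C ρ ε δ' δ1) (O : Γ.Oriented σ) (hc : Γ.Convex c C)
include Sc O hc

lemma Scale.gluedBranch_eq (hkin : S.IsKinetic ρ δ1 i kin) (hu : ‖u‖ < δ1) (hp : 0 < Γ.p u) : ∃ N Z,
    Γ.FanData ρ u (S.flat ρ i kin u) N Z (σ * kin u) (σ * S.muSharp ρ i kin u) ∧ ‖S.flat ρ i kin u‖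
    < δ' ∧ S.muNat ρ i u = σ * N ∧ |σ * kin u| < ε ∧ |σ * S.muSharp ρ i kin u| < ε ∧ |σ * kin u -
    Γ.p u| ≤ (C / c + 1) * Γ.p u ∧ ∀ m, |m| < ε → S.gluedBranch ρ i kin u m = Γ.gl u (S.flat ρ i kin
    u) (σ * kin u) (σ * S.muSharp ρ i kin u) (σ * m) := by
  obtain ⟨N, Z, T, F, hz, hN, -, hT⟩ := Sc.exists_fanData O hc hkin hu hp
  have hT' : σ * S.muSharp ρ i kin u = T := (O.mul_eq_iff).2 hT
  rw [← hT'] at F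
  have h1 := F.k_gt Sc.good hc
  have h2 := Sc.p_small u hu
  rw [abs_of_pos hp] at h2
  have h3 := F.k_lt_p
  have h4 := F.k_le_T
  have h5 := F.T_lt
  refine ⟨N, Z, F, hz, hN, abs_lt.2 ⟨by nlinarith, ?_⟩, abs_lt.2 ⟨by nlinarith, ?_⟩,
    abs_le.2 ⟨by nlinarith, ?_⟩, fun m hm => ?_⟩
  · have := Sc.p_lt u (hu.trans_le Sc.δ1_le); linarith [le_abs_self (Γ.p u)]
  · have := Sc.p_lt u (hu.trans_le Sc.δ1_le); linarith [le_abs_self (Γ.p u)]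
  · grind
  · rw [gluedBranch, gl, O.sgn_eq hp, Sc.classicalBranch_eq O hu hp hm,
      Sc.nonclassicalBranch_eq O hp hz hm]

end Chart

namespace Chart

/-- The constant in the estimates of a single fan. -/
def fanConst (Γ : Chart S i g) (c C : ℝ) : ℝ :=
  (C / c + 1) * (4 + ‖Γ.X‖ + ‖Γ.e‖ * ‖Γ.X‖ + 2 * (C / c + 1) / (3 * c / (16 * C)))

/-- The constant in the estimates of pairs of fans. -/
def pairConst (Γ : Chart S i g) (c K : ℝ) : ℝ :=
  ((3 + ‖Γ.X‖ + 2 * (‖Γ.e‖ * ‖Γ.X‖)) * (1 + K) * (2 * K + 1) + (2 * Γ.B + 1)) *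
    (2 * (2 / c * Γ.B * (K + 1)) + 1)

lemma fanConst_reflect : Γ.reflect.fanConst c C = Γ.fanConst c C := by
  simp [fanConst, Chart.reflect]

lemma pairConst_reflect : Γ.reflect.pairConst c K = Γ.pairConst c K := by
  simp [pairConst, Chart.reflect]

lemma Convex.fanConst_pos (hc : Γ.Convex c C) : 0 < Γ.fanConst c C := by
  have := hc.c_pos
  have := hc.C_pos
  unfold fanConst
  positivity

lemma Near.p_gl (hN : Γ.Near η r) {k T : ℝ} (hu : ‖u‖ < r) (hz : ‖z‖ < r) (hx : |x| < r) : Γ.p (Γ.gl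
    u z k T x) = x := by
  have hx' := hx.trans_le hN.r_M
  have hu' := hu.trans_le hN.r_R
  have hz' := hz.trans_le hN.r_R
  rw [gl, cb, nb]
  split_ifs
  exacts [Γ.p_W hx' hu', Γ.p_V hx' hu', Γ.p_V hx' hz', Γ.p_W hx' hz']

namespace FanData

variable {N Z k T : ℝ} (F : Γ.FanData ρ u z N Z k T) (hg : Γ.Good c C ρ)
  (hN : Γ.Near η r) (hu : ‖u‖ < r) (hz : ‖z‖ < r) (hp : |Γ.p u| < r) (hk : |k| < r)
include F hg hN hu hz

include hk

omit hu in
lemma nb_sub_le (hx : |x| < r) : ‖Γ.nb z k x - z - (x - k) • Γ.X‖ ≤ η * |x - k| := by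
  have h1 := hN.V_sub_le hx hz (by rwa [F.p_z hg])
  have h2 := hN.W_sub_le hx hz (by rwa [F.p_z hg])
  rw [F.p_z hg] at h1 h2
  rw [nb]; split_ifs <;> assumption

include hp

omit hg hz in
lemma flat_sub_le : ‖z - u - (k - Γ.p u) • Γ.X‖ ≤ η * |k - Γ.p u| := by
  have h1 := hN.V_sub_le hk hu hp
  rwa [F.z_eq] at h1

variable (hc : Γ.Convex c C) (hkp : |k - Γ.p u| ≤ (C / c + 1) * Γ.p u)
include hc hkp

lemma gl_sub_le (hx : |x| < r) : ‖Γ.gl u z k T x - u - (x - Γ.p u) • Γ.X‖ ≤ η * (1 + 2 * (C / c + 1)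
    / (3 * c / (16 * C))) * |x - Γ.p u| := by
  have hη := hN.η_nonneg
  have hc0 := hc.c_pos
  have hC0 := hc.C_pos
  rw [gl]; split_ifs with h
  · refine (hN.cb_sub_le hx hu hp).trans (mul_le_mul_of_nonneg_right ?_ (abs_nonneg _))
    exact le_mul_of_one_le_right hη (le_add_of_nonneg_right (by positivity))
  · have h1 := F.nb_sub_le hg hN hz hk hx
    have h2 := F.flat_sub_le hN hu hp hk
    have h3 := F.gap_le hg hc
    have h4 : |k - Γ.p u| ≤ (C / c + 1) / (3 * c / (16 * C)) * |x - Γ.p u| := by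
      rw [div_mul_eq_mul_div, le_div_iff₀ (by positivity)]
      have h5 : 3 * c / (16 * C) * Γ.p u ≤ |x - Γ.p u| := by
        have := neg_abs_le (x - Γ.p u); linarith
      have h6 : |k - Γ.p u| * (3 * c / (16 * C)) ≤ (C / c + 1) * Γ.p u * (3 * c / (16 * C)) :=
        by gcongr
      have h7 := mul_le_mul_of_nonneg_left h5 (show 0 ≤ C / c + 1 by positivity)
      linarith
    have h5 : |x - k| ≤ |x - Γ.p u| + |k - Γ.p u| := by
      rw [abs_sub_comm k]; exact abs_sub_le _ _ _
    have h6 : Γ.nb z k x - u - (x - Γ.p u) • Γ.X =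
        (Γ.nb z k x - z - (x - k) • Γ.X) + (z - u - (k - Γ.p u) • Γ.X) := by module
    rw [h6]
    refine (norm_add_le _ _).trans ((add_le_add h1 h2).trans ?_)
    rw [← mul_add, mul_assoc]
    refine mul_le_mul_of_nonneg_left ?_ hη
    have : 2 * (C / c + 1) / (3 * c / (16 * C)) = 2 * ((C / c + 1) / (3 * c / (16 * C))) := by ring
    rw [this]
    linarith

lemma gl_sub_W_le (hη1 : η ≤ 1) (hx : |x| < r) : ‖Γ.gl u z k T x - Γ.W x u‖ ≤ η * Γ.fanConst c C *
    Γ.p u := by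
  have hη := hN.η_nonneg
  have hc0 := hc.c_pos
  have hC0 := hc.C_pos
  have hpu := F.p_pos
  have hX := norm_nonneg Γ.X
  have heX : 0 ≤ ‖Γ.e‖ * ‖Γ.X‖ := by positivity
  have hD : 0 ≤ (C / c + 1) * Γ.p u := by positivity
  have hG : 0 ≤ 2 * (C / c + 1) / (3 * c / (16 * C)) := by positivity
  have h1 := F.gl_sub_le hg hN hu hz hp hk hc hkp hx
  have h2 := hN.W_sub_le hx hu hp
  have fin : ∀ {a w : ℝ}, w ≤ η * (a * ((C / c + 1) * Γ.p u)) → 0 ≤ a →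
      a ≤ 4 + ‖Γ.X‖ + ‖Γ.e‖ * ‖Γ.X‖ + 2 * (C / c + 1) / (3 * c / (16 * C)) →
      w ≤ η * Γ.fanConst c C * Γ.p u := fun {a w} h1 _ h2 => by
    refine h1.trans ?_
    rw [fanConst, mul_assoc η, mul_right_comm, mul_comm _ (4 + _ + _ + _)]
    gcongr
  by_cases hxk : k ≤ x
  · by_cases hxp : Γ.p u ≤ x
    · rw [gl, if_pos (F.T_lt.le.trans hxp), cb, if_pos hxp, sub_self, norm_zero]
      exact fin (a := 0) (by simp) le_rfl (by positivity)
    · have h3 : |x - Γ.p u| ≤ (C / c + 1) * Γ.p u := by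
        refine le_trans ?_ hkp
        rw [abs_of_neg (by linarith), abs_of_neg (by linarith)]; linarith
      have h4 : Γ.gl u z k T x - Γ.W x u = (Γ.gl u z k T x - u - (x - Γ.p u) • Γ.X) -
        (Γ.W x u - u - (x - Γ.p u) • Γ.X) := by abel
      refine fin (a := 2 + 2 * (C / c + 1) / (3 * c / (16 * C))) ?_ (by positivity) (by linarith)
      rw [h4]
      refine (norm_sub_le _ _).trans ((add_le_add h1 h2).trans ?_)
      rw [mul_assoc η, ← mul_add, ← add_one_mul]
      refine mul_le_mul_of_nonneg_left ((mul_le_mul_of_nonneg_left h3 (by positivity)).trans_eq ?_) hη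
      ring
  · have hu' := hu.trans_le hN.r_R
    have hz' := hz.trans_le hN.r_R
    have hx' := hx.trans_le hN.r_M
    rw [gl, if_neg (by have := F.k_le_T; linarith), nb, if_neg hxk]
    have h3 := hN.W hx hz hx hu
    rw [sub_self, abs_zero, zero_add] at h3
    have h4 := F.flat_sub_le hN hu hp hk
    set q := z - u - (k - Γ.p u) • Γ.X with hq
    have h5 : Γ.W x z - Γ.W x u = (Γ.dev z (Γ.W x z) - Γ.dev u (Γ.W x u)) + (q - Γ.e q • Γ.X) := by
      simp only [dev, hq, Γ.p_W hx' hz', Γ.p_W hx' hu', map_sub, map_smul, Γ.e_X, smul_eq_mul]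
      module
    have h6 : ‖z - u‖ ≤ (1 + ‖Γ.X‖) * |k - Γ.p u| := by
      have : z - u = q + (k - Γ.p u) • Γ.X := by rw [hq]; abel
      rw [this]
      refine (norm_add_le _ _).trans ?_
      rw [norm_smul, Real.norm_eq_abs]
      have := mul_le_mul_of_nonneg_right hη1 (abs_nonneg (k - Γ.p u))
      linarith
    refine fin (a := 2 + ‖Γ.X‖ + ‖Γ.e‖ * ‖Γ.X‖) ?_ (by positivity) (by linarith)
    rw [h5]
    refine (norm_add_le _ _).trans ((add_le_add h3 (norm_sub_proj_le q)).trans ?_)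
    have h7 : η * ‖z - u‖ ≤ η * ((1 + ‖Γ.X‖) * ((C / c + 1) * Γ.p u)) :=
      mul_le_mul_of_nonneg_left (h6.trans (mul_le_mul_of_nonneg_left hkp (by positivity))) hη
    have h8 : (1 + ‖Γ.e‖ * ‖Γ.X‖) * ‖q‖ ≤ (1 + ‖Γ.e‖ * ‖Γ.X‖) * (η * ((C / c + 1) * Γ.p u)) :=
      mul_le_mul_of_nonneg_left (h4.trans (mul_le_mul_of_nonneg_left hkp hη)) (by positivity)
    linarith

end FanData

/-- The dependence of fans on the initial state, for base points on one side of `p = 0`. -/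
lemma dev_gl_sub_le {P : State n → Prop} {z : State n → State n} {k T : State n → ℝ} (hK : 0 ≤ K)
    (hg : Γ.Good c C ρ) (hc : Γ.Convex c C) (hN : Γ.Near η r) (hη1 : η ≤ 1) (hP : ∀ u, P u → ‖u‖ < r
    ∧ ‖z u‖ < r ∧ |Γ.p u| < r ∧ |k u| < r ∧ |T u| < r ∧ ∃ N Z, Γ.FanData ρ u (z u) N Z (k u) (T u))
    (hk : ∀ u u', P u → P u' → |k u - k u'| ≤ K * ‖u - u'‖) {x' : ℝ} (hu : P u) (hu' : P u') (hx :
    |x| < r) (hx' : |x'| < r) : ‖Γ.dev u (Γ.gl u (z u) (k u) (T u) x) - Γ.dev u' (Γ.gl u' (z u') (k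
    u') (T u') x')‖ ≤ η * Γ.pairConst c K * (|x - x'| + ‖u - u'‖) := by
  have hη := hN.η_nonneg
  have hc0 := hc.c_pos
  have hB := Γ.B_pos
  set eX := ‖Γ.e‖ * ‖Γ.X‖ with heX
  have heX0 : 0 ≤ eX := by positivity
  have hX := norm_nonneg Γ.X
  set Λ := 3 + ‖Γ.X‖ + 2 * eX with hΛ
  have hlin : ∀ {u u'}, P u → P u' → ‖Γ.dev u (z u) - Γ.dev u' (z u')‖ ≤ η * ((1 + K) * ‖u - u'‖) ∧
    ‖z u - z u'‖ ≤ (2 + ‖Γ.X‖ + eX) * ((1 + K) * ‖u - u'‖) := by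
    intro u u' hu hu'
    obtain ⟨h1, h2, h3, h4, h5, N, Z, F⟩ := hP u hu
    obtain ⟨h1', h2', h3', h4', h5', N', Z', F'⟩ := hP u' hu'
    have h6 := hN.V h4 h1 h4' h1'
    rw [F.z_eq, F'.z_eq] at h6
    have h7 := hk u u' hu hu'
    have h8 : |k u - k u'| + ‖u - u'‖ ≤ (1 + K) * ‖u - u'‖ := by linarith
    have h9 := h6.trans (mul_le_mul_of_nonneg_left h8 hη)
    refine ⟨h9, ?_⟩
    have h10 : z u - z u' = (Γ.dev u (z u) - Γ.dev u' (z u')) + (u - u') + ((k u - k u') - Γ.e (u -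
      u')) • Γ.X := by
      rw [dev, dev, F.p_z hg, F'.p_z hg, map_sub]; module
    have h11 : ‖((k u - k u') - Γ.e (u - u')) • Γ.X‖ ≤ (K * ‖u - u'‖ + ‖Γ.e‖ * ‖u - u'‖) * ‖Γ.X‖ := by
      rw [norm_smul]
      refine mul_le_mul_of_nonneg_right ((norm_sub_le _ _).trans (add_le_add h7 ?_)) hX
      exact Γ.e.le_opNorm _
    have hd := norm_nonneg (u - u')
    have h12 : η * ((1 + K) * ‖u - u'‖) ≤ 1 * ((1 + K) * ‖u - u'‖) :=
      by gcongr
    rw [h10]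
    refine (norm_add₃_le).trans ((add_le_add (add_le_add (h9.trans h12) le_rfl) h11).trans ?_)
    have : 0 ≤ K * ‖u - u'‖ + ‖Γ.X‖ * ‖u - u'‖ + K * (eX * ‖u - u'‖) := by positivity
    rw [heX] at this ⊢
    linarith
  have hcomp : ∀ {Y : ℝ → State n → State n}, (∀ {m u m' u'}, |m| < r → ‖u‖ < r → |m'| < r → ‖u'‖ <
    r → ‖Γ.dev u (Y m u) - Γ.dev u' (Y m' u')‖ ≤ η * (|m - m'| + ‖u - u'‖)) → ∀ u u' x x', P u → P
    u' → |x| < r → |x'| < r → ‖Γ.dev u (Y x (z u)) - Γ.dev u' (Y x' (z u'))‖ ≤ η * (Λ * (1 + K)) *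
    (|x - x'| + ‖u - u'‖) := by
    intro Y hY u u' x x' hu hu' hx hx'
    have h1 := hY hx (hP u hu).2.1 hx' (hP u' hu').2.1
    obtain ⟨h2, h3⟩ := hlin hu hu'
    rw [dev_comp u (z u), dev_comp u' (z u')]
    have h4 : ∀ a b q q' : State n, a + (q - Γ.e q • Γ.X) - (b + (q' - Γ.e q' • Γ.X)) =
        (a - b) + ((q - q') - Γ.e (q - q') • Γ.X) := fun a b q q' => by rw [map_sub]; module
    rw [h4]
    refine (norm_add_le _ _).trans ((add_le_add h1 ((norm_sub_proj_le _).trans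
      (mul_le_mul_of_nonneg_left h2 (by positivity)))).trans ?_)
    have h5 := mul_le_mul_of_nonneg_left h3 hη
    have h6 : 0 ≤ η * |x - x'| * (Λ * (1 + K) - 1) := by
      have : 0 ≤ Λ * (1 + K) - 1 := by
        have : 0 ≤ Λ * K := by positivity
        rw [hΛ] at this ⊢
        linarith
      positivity
    rw [hΛ] at h6 ⊢
    linarith
  have hdB : 0 ≤ (2 * Γ.B + 1) := by positivity
  have hΛ0 : 0 ≤ Λ := by positivity
  have hαβ : ∀ {a b d : ℝ}, 0 ≤ b → 0 ≤ d → ∀ {w}, w ≤ η * a * d → w ≤ η * (a + b) * d :=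
    fun {a b d} hb hd {w} h => h.trans (by have : 0 ≤ η * b * d := by positivity
                                           linarith)
  have h := norm_ite_sub_ite_le (P := P) (s := {x | |x| < r}) (b := id)
    (α := fun u x => Γ.dev u (Γ.cb u x)) (β := fun u x => Γ.dev u (Γ.nb (z u) (k u) x)) (t := T)
    (L := η * (Λ * (1 + K) * (2 * K + 1) + (2 * Γ.B + 1))) (K := 2 / c * Γ.B * (K + 1))
    (by positivity) (by positivity)
    (fun u u' x x' hu hu' hx hx' => by
      rw [add_comm (Λ * (1 + K) * (2 * K + 1))]
      exact hαβ (by positivity) (by positivity) (hN.dev_cb_sub_le hx (hP u hu).1 (hP u hu).2.2.1 hx'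
        (hP u' hu').1 (hP u' hu').2.2.1))
    (fun u u' x x' hu hu' hx hx' => hαβ hdB (by positivity) (by
      have := norm_ite_sub_ite_le (P := P) (s := {x | |x| < r}) (b := id) (t := k)
        (L := η * (Λ * (1 + K))) (by positivity) hK (hcomp hN.V) (hcomp hN.W)
        (fun u hu => (hP u hu).2.2.2.1) hk (fun u hu => by
          obtain ⟨h1, h2, h3, h4, h5, N, Z, F⟩ := hP u hu
          rw [← F.p_z hg, Γ.W_p (F.z_R hg), Γ.V_p (F.z_R hg)]) hu hu' hx hx'
      simp only [nb, apply_ite (Γ.dev u), apply_ite (Γ.dev u')]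
      rw [← mul_assoc η (Λ * (1 + K))]
      exact this))
    (fun u hu => (hP u hu).2.2.2.2.1)
    (fun u u' hu hu' => by
      obtain ⟨h1, h2, h3, h4, h5, N, Z, F⟩ := hP u hu
      obtain ⟨h1', h2', h3', h4', h5', N', Z', F'⟩ := hP u' hu'
      have h6 := F.sharp_sub_le F' hg hc
      refine h6.trans ?_
      rw [mul_assoc (2 / c * Γ.B)]
      refine mul_le_mul_of_nonneg_left ?_ (by positivity)
      have := hk u u' hu hu'
      simp only [id]
      linarith)
    (fun u hu => by
      obtain ⟨h1, h2, h3, h4, h5, N, Z, F⟩ := hP u hu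
      rw [cb, nb, if_neg (not_le.2 F.T_lt), if_pos F.k_le_T, (F.sharp_flat hg).1])
    hu hu' hx hx'
  rw [pairConst, ← mul_assoc η]
  simpa only [gl, apply_ite (Γ.dev u), apply_ite (Γ.dev u'), id] using h

lemma Convex.coeff_le_fanConst (hc : Γ.Convex c C) : 1 + 2 * (C / c + 1) / (3 * c / (16 * C)) ≤
    Γ.fanConst c C := by
  have h1 := hc.c_pos
  have h2 := hc.C_pos
  have h3 : 0 ≤ C / c := by positivity
  have h4 : 0 ≤ ‖Γ.X‖ + ‖Γ.e‖ * ‖Γ.X‖ := by positivity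
  have h5 : 0 ≤ 2 * (C / c + 1) / (3 * c / (16 * C)) := by positivity
  rw [fanConst]
  nlinarith

namespace Scale

variable (Sc : Γ.Scale c C ρ ε δ' δ1) (O : Γ.Oriented σ) (hc : Γ.Convex c C) (hN : Γ.Near η r)
  (hε : ε ≤ r) (hδ : δ' ≤ r) (hη : η ≤ 1)
include Sc O hc

lemma isKinetic_muNat : S.IsKinetic ρ δ1 i (S.muNat ρ i) := fun u hu => by
  have h := Sc.wellDefined O hc (by simpa using hu)
  exact ⟨fun hp => ⟨(h.order_pos hp).2.1, le_rfl⟩, fun hp => ⟨le_rfl, (h.order_neg hp).2.1⟩⟩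

lemma muNat_sub_le (hu : ‖u‖ < δ1) (hu' : ‖u'‖ < δ1) (hp : 0 < Γ.p u) (hp' : 0 < Γ.p u') : |S.muNat
    ρ i u - S.muNat ρ i u'| ≤ Γ.B / c * ‖u - u'‖ := by
  obtain ⟨N, Z, D, -, -, hN, -, -, hr⟩ := Sc.shockData O hc hu hp
  obtain ⟨N', Z', D', -, -, hN', -, -, hr'⟩ := Sc.shockData O hc hu' hp'
  have huR := ((hu.trans_le Sc.δ1_le).trans_le Sc.δ'_le).trans_le Sc.good.le
  have huR' := ((hu'.trans_le Sc.δ1_le).trans_le Sc.δ'_le).trans_le Sc.good.le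
  have hM := (hr N D.Z_lt.le (D.N_lt hp).le).2.1
  have hM' := (hr' N' D'.Z_lt.le (D'.N_lt hp').le).2.1
  have h1 := Γ.s1_lip hM' huR hM' huR'
  rw [D'.s1_N, sub_self, abs_zero, zero_add, sub_zero] at h1
  rw [hN, hN', ← mul_sub, O.abs_mul, div_mul_eq_mul_div, le_div_iff₀ hc.c_pos]
  refine le_trans ?_ h1
  rcases le_total N N' with h | h
  · have h2 := hc.s1_mono huR hM hM' h
    rw [D.s1_N] at h2
    rw [abs_sub_comm, abs_of_nonneg (by linarith)]
    linarith [le_abs_self (Γ.s1 N' u)]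
  · have h2 := hc.s1_mono huR hM' hM h
    rw [D.s1_N] at h2
    rw [abs_of_nonneg (by linarith)]
    linarith [neg_abs_le (Γ.s1 N' u)]

include hN hε hδ hη

lemma glued_of_pos (hkin : S.IsKinetic ρ δ1 i kin) (hu : ‖u‖ < δ1) (hp : 0 < Γ.p u) (hm : |m| < ε) :
    Γ.p (S.gluedBranch ρ i kin u m) = σ * m ∧ ‖S.gluedBranch ρ i kin u m - u - (σ * m - Γ.p u) •
    Γ.X‖ ≤ η * Γ.fanConst c C * |σ * m - Γ.p u| ∧ ‖S.gluedBranch ρ i kin u m - Γ.W (σ * m) u‖ ≤ η *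
    Γ.fanConst c C * |Γ.p u| := by
  obtain ⟨N, Z, F, hz, -, hk, hT, hkp, he⟩ := Sc.gluedBranch_eq O hc hkin hu hp
  have hu' := (hu.trans_le Sc.δ1_le).trans_le hδ
  have hp' := (Sc.p_lt u (hu.trans_le Sc.δ1_le)).trans_le hε
  have hz' := hz.trans_le hδ
  have hm' : |σ * m| < r := by rw [O.abs_mul]; exact hm.trans_le hε
  have hk' := hk.trans_le hε
  rw [he m hm, abs_of_pos hp]
  refine ⟨hN.p_gl hu' hz' hm', ?_, F.gl_sub_W_le Sc.good hN hu' hz' hp' hk' hc hkp hη hm'⟩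
  refine (F.gl_sub_le Sc.good hN hu' hz' hp' hk' hc hkp hm').trans ?_
  exact mul_le_mul_of_nonneg_right
    (mul_le_mul_of_nonneg_left hc.coeff_le_fanConst hN.η_nonneg) (abs_nonneg _)

lemma dev_glued_sub_le_of_pos (hkin : S.IsKinetic ρ δ1 i kin) (hK : 0 ≤ K) (hkK : ∀ u u', ‖u‖ < δ1 →
    ‖u'‖ < δ1 → 0 < Γ.p u → 0 < Γ.p u' → |kin u - kin u'| ≤ K * ‖u - u'‖) {m' : ℝ} (hu : ‖u‖ < δ1)
    (hp : 0 < Γ.p u) (hm : |m| < ε) (hu' : ‖u'‖ < δ1) (hp' : 0 < Γ.p u') (hm' : |m'| < ε) : ‖Γ.dev u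
    (S.gluedBranch ρ i kin u m) - Γ.dev u' (S.gluedBranch ρ i kin u' m')‖ ≤ η * Γ.pairConst c K *
    (|m - m'| + ‖u - u'‖) := by
  have h := dev_gl_sub_le (P := fun u => ‖u‖ < δ1 ∧ 0 < Γ.p u) (z := S.flat ρ i kin)
    (k := fun u => σ * kin u) (T := fun u => σ * S.muSharp ρ i kin u) hK Sc.good hc hN hη
    (fun u hu => by
      obtain ⟨N, Z, F, hz, -, hk, hT, -, -⟩ := Sc.gluedBranch_eq O hc hkin hu.1 hu.2
      exact ⟨(hu.1.trans_le Sc.δ1_le).trans_le hδ, hz.trans_le hδ,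
        (Sc.p_lt u (hu.1.trans_le Sc.δ1_le)).trans_le hε, hk.trans_le hε, hT.trans_le hε, N, Z, F⟩)
    (fun u u' hu hu' => by
      rw [← mul_sub, O.abs_mul]; exact hkK u u' hu.1 hu'.1 hu.2 hu'.2)
    ⟨hu, hp⟩ ⟨hu', hp'⟩ (x := σ * m) (x' := σ * m') (by rw [O.abs_mul]; exact hm.trans_le hε)
    (by rw [O.abs_mul]; exact hm'.trans_le hε)
  obtain ⟨-, -, -, -, -, -, -, -, he⟩ := Sc.gluedBranch_eq O hc hkin hu hp
  obtain ⟨-, -, -, -, -, -, -, -, he'⟩ := Sc.gluedBranch_eq O hc hkin hu' hp'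
  rwa [he m hm, he' m' hm', ← O.abs_mul (m - m'), mul_sub]

end Scale

namespace Scale

variable (Sc : Γ.Scale c C ρ ε δ' δ1) (O : Γ.Oriented 1) (hc : Γ.Convex c C) (hN : Γ.Near η r)
  (hε : ε ≤ r) (hδ : δ' ≤ r) (hη : η ≤ 1)
include Sc O hc hN hε hδ hη

lemma glued_spec (hkin : S.IsKinetic ρ δ1 i kin) (hu : ‖u‖ < δ1) (hm : |m| < ε) : Γ.p (S.gluedBranch
    ρ i kin u m) = m ∧ ‖S.gluedBranch ρ i kin u m - u - (m - Γ.p u) • Γ.X‖ ≤ η * Γ.fanConst c C * |m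
    - Γ.p u| ∧ ‖S.gluedBranch ρ i kin u m - Γ.W m u‖ ≤ η * Γ.fanConst c C * |Γ.p u| := by
  rcases lt_trichotomy 0 (Γ.p u) with hp | hp | hp
  · simpa only [one_mul] using Sc.glued_of_pos O hc hN hε hδ hη hkin hu hp hm
  · have hr := hm.trans_le hε
    have hu' := (hu.trans_le Sc.δ1_le).trans_le hδ
    have h1 : S.gluedBranch ρ i kin u m = Γ.W m u := by
      rw [gluedBranch, sgn, O.mu_eq_iff.2 (show Γ.p u = 1 * 0 by rw [← hp, mul_zero]),
        Real.sign_zero, zero_mul, zero_mul, if_pos le_rfl, classicalBranch, sgn,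
        O.mu_eq_iff.2 (show Γ.p u = 1 * 0 by rw [← hp, mul_zero]), Real.sign_zero, zero_mul,
        zero_mul, if_pos le_rfl, Sc.integralPoint_eq O (hu.trans_le Sc.δ1_le) hm, one_mul]
    rw [h1, sub_self, norm_zero]
    refine ⟨Γ.p_W (hr.trans_le hN.r_M) (hu'.trans_le hN.r_R), ?_, by rw [← hp]; simp⟩
    refine (hN.W_sub_le hr hu' (by rw [← hp, abs_zero]; exact (norm_nonneg u).trans_lt hu')).trans ?_
    rw [mul_assoc]
    refine mul_le_mul_of_nonneg_left (le_mul_of_one_le_left (abs_nonneg _) ?_) hN.η_nonneg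
    have h2 := hc.c_pos
    have h3 := hc.C_pos
    exact le_trans (le_add_of_nonneg_right (by positivity)) hc.coeff_le_fanConst
  · obtain ⟨h1, h2, h3⟩ := Sc.reflect.glued_of_pos O.reflect hc.reflect hN.reflect hε hδ hη hkin hu
      (by simpa [Chart.reflect] using hp) hm
    rw [fanConst_reflect] at h2 h3
    refine ⟨?_, ?_, ?_⟩
    · simpa [Chart.reflect] using h1
    · convert h2 using 2
      · simp only [Chart.reflect]; module
      · rw [← abs_neg]; simp only [Chart.reflect]; congr 1; ring
    · simpa [Chart.reflect] using h3

lemma dev_glued_sub_le (hkin : S.IsKinetic ρ δ1 i kin) (hK : 0 ≤ K) (hkK : ∀ u u', ‖u‖ < δ1 → ‖u'‖ <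
    δ1 → 0 < Γ.p u * Γ.p u' → |kin u - kin u'| ≤ K * ‖u - u'‖) {m' : ℝ} (hu : ‖u‖ < δ1) (hm : |m| <
    ε) (hu' : ‖u'‖ < δ1) (hm' : |m'| < ε) : ‖Γ.dev u (S.gluedBranch ρ i kin u m) - Γ.dev u'
    (S.gluedBranch ρ i kin u' m')‖ ≤ η * (Γ.pairConst c K + (1 + Γ.B * Γ.fanConst c C)) * (|m - m'|
    + ‖u - u'‖) := by
  have hη0 := hN.η_nonneg
  have hB := Γ.B_pos
  have hc0 := hc.c_pos
  have hG := hc.fanConst_pos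
  have hP : 0 ≤ Γ.pairConst c K := by rw [pairConst]; positivity
  have hd : 0 ≤ |m - m'| + ‖u - u'‖ := by positivity
  have hsame : ∀ {w}, w ≤ η * Γ.pairConst c K * (|m - m'| + ‖u - u'‖) →
      w ≤ η * (Γ.pairConst c K + (1 + Γ.B * Γ.fanConst c C)) * (|m - m'| + ‖u - u'‖) := fun {w} h => by
    refine h.trans (mul_le_mul_of_nonneg_right (mul_le_mul_of_nonneg_left ?_ hη0) hd)
    linarith [mul_pos hB hG]
  rcases le_or_gt (Γ.p u * Γ.p u') 0 with hpp | hpp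
  · obtain ⟨h1, -, h2⟩ := Sc.glued_spec O hc hN hε hδ hη hkin hu hm
    obtain ⟨h1', -, h2'⟩ := Sc.glued_spec O hc hN hε hδ hη hkin hu' hm'
    have hur := (hu.trans_le Sc.δ1_le).trans_le hδ
    have hur' := (hu'.trans_le Sc.δ1_le).trans_le hδ
    have h3 := hN.W (hm.trans_le hε) hur (hm'.trans_le hε) hur'
    have h4 : |Γ.p u| + |Γ.p u'| ≤ Γ.B * ‖u - u'‖ := by
      refine le_trans (le_of_eq ?_) (Γ.p_lip (hur.trans_le hN.r_R) (hur'.trans_le hN.r_R))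
      rcases mul_nonpos_iff.1 hpp with h | h
      · rw [abs_of_nonneg h.1, abs_of_nonpos h.2, abs_of_nonneg (by linarith)]; ring
      · rw [abs_of_nonpos h.1, abs_of_nonneg h.2, abs_of_nonpos (by linarith)]; ring
    have h5 : Γ.dev u (S.gluedBranch ρ i kin u m) - Γ.dev u' (S.gluedBranch ρ i kin u' m') = (Γ.dev
      u (Γ.W m u) - Γ.dev u' (Γ.W m' u')) + (S.gluedBranch ρ i kin u m - Γ.W m u) - (S.gluedBranch ρ
      i kin u' m' - Γ.W m' u') := by
      rw [dev, dev, dev, dev, h1, h1', Γ.p_W ((hm.trans_le hε).trans_le hN.r_M) (hur.trans_le hN.r_R),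
        Γ.p_W ((hm'.trans_le hε).trans_le hN.r_M) (hur'.trans_le hN.r_R)]
      module
    rw [h5]
    refine (norm_sub_le _ _).trans ((add_le_add ((norm_add_le _ _).trans (add_le_add h3 h2)) h2').trans ?_)
    have h6 := mul_le_mul_of_nonneg_left h4 (show 0 ≤ η * Γ.fanConst c C by positivity)
    have h7 : 0 ≤ η * (Γ.pairConst c K) * (|m - m'| + ‖u - u'‖) := by positivity
    have h8 : 0 ≤ η * (Γ.B * Γ.fanConst c C) * |m - m'| := by positivity
    linarith
  · rcases pos_and_pos_or_neg_and_neg_of_mul_pos hpp with h | h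
    · exact hsame (Sc.dev_glued_sub_le_of_pos O hc hN hε hδ hη hkin hK
        (fun u u' h1 h2 h3 h4 => hkK u u' h1 h2 (mul_pos h3 h4)) hu h.1 hm hu' h.2 hm')
    · have := Sc.reflect.dev_glued_sub_le_of_pos O.reflect hc.reflect hN.reflect hε hδ hη hkin hK
        (fun u u' h1 h2 h3 h4 => hkK u u' h1 h2 (by
          have := mul_pos h3 h4
          simpa [Chart.reflect] using this)) hu
        (by simpa [Chart.reflect] using h.1) hm hu' (by simpa [Chart.reflect] using h.2) hm'
      rw [pairConst_reflect] at this
      refine hsame (le_trans (le_of_eq ?_) this)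
      congr 1
      simp only [dev, Chart.reflect, neg_apply]
      module

end Scale

end Chart

lemma hasNonclassical_seg_false : ¬ S.HasNonclassical (Wave.seg i false u v) := by
  rintro ⟨a, ha, h, -⟩
  rw [Wave.seg] at ha
  split_ifs at ha
  · simp at ha
  · grind

lemma hasNonclassical_seg_true (h : u ≠ v → S.Lax i u v) : ¬ S.HasNonclassical (Wave.seg i true u v)
    := by
  rintro ⟨a, ha, -, h'⟩
  rw [Wave.seg] at ha
  split_ifs at ha with he
  · simp at ha
  · grind

lemma hasNonclassical_cons : S.HasNonclassical (a :: L) ↔ S.IsNonclassical a ∨ S.HasNonclassical L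
    := by
  simp [HasNonclassical]

namespace Chart

lemma speed_near_of_isFan (hρ : ρ ≤ Γ.R) (hu : ‖u‖ < ρ) (h : S.IsFan ρ i u v L) : ∀ a ∈ L, |S.lo a -
    S.lam i 0| < g ∧ |S.hi a - S.lam i 0| < g := by
  obtain ⟨hc, hw, -⟩ := h
  induction L generalizing u with
  | nil => simp
  | cons a L ih =>
    obtain ⟨rfl, hc⟩ := hc
    obtain ⟨hfam, ha⟩ := hw a List.mem_cons_self
    have hr := ha.right_mem
    refine List.forall_mem_cons.2 ⟨?_, ih hr hc fun b hb => hw b (List.mem_cons_of_mem _ hb)⟩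
    rw [lo, hi, hfam]
    rcases ha with ⟨h1, h2, h3, -⟩ | ⟨h1, -⟩
    · rw [hfam] at h2
      rw [if_pos h1, if_pos h1, (speed_of_mem hρ hu h2 h3).2]
      have := Γ.s_near (Γ.p_lt (hr.trans_le hρ)) (hu.trans_le hρ)
      exact ⟨this, this⟩
    · rw [h1]
      simpa using ⟨Γ.lam_near (hu.trans_le hρ), Γ.lam_near (hr.trans_le hρ)⟩

namespace Scale

variable (Sc : Γ.Scale c C ρ ε δ' δ1) (O : Γ.Oriented σ) (hc : Γ.Convex c C)
include Sc O hc

/-- A fan is determined by its end states and by whether it is nonclassical. -/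
lemma pattern_of_pos (hkin : S.IsKinetic ρ δ1 i kin) (hnuc : S.IsThreshold ρ δ1 i kin nuc) (hu : ‖u‖
    < δ1) (hp : 0 < Γ.p u) : ∃ canon : Prop → State n → List (Wave n), ∀ v L, |S.mu i v| < ε →
    S.IsNCFan ρ i kin nuc u v L → L = canon (S.HasNonclassical L) v ∧ (S.HasNonclassical L → v =
    S.gluedBranch ρ i kin u (S.mu i v)) ∧ (¬ S.HasNonclassical L → v = S.gluedBranch ρ i (S.muNat ρ
    i) u (S.mu i v)) := by
  classical
  obtain ⟨N, Z, F, hz, hN, -, -, -, he⟩ := Sc.gluedBranch_eq O hc hkin hu hp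
  obtain ⟨N', Z', F', hz', hN', -, -, -, he'⟩ :=
    Sc.gluedBranch_eq O hc (Sc.isKinetic_muNat O hc) hu hp
  set T := σ * S.muSharp ρ i kin u with hT
  set T' := σ * S.muSharp ρ i (S.muNat ρ i) u with hT'
  have hu' := F.u_R Sc.good
  have hzR := F.z_R Sc.good
  have hkN' : σ * S.muNat ρ i u = N := O.mul_eq_iff.2 hN
  rw [hkN'] at F' he'
  have hNN : N' = N := by rw [← O.mul_eq_iff.2 hN', hkN']
  rw [hNN] at F'
  have hTN' : T' = N := by
    by_contra h
    have h1 := F'.data.s_strictMono hu' F'.k_lt (F'.T_M Sc.good) le_rfl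
      (lt_of_le_of_ne F'.k_le_T (Ne.symm h))
    rw [F'.s_T] at h1
    exact lt_irrefl _ h1
  have hTN : σ * kin u = N → T = N := fun h => by
    by_contra h2
    have h1 := F.data.s_strictMono hu' F'.k_lt (F.T_M Sc.good) le_rfl
      (lt_of_le_of_ne F.N_le (Ne.symm h2))
    rw [F.s_T, h] at h1
    exact lt_irrefl _ h1
  have hzz : σ * kin u = N → S.flat ρ i kin u = S.flat ρ i (S.muNat ρ i) u := fun h => by
    rw [← F.z_eq, ← F'.z_eq, h]
  have hspec := Sc.ncCurveAt O hc hkin hnuc hu hp (Real.le_coe_toNNReal Γ.B)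
  have hpc := pieces O hp (T := T) (by rw [hT, ← mul_assoc, O.sq, one_mul]) (nuc := nuc) (kin := kin)
  obtain ⟨hν, -⟩ := threshold O hnuc hu hp hN (T := T) (by rw [hT, ← mul_assoc, O.sq, one_mul])
  have hflat : S.IsNonclassical ⟨i, true, u, S.flat ρ i kin u⟩ ↔ σ * kin u < N := by
    have h1 := F.lax_z_iff Sc.good
    simp only [IsNonclassical, Lax, true_and]
    rw [← not_le, ← h1, not_iff_not]
    refine and_iff_left ?_
    rw [F.speed_z Sc.good]
    exact (F.data.s_lt F.k_lt F.Z_lt.le F.k_lt_p).le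
  refine ⟨fun b v => if b then ⟨i, true, u, S.flat ρ i kin u⟩ ::
      (if σ * kin u < Γ.p v then Wave.seg i true (S.flat ρ i kin u) v
        else Wave.seg i false (S.flat ρ i kin u) v)
    else if Γ.p u < Γ.p v then Wave.seg i false u v else if N ≤ Γ.p v then Wave.seg i true u v else
      ⟨i, true, u, S.flat ρ i kin u⟩ :: Wave.seg i false (S.flat ρ i kin u) v, fun v L hv hL => ?_⟩
  have hNp := F.data.N_lt hp
  rcases (hspec.fans v L).1 hL with ⟨hm, rfl⟩ | ⟨hm, rfl⟩ | ⟨hm, rfl⟩ | ⟨hm, rfl⟩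
  · have hnon := hasNonclassical_seg_false (S := S) (i := i) (u := u) (v := v)
    obtain ⟨h1, h2⟩ := (hpc v).1.1 hm
    have h3 := arc_right (Γ := Γ) Sc.good.le h1
    refine ⟨?_, fun h => absurd h hnon, fun _ => ?_⟩
    · beta_reduce
      rw [if_neg hnon]
      rcases h2.eq_or_lt with h4 | h4
      · rw [← h4, Γ.W_p hu'] at h3
        rw [h3, Wave.seg_self, if_neg (lt_irrefl _), if_pos hNp.le, Wave.seg_self]
      · rw [if_pos h4]
    · rw [he' _ hv, ← O.p_eq, gl, if_pos (F'.T_lt.le.trans h2), cb, if_pos h2]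
      exact h3
  · have hnon := hasNonclassical_seg_true (S := S) (i := i) (u := u) (v := v)
      fun h => hspec.piece2_lax v hm h.symm
    obtain ⟨h1, h2, h4⟩ := (hpc v).2.1.1 hm
    have h3 := ((mem_hugoniot Sc.good.le F.u_lt).1 h1).2
    refine ⟨?_, fun h => absurd h hnon, fun _ => ?_⟩
    · grind
    · rw [he' _ hv, ← O.p_eq, gl, if_pos (by rw [hTN']; exact hν.trans h2), cb]
      split_ifs with h5
      · have h6 := le_antisymm h4 h5
        rw [h6, Γ.V_p hu'] at h3
        rw [h6, Γ.W_p hu', h3]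
      · exact h3.symm
  · obtain ⟨h1, h2, h4⟩ := (hpc v).2.2.1.1 hm
    have h3 := ((mem_hugoniot Sc.good.le F.z_lt).1 h1).2
    have hkN : σ * kin u < N := lt_of_le_of_ne F.k_le fun h => by
      rw [hTN h] at h4; linarith
    have hnon : S.HasNonclassical (⟨i, true, u, S.flat ρ i kin u⟩ ::
      Wave.seg i true (S.flat ρ i kin u) v) := hasNonclassical_cons.2 (Or.inl (hflat.2 hkN))
    refine ⟨?_, fun _ => ?_, fun h => absurd hnon h⟩
    · beta_reduce
      rw [if_pos hnon]
      split_ifs with h5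
      · rfl
      · have h6 : Γ.p v = Γ.p (S.flat ρ i kin u) := by
          rw [F.p_z Sc.good]; exact le_antisymm (not_lt.1 h5) h2
        rw [h6, Γ.V_p hzR] at h3
        rw [h3, Wave.seg_self, Wave.seg_self]
    · rw [he _ hv, ← O.p_eq, gl, if_neg (not_le.2 h4), nb, if_pos h2]
      exact h3.symm
  · obtain ⟨h1, h2⟩ := (hpc v).2.2.2.1 hm
    have h3 := arc_right (Γ := Γ) Sc.good.le h1
    have hvz : Γ.p v = σ * kin u → v = S.flat ρ i kin u := fun h => by
      rw [h, ← F.p_z Sc.good, Γ.W_p hzR] at h3; exact h3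
    have hnon : S.HasNonclassical (⟨i, true, u, S.flat ρ i kin u⟩ :: Wave.seg i false (S.flat ρ i
      kin u) v) ↔ σ * kin u < N := by
      rw [hasNonclassical_cons, hflat, or_iff_left hasNonclassical_seg_false]
    rw [hnon]
    refine ⟨?_, fun hkN => ?_, fun hkN => ?_⟩
    · beta_reduce
      split_ifs with h5 h6 h7 h7
      · linarith
      · rfl
      · linarith [F.k_le]
      · have h8 : Γ.p v = σ * kin u := le_antisymm h2 ((F.k_le).trans h7)
        rw [hvz h8, Wave.seg_self, Wave.seg_of_ne (F.z_ne Sc.good).symm]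
      · rfl
    · rw [he _ hv, ← O.p_eq, gl, if_neg (by linarith [F.N_le]), nb]
      split_ifs with h5
      · have h8 := le_antisymm h2 h5
        rw [h8, ← F.p_z Sc.good, Γ.V_p hzR]; exact hvz h8
      · exact h3
    · have hkN' : σ * kin u = N := le_antisymm F.k_le (not_lt.1 hkN)
      rw [he' _ hv, ← O.p_eq, gl, hTN', ← hzz hkN']
      split_ifs with h5
      · have h8 : Γ.p v = N := le_antisymm (hkN' ▸ h2) h5
        rw [cb, if_neg (by linarith), h8, ← hkN', F.z_eq]
        exact hvz (by rw [h8, hkN'])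
      · rw [nb, if_neg h5]; exact h3

lemma pattern (hkin : S.IsKinetic ρ δ1 i kin) (hnuc : S.IsThreshold ρ δ1 i kin nuc) (hu : ‖u‖ < δ1)
    : ∃ canon : Prop → State n → List (Wave n), ∀ v L, |S.mu i v| < ε → S.IsNCFan ρ i kin nuc u v L
    → L = canon (S.HasNonclassical L) v ∧ (S.HasNonclassical L → v = S.gluedBranch ρ i kin u (S.mu i
    v)) ∧ (¬ S.HasNonclassical L → v = S.gluedBranch ρ i (S.muNat ρ i) u (S.mu i v)) := by
  rcases lt_trichotomy 0 (Γ.p u) with hp | hp | hp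
  · exact Sc.pattern_of_pos O hc hkin hnuc hu hp
  · refine ⟨fun _ v => Wave.seg i false u v, fun v L hv hL => ?_⟩
    obtain ⟨h1, rfl⟩ := (Sc.fans_of_zero hc hu hp.symm v L).1 hL
    refine ⟨rfl, fun h => absurd h hasNonclassical_seg_false, fun _ => ?_⟩
    have h0 : S.sgn i u = 0 := by
      rw [sgn, O.mu_eq_iff.2 (show Γ.p u = σ * 0 by rw [← hp, mul_zero]), Real.sign_zero]
    rw [gluedBranch, h0, zero_mul, zero_mul, if_pos le_rfl, classicalBranch, h0, zero_mul, zero_mul,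
      if_pos le_rfl, Sc.integralPoint_eq O (hu.trans_le Sc.δ1_le) hv, ← O.p_eq]
    exact arc_right Sc.good.le h1
  · exact Sc.reflect.pattern_of_pos O.reflect hc.reflect hkin hnuc hu
      (by simpa [Chart.reflect] using hp)

lemma gluedBranch_mem (hkin : S.IsKinetic ρ δ1 i kin) (hnuc : S.IsThreshold ρ δ1 i kin nuc) (hu :
    ‖u‖ < δ1) (hm : |m| < ε) : S.gluedBranch ρ i kin u m ∈ S.ncCurve ρ i kin nuc u := by
  have hpos : ∀ {Γ : Chart S i g} {σ : ℝ} (Sc : Γ.Scale c C ρ ε δ' δ1) (O : Γ.Oriented σ) (hc :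
    Γ.Convex c C), 0 < Γ.p u → S.gluedBranch ρ i kin u m ∈ S.ncCurve ρ i kin nuc u := by
    intro Γ σ Sc O hc hp
    obtain ⟨N, Z, F, -, hN, -⟩ := Sc.gluedBranch_eq O hc hkin hu hp
    have hspec := Sc.ncCurveAt O hc hkin hnuc hu hp (Real.le_coe_toNNReal Γ.B)
    obtain ⟨-, hν⟩ := threshold O hnuc hu hp hN (T := σ * S.muSharp ρ i kin u)
      (by rw [← mul_assoc, O.sq, one_mul])
    have hne : S.mu i u ≠ 0 := fun h => by
      rw [O.mu_eq_iff, mul_zero] at h; exact hp.ne' h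
    rw [ncCurve, if_neg hne, gluedBranch, union_assoc _ (S.piece3 ρ i kin u)]
    split_ifs with h
    · refine Or.inl (hspec.classical_mem m hm (le_trans ?_ h)).1
      rw [O.sgn_eq hp]; exact hν
    · exact Or.inr (hspec.nonclassical_mem m hm (not_le.1 h)).1
  rcases lt_trichotomy 0 (Γ.p u) with hp | hp | hp
  · exact hpos Sc O hc hp
  · have h0 : S.mu i u = 0 := O.mu_eq_iff.2 (by rw [← hp, mul_zero])
    have h1 : S.sgn i u = 0 := by rw [sgn, h0, Real.sign_zero]
    rw [ncCurve, if_pos h0, gluedBranch, h1, zero_mul, zero_mul, if_pos le_rfl, classicalBranch, h1,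
      zero_mul, zero_mul, if_pos le_rfl, Sc.integralPoint_eq O (hu.trans_le Sc.δ1_le) hm]
    exact (Sc.W_mem (hu.trans_le Sc.δ1_le) (by rwa [O.abs_mul])).1
  · exact hpos Sc.reflect O.reflect hc.reflect (by simpa [Chart.reflect] using hp)

end Scale

/-- The waves of a field whose fans consist of a single wave. -/
structure Simple (Γ : Chart S i g) (ρ : ℝ) : Prop where
  le : ρ ≤ Γ.R
  single : ∀ {u v a b L}, ‖u‖ < ρ → ¬ S.IsFan ρ i u v (a :: b :: L)
  shock : ∀ {u v}, ‖u‖ < ρ → v ∈ S.hugoniot ρ i u → v ≠ u →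
    (S.dissipation u v ≤ 0 ↔ S.lam i v ≤ S.lam i u) ∧
    (S.dissipation u v ≤ 0 → S.Lax i u v ∧ v = Γ.cb u (Γ.p v))
  rarefaction : ∀ {u v}, ‖u‖ < ρ → S.Rarefaction ρ i u v → v = Γ.cb u (Γ.p v)
  wave : ∀ {u v}, v ∈ S.integralCurve ρ i u → v ≠ u → S.lam i u ≤ S.lam i v →
    ∃ b, S.IsWave ρ ⟨i, b, u, v⟩
  cb_mem : ∀ {u m}, ‖u‖ < ρ → |m| < Γ.M → Γ.V m u ∈ S.hugoniot ρ i u →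
    Γ.W m u ∈ S.integralCurve ρ i u → Γ.cb u m ∈ S.classicalCurve ρ i u

lemma _root_.ConsLaw.Rarefaction.lam_lt (h : S.Rarefaction ρ i u v) : S.lam i u < S.lam i v := by
  obtain ⟨γ, hγ, hm⟩ := h
  have := hm (left_mem_Icc.2 zero_le_one) (right_mem_Icc.2 zero_le_one) zero_lt_one
  simpa only [hγ.1, hγ.2.1] using this

namespace Simple

variable (h : Γ.Simple ρ) (hu : ‖u‖ < ρ)
include h hu

lemma shock_of_isWave (hw : S.IsWave ρ ⟨i, true, u, v⟩) : v ∈ S.hugoniot ρ i u ∧ v ≠ u ∧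
    S.dissipation u v ≤ 0 ∧ S.lam i v ≤ S.lam i u := by
  rcases hw with ⟨-, h1, h2, h3⟩ | ⟨h1, -⟩
  · exact ⟨h1, h2, h3, (h.shock hu h1 h2).1.1 h3⟩
  · simp at h1

omit h hu in
lemma _root_.ConsLaw.rarefaction_of_isWave (hw : S.IsWave ρ ⟨i, false, u, v⟩) : S.Rarefaction ρ i u
    v := by
  rcases hw with ⟨h1, -⟩ | ⟨-, h1⟩
  · simp at h1
  · exact h1

lemma isFan (hL : S.IsFan ρ i u v L) : (u = v ∧ L = []) ∨ (u ≠ v ∧ ∃ b, L = Wave.seg i b u v ∧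
    S.IsWave ρ ⟨i, b, u, v⟩) := by
  match L, hL with
  | [], hL => exact Or.inl ⟨isFan_nil.1 hL, rfl⟩
  | [⟨j, b, w, x⟩], hL =>
    obtain ⟨⟨h1, h2⟩, h3, h4⟩ := isFan_single.1 hL
    simp only at h1 h2 h3
    subst h1 h2 h3
    have hne : w ≠ x := by
      cases b
      · exact (Rarefaction.ne (rarefaction_of_isWave h4)).symm
      · exact (h.shock_of_isWave hu h4).2.1.symm
    exact Or.inr ⟨hne, b, (Wave.seg_of_ne hne).symm, h4⟩
  | a :: b :: L, hL => exact absurd hL (h.single hu)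

lemma isFan_spec (hL : S.IsFan ρ i u v L) : v = Γ.cb u (Γ.p v) ∧ ¬ S.HasNonclassical L ∧ ((L =
    Wave.seg i true u v ∧ (u ≠ v → S.Lax i u v)) ∨ L = Wave.seg i false u v) ∧ ∀ L', S.IsFan ρ i u v
    L' → L' = L := by
  rcases h.isFan hu hL with ⟨rfl, rfl⟩ | ⟨hne, b, rfl, hw⟩
  · refine ⟨?_, by simp [HasNonclassical], Or.inr (Wave.seg_self _ _).symm, fun L' hL' => ?_⟩
    · rw [cb, if_pos le_rfl, Γ.W_p (hu.trans_le h.le)]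
    · rcases h.isFan hu hL' with h1 | h1
      exacts [h1.2, absurd rfl h1.1]
  · have huniq : ∀ L', S.IsFan ρ i u v L' → L' = Wave.seg i b u v := fun L' hL' => by
      rcases h.isFan hu hL' with ⟨h1, -⟩ | ⟨-, b', rfl, hw'⟩
      · exact absurd h1 hne
      cases b <;> cases b'
      · rfl
      · have h1 := (rarefaction_of_isWave hw).lam_lt
        have h2 := (h.shock_of_isWave hu hw').2.2.2
        linarith
      · have h1 := (rarefaction_of_isWave hw').lam_lt
        have h2 := (h.shock_of_isWave hu hw).2.2.2
        linarith
      · rfl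
    cases b
    · exact ⟨h.rarefaction hu (rarefaction_of_isWave hw), hasNonclassical_seg_false, Or.inr rfl,
        huniq⟩
    · obtain ⟨h1, h2, h3, -⟩ := h.shock_of_isWave hu hw
      obtain ⟨h4, h5⟩ := (h.shock hu h1 h2).2 h3
      exact ⟨h5, hasNonclassical_seg_true fun _ => h4, Or.inl ⟨rfl, fun _ => h4⟩, huniq⟩

omit v in
lemma setOf_isFan_eq : {v | ∃ L, S.IsFan ρ i u v L} = S.classicalCurve ρ i u := by
  ext v
  constructor
  · rintro ⟨L, hL⟩
    rcases h.isFan hu hL with ⟨rfl, -⟩ | ⟨hne, b, -, hw⟩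
    · exact Or.inl ⟨self_mem_hugoniot hu, le_rfl⟩
    · cases b
      · have h1 := rarefaction_of_isWave hw
        exact Or.inr ⟨Rarefaction.mem h1, h1.lam_lt.le⟩
      · have h1 := h.shock_of_isWave hu hw
        exact Or.inl ⟨h1.1, h1.2.2.2⟩
  · intro hv
    by_cases hne : v = u
    · subst hne; exact ⟨[], isFan_nil.2 rfl⟩
    · obtain ⟨b, hb⟩ : ∃ b, S.IsWave ρ ⟨i, b, u, v⟩ := by
        rcases hv with ⟨h1, h2⟩ | ⟨h1, h2⟩
        · exact ⟨true, Or.inl ⟨rfl, h1, hne, (h.shock hu h1 hne).1.2 h2⟩⟩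
        · exact h.wave h1 hne h2
      exact ⟨_, isFan_single.2 ⟨⟨rfl, rfl⟩, rfl, hb⟩⟩

end Simple

lemma Nonlinear.lam_lt_of_arc (hΓ : Γ.Nonlinear) (hρ : ρ ≤ Γ.R) (hγ : S.IsArc ρ i u v γ) {τ τ' : ℝ}
    (hτ : τ ∈ Icc (0 : ℝ) 1) (hτ' : τ' ∈ Icc (0 : ℝ) 1) (hlt : Γ.p (γ τ) < Γ.p (γ τ')) : S.lam i (γ
    τ) < S.lam i (γ τ') := by
  have hu := hγ.left_mem.trans_le hρ
  have hm : ∀ x ∈ Icc (Γ.p (γ τ)) (Γ.p (γ τ')), ‖Γ.W x u‖ < Γ.R ∧ |x| < Γ.M := fun x hx => by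
    obtain ⟨t, ht, h1, h2, h3⟩ := exists_arc_param hρ hγ hτ hτ' (Icc_subset_uIcc hx)
    have h4 := h3.trans_le hρ
    refine ⟨h4, ?_⟩
    rw [← h1, h2]; exact Γ.p_lt h4
  have := lt_of_deriv_pos hlt (f := fun x => S.lam i (Γ.W x u))
    (fun x hx => Γ.lam_W (hm x hx).2 hu) fun x hx => hΓ.h_pos (hm x (Ioo_subset_Icc_self hx)).1
  simpa only [← (Γ.arc_eq hρ hγ).1 τ hτ, ← (Γ.arc_eq hρ hγ).1 τ' hτ'] using this

lemma Nonlinear.rarefaction_iff (hΓ : Γ.Nonlinear) (hρ : ρ ≤ Γ.R) (h : v ∈ S.integralCurve ρ i u) :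
    (S.Rarefaction ρ i u v ↔ Γ.p u < Γ.p v) ∧ (Γ.p v < Γ.p u → S.lam i v < S.lam i u) := by
  obtain ⟨γ, hγ⟩ := id h
  have h01 : (0 : ℝ) ∈ Icc (0 : ℝ) 1 := left_mem_Icc.2 zero_le_one
  have h11 : (1 : ℝ) ∈ Icc (0 : ℝ) 1 := right_mem_Icc.2 zero_le_one
  have hlt : Γ.p v < Γ.p u → S.lam i v < S.lam i u := fun h1 => by
    have := hΓ.lam_lt_of_arc hρ hγ h11 h01 (by rwa [hγ.1, hγ.2.1])
    rwa [hγ.1, hγ.2.1] at this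
  refine ⟨⟨fun hr => ?_, fun hp => ⟨γ, hγ, ?_⟩⟩, hlt⟩
  · have h1 := hr.lam_lt
    rcases lt_trichotomy (Γ.p u) (Γ.p v) with h2 | h2 | h2
    · exact h2
    · refine absurd ?_ (Rarefaction.ne hr)
      rw [arc_right hρ h, ← h2, Γ.W_p (hγ.left_mem.trans_le hρ)]
    · linarith [hlt h2]
  · intro τ hτ τ' hτ' hlt'
    refine hΓ.lam_lt_of_arc hρ hγ hτ hτ' ?_
    rcases (Γ.arc_eq hρ hγ).2 with h | h | h
    · exact h hτ hτ' hlt'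
    · have := h h01 h11 zero_lt_one
      simp only [hγ.1, hγ.2.1] at this
      linarith
    · have := h 1 h11
      rw [hγ.2.1] at this
      rw [this] at hp
      exact absurd hp (lt_irrefl _)

lemma Nonlinear.shock_spec (hΓ : Γ.Nonlinear) (hu : ‖u‖ < Γ.R) (hm : |m| < Γ.M) : (m < Γ.p u →
    S.dissipation u (Γ.V m u) < 0 ∧ S.lam i (Γ.V m u) < Γ.s m u ∧ Γ.s m u < S.lam i u) ∧ (Γ.p u < m
    → 0 < S.dissipation u (Γ.V m u) ∧ S.lam i u < S.lam i (Γ.V m u)) := by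
  have hpM := Γ.p_lt hu
  have hE : S.dissipation u (Γ.V (Γ.p u) u) = 0 := by rw [Γ.V_p hu, diss_self]
  obtain ⟨κ, hκ, hlax⟩ := Γ.lax hm hu
  have hs1 := hΓ.s1_pos hm hu
  constructor
  · intro hlt
    have hI : ∀ x ∈ Icc m (Γ.p u), |x| < Γ.M := fun x hx => abs_lt_of_mem_Icc hm hpM hx
    refine ⟨?_, ?_, ?_⟩
    · rw [← hE]
      refine lt_of_deriv_pos hlt (fun x hx => Γ.E_deriv (hI x hx) hu) fun x hx => ?_
      have hx' := hI x (Ioo_subset_Icc_self hx)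
      refine mul_pos (hΓ.s1_pos hx' hu) ?_
      rw [← Γ.Q_self hu]
      exact Q_lt hu hx' hx.2 le_rfl
    · have : κ * ((m - Γ.p u) * Γ.s1 m u) < 0 :=
        mul_neg_of_pos_of_neg hκ (mul_neg_of_neg_of_pos (sub_neg.2 hlt) hs1)
      linarith
    · rw [← Γ.s_self hu]
      exact lt_of_deriv_pos hlt (fun x hx => Γ.s_deriv (hI x hx) hu)
        fun x hx => hΓ.s1_pos (hI x (Ioo_subset_Icc_self hx)) hu
  · intro hlt
    have hI : ∀ x ∈ Icc (Γ.p u) m, |x| < Γ.M := fun x hx => abs_lt_of_mem_Icc hpM hm hx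
    refine ⟨?_, ?_⟩
    · rw [← hE]
      refine lt_of_deriv_pos hlt (fun x hx => Γ.E_deriv (hI x hx) hu) fun x hx => ?_
      have hx' := hI x (Ioo_subset_Icc_self hx)
      refine mul_pos (hΓ.s1_pos hx' hu) ?_
      rw [← Γ.Q_self hu]
      exact Q_lt_right hu hx' hx.1 le_rfl
    · have h1 : Γ.s (Γ.p u) u < Γ.s m u := lt_of_deriv_pos hlt
        (fun x hx => Γ.s_deriv (hI x hx) hu) fun x hx => hΓ.s1_pos (hI x (Ioo_subset_Icc_self hx)) hu
      rw [Γ.s_self hu] at h1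
      have : 0 < κ * ((m - Γ.p u) * Γ.s1 m u) := mul_pos hκ (mul_pos (sub_pos.2 hlt) hs1)
      linarith

lemma Nonlinear.simple (hΓ : Γ.Nonlinear) (hρ : ρ ≤ Γ.R) : Γ.Simple ρ := by
  have hshock : ∀ {u v}, ‖u‖ < ρ → v ∈ S.hugoniot ρ i u → v ≠ u → (S.dissipation u v ≤ 0 ↔ S.lam i v
    ≤ S.lam i u) ∧ (S.dissipation u v ≤ 0 → Γ.p v < Γ.p u ∧ S.lam i v < S.speed u v ∧ S.speed u v <
    S.lam i u) := by
    intro u v hu hv hne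
    obtain ⟨h1, h2⟩ := speed_of_mem hρ hu hv hne
    obtain ⟨h3, h4⟩ := (mem_hugoniot hρ hu).1 hv
    obtain ⟨h5, h6⟩ := hΓ.shock_spec (hu.trans_le hρ) (Γ.p_lt (h3.trans_le hρ))
    rw [h4] at h5 h6
    rw [h2]
    rcases lt_or_gt_of_ne h1 with h | h
    · grind
    · grind
  refine ⟨hρ, fun {u v a b L} hu hL => ?_, fun {u v} hu hv hne => ?_, fun {u v} hu hr => ?_,
    fun {u v} hv hne hle => ?_, fun {u m} hu hm hV hW => ?_⟩
  · obtain ⟨h1, h2, -⟩ := hL.next fun u v hu hv hne hd => ((hshock hu hv hne).2 hd).2.2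
    obtain ⟨h4, h5, h6⟩ := hL.head
    rcases h6 with ⟨-, h7, h8, h9⟩ | ⟨h7, -⟩
    · grind
    · rw [h1] at h7; simp at h7
  · refine ⟨(hshock hu hv hne).1, fun hd => ?_⟩
    obtain ⟨h1, h2, h3⟩ := (hshock hu hv hne).2 hd
    refine ⟨⟨h2.le, h3.le⟩, ?_⟩
    rw [cb, if_neg (not_le.2 h1), ((mem_hugoniot hρ hu).1 hv).2]
  · have hv := Rarefaction.mem hr
    rw [cb, if_pos ((hΓ.rarefaction_iff hρ hv).1.1 hr).le]
    exact arc_right hρ hv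
  · refine ⟨false, Or.inr ⟨rfl, (hΓ.rarefaction_iff hρ hv).1.2 ?_⟩⟩
    refine lt_of_not_ge fun h => ?_
    rcases h.eq_or_lt with h | h
    · refine hne ?_
      obtain ⟨γ, hγ⟩ := id hv
      rw [arc_right hρ hv, h, Γ.W_p (hγ.left_mem.trans_le hρ)]
    · linarith [(hΓ.rarefaction_iff hρ hv).2 h]
  · have hR := hu.trans_le hρ
    rw [cb]
    split_ifs with h
    · refine Or.inr ⟨hW, ?_⟩
      rcases h.eq_or_lt with h | h
      · rw [← h, Γ.W_p hR]
      · exact ((hΓ.rarefaction_iff hρ hW).1.2 (by rwa [Γ.p_W hm hR])).lam_lt.le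
    · obtain ⟨-, h1, h2⟩ := (hΓ.shock_spec hR hm).1 (not_le.1 h)
      exact Or.inl ⟨hV, (h1.trans h2).le⟩

lemma Degenerate.simple (hΓ : Γ.Degenerate) (hρ : ρ ≤ Γ.R) : Γ.Simple ρ := by
  have hshock : ∀ {u v}, ‖u‖ < ρ → v ∈ S.hugoniot ρ i u → v ≠ u → S.dissipation u v = 0 ∧ S.lam i v
    = S.lam i u ∧ S.speed u v = S.lam i u ∧ Γ.W (Γ.p v) u = v := by
    intro u v hu hv hne
    obtain ⟨h1, h2⟩ := speed_of_mem hρ hu hv hne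
    obtain ⟨h3, h4⟩ := (mem_hugoniot hρ hu).1 hv
    have hR := hu.trans_le hρ
    have hM := Γ.p_lt (h3.trans_le hρ)
    have h5 := hΓ.diss hM hR
    have h6 := hΓ.lam_V hM hR
    rw [h4] at h5 h6
    exact ⟨h5, h6, by rw [h2, hΓ.s_eq hM hR], by rw [← hΓ.V_eq hM hR, h4]⟩
  have hcurve : ∀ {u v}, v ∈ S.integralCurve ρ i u → v ∈ S.hugoniot ρ i u := fun {u v} hv => by
    obtain ⟨γ, hγ⟩ := id hv
    refine (mem_hugoniot hρ hγ.left_mem).2 ⟨hγ.right_mem, ?_⟩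
    rw [hΓ.V_eq (Γ.p_lt (hγ.right_mem.trans_le hρ)) (hγ.left_mem.trans_le hρ), ← arc_right hρ hv]
  have hnr : ∀ {u v}, ‖u‖ < ρ → ¬ S.Rarefaction ρ i u v := fun {u v} hu hr => by
    have := (hshock hu (hcurve (Rarefaction.mem hr)) (Rarefaction.ne hr)).2.1
    linarith [hr.lam_lt]
  have hcb : ∀ {u v}, ‖u‖ < ρ → Γ.V (Γ.p v) u = v → Γ.W (Γ.p v) u = v → v = Γ.cb u (Γ.p v) :=
    fun {u v} _ h1 h2 => by rw [cb, h1, h2, ite_self]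
  refine ⟨hρ, fun {u v a b L} hu hL => ?_, fun {u v} hu hv hne => ?_,
    fun {u v} hu hr => absurd hr (hnr hu), fun {u v} hv hne hle => ?_, fun {u m} hu hm hV hW => ?_⟩
  · obtain ⟨⟨h1, h2, h3, h4⟩, h5⟩ := isFan_cons_cons.1 hL
    obtain ⟨h6, h7, h8⟩ := h5.head
    have hz := h3.right_mem
    rcases h3 with ⟨ha, h9, h10, -⟩ | ⟨-, h9⟩
    · rcases h8 with ⟨hb, h11, h12, -⟩ | ⟨-, h11⟩
      · rw [h2, h1] at h9
        rw [h1] at h10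
        rw [h6, h7] at h11
        rw [h6] at h12
        obtain ⟨-, e1, e2, -⟩ := hshock hu h9 h10
        obtain ⟨-, e3, e4, -⟩ := hshock hz h11 h12
        rw [hi, lo, if_pos ha, if_pos hb, h1, h6, e2, e4, e1, ha, hb] at h4
        simp at h4
      · grind
    · grind
  · obtain ⟨h1, h2, h3, h4⟩ := hshock hu hv hne
    exact ⟨iff_of_true h1.le h2.le, fun _ => ⟨⟨by rw [h2, h3], h3.le⟩,
      hcb hu ((mem_hugoniot hρ hu).1 hv).2 h4⟩⟩
  · obtain ⟨γ, hγ⟩ := id hv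
    exact ⟨true, Or.inl ⟨rfl, hcurve hv, hne, (hshock hγ.left_mem (hcurve hv) hne).1.le⟩⟩
  · rw [cb, hΓ.V_eq hm (hu.trans_le hρ), ite_self, ← hΓ.V_eq hm (hu.trans_le hρ)]
    exact Or.inl ⟨hV, (hΓ.lam_V hm (hu.trans_le hρ)).le⟩

end Chart

section Chains

variable {E : Type*} [NormedAddCommGroup E] [NormedSpace ℝ E]

lemma Fin.sum_sub_castSucc {E : Type*} [AddCommGroup E] (D : Fin (n + 1) → E) : ∑ j : Fin n, (D
    j.succ - D j.castSucc) = D (Fin.last n) - D 0 := by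
  have h1 := Fin.sum_univ_succ D
  rw [Fin.sum_univ_castSucc] at h1
  rw [Finset.sum_sub_distrib, sub_eq_sub_iff_add_eq_add, add_comm, ← h1, add_comm]

/-- Chains of approximate steps in the directions of a basis are controlled by their end points. -/
lemma exists_chain_bound (f : (Fin n → ℝ) ≃L[ℝ] E) (X : Fin n → E) (hf : ∀ y, f y = ∑ j, y j • X j)
    : ∃ η > 0, ∃ G > 0, ∀ (D : Fin (n + 1) → E) (y : Fin n → ℝ), (∀ j, ‖D j.succ - D j.castSucc - y
    j • X j‖ ≤ η * (|y j| + ‖D j.castSucc‖)) → ‖D (Fin.last n) - D 0 - f y‖ ≤ 1 / (2 * (‖(f.symm : E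
    →L[ℝ] Fin n → ℝ)‖ + 1)) * (‖D 0‖ + ‖y‖) ∧ ‖y‖ ≤ G * (‖D 0‖ + ‖D (Fin.last n)‖) ∧ ∀ k, ‖D k‖ ≤ G
    * (‖D 0‖ + ‖D (Fin.last n)‖) := by
  set a := ‖(f.symm : E →L[ℝ] Fin n → ℝ)‖ with ha
  have ha0 : 0 ≤ a := norm_nonneg _
  set x := ∑ j, ‖X j‖ with hx
  have hx0 : 0 ≤ x := Finset.sum_nonneg fun j _ => norm_nonneg _
  set H := (3 : ℝ) ^ n * (x + 2) with hH
  have h3 : (1 : ℝ) ≤ 3 ^ n := one_le_pow₀ (by norm_num)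
  have hH1 : 1 ≤ H := by nlinarith
  set η := min 1 (1 / (4 * (n + 1) * H * (a + 1))) with hη
  have hη0 : 0 < η := lt_min one_pos (by positivity)
  refine ⟨η, hη0, H * (2 * a + 4), by positivity, fun D y hD => ?_⟩
  have hXx : ∀ j, ‖X j‖ ≤ x := fun j =>
    Finset.single_le_sum (f := fun j => ‖X j‖) (fun j _ => norm_nonneg _) (Finset.mem_univ j)
  have hyj : ∀ j, |y j| ≤ ‖y‖ := fun j => norm_le_pi_norm y j
  set t := ‖D 0‖ + (x + 1) * ‖y‖ with ht
  have ht0 : 0 ≤ t := by positivity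
  have hfwd : ∀ k : Fin (n + 1), ‖D k‖ ≤ 3 ^ (k : ℕ) * t := by
    intro k
    induction k using Fin.induction with
    | zero => simpa [ht] using mul_nonneg (by linarith : 0 ≤ x + 1) (norm_nonneg y)
    | succ j ih =>
      have h1 := norm_add₃_le (a := D j.succ - D j.castSucc - y j • X j) (b := y j • X j)
        (c := D j.castSucc)
      rw [sub_add_cancel, sub_add_cancel, norm_smul, Real.norm_eq_abs] at h1
      have h2 : η * (|y j| + ‖D j.castSucc‖) ≤ 1 * (|y j| + ‖D j.castSucc‖) :=
        mul_le_mul_of_nonneg_right (min_le_left _ _) (by positivity)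
      have h4 : |y j| * ‖X j‖ ≤ ‖y‖ * x := mul_le_mul (hyj j) (hXx j) (norm_nonneg _) (norm_nonneg _)
      have h5 : (1 : ℝ) ≤ 3 ^ (j : ℕ) := one_le_pow₀ (by norm_num)
      have h6 : (x + 1) * ‖y‖ ≤ 3 ^ (j : ℕ) * t :=
        (le_add_of_nonneg_left (norm_nonneg _)).trans (le_mul_of_one_le_left ht0 h5)
      rw [Fin.val_castSucc] at ih
      rw [Fin.val_succ, pow_succ]
      linarith [hD j, hyj j]
  have hbound : ∀ k, ‖D k‖ ≤ H * (‖D 0‖ + ‖y‖) := fun k => by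
    refine (hfwd k).trans ?_
    have h1 : (3 : ℝ) ^ (k : ℕ) ≤ 3 ^ n := pow_le_pow_right₀ (by norm_num) (Nat.lt_succ_iff.1 k.2)
    have h2 : t ≤ (x + 2) * (‖D 0‖ + ‖y‖) := by
      have : 0 ≤ (x + 1) * ‖D 0‖ + ‖y‖ := by positivity
      rw [ht]; linarith
    rw [hH, mul_assoc]
    exact mul_le_mul h1 h2 ht0 (by positivity)
  have hfirst : ‖D (Fin.last n) - D 0 - f y‖ ≤ 1 / (2 * (a + 1)) * (‖D 0‖ + ‖y‖) := by
    rw [hf, ← Fin.sum_sub_castSucc, ← Finset.sum_sub_distrib]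
    have h1 : ∀ j ∈ Finset.univ, ‖D j.succ - D j.castSucc - y j • X j‖ ≤
        1 / (4 * (n + 1) * H * (a + 1)) * (2 * H * (‖D 0‖ + ‖y‖)) := fun j _ => by
      refine (hD j).trans (mul_le_mul (min_le_right _ _) ?_ (by positivity) (by positivity))
      have := hbound j.castSucc
      have h2 : ‖y‖ ≤ H * (‖D 0‖ + ‖y‖) :=
        (le_add_of_nonneg_left (norm_nonneg _)).trans (le_mul_of_one_le_left (by positivity) hH1)
      linarith [hyj j]
    refine (norm_sum_le_of_le _ h1).trans ?_
    rw [Finset.sum_const, Finset.card_univ, Fintype.card_fin, nsmul_eq_mul]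
    have h2 : (n : ℝ) * (1 / (4 * (n + 1) * H * (a + 1)) * (2 * H * (‖D 0‖ + ‖y‖))) =
        n / (n + 1) * (1 / (2 * (a + 1)) * (‖D 0‖ + ‖y‖)) := by field_simp; ring
    rw [h2]
    exact mul_le_of_le_one_left (by positivity) (by rw [div_le_one (by positivity)]; linarith)
  have hy : ‖y‖ ≤ (2 * a + 3) * (‖D 0‖ + ‖D (Fin.last n)‖) := by
    have h1 : ‖y‖ ≤ a * ‖f y‖ := by
      have := (f.symm : E →L[ℝ] Fin n → ℝ).le_opNorm (f y)
      simpa using this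
    have h2 : ‖f y‖ ≤ ‖D (Fin.last n)‖ + ‖D 0‖ + 1 / (2 * (a + 1)) * (‖D 0‖ + ‖y‖) := by
      have h3 : f y = (D (Fin.last n) - D 0) - (D (Fin.last n) - D 0 - f y) := by abel
      rw [h3]
      exact (norm_sub_le _ _).trans (add_le_add (norm_sub_le _ _) hfirst)
    have h3 : ‖y‖ ≤ (a + 1) * (‖D (Fin.last n)‖ + ‖D 0‖ + 1 / (2 * (a + 1)) * (‖D 0‖ + ‖y‖)) :=
      h1.trans (mul_le_mul (by linarith) h2 (norm_nonneg _) (by positivity))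
    have h4 : (a + 1) * (1 / (2 * (a + 1)) * (‖D 0‖ + ‖y‖)) = (‖D 0‖ + ‖y‖) / 2 := by field_simp
    nlinarith [norm_nonneg (D (Fin.last n))]
  have hd : 0 ≤ ‖D 0‖ + ‖D (Fin.last n)‖ := by positivity
  refine ⟨hfirst, hy.trans ?_, fun k => (hbound k).trans ?_⟩
  · refine mul_le_mul_of_nonneg_right ?_ hd
    nlinarith
  · rw [mul_assoc H]
    refine mul_le_mul_of_nonneg_left ?_ (zero_le_one.trans hH1)
    nlinarith [norm_nonneg (D (Fin.last n)), norm_nonneg (D 0)]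

/-- Chains of approximate steps join any two points. -/
lemma exists_chain [CompleteSpace E] (f : (Fin n → ℝ) ≃L[ℝ] E) (X : Fin n → E) {G κ : ℝ} (hκ : 0 ≤
    κ) (h : ∀ (D : Fin (n + 1) → E) (y : Fin n → ℝ), (∀ j, ‖D j.succ - D j.castSucc - y j • X j‖ ≤ η
    * (|y j| + ‖D j.castSucc‖)) → ‖D (Fin.last n) - D 0 - f y‖ ≤ 1 / (2 * (‖(f.symm : E →L[ℝ] Fin n
    → ℝ)‖ + 1)) * (‖D 0‖ + ‖y‖) ∧ ‖y‖ ≤ G * (‖D 0‖ + ‖D (Fin.last n)‖) ∧ ∀ k, ‖D k‖ ≤ G * (‖D 0‖ +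
    ‖D (Fin.last n)‖)) (e : Fin n → E →L[ℝ] ℝ) (he : ∀ j, ‖e j‖ ≤ c) (hc : κ * (1 + c) ≤ η) (hc0 : 0
    ≤ c) (R : Fin n → ℝ → E → E) (hR : ∀ j m m' u u', ‖R j m u - R j m' u'‖ ≤ κ * (|m - m'| + ‖u -
    u'‖)) (hR0 : ∀ j, R j 0 0 = 0) (a b : E) : ∃ (st : Fin (n + 1) → E) (m : Fin n → ℝ), st 0 = a ∧
    st (Fin.last n) = b ∧ (∀ j, st j.succ = st j.castSucc + (m j - e j (st j.castSucc)) • X j + R j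
    (m j) (st j.castSucc)) ∧ (∀ j, |m j| ≤ (1 + c) * (G * (‖a‖ + ‖b‖))) ∧ ∀ k, ‖st k‖ ≤ G * (‖a‖ +
    ‖b‖) := by
  set st : (Fin n → ℝ) → Fin (n + 1) → E := fun y =>
    Fin.induction a fun j u => u + y j • X j + R j (y j + e j u) u with hst
  have h0 : ∀ y, st y 0 = a := fun y => Fin.induction_zero _ _
  have hs : ∀ y j, st y j.succ = st y j.castSucc + y j • X j +
      R j (y j + e j (st y j.castSucc)) (st y j.castSucc) := fun y j => Fin.induction_succ _ _ _
  have hstep : ∀ j (y y' : ℝ) (u u' : E), ‖R j (y + e j u) u - R j (y' + e j u') u'‖ ≤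
      η * (|y - y'| + ‖u - u'‖) := fun j y y' u u' => by
    refine (hR j _ _ _ _).trans ?_
    have h1 : |y + e j u - (y' + e j u')| ≤ |y - y'| + c * ‖u - u'‖ := by
      have h2 : y + e j u - (y' + e j u') = (y - y') + e j (u - u') := by rw [map_sub]; ring
      rw [h2]
      refine (abs_add_le _ _).trans (add_le_add_right ?_ _)
      exact ((e j).le_opNorm _).trans (mul_le_mul_of_nonneg_right (he j) (norm_nonneg _))
    have h3 : κ * (|y + e j u - (y' + e j u')| + ‖u - u'‖) ≤ κ * ((1 + c) * (|y - y'| + ‖u - u'‖))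
      := by
      refine mul_le_mul_of_nonneg_left ?_ hκ
      have : 0 ≤ c * |y - y'| := by positivity
      linarith
    refine h3.trans ?_
    rw [← mul_assoc]
    gcongr
  have happ : ApproximatesLinearOn (fun y => st y (Fin.last n)) (f : (Fin n → ℝ) →L[ℝ] E) univ
      (1 / (2 * (‖(f.symm : E →L[ℝ] Fin n → ℝ)‖₊ + 1))) := by
    intro y _ y' _
    have h1 := (h (fun k => st y k - st y' k) (y - y') fun j => by
      have h2 : st y j.succ - st y' j.succ - (st y j.castSucc - st y' j.castSucc) - (y - y') j • X j
        = R j (y j + e j (st y j.castSucc)) (st y j.castSucc) - R j (y' j + e j (st y' j.castSucc))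
        (st y' j.castSucc) := by
        rw [hs, hs, Pi.sub_apply]; module
      rw [h2]
      exact hstep j _ _ _ _).1
    simp only [h0, sub_self, sub_zero, norm_zero, zero_add] at h1
    simpa using h1
  obtain ⟨y, hy⟩ := happ.surjective (by
    rcases f.subsingleton_or_nnnorm_symm_pos with h1 | h1
    · exact Or.inl h1
    · refine Or.inr ?_
      rw [one_div]
      refine inv_strictAnti₀ h1 ?_
      rw [two_mul]
      exact (lt_add_one _).trans_le (le_add_of_nonneg_right (by positivity))) b
  simp only at hy
  obtain ⟨-, hy1, hy2⟩ := h (st y) y fun j => by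
    have h2 : st y j.succ - st y j.castSucc - y j • X j =
        R j (y j + e j (st y j.castSucc)) (st y j.castSucc) - R j (0 + e j 0) 0 := by grind
    rw [h2]
    simpa using hstep j (y j) 0 (st y j.castSucc) 0
  rw [h0, hy] at hy1 hy2
  refine ⟨st y, fun j => y j + e j (st y j.castSucc), h0 y, hy, fun j => ?_, fun j => ?_, hy2⟩
  · grind
  · refine (abs_add_le _ _).trans ?_
    have h1 : |e j (st y j.castSucc)| ≤ c * (G * (‖a‖ + ‖b‖)) := ((e j).le_opNorm _).trans
      (mul_le_mul (he j) (hy2 _) (norm_nonneg _) hc0)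
    have h2 := (norm_le_pi_norm y j).trans hy1
    rw [Real.norm_eq_abs] at h2
    linarith

end Chains

/-- The fans admitted in the family `j`. -/
def Admits (S : ConsLaw n) (ρ δ : ℝ) (kin nuc : Fin n → State n → ℝ) (j : Fin n) (u v : State n)
    (L : List (Wave n)) : Prop :=
  S.IsFan ρ j u v L ∧ (S.IsCC δ j → S.IsNCFan ρ j (kin j) (nuc j) u v L)

/-- The admissible fans of the family `j`, in terms of branches `B b u m` depending on the pattern
`b`, on the left state `u` and on the parameter `m` of the right state. -/
structure FamilySpec (Γ : Chart S j g) (ρ δ δ1 d η0 η : ℝ) (kin nuc : Fin n → State n → ℝ)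
    (B : Prop → State n → ℝ → State n) : Prop where
  curve : ∀ {u}, ‖u‖ < δ1 → {v | ∃ L, S.Admits ρ δ kin nuc j u v L} = S.waveCurve ρ δ kin nuc j u
  canon : ∀ {u}, ‖u‖ < δ1 → ∃ canon : Prop → State n → List (Wave n), ∀ v L, ‖v‖ < δ1 →
    S.Admits ρ δ kin nuc j u v L → L = canon (S.HasNonclassical L) v ∧
      v = B (S.HasNonclassical L) u (Γ.p v) ∧ ‖v - u - (Γ.p v - Γ.p u) • Γ.X‖ ≤ η0 * |Γ.p v - Γ.p u|
  near : ∀ {u v L}, ‖u‖ < δ1 → S.Admits ρ δ kin nuc j u v L →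
    ∀ a ∈ L, |S.lo a - S.lam j 0| < g ∧ |S.hi a - S.lam j 0| < g
  simple : ∀ {u v L}, ‖u‖ < δ1 → ¬ S.IsCC δ j → S.Admits ρ δ kin nuc j u v L →
    (L = Wave.seg j true u v ∧ (u ≠ v → S.Lax j u v)) ∨ L = Wave.seg j false u v
  d_le : d ≤ δ1
  p_lt : ∀ {u}, ‖u‖ < d → |Γ.p u| ≤ Γ.B * ‖u‖
  mem : ∀ {u m}, ‖u‖ < d → |m| < d → B True u m ∈ S.waveCurve ρ δ kin nuc j u
  p_B : ∀ {b u m}, ‖u‖ < d → |m| < d → Γ.p (B b u m) = m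
  zero : B True 0 0 = 0
  dev : ∀ {b u u' m m'}, ‖u‖ < d → |m| < d → ‖u'‖ < d → |m'| < d →
    ‖Γ.dev u (B b u m) - Γ.dev u' (B b u' m')‖ ≤ η * (|m - m'| + ‖u - u'‖)

lemma exists_minimal_pattern (prio : Equiv.Perm (Fin n)) {Y : Set (Fin n → List (Wave n))} (hY :
    Y.Nonempty) : ∃ a ∈ Y, ∀ b ∈ Y, ¬ S.Preferred prio b a := by
  set q : (Fin n → List (Wave n)) → Lex (Fin n → Prop) := fun a =>
    toLex fun k => S.HasNonclassical (a (prio.symm k))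
  obtain ⟨a, ha, hmin⟩ := (InvImage.wf q (wellFounded_lt (α := Lex (Fin n → Prop)))).has_min Y hY
  refine ⟨a, ha, fun b hb ⟨i, h1, h2, h3⟩ => hmin b hb ⟨prio i, fun k hk => ?_, ?_⟩⟩
  · have := h1 (prio.symm k) (by simpa using hk)
    simpa [q] using this
  · simp only [q, Pi.toLex_apply, Equiv.symm_apply_apply]
    exact lt_of_le_of_ne (fun h => absurd h h2) fun h => h2 (h ▸ h3)

lemma preferred_total (prio : Equiv.Perm (Fin n)) {a b : Fin n → List (Wave n)} (h1 : ¬ S.Preferred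
    prio a b) (h2 : ¬ S.Preferred prio b a) (k : Fin n) : S.HasNonclassical (a k) ↔
    S.HasNonclassical (b k) := by
  by_contra hk
  set s : Set (Fin n) := {k | ¬ (S.HasNonclassical (a k) ↔ S.HasNonclassical (b k))}
  obtain ⟨i, hi, hmin⟩ := (InvImage.wf prio (wellFounded_lt (α := Fin n))).has_min s ⟨k, hk⟩
  have heq : ∀ k, prio k < prio i → (S.HasNonclassical (a k) ↔ S.HasNonclassical (b k)) :=
    fun k hk => by
      by_contra h
      exact hmin k h hk
  by_cases hb : S.HasNonclassical (b i)
  · exact h1 ⟨i, heq, fun ha => hi (iff_of_true ha hb), hb⟩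
  · refine h2 ⟨i, fun k hk => (heq k hk).symm, hb, ?_⟩
    by_contra ha
    exact hi (iff_of_false ha hb)

section Solve

variable {Γ : ∀ j, Chart S j g} {kin nuc : Fin n → State n → ℝ}
  {B : Fin n → Prop → State n → ℝ → State n} {d η0 η' G δ2 : ℝ}
  (hF : ∀ j, FamilySpec (Γ j) ρ δ δ1 d η0 η kin nuc (B j))
  {f : (Fin n → ℝ) ≃L[ℝ] State n} (hG : 0 < G) (hη'0 : 0 < η')
  (hf : ∀ (D : Fin (n + 1) → State n) (y : Fin n → ℝ),
      (∀ j, ‖D j.succ - D j.castSucc - y j • (Γ j).X‖ ≤ η' * (|y j| + ‖D j.castSucc‖)) →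
      ‖D (Fin.last n) - D 0 - f y‖ ≤
        1 / (2 * (‖(f.symm : State n →L[ℝ] Fin n → ℝ)‖ + 1)) * (‖D 0‖ + ‖y‖) ∧
      ‖y‖ ≤ G * (‖D 0‖ + ‖D (Fin.last n)‖) ∧ ∀ k, ‖D k‖ ≤ G * (‖D 0‖ + ‖D (Fin.last n)‖))
  (hc : ∀ j, ‖(Γ j).e‖ ≤ c) (hc0 : 0 ≤ c) (hη₀ : η0 ≤ η') (hη0 : 0 ≤ η) (hη : η * (1 + c) ≤ η')
  (hη2 : lipschitzExtensionConstant (State n) * (2 * η) * (1 + c) ≤ η')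
  (hgap : ∀ i j, i ≠ j → 4 * g < |S.lam i 0 - S.lam j 0|)
  (hmono : StrictMono fun j => S.lam j 0) (hr : r ≤ d) (hBr : ∀ j, (Γ j).B * r ≤ d)
  (hδ2 : (G + 1) * (3 * δ2) ≤ r) (hδ2' : (1 + c) * (G * (2 * δ2)) ≤ d) (hδ1 : δ2 ≤ δ1)
include hF

section
include hgap hmono

lemma isCandidate_iff {ul ur : State n} {st : Fin (n + 1) → State n} {fan : Fin n → List (Wave n)} :
    S.IsCandidate ρ δ δ1 kin nuc ul ur st fan ↔ IsStates δ1 ul ur st ∧ ∀ j : Fin n, S.Admits ρ δ kin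
    nuc j (st j.castSucc) (st j.succ) (fan j) := by
  refine ⟨fun h => ⟨h.1, fun j => ⟨h.2.1 j, h.2.2.2 j⟩⟩, fun ⟨h1, h2⟩ =>
    ⟨h1, fun j => (h2 j).1, fun j k hjk a ha b hb => ?_, fun j hj => (h2 j).2 hj⟩⟩
  have hst : ∀ k, ‖st k‖ < δ1 := fun k => by simpa using h1.2.2 k
  have h3 := abs_lt.1 ((hF j).near (hst _) (h2 j) a ha).2
  have h4 := abs_lt.1 ((hF k).near (hst _) (h2 k) b hb).1
  have h5 := hgap j k hjk.ne
  have h6 : S.lam j 0 < S.lam k 0 := hmono hjk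
  rw [abs_of_neg (by linarith)] at h5
  linarith [h3.1, h3.2, h4.1, h4.2]

end

section
include hf hη₀ hη'0

lemma norm_states_le {ul ur : State n} {st : Fin (n + 1) → State n} {fan : Fin n → List (Wave n)}
    (hst : IsStates δ1 ul ur st) (hfan : ∀ j : Fin n, S.Admits ρ δ kin nuc j (st j.castSucc) (st
    j.succ) (fan j)) (k : Fin (n + 1)) : ‖st k‖ ≤ G * ‖ur - ul‖ + ‖ul‖ := by
  have hst' : ∀ k, ‖st k‖ < δ1 := fun k => by simpa using hst.2.2 k
  have h := (hf (fun k => st k - ul) (fun j => (Γ j).p (st j.succ) - (Γ j).p (st j.castSucc))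
    fun j => by
      obtain ⟨canon, h1⟩ := (hF j).canon (hst' j.castSucc)
      have h2 := (h1 _ _ (hst' j.succ) (hfan j)).2.2
      rw [sub_sub_sub_cancel_right]
      refine h2.trans ((mul_le_mul_of_nonneg_right hη₀ (abs_nonneg _)).trans ?_)
      exact mul_le_mul_of_nonneg_left (le_add_of_nonneg_right (norm_nonneg _)) hη'0.le).2.2 k
  rw [hst.1, hst.2.1, sub_self, norm_zero, zero_add] at h
  have h2 := norm_add_le (st k - ul) ul
  rw [sub_add_cancel] at h2
  linarith

end

section
include hf hη hη0 hc hr hBr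

lemma states_unique {ul ur : State n} {st st' : Fin (n + 1) → State n} {fan fan' : Fin n → List
    (Wave n)} (hst : IsStates δ1 ul ur st) (hst' : IsStates δ1 ul ur st') (hn : ∀ k, ‖st k‖ < r)
    (hn' : ∀ k, ‖st' k‖ < r) (hfan : ∀ j : Fin n, S.Admits ρ δ kin nuc j (st j.castSucc) (st j.succ)
    (fan j)) (hfan' : ∀ j : Fin n, S.Admits ρ δ kin nuc j (st' j.castSucc) (st' j.succ) (fan' j))
    (hpat : ∀ j, S.HasNonclassical (fan j) ↔ S.HasNonclassical (fan' j)) : st = st' ∧ fan = fan' :=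
    by
  have hsmall : ∀ {u : State n} (j : Fin n), ‖u‖ < r → ‖u‖ < δ1 ∧ ‖u‖ < d ∧ |(Γ j).p u| < d :=
    fun {u} j h => by
      refine ⟨(h.trans_le hr).trans_le (hF j).d_le, h.trans_le hr, ?_⟩
      exact (((hF j).p_lt (h.trans_le hr)).trans_lt
        (mul_lt_mul_of_pos_left h (Γ j).B_pos)).trans_le (hBr j)
  have h := hf (fun k => st k - st' k) (fun j => ((Γ j).p (st j.succ) - (Γ j).p (st' j.succ)) -
      (Γ j).e (st j.castSucc - st' j.castSucc)) fun j => by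
    obtain ⟨h1, h2, -⟩ := hsmall j (hn j.castSucc)
    obtain ⟨h1', h2', -⟩ := hsmall j (hn' j.castSucc)
    obtain ⟨h3, -, h4⟩ := hsmall j (hn j.succ)
    obtain ⟨h3', -, h4'⟩ := hsmall j (hn' j.succ)
    obtain ⟨canon, h5⟩ := (hF j).canon h1
    obtain ⟨canon', h5'⟩ := (hF j).canon h1'
    have h6 := (h5 _ _ h3 (hfan j)).2.1
    have h6' := (h5' _ _ h3' (hfan' j)).2.1
    rw [← hpat j] at h6'
    have h7 := (hF j).dev (b := S.HasNonclassical (fan j)) h2 h4 h2' h4'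
    rw [← h6, ← h6'] at h7
    refine le_trans (le_of_eq ?_) (h7.trans ?_)
    · simp only [Chart.dev, map_sub]; congr 1; module
    · set q := (Γ j).p (st j.succ) - (Γ j).p (st' j.succ)
      set D := st j.castSucc - st' j.castSucc
      have h8 : |q| ≤ |q - (Γ j).e D| + c * ‖D‖ := by
        have h9 := abs_add_le (q - (Γ j).e D) ((Γ j).e D)
        rw [sub_add_cancel] at h9
        have h10 : |(Γ j).e D| ≤ c * ‖D‖ := ((Γ j).e.le_opNorm D).trans
          (mul_le_mul_of_nonneg_right (hc j) (norm_nonneg _))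
        linarith
      have h11 : |q| + ‖D‖ ≤ (1 + c) * (|q - (Γ j).e D| + ‖D‖) := by
        have : 0 ≤ c * |q - (Γ j).e D| :=
          mul_nonneg ((norm_nonneg _).trans (hc j)) (abs_nonneg _)
        linarith
      refine (mul_le_mul_of_nonneg_left h11 hη0).trans ?_
      rw [← mul_assoc]
      exact mul_le_mul_of_nonneg_right hη (by positivity)
  have hz : ∀ k, st k = st' k := fun k => by
    have := h.2.2 k
    rw [hst.1, hst.2.1, hst'.1, hst'.2.1, sub_self, sub_self, norm_zero, add_zero, mul_zero] at this
    exact sub_eq_zero.1 (norm_le_zero_iff.1 this)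
  refine ⟨funext hz, funext fun j => ?_⟩
  obtain ⟨canon, h1⟩ := (hF j).canon (hsmall j (hn j.castSucc)).1
  have h2 := (h1 _ _ (hsmall j (hn j.succ)).1 (hfan j)).1
  have h3 := hfan' j
  rw [← hz, ← hz] at h3
  have h4 := (h1 _ _ (hsmall j (hn j.succ)).1 h3).1
  rw [h2, h4, propext (hpat j)]

end

section
include hf hη0 hc hc0 hη2 hδ2' hδ1 hG

lemma exists_states {ul ur : State n} (hul : ‖ul‖ < δ2) (hur : ‖ur‖ < δ2) : ∃ (st : Fin (n + 1) →
    State n) (fan : Fin n → List (Wave n)), IsStates δ1 ul ur st ∧ ∀ j : Fin n, S.Admits ρ δ kin nuc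
    j (st j.castSucc) (st j.succ) (fan j) := by
  set κ : ℝ := lipschitzExtensionConstant (State n) * (2 * η) with hκ
  have hext : ∀ j, ∃ R : ℝ × State n → State n, (∀ z z', ‖R z - R z'‖ ≤ κ * ‖z - z'‖) ∧
      ∀ m u, |m| < d → ‖u‖ < d → R (m, u) = (Γ j).dev u (B j True u m) := fun j => by
    have hL : LipschitzOnWith (2 * η).toNNReal
        (fun z : ℝ × State n => (Γ j).dev z.2 (B j True z.2 z.1)) {z | |z.1| < d ∧ ‖z.2‖ < d} := by
      refine LipschitzOnWith.of_dist_le_mul fun z hz z' hz' => ?_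
      rw [dist_eq_norm, dist_eq_norm, Real.coe_toNNReal _ (by positivity)]
      refine ((hF j).dev hz.2 hz.1 hz'.2 hz'.1).trans ?_
      have h1 : |z.1 - z'.1| ≤ ‖z - z'‖ := norm_fst_le (z - z')
      have h2 : ‖z.2 - z'.2‖ ≤ ‖z - z'‖ := norm_snd_le (z - z')
      rw [mul_comm 2 η, mul_assoc]
      exact mul_le_mul_of_nonneg_left (by linarith) hη0
    obtain ⟨R, hR, he⟩ := hL.extend_finite_dimension
    refine ⟨R, fun z z' => ?_, fun m u hm hu => (he (show (m, u) ∈ _ from ⟨hm, hu⟩)).symm⟩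
    have := hR.dist_le_mul z z'
    rwa [dist_eq_norm, dist_eq_norm, NNReal.coe_mul, Real.coe_toNNReal _ (by positivity)] at this
  choose R hR hRe using hext
  have hκ0 : 0 ≤ κ := by positivity
  have hs : ‖ul‖ + ‖ur‖ < 2 * δ2 := by linarith
  have hlt : (1 + c) * (G * (‖ul‖ + ‖ur‖)) < d :=
    (mul_lt_mul_of_pos_left (mul_lt_mul_of_pos_left hs hG) (by linarith)).trans_le hδ2'
  have hlt' : G * (‖ul‖ + ‖ur‖) < d := by
    refine lt_of_le_of_lt ?_ hlt
    exact le_mul_of_one_le_left (by positivity) (by linarith)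
  have hd : 0 < d := lt_of_le_of_lt (by positivity) hlt
  obtain ⟨st, m, h0, hl, hstep, hm, hn⟩ := exists_chain f (fun j => (Γ j).X) hκ0 hf
    (fun j => (Γ j).e) hc hη2 hc0 (fun j m u => R j (m, u)) (fun j m m' u u' => by
      refine (hR j _ _).trans (mul_le_mul_of_nonneg_left ?_ hκ0)
      rw [Prod.mk_sub_mk, Prod.norm_def]
      exact max_le (le_add_of_nonneg_right (norm_nonneg _)) (le_add_of_nonneg_left (abs_nonneg _)))
    (fun j => by
      rw [hRe j 0 0 (by simpa) (by simpa), (hF j).zero, Chart.dev, (Γ j).p_zero]; simp) ul ur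
  have hst : ∀ j : Fin n, st j.succ ∈ S.waveCurve ρ δ kin nuc j (st j.castSucc) := fun j => by
    have h1 := (hn j.castSucc).trans_lt hlt'
    have h2 := (hm j).trans_lt hlt
    have h3 : st j.succ = B j True (st j.castSucc) (m j) := by
      rw [hstep j, hRe j _ _ h2 h1, Chart.dev, (hF j).p_B h1 h2]
      module
    rw [h3]
    exact (hF j).mem h1 h2
  have hb : ∀ j : Fin n, ∃ L, S.Admits ρ δ kin nuc j (st j.castSucc) (st j.succ) L := fun j => by
    have h1 := ((hn j.castSucc).trans_lt hlt').trans_le (hF j).d_le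
    have h2 := hst j
    rwa [← (hF j).curve h1] at h2
  choose fan hfan using hb
  refine ⟨st, fan, ⟨h0, hl, fun k => ?_⟩, hfan⟩
  rw [mem_ball_zero_iff]
  induction k using Fin.cases with
  | zero => rw [h0]; linarith
  | succ j => exact ((hn _).trans_lt hlt').trans_le (hF j).d_le

end

include hf hη0 hη hc hc0 hη2 hδ2 hδ2' hδ1 hgap hmono hr hBr hη₀ hη'0 hG

lemma riemannSolved (prio : Equiv.Perm (Fin n)) {ul ur : State n} (hul : ‖ul‖ < δ2) (hur : ‖ur‖ <
    δ2) (hweak : ∀ st fan, S.IsCandidate ρ δ δ1 kin nuc ul ur st fan → S.IsEntropySolution ρ ul ur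
    fun p => S.profile ρ ul (List.ofFn fan).flatten (p.2 / p.1)) : S.RiemannSolved ρ δ δ1 kin nuc
    prio ul ur := by
  have hcand := fun st fan => isCandidate_iff hF hgap hmono (ul := ul) (ur := ur) (st := st) (fan := fan)
  have hsmall : ∀ {st fan}, S.IsCandidate ρ δ δ1 kin nuc ul ur st fan → ∀ k, ‖st k‖ < r :=
    fun {st fan} h k => by
      obtain ⟨h1, h2⟩ := (hcand _ _).1 h
      have h3 := norm_states_le hF hη'0 hf hη₀ h1 h2 k
      have h4 := norm_sub_le ur ul
      have h5 : G * ‖ur - ul‖ ≤ G * (‖ur‖ + ‖ul‖) := mul_le_mul_of_nonneg_left h4 hG.le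
      have h6 : G * (‖ur‖ + ‖ul‖) ≤ G * (2 * δ2) := mul_le_mul_of_nonneg_left (by linarith) hG.le
      have h7 : 0 < G * δ2 := mul_pos hG ((norm_nonneg ul).trans_lt hul)
      have h8 := (norm_nonneg ul).trans_lt hul
      linarith
  obtain ⟨fan, ⟨st, hst⟩, hmin⟩ := exists_minimal_pattern (S := S) prio
    (Y := {fan | ∃ st, S.IsCandidate ρ δ δ1 kin nuc ul ur st fan}) (by
      obtain ⟨st, fan, h1, h2⟩ := exists_states hF hG hf hc hc0 hη0 hη2 hδ2' hδ1 hul hur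
      exact ⟨fan, st, (hcand _ _).2 ⟨h1, h2⟩⟩)
  refine ⟨⟨(st, fan), ⟨hst, fun st' fan' h => hmin fan' ⟨st', h⟩⟩, ?_⟩, fun st hst => ?_, ?_,
    fun st fan h => hweak st fan h.1⟩
  · rintro ⟨st', fan'⟩ ⟨h1, h2⟩
    have h3 := preferred_total prio (hmin fan' ⟨st', h1⟩) (h2 st fan hst)
    obtain ⟨h4, h5⟩ := (hcand _ _).1 hst
    obtain ⟨h6, h7⟩ := (hcand _ _).1 h1
    obtain ⟨h8, h9⟩ := states_unique hF hf hc hη0 hη hr hBr h6 h4 (hsmall h1) (hsmall hst) h7 h5 h3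
    exact Prod.ext h8 h9
  · have hn : ∀ k, ‖st k‖ < δ1 := fun k => by simpa using hst.2.2 k
    have h : ∀ j : Fin n, st j.succ ∈ S.waveCurve ρ δ kin nuc j (st j.castSucc) ↔
        ∃ L, S.Admits ρ δ kin nuc j (st j.castSucc) (st j.succ) L := fun j => by
      rw [← (hF j).curve (hn _)]; rfl
    simp only [h, hcand]
    refine ⟨fun ⟨fan, _, h⟩ j => ⟨fan j, h j⟩, fun h => ?_⟩
    choose fan hfan using h
    exact ⟨fan, hst, hfan⟩
  · intro st fan h j hj
    obtain ⟨h1, h2⟩ := (hcand _ _).1 h.1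
    exact (hF j).simple (by simpa using h1.2.2 _) hj (h2 j)

end Solve

section TestFunction

variable {E : Type*} [NormedAddCommGroup E] [NormedSpace ℝ E] [CompleteSpace E]
  {φ : ℝ × ℝ → ℝ}
  (hφ : ContDiff ℝ 1 φ) (hc : HasCompactSupport φ)
include hφ hc

lemma integrable_fderiv_apply (v : ℝ × ℝ) : Integrable fun p => fderiv ℝ φ p v :=
  ((hφ.continuous_fderiv one_ne_zero).clm_apply continuous_const).integrable_of_hasCompactSupport
    (hc.fderiv_apply (𝕜 := ℝ) v)

lemma integral_fderiv_fst {r : Set ℝ} {k : (ℝ → ℝ) → ℝ} (hr : ∀ g : ℝ → ℝ, ContDiff ℝ 1 g →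
    HasCompactSupport g → ∫ x in r, deriv g x = -k g) (s : Set ℝ) : ∫ p in r ×ˢ s, fderiv ℝ φ p (1,
    0) = -∫ x in s, k fun t => φ (t, x) := by
  have hi := integrable_fderiv_apply hφ hc (1, 0)
  rw [Measure.volume_eq_prod, ← setIntegral_prod_swap,
    setIntegral_prod _ (by exact hi.swap.integrableOn), ← integral_neg]
  refine integral_congr_ae (Eventually.of_forall fun x => ?_)
  have hl : Topology.IsClosedEmbedding fun t : ℝ => (t, x) :=
    .of_continuous_injective_isClosedMap (by fun_prop) (fun t t' h => (Prod.ext_iff.1 h).1)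
      (isClosedMap_prodMk_right x)
  simp only [Prod.swap_prod_mk]
  refine Eq.trans ?_ (hr _ (hφ.comp (by fun_prop)) (hc.comp_isClosedEmbedding hl))
  congr 1 with t
  have h1 : HasDerivAt (fun t : ℝ => (t, x)) (1, 0) t :=
    (hasDerivAt_id t).prodMk (hasDerivAt_const t x)
  exact ((hφ.differentiable one_ne_zero (t, x)).hasFDerivAt.comp_hasDerivAt t h1).deriv.symm

lemma integral_fderiv_snd {r : Set ℝ} {k : (ℝ → ℝ) → ℝ} (hr : ∀ g : ℝ → ℝ, ContDiff ℝ 1 g →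
    HasCompactSupport g → ∫ x in r, deriv g x = -k g) (s : Set ℝ) : ∫ p in s ×ˢ r, fderiv ℝ φ p (0,
    1) = -∫ t in s, k fun x => φ (t, x) := by
  have h := integral_fderiv_fst (φ := φ ∘ ContinuousLinearEquiv.prodComm ℝ ℝ ℝ)
    (hφ.comp (by fun_prop)) (hc.comp_homeomorph (ContinuousLinearEquiv.prodComm ℝ ℝ ℝ).toHomeomorph)
    hr s
  simp only [ContinuousLinearEquiv.comp_right_fderiv] at h
  rw [Measure.volume_eq_prod, ← setIntegral_prod_swap]
  exact h

lemma integral_half_plane (a b : E) : ∫ p in {p : ℝ × ℝ | 0 < p.1}, (fderiv ℝ φ p (1, 0) • a +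
    fderiv ℝ φ p (0, 1) • b) = -(∫ x, φ (0, x)) • a := by
  have h : {p : ℝ × ℝ | 0 < p.1} = Ioi 0 ×ˢ univ := by ext; simp
  rw [h, integral_add ((integrable_fderiv_apply hφ hc _).smul_const a).integrableOn
      ((integrable_fderiv_apply hφ hc _).smul_const b).integrableOn, integral_smul_const,
    integral_smul_const, integral_fderiv_fst hφ hc (fun g h1 h2 => h2.integral_Ioi_deriv_eq h1 0),
    integral_fderiv_snd hφ hc (k := fun _ => 0) fun g h1 h2 => by
      rw [setIntegral_univ, integral_eq_zero_of_hasDerivAt_of_integrable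
        (fun x => (h1.differentiable one_ne_zero x).hasDerivAt)
        ((h1.continuous_deriv le_rfl).integrable_of_hasCompactSupport h2.deriv)
        (h1.continuous.integrable_of_hasCompactSupport h2), neg_zero]]
  simp

lemma integral_sector (σ : ℝ) (a b : E) : ∫ p in {p : ℝ × ℝ | 0 < p.1}, {p : ℝ × ℝ | σ < p.2 /
    p.1}.indicator (fun p => fderiv ℝ φ p (1, 0) • a + fderiv ℝ φ p (0, 1) • b) p = -(∫ x in Ioi 0,
    φ (0, x)) • a - (∫ t in Ioi 0, φ (t, σ * t)) • (b - σ • a) := by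
  let L (c : ℝ) : ℝ × ℝ →L[ℝ] ℝ × ℝ :=
    (ContinuousLinearMap.fst ℝ ℝ ℝ).prod (.snd ℝ ℝ ℝ + c • .fst ℝ ℝ ℝ)
  let Ψ : (ℝ × ℝ) ≃L[ℝ] ℝ × ℝ := .equivOfInverse (L σ) (L (-σ)) (fun p => by simp [L])
    fun p => by simp [L]
  have hΨ : ∀ p, Ψ p = (p.1, p.2 + σ * p.1) := fun p => by simp [Ψ, L]
  have hm : MeasurePreserving Ψ := by
    have := (MeasurePreserving.id (volume : Measure ℝ)).skew_product (μc := volume) (μd := volume)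
      (g := fun t y => y + σ * t) (by fun_prop)
      (Eventually.of_forall fun t => map_add_right_eq_self volume (σ * t))
    rw [Measure.volume_eq_prod]
    rw [funext hΨ]
    exact this
  have hs : Ψ ⁻¹' ({p : ℝ × ℝ | 0 < p.1} ∩ {p | σ < p.2 / p.1}) = Ioi 0 ×ˢ Ioi 0 := by
    ext p
    simp only [mem_preimage, hΨ, mem_inter_iff, mem_prod, mem_Ioi, mem_ofPred_eq]
    refine and_congr_right fun h => ?_
    rw [lt_div_iff₀ h]; simp
  rw [setIntegral_indicator (s := {p : ℝ × ℝ | 0 < p.1})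
    (measurableSet_lt measurable_const (by fun_prop)), ← hm.setIntegral_preimage_emb
    Ψ.toHomeomorph.measurableEmbedding, hs]
  have h1 : ContDiff ℝ 1 (φ ∘ Ψ) := hφ.comp Ψ.contDiff
  have h2 : HasCompactSupport (φ ∘ Ψ) := hc.comp_homeomorph Ψ.toHomeomorph
  have h3 : ∀ p, fderiv ℝ φ (Ψ p) (1, 0) • a + fderiv ℝ φ (Ψ p) (0, 1) • b =
      fderiv ℝ (φ ∘ Ψ) p (1, 0) • a + fderiv ℝ (φ ∘ Ψ) p (0, 1) • (b - σ • a) := fun p => by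
    have : ((1 : ℝ), σ) = (1, 0) + σ • (0, 1) := by simp
    simp only [ContinuousLinearEquiv.comp_right_fderiv, ContinuousLinearMap.comp_apply,
      ContinuousLinearEquiv.coe_coe, hΨ, zero_add, mul_one, mul_zero, add_zero, this, map_add,
      map_smul, smul_eq_mul]
    module
  have hI : ∀ g : ℝ → ℝ, ContDiff ℝ 1 g → HasCompactSupport g → ∫ x in Ioi 0, deriv g x = -g 0 :=
    fun g h1 h2 => h2.integral_Ioi_deriv_eq h1 0
  simp only [h3]
  rw [integral_add ((integrable_fderiv_apply h1 h2 _).smul_const a).integrableOn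
      ((integrable_fderiv_apply h1 h2 _).smul_const _).integrableOn, integral_smul_const,
    integral_smul_const, integral_fderiv_fst h1 h2 hI, integral_fderiv_snd h1 h2 hI, neg_smul,
    neg_smul, sub_eq_add_neg]
  simp [hΨ, ← sub_eq_add_neg]

lemma integral_superposition {σ : ℝ → ℝ} (hσ : Measurable σ) {a b : ℝ → E} (ha : IntegrableOn a (Ioo
    0 1)) (hb : IntegrableOn b (Ioo 0 1)) {A B : ℝ → E} (hA : ∀ ξ, A ξ = ∫ s in Ioo 0 1, {s | σ s <
    ξ}.indicator a s) (hB : ∀ ξ, B ξ = ∫ s in Ioo 0 1, {s | σ s < ξ}.indicator b s) : IntegrableOn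
    (fun p : ℝ × ℝ => fderiv ℝ φ p (1, 0) • A (p.2 / p.1) + fderiv ℝ φ p (0, 1) • B (p.2 / p.1)) {p
    | 0 < p.1} ∧ ∫ p in {p : ℝ × ℝ | 0 < p.1}, (fderiv ℝ φ p (1, 0) • A (p.2 / p.1) + fderiv ℝ φ p
    (0, 1) • B (p.2 / p.1)) = ∫ s in Ioo 0 1, (-(∫ x in Ioi 0, φ (0, x)) • a s - (∫ t in Ioi 0, φ
    (t, σ s * t)) • (b s - σ s • a s)) := by
  set H : ℝ × ℝ → ℝ → E := fun p s => {p : ℝ × ℝ | σ s < p.2 / p.1}.indicator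
    (fun p => fderiv ℝ φ p (1, 0) • a s + fderiv ℝ φ p (0, 1) • b s) p with hH
  have hi := fun v => (integrable_fderiv_apply hφ hc v).integrableOn (s := {p : ℝ × ℝ | 0 < p.1})
  have hint : Integrable (Function.uncurry H)
      ((volume.restrict {p : ℝ × ℝ | 0 < p.1}).prod (volume.restrict (Ioo 0 1))) :=
    (((hi (1, 0)).smul_prod ha).add ((hi (0, 1)).smul_prod hb)).indicator
      (s := {z : (ℝ × ℝ) × ℝ | σ z.2 < z.1.2 / z.1.1}) (measurableSet_lt (by fun_prop) (by fun_prop))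
  have hp : ∀ p : ℝ × ℝ, fderiv ℝ φ p (1, 0) • A (p.2 / p.1) + fderiv ℝ φ p (0, 1) • B (p.2 / p.1) =
      ∫ s in Ioo 0 1, H p s := fun p => by
    have hm : MeasurableSet {s | σ s < p.2 / p.1} := measurableSet_lt hσ measurable_const
    rw [hA, hB, ← integral_smul, ← integral_smul]
    refine (integral_add ((ha.indicator hm).smul _) ((hb.indicator hm).smul _)).symm.trans ?_
    congr 1 with s
    by_cases h : σ s < p.2 / p.1 <;> simp [hH, h]
  simp only [hp]
  refine ⟨hint.integral_prod_left, ?_⟩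
  rw [integral_integral_swap hint]
  congr 1 with s
  exact integral_sector hφ hc (σ s) (a s) (b s)

end TestFunction

lemma IsArc.sub (h : S.IsArc ρ i u v γ) {a b : ℝ} (ha : a ∈ Icc (0 : ℝ) 1) (hb : b ∈ Icc (0 : ℝ) 1)
    : S.IsArc ρ i (γ a) (γ b) fun t => γ (a + t * (b - a)) := by
  obtain ⟨-, -, s, hs⟩ := h
  refine ⟨by simp, by simp, (b - a) * s, fun t ht => ?_⟩
  obtain ⟨h1, h2⟩ := hs (a + t * (b - a))
    (by simpa [mul_comm] using (convex_Icc (0 : ℝ) 1).add_smul_sub_mem ha hb ht)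
  refine ⟨h1, ?_⟩
  rw [mul_smul]
  exact h2.scomp t (by simpa using ((hasDerivAt_id t).mul_const (b - a)).const_add a)

lemma Rarefaction.sub (h : S.IsArc ρ i u v γ) (hm : StrictMonoOn (fun τ => S.lam i (γ τ)) (Icc 0 1))
    {a b : ℝ} (ha : a ∈ Icc (0 : ℝ) 1) (hb : b ∈ Icc (0 : ℝ) 1) (hab : a < b) : S.Rarefaction ρ i (γ
    a) (γ b) := by
  have hmem : ∀ t ∈ Icc (0 : ℝ) 1, a + t * (b - a) ∈ Icc (0 : ℝ) 1 := fun t ht => by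
    simpa [mul_comm] using (convex_Icc (0 : ℝ) 1).add_smul_sub_mem ha hb ht
  refine ⟨_, h.sub ha hb, fun t ht t' ht' hlt => hm (hmem t ht) (hmem t' ht') ?_⟩
  have := mul_lt_mul_of_pos_right hlt (sub_pos.2 hab)
  linarith

lemma Chart.mem_arc_of_rarefactions (hρ : ρ ≤ Γ.R) (hγ : S.IsArc ρ i u v γ) (h1 : S.Rarefaction ρ i
    u z) (h2 : S.Rarefaction ρ i z v) : ∃ t ∈ Icc (0 : ℝ) 1, γ t = z := by
  have h01 : (0 : ℝ) ∈ Icc (0 : ℝ) 1 := left_mem_Icc.2 zero_le_one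
  have h11 : (1 : ℝ) ∈ Icc (0 : ℝ) 1 := right_mem_Icc.2 zero_le_one
  have hl := h1.lam_lt
  have hl' := h2.lam_lt
  have hz := arc_right hρ (Rarefaction.mem h1)
  obtain ⟨γ1, hγ₁, hm1⟩ := h1
  obtain ⟨γ2, hγ2, hm2⟩ := h2
  have : Γ.p z ∈ uIcc (Γ.p u) (Γ.p v) ∨ Γ.p v ∈ uIcc (Γ.p u) (Γ.p z) ∨ Γ.p u ∈ uIcc (Γ.p z) (Γ.p v)
    := by
    simp only [mem_uIcc]; grind
  rcases this with h | h | h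
  · obtain ⟨t, ht, -, h3, -⟩ := exists_arc_param hρ hγ h01 h11 (by rwa [hγ.1, hγ.2.1])
    exact ⟨t, ht, h3.trans hz.symm⟩
  · obtain ⟨t, ht, -, h3, -⟩ := exists_arc_param hρ hγ₁ h01 h11 (by rwa [hγ₁.1, hγ₁.2.1])
    have h4 := hm1.monotoneOn ht h11 ht.2
    simp only [h3, hγ₁.2.1, ← arc_right hρ ⟨γ, hγ⟩] at h4
    linarith
  · obtain ⟨t, ht, -, h3, -⟩ := exists_arc_param hρ hγ2 h01 h11 (by rwa [hγ2.1, hγ2.2.1])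
    have h4 := hm2.monotoneOn h01 ht ht.1
    have h5 := hγ₁.sub h11 h01
    rw [hγ₁.1, hγ₁.2.1] at h5
    simp only [h3, hγ2.1, ← arc_right hρ ⟨_, h5⟩] at h4
    linarith

/-- `(η, q)` is a (possibly vector-valued) entropy pair. -/
structure IsPair {E : Type} [NormedAddCommGroup E] [NormedSpace ℝ E] (S : ConsLaw n) (δ : ℝ)
    (η q : State n → E) : Prop where
  smooth : ContDiffOn ℝ 1 η (ball 0 δ)
  flux : ∀ u ∈ ball (0 : State n) δ, ∃ D : State n →L[ℝ] E, HasFDerivAt q D u ∧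
    ∀ j, D (S.r j u) = S.lam j u • fderiv ℝ η u (S.r j u)

/-- The contribution of a wave to the weak formulation. -/
def defect {E : Type} [NormedAddCommGroup E] [NormedSpace ℝ E] (S : ConsLaw n) (φ : ℝ × ℝ → ℝ)
    (η q : State n → E) (a : Wave n) : E :=
  if a.isShock = true then -((∫ t in Ioi 0, φ (t, S.speed a.left a.right * t)) •
    (q a.right - q a.left - S.speed a.left a.right • (η a.right - η a.left))) else 0

section Wave

variable {Γ : Chart S a.fam g} (hS : S.Hyp δ) (hρ : ρ ≤ δ)
  (hΓ : ρ ≤ Γ.R)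
include hS hρ

lemma continuousOn_lam_arc (hγ : S.IsArc ρ i u v γ) : ContinuousOn (fun s => S.lam i (γ s)) (Icc 0
    1) :=
  (hS.contDiffOn_lam i).continuousOn.comp hγ.continuousOn fun s hs => by
    obtain ⟨-, -, k, hk⟩ := hγ
    exact ball_subset_ball hρ (hk s hs).1

include hΓ

lemma Rarefaction.profile (hb : a.isShock = false) (hR : S.Rarefaction ρ a.fam a.left a.right) : ∃ γ
    τ, S.IsArc ρ a.fam a.left a.right γ ∧ Monotone τ ∧ (∀ ξ, τ ξ ∈ Icc (0 : ℝ) 1) ∧ (∀ ξ, S.profile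
    ρ a.left [a] ξ = γ (τ ξ)) ∧ ∀ ξ, ∀ s ∈ Ioo (0 : ℝ) 1, S.lam a.fam (γ s) < ξ ↔ s < τ ξ := by
  obtain ⟨γ, hγ, hm⟩ := hR
  have h01 : (0 : ℝ) ∈ Icc (0 : ℝ) 1 := left_mem_Icc.2 zero_le_one
  have h11 : (1 : ℝ) ∈ Icc (0 : ℝ) 1 := right_mem_Icc.2 zero_le_one
  have hlt := hm h01 h11 zero_lt_one
  simp only at hlt
  have hex := fun ξ => intermediate_value_Icc zero_le_one (continuousOn_lam_arc hS hρ hγ)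
    (show max (S.lam a.fam (γ 0)) (min (S.lam a.fam (γ 1)) ξ) ∈ _ from
      ⟨le_max_left _ _, max_le hlt.le (min_le_left _ _)⟩)
  choose τ hτ he using hex
  simp only at he
  refine ⟨γ, τ, hγ, fun ξ ξ' h => (hm.le_iff_le (hτ ξ) (hτ ξ')).1 (by simp only [he]; gcongr), hτ,
    fun ξ => ?_, fun ξ s hs => ?_⟩
  · simp only [ConsLaw.profile, lo, hi, hb, Bool.false_eq_true, if_false]
    rw [← hγ.1, ← hγ.2.1]
    split_ifs with h1 h2
    · rw [hm.injOn (hτ ξ) h01 (by simp [he, h1])]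
    · rw [not_le] at h1
      have h3 : S.lam a.fam (γ (τ ξ)) = ξ := by rw [he, min_eq_right h2.le, max_eq_right h1.le]
      obtain ⟨h4, h5, h6⟩ := Classical.epsilon_spec (p := fun z => S.Rarefaction ρ a.fam (γ 0) z ∧
        S.Rarefaction ρ a.fam z (γ 1) ∧ S.lam a.fam z = ξ) ⟨γ (τ ξ),
          Rarefaction.sub hγ hm h01 (hτ ξ) ((hm.lt_iff_lt h01 (hτ ξ)).1 (by simpa only [h3])),
          Rarefaction.sub hγ hm (hτ ξ) h11 ((hm.lt_iff_lt (hτ ξ) h11).1 (by simpa only [h3])), h3⟩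
      generalize (Classical.epsilon _ : State n) = z at h4 h5 h6 ⊢
      rw [hγ.1] at h4
      rw [hγ.2.1] at h5
      obtain ⟨t, ht, rfl⟩ := Chart.mem_arc_of_rarefactions hΓ hγ h4 h5
      rw [hm.injOn ht (hτ ξ) (h6.trans h3.symm)]
    · rw [hm.injOn (hτ ξ) h11 (by simp [he, not_lt.1 h2, hlt.le])]
  · have h1 := Ioo_subset_Icc_self hs
    rw [← hm.lt_iff_lt h1 (hτ ξ)]
    have h2 := hm h01 h1 hs.1
    have h3 := hm h1 h11 hs.2
    simp only [he, lt_max_iff, lt_min_iff] at h2 h3 ⊢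
    exact ⟨fun h => .inr ⟨h3, h⟩, fun h => h.elim (fun h => absurd h h2.not_gt) And.right⟩

lemma IsWave.profile (ha : S.IsWave ρ a) (hl : ‖a.left‖ < ρ) : Measurable (S.profile ρ a.left [a]) ∧
    ∀ ξ, S.profile ρ a.left [a] ξ ∈ ball (0 : State n) ρ := by
  have hr := ha.right_mem
  rcases ha with ⟨hb, -⟩ | ⟨hb, ha⟩
  · refine ⟨?_, fun ξ => ?_⟩
    · have : S.profile ρ a.left [a] = fun ξ => if ξ ≤ S.lo a then a.left else a.right := by
        ext1 ξ
        simp only [ConsLaw.profile, lo, hi, hb, if_true]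
        grind
      rw [this]
      exact measurable_const.ite measurableSet_Iic measurable_const
    · rw [mem_ball_zero_iff]
      simp only [ConsLaw.profile, lo, hi, hb, if_true]
      split_ifs <;> first | assumption | contradiction | linarith
  · obtain ⟨γ, τ, hγ, hτ, hτ', he, -⟩ := Rarefaction.profile hS hρ hΓ hb ha
    refine ⟨?_, fun ξ => ?_⟩
    · have : S.profile ρ a.left [a] = IccExtend zero_le_one ((Icc (0 : ℝ) 1).domRestrict γ) ∘ τ := by
        ext1 ξ
        rw [he, Function.comp_apply, IccExtend_of_mem _ _ (hτ' ξ)]; rfl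
      rw [this]
      exact hγ.continuousOn.domRestrict.Icc_extend'.measurable.comp hτ.measurable
    · obtain ⟨-, -, k, hk⟩ := hγ
      exact he ξ ▸ (hk _ (hτ' ξ)).1

lemma IsWave.integral {E : Type} [NormedAddCommGroup E] [NormedSpace ℝ E] [CompleteSpace E] {η q :
    State n → E} (hP : IsPair S δ η q) {φ : ℝ × ℝ → ℝ} (hφ : ContDiff ℝ 1 φ) (hc : HasCompactSupport
    φ) (ha : S.IsWave ρ a) : IntegrableOn (fun p : ℝ × ℝ => fderiv ℝ φ p (1, 0) • (η (S.profile ρ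
    a.left [a] (p.2 / p.1)) - η a.left) + fderiv ℝ φ p (0, 1) • (q (S.profile ρ a.left [a] (p.2 /
    p.1)) - q a.left)) {p | 0 < p.1} ∧ ∫ p in {p : ℝ × ℝ | 0 < p.1}, (fderiv ℝ φ p (1, 0) • (η
    (S.profile ρ a.left [a] (p.2 / p.1)) - η a.left) + fderiv ℝ φ p (0, 1) • (q (S.profile ρ a.left
    [a] (p.2 / p.1)) - q a.left)) = -(∫ x in Ioi 0, φ (0, x)) • (η a.right - η a.left) + S.defect φ
    η q a := by
  rcases ha with ⟨hb, -⟩ | ⟨hb, ha⟩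
  · have h1 : ∀ (G : State n → E) (ξ : ℝ), G (S.profile ρ a.left [a] ξ) - G a.left =
        ∫ s in Ioo (0 : ℝ) 1, {_s : ℝ | S.speed a.left a.right < ξ}.indicator
          (fun _ => G a.right - G a.left) s := fun G ξ => by
      simp only [ConsLaw.profile, lo, hi, hb, if_true]
      by_cases h : S.speed a.left a.right < ξ
      · simp [h, h.not_ge, h.not_gt]
      · simp [h, not_lt.1 h]
    obtain ⟨h2, h3⟩ := integral_superposition hφ hc (σ := fun _ => S.speed a.left a.right)
      measurable_const (integrableOn_const (by simp)) (integrableOn_const (by simp))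
      (h1 η) (h1 q)
    refine ⟨h2, h3.trans ?_⟩
    simp [defect, hb, sub_eq_add_neg]
  · obtain ⟨γ, τ, hγ, -, hτ, he, hlt⟩ := Rarefaction.profile hS hρ hΓ hb ha
    have hl := continuousOn_lam_arc hS hρ hγ
    have hcont := hγ.continuousOn
    have h0 := hγ.1
    have h1 := hγ.2.1
    obtain ⟨-, -, k, hk⟩ := hγ
    have hmem : ∀ s ∈ Icc (0 : ℝ) 1, γ s ∈ ball (0 : State n) δ := fun s hs =>
      ball_subset_ball hρ (hk s hs).1
    set A : ℝ → E := fun s => fderiv ℝ η (γ s) (k • S.r a.fam (γ s)) with hA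
    set l := IccExtend zero_le_one ((Icc (0 : ℝ) 1).domRestrict fun s => S.lam a.fam (γ s))
    have hle : ∀ s ∈ Icc (0 : ℝ) 1, l s = S.lam a.fam (γ s) := fun s hs => IccExtend_of_mem _ _ hs
    have hAc : ContinuousOn A (Icc 0 1) :=
      ((hP.smooth.continuousOn_fderiv_of_isOpen isOpen_ball le_rfl).comp hcont hmem).clm_apply
        (((hS.r_smooth a.fam).continuousOn.comp hcont hmem).const_smul k)
    have hLc : Continuous l := hl.domRestrict.Icc_extend'
    have hBc : ContinuousOn (fun s => l s • A s) (Icc 0 1) := hLc.continuousOn.smul hAc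
    have hηd : ∀ s ∈ Icc (0 : ℝ) 1, HasDerivAt (fun s => η (γ s)) (A s) s := fun s hs =>
      ((hP.smooth.contDiffAt (isOpen_ball.mem_nhds (hmem s hs))).differentiableAt
        one_ne_zero).hasFDerivAt.comp_hasDerivAt s (hk s hs).2
    have hqd : ∀ s ∈ Icc (0 : ℝ) 1, HasDerivAt (fun s => q (γ s)) (l s • A s) s := fun s hs => by
      obtain ⟨D, hD, hD'⟩ := hP.flux _ (hmem s hs)
      have := hD.comp_hasDerivAt s (hk s hs).2
      rwa [map_smul, hD', smul_comm, ← map_smul, ← hle s hs] at this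
    have key : ∀ {G : State n → E} {G' : ℝ → E}, ContinuousOn G' (Icc 0 1) →
        (∀ s ∈ Icc (0 : ℝ) 1, HasDerivAt (fun s => G (γ s)) (G' s) s) → ∀ ξ,
        G (S.profile ρ a.left [a] ξ) - G a.left = ∫ s in Ioo 0 1, {s | l s < ξ}.indicator G' s :=
      fun {G G'} h2 h3 ξ => by
        have hs : Ioo 0 1 ∩ {s | l s < ξ} = Ioo 0 (τ ξ) := by
          ext s
          refine ⟨fun h => ⟨h.1.1, (hlt ξ s h.1).1 (hle s (Ioo_subset_Icc_self h.1) ▸ h.2)⟩,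
            fun h => ?_⟩
          have h4 : s ∈ Ioo (0 : ℝ) 1 := ⟨h.1, h.2.trans_le (hτ ξ).2⟩
          exact ⟨h4, (hle s (Ioo_subset_Icc_self h4)).trans_lt ((hlt ξ s h4).2 h.2)⟩
        have hsub : uIcc 0 (τ ξ) ⊆ Icc 0 1 := by
          rw [uIcc_of_le (hτ ξ).1]; exact Icc_subset_Icc_right (hτ ξ).2
        rw [he, ← h0, setIntegral_indicator (measurableSet_lt hLc.measurable measurable_const), hs,
          ← integral_Ioc_eq_integral_Ioo, ← intervalIntegral.integral_of_le (hτ ξ).1,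
          intervalIntegral.integral_eq_sub_of_hasDerivAt (fun s hs => h3 s (hsub hs))
            (h2.mono hsub).intervalIntegrable]
    have hint : ∀ {G' : ℝ → E}, ContinuousOn G' (Icc 0 1) → IntegrableOn G' (Ioo 0 1) :=
      fun h => h.integrableOn_Icc.mono_set Ioo_subset_Icc_self
    obtain ⟨h2, h3⟩ := integral_superposition hφ hc hLc.measurable (hint hAc) (hint hBc)
      (key hAc hηd) (key hBc hqd)
    refine ⟨h2, h3.trans ?_⟩
    have h4 := intervalIntegral.integral_eq_sub_of_hasDerivAt
      (fun s hs => hηd s (by rwa [uIcc_of_le zero_le_one] at hs))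
      (by rw [← uIcc_of_le (zero_le_one' ℝ)] at hAc; exact hAc.intervalIntegrable)
    rw [intervalIntegral.integral_of_le zero_le_one, integral_Ioc_eq_integral_Ioo, h0, h1] at h4
    simp only [sub_self, smul_zero, sub_zero]
    rw [integral_smul, h4]
    simp [defect, hb]

end Wave

section Fan

lemma profile_eq_of_lt (h : ∀ b ∈ L, S.hi a ≤ S.lo b) {ξ : ℝ} (hξ : ξ ≤ S.hi a) (u : State n) :
    S.profile ρ u L ξ = u := by
  cases L with
  | nil => rfl
  | cons b L => exact if_pos (hξ.trans (h b List.mem_cons_self))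

lemma profile_cons (hle : S.lo a ≤ S.hi a) (h : ∀ b ∈ L, S.hi a ≤ S.lo b) (ξ : ℝ) (u : State n) :
    (S.profile ρ u (a :: L) ξ = S.profile ρ u [a] ξ ∧ S.profile ρ a.right L ξ = a.right) ∨
    (S.profile ρ u [a] ξ = a.right ∧ S.profile ρ u (a :: L) ξ = S.profile ρ a.right L ξ) := by
  by_cases h1 : ξ ≤ S.hi a
  · have := profile_eq_of_lt (ρ := ρ) h h1 a.right
    refine Or.inl ⟨?_, this⟩
    simp only [profile, this]
  · have h2 : ¬ ξ ≤ S.lo a := by linarith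
    have h3 : ¬ ξ < S.hi a := by linarith
    simp [profile, h2, h3]

variable {Γ : ∀ j, Chart S j g} (hS : S.Hyp δ) (hρ : ρ ≤ δ) (hΓ : ∀ j, ρ ≤ (Γ j).R)
include hS hρ hΓ

lemma profile_spec (hu : ‖u‖ < ρ) (hL : Wave.Connects u v L) (hw : ∀ a ∈ L, S.IsWave ρ a ∧ S.lo a ≤
    S.hi a) (hp : L.Pairwise fun a b => S.hi a ≤ S.lo b) : (Measurable (S.profile ρ u L) ∧ ∀ ξ,
    S.profile ρ u L ξ ∈ ball (0 : State n) ρ) ∧ ∀ {E : Type} [NormedAddCommGroup E] [NormedSpace ℝ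
    E] [CompleteSpace E] {η q : State n → E}, IsPair S δ η q → ∀ {φ : ℝ × ℝ → ℝ}, ContDiff ℝ 1 φ →
    HasCompactSupport φ → IntegrableOn (fun p : ℝ × ℝ => fderiv ℝ φ p (1, 0) • (η (S.profile ρ u L
    (p.2 / p.1)) - η u) + fderiv ℝ φ p (0, 1) • (q (S.profile ρ u L (p.2 / p.1)) - q u)) {p | 0 <
    p.1} ∧ ∫ p in {p : ℝ × ℝ | 0 < p.1}, (fderiv ℝ φ p (1, 0) • (η (S.profile ρ u L (p.2 / p.1)) - η
    u) + fderiv ℝ φ p (0, 1) • (q (S.profile ρ u L (p.2 / p.1)) - q u)) = -(∫ x in Ioi 0, φ (0, x))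
    • (η v - η u) + (L.map (S.defect φ η q)).sum := by
  induction L generalizing u with
  | nil =>
    obtain rfl : u = v := hL
    exact ⟨⟨measurable_const, fun ξ => by simpa [profile]⟩, fun _ _ _ _ => by simp [profile]⟩
  | cons a L ih =>
    obtain ⟨rfl, hL⟩ := hL
    rw [List.pairwise_cons] at hp
    obtain ⟨⟨h1, hle⟩, h2⟩ := List.forall_mem_cons.1 hw
    obtain ⟨⟨h3, h4⟩, h5⟩ := ih h1.right_mem hL h2 hp.2
    obtain ⟨h6, h7⟩ := h1.profile hS hρ (hΓ a.fam) hu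
    have hcons := fun ξ => profile_cons (ρ := ρ) hle hp.1 ξ a.left
    have hadd : ∀ {E : Type} [AddCommGroup E] (G : State n → E) (ξ : ℝ),
        G (S.profile ρ a.left (a :: L) ξ) - G a.left = (G (S.profile ρ a.left [a] ξ) - G a.left) +
          (G (S.profile ρ a.right L ξ) - G a.right) := fun G ξ => by
      rcases hcons ξ with ⟨h, h'⟩ | ⟨h, h'⟩ <;> rw [h, h'] <;> abel
    refine ⟨⟨?_, fun ξ => ?_⟩, fun {E} _ _ _ η q hP φ hφ hc => ?_⟩
    · have : S.profile ρ a.left (a :: L) =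
          fun ξ => S.profile ρ a.left [a] ξ + (S.profile ρ a.right L ξ - a.right) := by
        ext1 ξ
        have := hadd id ξ
        simp only [id] at this
        rw [← sub_left_inj (a := a.left), this]; abel
      rw [this]
      exact h6.add (h3.sub_const _)
    · rcases hcons ξ with ⟨h, -⟩ | ⟨-, h⟩ <;> rw [h]
      exacts [h7 ξ, h4 ξ]
    · obtain ⟨h8, h9⟩ := h1.integral hS hρ (hΓ a.fam) hP hφ hc
      obtain ⟨h10, h11⟩ := h5 hP hφ hc
      simp only [hadd η, hadd q, smul_add, add_add_add_comm _ (fderiv ℝ φ _ (1, 0) • _)]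
      refine ⟨h8.add h10, (integral_add h8 h10).trans ?_⟩
      rw [h9, h11, List.map_cons, List.sum_cons]
      module

end Fan

lemma IsFan.pairwise (h : S.IsFan ρ j u v L) : (∀ a ∈ L, S.IsWave ρ a ∧ S.lo a ≤ S.hi a) ∧
    L.Pairwise fun a b => S.hi a ≤ S.lo b := by
  have hw : ∀ a ∈ L, S.IsWave ρ a ∧ S.lo a ≤ S.hi a := fun a ha => by
    have h1 := (h.2.1 a ha).2
    refine ⟨h1, ?_⟩
    rcases h1 with ⟨hb, -⟩ | ⟨hb, hr⟩
    · simp [lo, hi, hb]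
    · simpa [lo, hi, hb] using hr.lam_lt.le
  refine ⟨hw, ?_⟩
  let R : Wave n → Wave n → Prop := fun a b => S.hi a ≤ S.lo b ∧ S.lo b ≤ S.hi b
  have : Trans R R R := ⟨fun h h' => ⟨h.1.trans (h.2.trans h'.1), h'.2⟩⟩
  have h2 : L.IsChain R := by
    refine List.IsChain.imp_of_mem_imp (fun a b _ hb hab => ?_) h.2.2
    exact ⟨hab.elim le_of_lt fun h => h.1.le, (hw b hb).2⟩
  exact (List.isChain_iff_pairwise.1 h2).imp And.left

lemma connects_append {w : State n} {L' : List (Wave n)} (h : Wave.Connects u v L) (h' :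
    Wave.Connects v w L') : Wave.Connects u w (L ++ L') := by
  induction L generalizing u with
  | nil => obtain rfl : u = v := h; exact h'
  | cons a L ih => exact ⟨h.1, ih h.2⟩

lemma connects_flatten {k : ℕ} (st : Fin (k + 1) → State n) (fan : Fin k → List (Wave n)) (h : ∀ j :
    Fin k, Wave.Connects (st j.castSucc) (st j.succ) (fan j)) : Wave.Connects (st 0) (st (Fin.last
    k)) (List.ofFn fan).flatten := by
  induction k with
  | zero => rfl
  | succ k ih =>
    rw [List.ofFn_succ, List.flatten_cons]
    exact connects_append (h 0) (ih (fun j => st j.succ) (fun j => fan j.succ) fun j => h j.succ)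

lemma IsCandidate.isEntropySolution {Γ : ∀ j, Chart S j g} (hS : S.Hyp δ) (hρ : ρ ≤ δ) (hΓ : ∀ j, ρ
    ≤ (Γ j).R) {kin nuc : Fin n → State n → ℝ} {ul ur : State n} (hul : ‖ul‖ < ρ) {st : Fin (n + 1)
    → State n} {fan : Fin n → List (Wave n)} (h : S.IsCandidate ρ δ δ1 kin nuc ul ur st fan) :
    S.IsEntropySolution ρ ul ur fun p => S.profile ρ ul (List.ofFn fan).flatten (p.2 / p.1) := by
  obtain ⟨⟨h0, h1, -⟩, hfan, hsort, -⟩ := h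
  have hL := connects_flatten st fan fun j => (hfan j).1
  rw [h0, h1] at hL
  set L := (List.ofFn fan).flatten with hLdef
  have hw : ∀ a ∈ L, S.IsWave ρ a ∧ S.lo a ≤ S.hi a := fun a ha => by
    obtain ⟨l, hl, hal⟩ := List.mem_flatten.1 ha
    obtain ⟨j, rfl⟩ := (List.mem_ofFn' _ _).1 hl
    exact (hfan j).pairwise.1 a hal
  have hp : L.Pairwise fun a b => S.hi a ≤ S.lo b := List.pairwise_flatten.2
    ⟨fun l hl => by obtain ⟨j, rfl⟩ := (List.mem_ofFn' _ _).1 hl; exact (hfan j).pairwise.2,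
      List.pairwise_ofFn.2 fun i j hij a ha b hb => (hsort i j hij a ha b hb).le⟩
  obtain ⟨⟨hm, hb⟩, hint⟩ := profile_spec hS hρ hΓ hul hL hw hp
  have key : ∀ {E : Type} [NormedAddCommGroup E] [NormedSpace ℝ E] [CompleteSpace E] {η q : State n
    → E}, IsPair S δ η q → ∀ {φ : ℝ × ℝ → ℝ}, ContDiff ℝ ∞ φ → HasCompactSupport φ → (∫ p in {p : ℝ
    × ℝ | 0 < p.1}, (fderiv ℝ φ p (1, 0) • η (S.profile ρ ul L (p.2 / p.1)) + fderiv ℝ φ p (0, 1) •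
    q (S.profile ρ ul L (p.2 / p.1)))) + ∫ x : ℝ, φ (0, x) • η (if x < 0 then ul else ur) = (L.map
    (S.defect φ η q)).sum := by
    intro E _ _ _ η q hP φ hφ hc
    have hφ' := hφ.of_le (m := 1) (by norm_cast)
    obtain ⟨h2, h3⟩ := hint hP hφ' hc
    have h4 := fun v => (integrable_fderiv_apply hφ' hc v).integrableOn (s := {p : ℝ × ℝ | 0 < p.1})
    have h5 := ((h4 (1, 0)).smul_const (η ul)).add ((h4 (0, 1)).smul_const (q ul))
    have h6 : Integrable fun x : ℝ => φ (0, x) :=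
      (hφ'.continuous.comp (by fun_prop)).integrable_of_hasCompactSupport
        (hc.comp_isClosedEmbedding (.of_continuous_injective_isClosedMap (by fun_prop)
          (fun t t' h => (Prod.ext_iff.1 h).2) (isClosedMap_prodMk_left 0)))
    have h7 : ∀ x : ℝ, φ (0, x) • η (if x < 0 then ul else ur) =
        φ (0, x) • η ul + (Ici (0 : ℝ)).indicator (fun x => φ (0, x) • (η ur - η ul)) x := fun x => by
      by_cases hx : x < 0
      · simp [hx]
      · simp [hx, not_lt.1 hx, ← smul_add]
    have h8 := integral_add h2 h5
    rw [h3, Pi.add_def, integral_half_plane hφ' hc] at h8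
    simp only [h7]
    rw [integral_add (h6.smul_const _) ((h6.smul_const _).indicator measurableSet_Ici),
      integral_indicator measurableSet_Ici, integral_Ici_eq_integral_Ioi, integral_smul_const,
      integral_smul_const]
    rw [show (∫ p in {p : ℝ × ℝ | 0 < p.1},
        (fderiv ℝ φ p (1, 0) • η (S.profile ρ ul L (p.2 / p.1)) +
          fderiv ℝ φ p (0, 1) • q (S.profile ρ ul L (p.2 / p.1)))) = _ from
        (integral_congr_ae (Eventually.of_forall fun p => by simp only; module)).trans h8]
    module
  refine ⟨hm.comp (by fun_prop), fun p => hb _, fun φ hφ hc => ?_, fun φ hφ hc h0 => ?_⟩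
  · refine (key (η := id) ⟨contDiffOn_id, fun u hu => ⟨fderiv ℝ S.f u,
      ((hS.f_smooth.contDiffAt (isOpen_ball.mem_nhds hu)).differentiableAt
        (by norm_num)).hasFDerivAt, fun j => by simp [hS.eigen j u hu]⟩⟩ hφ hc).trans
        (List.sum_eq_zero fun x hx => ?_)
    obtain ⟨a, ha, rfl⟩ := List.mem_map.1 hx
    rcases (hw a ha).1 with ⟨hs, hv, hne, -⟩ | ⟨hs, -⟩
    · simp [defect, ((hv.2.resolve_left hne).1)]
    · simp [defect, hs]
  · refine (List.sum_nonneg fun x hx => ?_).trans_eq (key (η := S.U) (q := S.F)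
      ⟨hS.U_smooth.of_le (by norm_num), fun u hu => ⟨_, hS.entropy_pair u hu, fun j => by
        simp [hS.eigen j u hu]⟩⟩ hφ hc).symm
    obtain ⟨a, ha, rfl⟩ := List.mem_map.1 hx
    rcases (hw a ha).1 with ⟨hs, -, -, hd⟩ | ⟨hs, -⟩
    · rw [defect, if_pos hs, ← smul_neg]
      refine mul_nonneg (setIntegral_nonneg measurableSet_Ioi fun t _ => h0 _) ?_
      rw [dissipation] at hd
      simp only [smul_eq_mul]; linarith
    · simp [defect, hs]

lemma eventually_forall_norm_lt {E : Type*} [SeminormedAddCommGroup E] {P : E → Prop} (h : ∀ᶠ z in 𝓝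
    (0 : E), P z) : ∀ᶠ r in 𝓝[>] (0 : ℝ), ∀ z, ‖z‖ < r → P z := by
  obtain ⟨a, ha, h⟩ := Metric.eventually_nhds_iff_ball.1 h
  filter_upwards [Ioo_mem_nhdsGT ha] with r hr z hz
  exact h z (mem_ball_zero_iff.2 (hz.trans hr.2))

lemma _root_.eventually_mul_le (a : ℝ) {b : ℝ} (hb : 0 < b) : ∀ᶠ t in 𝓝[>] (0 : ℝ), t * a ≤ b := by
  have : Tendsto (fun t : ℝ => t * a) (𝓝 0) (𝓝 (0 * a)) := (continuous_mul_const a).tendsto 0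
  rw [zero_mul] at this
  exact nhdsWithin_le_nhds (this.eventually_le_const hb)

lemma _root_.eventually_le {b : ℝ} (hb : 0 < b) : ∀ᶠ t in 𝓝[>] (0 : ℝ), t ≤ b := by
  simpa using eventually_mul_le 1 hb

namespace Chart

variable {Γ : Chart S j g}

lemma eventually_abs_p_lt (Γ : Chart S j g) (k : ℝ) {t : ℝ} (ht : 0 < t) : ∀ᶠ u in 𝓝 (0 : State n),
    k * |Γ.p u| < t := by
  have h := ((Γ.p_strict.continuousAt.abs).const_mul k).tendsto
  simp only [Γ.p_zero, abs_zero, mul_zero] at h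
  exact h.eventually_lt_const ht

lemma eventually_curve_lt {Y : ℝ → State n → State n} {A : ℝ × State n →L[ℝ] State n} (hY :
    HasStrictFDerivAt (fun z : ℝ × State n => Y z.1 z.2) A 0) (h0 : Y 0 0 = 0) {t : ℝ} (ht : 0 < t)
    : ∀ᶠ r in 𝓝[>] (0 : ℝ), ∀ m u, |m| < r → ‖u‖ < r → ‖Y m u‖ < t := by
  have h := hY.continuousAt.norm.tendsto
  simp only [Prod.fst_zero, Prod.snd_zero, h0, norm_zero] at h
  filter_upwards [eventually_forall_norm_lt (h.eventually_lt_const ht)] with r hr m u hm hu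
  exact hr (m, u) (max_lt hm hu)

lemma abs_p_le (Γ : Chart S j g) (hu : ‖u‖ < Γ.R) : |Γ.p u| ≤ Γ.B * ‖u‖ := by
  simpa [Γ.p_zero] using Γ.p_lip hu (v := 0) (by simpa using Γ.R_pos)

lemma eventually_good (Γ : Chart S j g) (c C : ℝ) : ∀ᶠ ρ in 𝓝[>] (0 : ℝ), Γ.Good c C ρ := by
  filter_upwards [eventually_le Γ.R_pos, self_mem_nhdsWithin,
    eventually_forall_norm_lt (Γ.eventually_abs_p_lt (C / c + 1) Γ.M_pos),
    eventually_curve_lt Γ.V_strict Γ.V_zero Γ.R_pos] with ρ h1 h2 h3 h4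
  exact ⟨h1, h3, fun z hz => h4 0 z (by simpa using h2) hz⟩

lemma Good.eventually_scale (hg : Γ.Good c C ρ) (hρ : 0 < ρ) : ∀ᶠ ε in 𝓝[>] (0 : ℝ), ∀ᶠ δ' in 𝓝[>]
    (0 : ℝ), ∀ᶠ δ1 in 𝓝[>] (0 : ℝ), Γ.Scale c C ρ ε δ' δ1 := by
  filter_upwards [self_mem_nhdsWithin, eventually_le Γ.M_pos, eventually_curve_lt Γ.V_strict Γ.V_zero hρ,
    eventually_curve_lt Γ.W_strict Γ.W_zero hρ] with ε hε h1 h2 h3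
  filter_upwards [self_mem_nhdsWithin, eventually_le hρ, eventually_le hε,
    eventually_forall_norm_lt (Γ.eventually_abs_p_lt 1 hε)] with δ' hδ' h4 h5 h6
  obtain ⟨t, h7, ht⟩ := ((eventually_curve_lt Γ.V_strict Γ.V_zero hδ').and self_mem_nhdsWithin).exists
  filter_upwards [eventually_le hδ', eventually_le ht,
    eventually_forall_norm_lt (Γ.eventually_abs_p_lt (C / c + 1) hε),
    eventually_forall_norm_lt (Γ.eventually_abs_p_lt (C / c + 1) ht)] with δ1 h8 h9 h10 h11
  exact ⟨hg, hε, h1, h4, fun z m hz hm => ⟨h2 m z hm (hz.trans_le h5), h3 m z hm (hz.trans_le h5)⟩,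
    fun z hz => by simpa using h6 z hz, h8, h10,
    fun u m hu hm => h7 m u (hm.trans_lt (h11 u hu)) (hu.trans_le h9)⟩

variable {ε2 δ2 d η0 η1 η2 r2 : ℝ} {kin nuc : Fin n → State n → ℝ}
  (Sc : Γ.Scale c C ρ ε δ' δ1) (hN : Γ.Near η1 r) (hε : ε ≤ r) (hδ : δ' ≤ r)
  (Sc2 : Γ.Scale c C ρ ε2 δ2 d) (hN2 : Γ.Near η2 r2) (hε2 : ε2 ≤ r2) (hδ2 : δ2 ≤ r2)
  (hd : 0 < d) (hdδ : d ≤ δ1) (hdε : d ≤ ε) (hdε2 : d ≤ ε2)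
include Sc hN hε hδ Sc2 hN2 hε2 hδ2 hdδ hdε hdε2

lemma Simple.familySpec (hs : Γ.Simple ρ) (hcc : ¬ S.IsCC δ j) (hη₁ : η1 ≤ η0) (hη₂ : η2 * (2 * Γ.B
    + 1) ≤ η) : FamilySpec Γ ρ δ δ1 d η0 η kin nuc fun _ u m => Γ.cb u m := by
  have hρ : ∀ {u : State n}, ‖u‖ < δ1 → ‖u‖ < ρ := fun h => (h.trans_le Sc.δ1_le).trans_le Sc.δ'_le
  have hr : ∀ {u : State n}, ‖u‖ < δ1 → ‖u‖ < r ∧ |Γ.p u| < r := fun h =>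
    ⟨(h.trans_le Sc.δ1_le).trans_le hδ, (Sc.p_lt _ (h.trans_le Sc.δ1_le)).trans_le hε⟩
  have hr2 : ∀ {u : State n}, ‖u‖ < d → ‖u‖ < r2 ∧ |Γ.p u| < r2 := fun h =>
    ⟨(h.trans_le Sc2.δ1_le).trans_le hδ2, (Sc2.p_lt _ (h.trans_le Sc2.δ1_le)).trans_le hε2⟩
  have hA : ∀ {u v L}, S.Admits ρ δ kin nuc j u v L ↔ S.IsFan ρ j u v L := by simp [Admits, hcc]
  refine ⟨fun {u} hu => ?_, fun {u} hu => ?_, fun {u v L} hu hL => ?_, fun {u v L} hu _ hL => ?_, hdδ,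
    fun {u} hu => ?_, fun {u m} hu hm => ?_, fun {b u m} hu hm => ?_, ?_,
    fun {b u u' m m'} hu hm hu' hm' => ?_⟩
  · simp only [hA, waveCurve, if_neg hcc]
    exact hs.setOf_isFan_eq (hρ hu)
  · refine ⟨fun _ v => Classical.epsilon fun L => S.IsFan ρ j u v L, fun v L hv hL => ?_⟩
    rw [hA] at hL
    obtain ⟨h1, -, -, h2⟩ := hs.isFan_spec (hρ hu) hL
    refine ⟨(h2 _ (Classical.epsilon_spec ⟨L, hL⟩)).symm, h1, ?_⟩
    have h3 := hN.cb_sub_le (hr hv).2 (hr hu).1 (hr hu).2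
    rw [← h1] at h3
    exact h3.trans (mul_le_mul_of_nonneg_right hη₁ (abs_nonneg _))
  · exact speed_near_of_isFan hs.le (hρ hu) (hA.1 hL)
  · exact (hs.isFan_spec (hρ hu) (hA.1 hL)).2.2.1
  · exact Γ.abs_p_le ((hρ (hu.trans_le hdδ)).trans_le hs.le)
  · rw [waveCurve, if_neg hcc]
    have hu' := (hu.trans_le hdδ).trans_le Sc.δ1_le
    have hm' := hm.trans_le hdε
    exact hs.cb_mem (hu'.trans_le Sc.δ'_le) (hm'.trans_le Sc.ε_le) (Sc.V_mem hu' hm').1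
      (Sc.W_mem hu' hm').1
  · have hu' := (hρ (hu.trans_le hdδ)).trans_le hs.le
    have hm' := (hm.trans_le hdε).trans_le Sc.ε_le
    rw [cb]; split_ifs
    exacts [Γ.p_W hm' hu', Γ.p_V hm' hu']
  · simp [cb, Γ.p_zero, Γ.W_zero]
  · refine (hN2.dev_cb_sub_le ((hm.trans_le hdε2).trans_le hε2) (hr2 hu).1 (hr2 hu).2
      ((hm'.trans_le hdε2).trans_le hε2) (hr2 hu').1 (hr2 hu').2).trans ?_
    gcongr

include hd in
open Classical in
lemma Scale.familySpec (O : Γ.Oriented 1) (hc : Γ.Convex c C) (hcc : S.IsCC δ j) (hkin : S.IsKinetic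
    ρ δ1 j (kin j)) (hnuc : S.IsThreshold ρ δ1 j (kin j) (nuc j)) (hK : 0 ≤ K) (hkK : ∀ u u', ‖u‖ <
    δ1 → ‖u'‖ < δ1 → |kin j u - kin j u'| ≤ K * ‖u - u'‖) (hBK : Γ.B / c ≤ K) (hη11 : η1 ≤ 1) (hη21
    : η2 ≤ 1) (hη₁ : η1 * Γ.fanConst c C ≤ η0) (hη₂ : η2 * (Γ.pairConst c K + (1 + Γ.B * Γ.fanConst
    c C)) ≤ η) : FamilySpec Γ ρ δ δ1 d η0 η kin nuc fun b => S.gluedBranch ρ j (if b then kin j else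
    S.muNat ρ j) := by
  have hρ : ∀ {u : State n}, ‖u‖ < δ1 → ‖u‖ < ρ := fun h => (h.trans_le Sc.δ1_le).trans_le Sc.δ'_le
  have hA : ∀ {u v L}, S.Admits ρ δ kin nuc j u v L ↔ S.IsNCFan ρ j (kin j) (nuc j) u v L := by
    simp only [Admits, hcc, forall_true_left]
    exact ⟨And.right, fun h => ⟨h.1, h⟩⟩
  have hp : S.mu j = Γ.p := funext fun u => by rw [O.p_eq, one_mul]
  have hkinb : ∀ b : Prop, S.IsKinetic ρ δ1 j (if b then kin j else S.muNat ρ j) := fun b => by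
    split_ifs
    exacts [hkin, Sc.isKinetic_muNat O hc]
  have hspec := fun b {u m} => Sc.glued_spec O hc hN hε hδ hη11 (hkinb b) (u := u) (m := m)
  have hnat : ∀ u u', ‖u‖ < δ1 → ‖u'‖ < δ1 → 0 < Γ.p u * Γ.p u' →
      |S.muNat ρ j u - S.muNat ρ j u'| ≤ Γ.B / c * ‖u - u'‖ := fun u u' hu hu' h => by
    rcases pos_and_pos_or_neg_and_neg_of_mul_pos h with ⟨h1, h2⟩ | ⟨h1, h2⟩
    · exact Sc.muNat_sub_le O hc hu hu' h1 h2
    · exact Sc.reflect.muNat_sub_le O.reflect hc.reflect hu hu' (neg_pos.2 h1) (neg_pos.2 h2)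
  refine ⟨fun {u} hu => ?_, fun {u} hu => ?_, fun {u v L} hu hL => ?_, fun {u v L} _ h => absurd hcc h,
    hdδ, fun {u} hu => ?_, fun {u m} hu hm => ?_, fun {b u m} hu hm => ?_, ?_,
    fun {b u u' m m'} hu hm hu' hm' => ?_⟩
  · simp only [hA, waveCurve, if_pos hcc]
    exact (Sc.waveCurve_spec O hc hkin hnuc hu (B := ⟨Γ.B, Γ.B_pos.le⟩) le_rfl).1
  · obtain ⟨canon, h⟩ := Sc.pattern O hc hkin hnuc hu
    refine ⟨canon, fun v L hv hL => ?_⟩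
    have hv' := Sc.p_lt v (hv.trans_le Sc.δ1_le)
    obtain ⟨h1, h2, h3⟩ := h v L (by rwa [hp]) (hA.1 hL)
    rw [hp] at h2 h3
    have h4 : v = S.gluedBranch ρ j (if S.HasNonclassical L then kin j else S.muNat ρ j) u (Γ.p v) := by
      split_ifs with hb
      exacts [h2 hb, h3 hb]
    have h5 := (hspec (S.HasNonclassical L) hu hv').2.1
    rw [← h4] at h5
    exact ⟨h1, h4, h5.trans (mul_le_mul_of_nonneg_right hη₁ (abs_nonneg _))⟩
  · exact speed_near_of_isFan Sc.good.le (hρ hu) hL.1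
  · exact Γ.abs_p_le ((hρ (hu.trans_le hdδ)).trans_le Sc.good.le)
  · rw [waveCurve, if_pos hcc, if_pos trivial]
    exact Sc.gluedBranch_mem O hc hkin hnuc (hu.trans_le hdδ) (hm.trans_le hdε)
  · exact (hspec b (hu.trans_le hdδ) (hm.trans_le hdε)).1
  · have h := (hspec True (u := 0) (m := 0) (by simpa using hd.trans_le hdδ)
      (by simpa using hd.trans_le hdε)).2.1
    simpa [Γ.p_zero] using h
  · have h1 : S.IsKinetic ρ d j (if b then kin j else S.muNat ρ j) := fun u hu =>
      hkinb b u (ball_subset_ball hdδ hu)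
    refine (Sc2.dev_glued_sub_le O hc hN2 hε2 hδ2 hη21 h1 hK (fun u u' hu hu' h => ?_) hu
      (hm.trans_le hdε2) hu' (hm'.trans_le hdε2)).trans
      (mul_le_mul_of_nonneg_right hη₂ (by positivity))
    split_ifs
    · exact hkK u u' (hu.trans_le hdδ) (hu'.trans_le hdδ)
    · exact (hnat u u' (hu.trans_le hdδ) (hu'.trans_le hdδ) h).trans
        (mul_le_mul_of_nonneg_right hBK (norm_nonneg _))

end Chart

lemma Hyp.exists_coordinates (hδ : 0 < δ) (hS : S.Hyp δ) {X : Fin n → State n} (hX : ∀ j, X j =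
    S.unitField δ j 0) (h0 : ∀ j, X j ≠ 0) : ∃ f : (Fin n → ℝ) ≃L[ℝ] State n, ∀ y, f y = ∑ j, y j •
    X j := by
  have h := mem_ball_self (x := (0 : State n)) hδ
  have hli : LinearIndependent ℝ X := Module.End.eigenvectors_linearIndependent'
    (fderiv ℝ S.f 0 : State n →ₗ[ℝ] State n) (fun j => S.lam j 0) (hS.strict 0 h).injective X
    fun j => ⟨Module.End.mem_eigenspace_iff.2 (by
      simp [hX, unitField, hS.eigen j 0 h, smul_comm (S.lam j 0)]), h0 j⟩
  let b := Module.Basis.mk hli (hli.span_eq_top_of_card_eq_finrank' (by simp)).ge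
  exact ⟨b.equivFunL.symm, fun y => (b.equivFun_symm_apply y).trans (by simp [b])⟩

end ConsLaw

end

theorem theorem2p1 {n : ℕ} (S : ConsLaw n) (δ₀ : ℝ) (hδ₀ : 0 < δ₀) (hS : S.Hyp δ₀) :
    ∃ (ρ δ₁ ε : ℝ) (C : ℝ≥0), 0 < δ₁ ∧ δ₁ < ρ ∧ ρ ≤ δ₀ ∧ 0 < ε ∧
      (∀ i, S.IsCC δ₀ i → ∀ u ∈ ball (0 : State n) δ₁, S.WellDefined ρ ε i u) ∧
      (∀ i, S.IsCC δ₀ i → ∀ kin nuc : State n → ℝ,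
        (∃ K : ℝ≥0, LipschitzOnWith K kin (ball 0 δ₁)) → S.IsKinetic ρ δ₁ i kin →
        (∃ K : ℝ≥0, LipschitzOnWith K nuc (ball 0 δ₁)) → S.IsThreshold ρ δ₁ i kin nuc →
        ∀ u ∈ ball (0 : State n) δ₁,
          {v | ∃ L, S.IsNCFan ρ i kin nuc u v L} = S.ncCurve ρ i kin nuc u ∧
          S.ncCurve ρ i kin nuc u ⊆ S.waveSet ρ i u ∧
          (S.mu i u ≠ 0 → S.NCCurveAt ρ ε C i kin nuc u) ∧
          (S.mu i u = 0 → S.NCCurveAtZero ρ ε C i kin nuc u)) ∧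
      ∀ K : ℝ≥0, ∃ δ₂ : ℝ, 0 < δ₂ ∧ δ₂ ≤ δ₁ ∧
        ∀ kin nuc : Fin n → State n → ℝ,
          (∀ i, S.IsCC δ₀ i → LipschitzOnWith K (kin i) (ball 0 δ₁) ∧
            S.IsKinetic ρ δ₁ i (kin i) ∧
            (∃ K' : ℝ≥0, LipschitzOnWith K' (nuc i) (ball 0 δ₁)) ∧
            S.IsThreshold ρ δ₁ i (kin i) (nuc i)) →
          ∀ prio : Equiv.Perm (Fin n),
          ∀ ul ∈ ball (0 : State n) δ₂, ∀ ur ∈ ball (0 : State n) δ₂,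
            S.RiemannSolved ρ δ₀ δ₁ kin nuc prio ul ur := by
  have h0 : (0 : State n) ∈ ball (0 : State n) δ₀ := mem_ball_self hδ₀
  obtain ⟨g, hg, hgap⟩ := exists_gap (fun j => S.lam j 0) (hS.strict 0 h0).injective
  choose Γ hp hX hconv hgnl hld using hS.exists_chart hδ₀ hg hgap
  have hex : ∀ j, ∃ c C, S.IsCC δ₀ j → (Γ j).Convex c C := fun j => by
    by_cases h : S.IsCC δ₀ j
    · obtain ⟨c, C, hc⟩ := hconv j h
      exact ⟨c, C, fun _ => hc⟩
    · exact ⟨1, 1, fun h' => absurd h' h⟩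
  choose c C hc using hex
  have O : ∀ j, S.IsCC δ₀ j → (Γ j).Oriented 1 := fun j h =>
    ⟨Or.inl rfl, fun u => by rw [hp, ConsLaw.param, if_pos h, one_mul]⟩
  obtain ⟨f, hf⟩ := hS.exists_coordinates hδ₀ hX fun j h => by
    simpa [h] using (Γ j).e_X
  obtain ⟨η', hη', G, hG, hchain⟩ := ConsLaw.exists_chain_bound f _ hf
  obtain ⟨ρ, hρ, hρδ, hgood⟩ := (eventually_mem_nhdsWithin.and ((eventually_le hδ₀).and
    (Filter.eventually_all.2 fun j => (Γ j).eventually_good (c j) (C j)))).exists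
  have hsimple : ∀ j, ¬ S.IsCC δ₀ j → (Γ j).Simple ρ := fun j h => by
    rcases hS.fields j with h1 | h1 | h1
    exacts [(hgnl j h1).simple (hgood j).le, (hld j h1).simple (hgood j).le, absurd h1 h]
  obtain ⟨η₁, hη₁, hη₁1, hη₁', hη₁c⟩ := (eventually_mem_nhdsWithin.and ((eventually_le one_pos).and
    ((eventually_le hη').and (Filter.eventually_all.2 fun j =>
      eventually_mul_le ((Γ j).fanConst (c j) (C j)) hη')))).exists
  choose r hr hN using fun j => (Γ j).exists_near hη₁
  have hscale := fun j => (hgood j).eventually_scale hρ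
  simp only [← Filter.eventually_all] at hscale
  obtain ⟨ε, hε, hεr, hscale'⟩ := (eventually_mem_nhdsWithin.and
    ((Filter.eventually_all.2 fun j => eventually_le (hr j)).and hscale)).exists
  obtain ⟨δ', hδr, hscale''⟩ := ((Filter.eventually_all.2 fun j => eventually_le (hr j)).and hscale').exists
  obtain ⟨δ₁, hδ₁, hδ₁ρ, Sc⟩ := (eventually_mem_nhdsWithin.and
    ((eventually_le (half_pos hρ)).and hscale'')).exists
  refine ⟨ρ, δ₁, ε, ∑ j, ⟨(Γ j).B, (Γ j).B_pos.le⟩, hδ₁, hδ₁ρ.trans_lt (half_lt_self hρ), hρδ, hε,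
    fun i hi u hu => (Sc i).wellDefined (O i hi) (hc i hi) (by simpa using hu),
    fun i hi kin nuc _ hkin _ hnuc u hu => (Sc i).waveCurve_spec (O i hi) (hc i hi) hkin hnuc
      (by simpa using hu) (NNReal.coe_le_coe.2 (Finset.single_le_sum
        (f := fun j => (⟨(Γ j).B, (Γ j).B_pos.le⟩ : ℝ≥0)) (fun _ _ => zero_le) (Finset.mem_univ i))), fun K => ?_⟩
  set c₀ := ∑ j, ‖(Γ j).e‖
  have hc₀ : ∀ j, ‖(Γ j).e‖ ≤ c₀ := fun j =>
    Finset.single_le_sum (f := fun j => ‖(Γ j).e‖) (fun _ _ => norm_nonneg _) (Finset.mem_univ j)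
  have hc₀0 : 0 ≤ c₀ := Finset.sum_nonneg fun _ _ => norm_nonneg _
  obtain ⟨η, hη, hηc, hηL⟩ := (eventually_mem_nhdsWithin.and ((eventually_mul_le (1 + c₀) hη').and
    (eventually_mul_le (lipschitzExtensionConstant (State n) * 2 * (1 + c₀)) hη'))).exists
  obtain ⟨η₂, hη₂, hη₂1, hη₂c, hη₂s⟩ := (eventually_mem_nhdsWithin.and ((eventually_le one_pos).and
    ((Filter.eventually_all.2 fun j => eventually_mul_le ((Γ j).pairConst (c j) (max K ((Γ j).B / c j)) +
      (1 + (Γ j).B * (Γ j).fanConst (c j) (C j))) hη).and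
    (Filter.eventually_all.2 fun j => eventually_mul_le (2 * (Γ j).B + 1) hη)))).exists
  choose r₂ hr₂ hN₂ using fun j => (Γ j).exists_near hη₂
  obtain ⟨ε₂, hε₂, hε₂r, hsc'⟩ := (eventually_mem_nhdsWithin.and
    ((Filter.eventually_all.2 fun j => eventually_le (hr₂ j)).and hscale)).exists
  obtain ⟨δ₂', hδ₂r, hsc''⟩ := ((Filter.eventually_all.2 fun j => eventually_le (hr₂ j)).and hsc').exists
  obtain ⟨d, hd, hdδ, hdε, hdε₂, Sc₂⟩ := (eventually_mem_nhdsWithin.and ((eventually_le hδ₁).and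
    ((eventually_le hε).and ((eventually_le hε₂).and hsc'')))).exists
  obtain ⟨s, hs, hsd, hBs⟩ := (eventually_mem_nhdsWithin.and ((eventually_le hd).and
    (Filter.eventually_all.2 fun j => eventually_mul_le (Γ j).B hd))).exists
  obtain ⟨δ₂, hδ₂, hδ₂δ, hδ₂s, hδ₂d⟩ := (eventually_mem_nhdsWithin.and ((eventually_le hδ₁).and
    ((eventually_mul_le ((G + 1) * 3) hs).and (eventually_mul_le ((1 + c₀) * G * 2) hd)))).exists
  refine ⟨δ₂, hδ₂, hδ₂δ, fun kin nuc hkn prio ul hul ur hur => ?_⟩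
  rw [mem_ball_zero_iff] at hul hur
  have hF : ∀ j, ∃ B, ConsLaw.FamilySpec (Γ j) ρ δ₀ δ₁ d η' η kin nuc B := fun j => by
    by_cases hj : S.IsCC δ₀ j
    · obtain ⟨h1, h2, -, h4⟩ := hkn j hj
      refine ⟨_, (Sc j).familySpec (hN j) (hεr j) (hδr j) (Sc₂ j) (hN₂ j) (hε₂r j) (hδ₂r j) hd hdδ hdε
        hdε₂ (O j hj) (hc j hj) hj h2 h4 (K.2.trans (le_max_left _ _)) (fun u u' hu hu' => ?_)
        (le_max_right _ _) hη₁1 hη₂1 (hη₁c j) (hη₂c j)⟩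
      have := h1.dist_le_mul u (by simpa) u' (by simpa)
      rw [Real.dist_eq, dist_eq_norm] at this
      exact this.trans (mul_le_mul_of_nonneg_right (le_max_left _ _) (norm_nonneg _))
    · exact ⟨_, (hsimple j hj).familySpec (Sc j) (hN j) (hεr j) (hδr j) (Sc₂ j) (hN₂ j) (hε₂r j)
        (hδ₂r j) hdδ hdε hdε₂ hj hη₁' (hη₂s j)⟩
  choose B hB using hF
  exact ConsLaw.riemannSolved hB hG hη' hchain hc₀ hc₀0 le_rfl (le_of_lt hη) hηc (by linarith) hgap
    (hS.strict 0 h0) hsd (fun j => by linarith [hBs j]) (by linarith) (by linarith) hδ₂δ prio hul hur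
    fun st fan h => h.isEntropySolution hS hρδ (fun j => (hgood j).le)
      (by linarith [show (0 : ℝ) < ρ from hρ])
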